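/- Let $d\ge 1$, $\alpha\in(0,2)$, and let $m(dx)=M(x)\,dx$ on $\mathbb R^d$, where $M$ is measurable and bounded between two positive constants. Let $X=(X_t,\mathbb P_x)$ be a Hunt process on $\mathbb R^d$ (not assumed symmetric, possibly with a finite lifetime after which it stays at a cemetery point, where all functions are extended by $0$) which is $\alpha$-stable-like: there is a bounded nonnegative measurable function $C$ on $\mathbb R^d\times\mathbb R^d$ such that for every measurable $f\ge 0$ on $\mathbb R^d\times\mathbb R^d$ vanishing on the diagonal, every $x\in\mathbb R^d$ and every $t>0$, $$\mathbb E_x\Big[\sum_{s\le t}f(X_{s-},X_s)\Big]=\mathbb E_x\Big[\int_0^t\int_{\mathbb R^d}\frac{2C(X_s,y)f(X_s,y)}{|X_s-y|^{d+\alpha}}\,m(dy)\,ds\Big].$$ Assume that $X$ has a transition density $p(t,x,y)$ with respect to $m$ which is jointly continuous on $(0,\infty)\times\mathbb R^d\times\mathbb R^d$ and satisfies, for some constants $M_1,M_2>0$ and all $t>0$, $x,y\in\mathbb R^d$, $$M_1t^{-d/\alpha}\Big(1\wedge\frac{t^{1/\alpha}}{|x-y|}\Big)^{d+\alpha}\le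 p(t,x,y)\le M_2t^{-d/\alpha}\Big(1\wedge\frac{t^{1/\alpha}}{|x-y|}\Big)^{d+\alpha},$$ where the minimum is $1$ if $x=y$. Let $\mathbf J_{d,\alpha}$ be the class of bounded measurable functions $G$ on $\mathbb R^d\times\mathbb R^d$ that vanish on the diagonal and satisfy $$\lim_{t\downarrow0}\sup_{x\in\mathbb R^d}\int_0^t\int_{\mathbb R^d}p(s,x,y)\Big(\int_{\mathbb R^d}\frac{|G(y,w)|}{|y-w|^{d+\alpha}}\,dw\Big)dy\,ds=0.$$ Let $F$ be a function such that both $F$ and $\tilde F(x,y)=F(y,x)$ belong to $\mathbf J_{d,\alpha}$, and set $A_t^F=\sum_{s\le t}F(X_{s-},X_s)$, a sum which converges absolutely $\mathbb P_x$-almost surely for all $x\in\mathbb R^d$ and $t>0$. Then the Feynman–Kac semigroup $S_t^Ff(x)=\mathbb E_x\big[e^{-A_t^F}f(X_t)\big]$ has a density $q$ with respect to $m$, jointly continuous on $(0,\infty)\times\mathbb R^d\times\mathbb R^d$; that is, $S^F_tf(x)=\int_{\mathbb R^d}q(t,x,z)f(z)\,m(dz)$ for all $t>0$, $x\in\mathbb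 R^d$ and bounded measurable $f$ (all these integrals being absolutely convergent). Moreover there are constants $C_3,C_4,C_5,C_6>0$ such that $$C_3e^{-C_4t}\,t^{-d/\alpha}\Big(1\wedge\frac{t^{1/\alpha}}{|x-z|}\Big)^{d+\alpha}\le q(t,x,z)\le C_5e^{C_6t}\,t^{-d/\alpha}\Big(1\wedge\frac{t^{1/\alpha}}{|x-z|}\Big)^{d+\alpha}$$ for all $t>0$ and $x,z\in\mathbb R^d$. -/

import Mathlib

open MeasureTheory Filter Topology Set
open scoped NNReal ENNReal

noncomputable section

/-- The Borel σ-algebra on the state space with the cemetery point `∞` adjoined. -/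
instance OnePoint.instMeasurableSpaceBorel {E : Type*} [TopologicalSpace E] :
    MeasurableSpace (OnePoint E) := borel (OnePoint E)

instance OnePoint.instBorelSpace {E : Type*} [TopologicalSpace E] :
    BorelSpace (OnePoint E) := ⟨rfl⟩

/-- Data of a family of processes on `E` with cemetery `∞`: the paths `X` and, for each starting
point `x`, the law `P x`. -/
structure PathFamily (E Ω : Type*) [TopologicalSpace E] [MeasurableSpace Ω] where
  X : ℝ≥0 → Ω → OnePoint E
  P : OnePoint E → Measure Ω

namespace PathFamily

variable {E Ω : Type*} [TopologicalSpace E] [MeasurableSpace Ω]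

/-- The σ-algebra generated by `X s`, `s ≤ t`. -/
@[reducible]
def pastSigma (Z : PathFamily E Ω) (t : ℝ≥0) : MeasurableSpace Ω :=
  ⨆ s : Set.Iic t, MeasurableSpace.comap (Z.X s) inferInstance

/-- Stopping times of the right-continuous filtration `⋂ u > t, σ(X s, s ≤ u)`. -/
def IsOptionalTime (Z : PathFamily E Ω) (T : Ω → ℝ≥0∞) : Prop :=
  ∀ t : ℝ≥0, MeasurableSet[Z.pastSigma t] {ω | T ω < t}

/-- Events of the σ-algebra of the past of the stopping time `T`
(for the right-continuous filtration), seen on `{T < ∞}`. -/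
def IsPastEvent (Z : PathFamily E Ω) (T : Ω → ℝ≥0∞) (A : Set Ω) : Prop :=
  ∀ t : ℝ≥0, MeasurableSet[Z.pastSigma t] (A ∩ {ω | T ω < t})

/-- The left limit `X_{s-}` (with `X_{0-} = X_0`). -/
def leftX (Z : PathFamily E Ω) (s : ℝ≥0) (ω : Ω) : OnePoint E :=
  Function.leftLim (fun u => Z.X u ω) s

/-- The jump `(X_{s-}, X_s)` seen through `f`, where `f` is extended by `0` to the cemetery. -/
def jump {R : Type*} [Zero R] (Z : PathFamily E Ω) (f : E → E → R) (s : ℝ≥0) (ω : Ω) : R :=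
  (Z.leftX s ω).elim 0 fun x => (Z.X s ω).elim 0 fun y => f x y

/-- The discontinuous additive functional `A_t^F = ∑_{s ≤ t} F(X_{s-}, X_s)`. -/
def additiveFunctional (Z : PathFamily E Ω) (F : E → E → ℝ) (t : ℝ≥0) (ω : Ω) : ℝ :=
  ∑' s : Set.Ioc (0 : ℝ≥0) t, Z.jump F s ω

/-- The random variable `exp (-A_t^F) f(X_t)`, with `f(∞) = 0`. -/
def feynmanKacWeight (Z : PathFamily E Ω) (F : E → E → ℝ) (f : E → ℝ) (t : ℝ≥0) (ω : Ω) : ℝ :=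
  Real.exp (-Z.additiveFunctional F t ω) * (Z.X t ω).elim 0 f

/-- The Feynman-Kac semigroup `S_t^F f (x) = 𝔼_x [exp (-A_t^F) f(X_t)]`. -/
def feynmanKac (Z : PathFamily E Ω) (F : E → E → ℝ) (t : ℝ≥0) (f : E → ℝ) (x : E) : ℝ :=
  ∫ ω, Z.feynmanKacWeight F f t ω ∂(Z.P x)

/-- Hunt processes on `E`: normal, right-continuous with left limits in `E ∪ {∞}`, strong Markov and
quasi-left-continuous, with `∞` as a trap. -/
structure IsHunt (Z : PathFamily E Ω) : Prop where
  prob : ∀ x, IsProbabilityMeasure (Z.P x)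
  measurable_X : ∀ t, Measurable (Z.X t)
  measurable_P : ∀ (t : ℝ≥0) (B : Set (OnePoint E)), MeasurableSet B →
    Measurable fun x => Z.P x (Z.X t ⁻¹' B)
  normal : ∀ x, ∀ᵐ ω ∂(Z.P x), Z.X 0 ω = x
  trap : ∀ (s t : ℝ≥0) (ω : Ω), s ≤ t → Z.X s ω = OnePoint.infty → Z.X t ω = OnePoint.infty
  right_continuous : ∀ (t : ℝ≥0) (ω : Ω), ContinuousWithinAt (fun s => Z.X s ω) (Set.Ioi t) t
  left_limits : ∀ (t : ℝ≥0) (ω : Ω), 0 < t →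
    ∃ y, Tendsto (fun s => Z.X s ω) (𝓝[<] t) (𝓝 y)
  strong_markov : ∀ (x : OnePoint E) (T : Ω → ℝ≥0∞), Z.IsOptionalTime T →
    ∀ A : Set Ω, Z.IsPastEvent T A → ∀ (s : ℝ≥0) (B : Set (OnePoint E)), MeasurableSet B →
      Z.P x (A ∩ {ω | T ω < ⊤ ∧ Z.X ((T ω).toNNReal + s) ω ∈ B}) =
        ∫⁻ ω in A ∩ {ω | T ω < ⊤}, Z.P (Z.X (T ω).toNNReal ω) (Z.X s ⁻¹' B) ∂(Z.P x)
  quasi_left_continuous : ∀ (x : OnePoint E) (T : ℕ → Ω → ℝ≥0∞),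
    (∀ n, Z.IsOptionalTime (T n)) → (∀ ω, Monotone fun n => T n ω) →
      ∀ᵐ ω ∂(Z.P x), (⨆ n, T n ω) < ⊤ →
        Tendsto (fun n => Z.X (T n ω).toNNReal ω) atTop
          (𝓝 (Z.X (⨆ n, T n ω).toNNReal ω))

/-- `Z` has the Lévy system `(N, H)` with `H_t = t`. -/
def HasLevySystem [MeasurableSpace E] (Z : PathFamily E Ω) (N : E → Measure E) : Prop :=
  ∀ f : E → E → ℝ≥0∞, Measurable (Function.uncurry f) → (∀ x, f x x = 0) →
    ∀ (x : E) (t : ℝ≥0), 0 < t →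
      ∫⁻ ω, ∑' s : Set.Ioc (0 : ℝ≥0) t, Z.jump f s ω ∂(Z.P x) =
        ∫⁻ ω, (∫⁻ s in Set.Ioc (0 : ℝ) t,
          (Z.X s.toNNReal ω).elim 0 fun w => ∫⁻ y, f w y ∂(N w)) ∂(Z.P x)

/-- `p` is a transition density of `Z` with respect to `m`. -/
def HasTransitionDensity [MeasurableSpace E] (Z : PathFamily E Ω) (m : Measure E)
    (p : ℝ → E → E → ℝ) : Prop :=
  ∀ (t : ℝ≥0) (x : E), 0 < t → ∀ B : Set E, MeasurableSet B →
    Z.P x {ω | ∃ y ∈ B, Z.X t ω = (y : OnePoint E)} = ∫⁻ y in B, ENNReal.ofReal (p t x y) ∂m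

/-- `q` is a density, with respect to `m`, of the Feynman-Kac semigroup of `F`; this includes that
`A_t^F` is almost surely an absolutely convergent sum and that all the integrals converge. -/
def HasFeynmanKacDensity [MeasurableSpace E] (Z : PathFamily E Ω) (m : Measure E)
    (F : E → E → ℝ) (q : ℝ → E → E → ℝ) : Prop :=
  ∀ (t : ℝ≥0) (x : E), 0 < t →
    (∀ᵐ ω ∂(Z.P x), Summable fun s : Set.Ioc (0 : ℝ≥0) t => Z.jump F s ω) ∧
    ∀ f : E → ℝ, Measurable f → (∃ B, ∀ y, |f y| ≤ B) →
      Integrable (Z.feynmanKacWeight F f t) (Z.P x) ∧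
      Integrable (fun z => q t x z * f z) m ∧
      Z.feynmanKac F t f x = ∫ z, q t x z * f z ∂m

end PathFamily

/-- The measure `m(dx) = M(x) dx` on `ℝ^d`. -/
def refMeasure {d : ℕ} (M : EuclideanSpace ℝ (Fin d) → ℝ) : Measure (EuclideanSpace ℝ (Fin d)) :=
  volume.withDensity fun x => ENNReal.ofReal (M x)

/-- The kernel `N(x, dy) = 2 C(x, y) |x - y|^{-(d + α)} m(dy)`. -/
def stableLikeKernel {d : ℕ} (α : ℝ) (C : EuclideanSpace ℝ (Fin d) → EuclideanSpace ℝ (Fin d) → ℝ)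
    (m : Measure (EuclideanSpace ℝ (Fin d))) (x : EuclideanSpace ℝ (Fin d)) :
    Measure (EuclideanSpace ℝ (Fin d)) :=
  m.withDensity fun y => ENNReal.ofReal (2 * C x y / ‖x - y‖ ^ ((d : ℝ) + α))

/-- `Z` is an `α`-stable-like process on `ℝ^d` with jump intensity given by `C` and `m`;
no symmetry is required. -/
structure IsStableLike {d : ℕ} {Ω : Type*} [MeasurableSpace Ω]
    (Z : PathFamily (EuclideanSpace ℝ (Fin d)) Ω) (α : ℝ)
    (C : EuclideanSpace ℝ (Fin d) → EuclideanSpace ℝ (Fin d) → ℝ)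
    (m : Measure (EuclideanSpace ℝ (Fin d))) : Prop where
  hunt : Z.IsHunt
  measurable_C : Measurable (Function.uncurry C)
  nonneg_C : ∀ x y, 0 ≤ C x y
  bounded_C : ∃ K, ∀ x y, C x y ≤ K
  levy : Z.HasLevySystem (stableLikeKernel α C m)

/-- `t^{-d/α} (1 ∧ t^{1/α} / r)^{d + α}`, where the minimum is `1` for `r = 0`. -/
def stableProfile (d : ℕ) (α t r : ℝ) : ℝ :=
  t ^ (-((d : ℝ) / α)) * (if r = 0 then 1 else min 1 (t ^ (1 / α) / r)) ^ ((d : ℝ) + α)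

/-- The Kato class relative to the transition density `p`, for a nonnegative function `V`. -/
def KatoClass {d : ℕ} (p : ℝ → EuclideanSpace ℝ (Fin d) → EuclideanSpace ℝ (Fin d) → ℝ)
    (V : EuclideanSpace ℝ (Fin d) → ℝ≥0∞) : Prop :=
  Tendsto
    (fun t : ℝ => ⨆ x, ∫⁻ s in Set.Ioc (0 : ℝ) t, ∫⁻ y, ENNReal.ofReal (p s x y) * V y)
    (𝓝[>] 0) (𝓝 0)

/-- The class `J_{d,α}`, relative to the transition density `p`. -/
structure JClass {d : ℕ} (α : ℝ)
    (p : ℝ → EuclideanSpace ℝ (Fin d) → EuclideanSpace ℝ (Fin d) → ℝ)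
    (F : EuclideanSpace ℝ (Fin d) → EuclideanSpace ℝ (Fin d) → ℝ) : Prop where
  measurable : Measurable (Function.uncurry F)
  bounded : ∃ L, ∀ x y, |F x y| ≤ L
  diag : ∀ x, F x x = 0
  kato : KatoClass p fun x => ∫⁻ y, ENNReal.ofReal (|F x y| / ‖x - y‖ ^ ((d : ℝ) + α))

end

open MeasureTheory Filter Topology Set
open scoped NNReal ENNReal

set_option linter.unusedSectionVars false

noncomputable section

/-! Expanding the exponential of a sum along the jumps gives e^{-A_t} = 1 + ∑_{s ≤ t} (e^{-F(X_{s-},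
X_s)} - 1) e^{-(A_t - A_s)} (`exp_neg_tsum`). In expectation, the Markov property and the Lévy
system turn this into the Duhamel equation q = p + p * j * q, a convolution in time and space
through j(u, w) = (e^{-F(u, w)} - 1) 2C(u, w) |u - w|^{-(d+α)}. The density is the solution of this
equation for small times, and is carried to all times by composition.

Upper bound and continuity. The Neumann series is controlled by a three-point inequality
(`prof_three_point`): along x, u, w, z, with time s before the jump from u to w and t - s after it,
one of the two profiles is at most a constant times the profile at time t between x and z, or else
|u - w|^{-(d+α)} is at most 1/t times such a multiple. In the first two cases what remains is the
potential of one of the two marginals of |j|, small for small t by the Kato condition; the marginals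
correspond to F and to its transpose, whence the two hypotheses. In the third case the coefficient
is not small, but what remains is a total mass of the previous iterate, and these masses decrease
geometrically by a separate, simpler argument. So the n-th term is at most B 2^{-n} times the
profile (`IsKatoJump.exists_kIter_le`). Its continuity follows by cutting off the times near 0 and
t, at a cost measured by the Kato moduli (`continuousOn_rconv`, `IsKatoJump.exists_solution`).

Identification. A bounded continuous solution h of the Duhamel equation must be the Feynman-Kac
semigroup on any interval on which the expectation of ∑ (e^{|F|} - 1) is at most 1/2: the largest
error between the two is then at most half of itself (`IsMarkovLaw.abs_fkError_le_half`). To use the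
Markov property at a jump time, the jump time is replaced by the next point of a uniform grid, where
the simple Markov property applies; the grid is then refined, using right-continuity and dominated
convergence. The same device proves Khasminskii's lemma (`IsMarkovLaw.exp_le_two`) and extends the
Lévy system to functions that depend on time (`HasJumpDensity.levy_time`).

Lower bound. The upper bound holds for -F as well. Since e^{-r} ≥ 2/c - e^r/c^2, the density for F
is at least (2/c) p minus c^{-2} times the density for -F, hence at least p/c once both densities
are at most c p (`IsKatoPerturbation.exists_local`).

Large times. By Chapman-Kolmogorov the two-sided comparison with p, with constant c up to time T,
becomes one with constant c^N up to time N T (`IsKatoPerturbation.exists_multiple`), which is the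
exponential factor in time. All this is done on the canonical space of càdlàg paths, where past and
future are functions of the path and the laws form a kernel. -/

/-- Right-continuous paths with left limits in `E ∪ {∞}`. -/
@[ext] structure CadlagPath (E : Type*) [TopologicalSpace E] where
  toFun : ℝ≥0 → OnePoint E
  right_cont_Ioi : ∀ t, ContinuousWithinAt toFun (Set.Ioi t) t
  exists_left_lim : ∀ t, 0 < t → ∃ y, Tendsto toFun (𝓝[<] t) (𝓝 y)

/-! ### The canonical path space: shifting, freezing, cylinder sets. -/

namespace CadlagPath

variable {E : Type*} [TopologicalSpace E]

instance : CoeFun (CadlagPath E) fun _ => ℝ≥0 → OnePoint E := ⟨toFun⟩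

instance : MeasurableSpace (CadlagPath E) := MeasurableSpace.comap toFun MeasurableSpace.pi

lemma measurable_eval (t : ℝ≥0) : Measurable fun w : CadlagPath E => w t :=
  (measurable_pi_apply t).comp (comap_measurable _)

lemma measurable_iff {Ω : Type*} [MeasurableSpace Ω] {f : Ω → CadlagPath E} :
    Measurable f ↔ ∀ t, Measurable fun ω => f ω t := by
  constructor
  · intro h t
    exact (measurable_eval t).comp h
  · intro h
    exact measurable_comap_iff.2 (measurable_pi_iff.2 h)

lemma right_cont (w : CadlagPath E) (t : ℝ≥0) : ContinuousWithinAt w (Set.Ici t) t :=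
  continuousWithinAt_Ioi_iff_Ici.1 (w.right_cont_Ioi t)

/-- The path started afresh at time `s`. -/
def shift (s : ℝ≥0) (w : CadlagPath E) : CadlagPath E :=
  have h : (∀ t, ContinuousWithinAt (fun r => w (s + r)) (Set.Ioi t) t) ∧
      ∀ t, 0 < t → ∃ y, Tendsto (fun r => w (s + r)) (𝓝[<] t) (𝓝 y) := by
    have hmono : StrictMono fun r : ℝ≥0 => s + r := fun a b h => by simpa using h
    have hc : Continuous fun r : ℝ≥0 => s + r := by fun_prop
    refine ⟨fun t => ?_, fun t ht => ?_⟩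
    · exact (w.right_cont_Ioi (s + t)).comp (f := fun r => s + r) hc.continuousWithinAt
        fun r hr => hmono hr
    · obtain ⟨y, hy⟩ := w.exists_left_lim (s + t) (by positivity)
      refine ⟨y, hy.comp (tendsto_nhdsWithin_iff.2 ⟨(hc.tendsto t).mono_left inf_le_left, ?_⟩)⟩
      filter_upwards [self_mem_nhdsWithin] with r hr using hmono hr
  ⟨fun r => w (s + r), h.1, h.2⟩

/-- The path frozen at time `s`. -/
def freeze (s : ℝ≥0) (w : CadlagPath E) : CadlagPath E :=
  have h : (∀ t, ContinuousWithinAt (fun r => w (min r s)) (Set.Ioi t) t) ∧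
      ∀ t, 0 < t → ∃ y, Tendsto (fun r => w (min r s)) (𝓝[<] t) (𝓝 y) := by
    refine ⟨fun t => ?_, fun t ht => ?_⟩
    · rcases lt_or_ge t s with h | h
      · have : (fun r => w (min r s)) =ᶠ[𝓝 t] w := by
          filter_upwards [Iio_mem_nhds h] with r hr
          rw [min_eq_left (le_of_lt hr)]
        exact (w.right_cont_Ioi t).congr_of_eventuallyEq (this.filter_mono inf_le_left) this.eq_of_nhds
      · refine (continuousWithinAt_const (b := w s)).congr (fun r hr => ?_) ?_
        · rw [min_eq_right (h.trans (le_of_lt hr))]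
        · rw [min_eq_right h]
    · rcases le_or_gt t s with h | h
      · obtain ⟨y, hy⟩ := w.exists_left_lim t ht
        refine ⟨y, hy.congr' ?_⟩
        filter_upwards [self_mem_nhdsWithin] with r hr
        rw [min_eq_left ((le_of_lt hr).trans h)]
      · refine ⟨w s, tendsto_const_nhds.congr' ?_⟩
        filter_upwards [mem_nhdsWithin_of_mem_nhds (Ioi_mem_nhds h)] with r hr
        rw [min_eq_right (le_of_lt hr)]
  ⟨fun r => w (min r s), h.1, h.2⟩

@[simp] lemma shift_apply (s r : ℝ≥0) (w : CadlagPath E) : shift s w r = w (s + r) := rfl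

@[simp] lemma freeze_apply (s r : ℝ≥0) (w : CadlagPath E) : freeze s w r = w (min r s) := rfl

lemma measurable_shift (s : ℝ≥0) : Measurable (shift s : CadlagPath E → CadlagPath E) :=
  measurable_iff.2 fun t => measurable_eval (s + t)

lemma measurable_freeze (s : ℝ≥0) : Measurable (freeze s : CadlagPath E → CadlagPath E) :=
  measurable_iff.2 fun t => measurable_eval (min t s)

/-- Finite-dimensional cylinder sets, encoded by the successive time increments. -/
def cyl : List (ℝ≥0 × Set (OnePoint E)) → Set (CadlagPath E)
  | [] => Set.univ
  | (s, B) :: l => {w | w s ∈ B ∧ shift s w ∈ cyl l}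

/-- Take out the smallest time and subtract it from the others: what is left constrains the path
shifted by it. Encoding by increments is what lets the Markov property be applied one time after
another. -/
lemma exists_cyl_eq (n : ℕ) : ∀ (I : Finset ℝ≥0), I.card = n → ∀ B : ℝ≥0 → Set (OnePoint E),
    (∀ t, MeasurableSet (B t)) → ∃ l : List (ℝ≥0 × Set (OnePoint E)),
      (∀ a ∈ l, MeasurableSet a.2) ∧ {w : CadlagPath E | ∀ t ∈ I, w t ∈ B t} = cyl l := by
  classical
  induction n with
  | zero =>
    intro I hI B _
    refine ⟨[], by simp, ?_⟩
    rw [Finset.card_eq_zero.1 hI]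
    simp [cyl]
  | succ n ih =>
    intro I hI B hB
    have hne : I.Nonempty := Finset.card_pos.1 (by omega)
    set s := I.min' hne with hs
    have hsI : s ∈ I := I.min'_mem hne
    have hinj : Set.InjOn (fun t : ℝ≥0 => t - s) (I.erase s : Finset ℝ≥0) := by
      intro a ha b hb hab
      have h1 : s ≤ a := I.min'_le a (Finset.mem_of_mem_erase ha)
      have h2 : s ≤ b := I.min'_le b (Finset.mem_of_mem_erase hb)
      have := congrArg (· + s) hab
      simpa [tsub_add_cancel_of_le h1, tsub_add_cancel_of_le h2] using this
    obtain ⟨l, hl, hlc⟩ := ih ((I.erase s).image fun t => t - s)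
      (by rw [Finset.card_image_of_injOn hinj, Finset.card_erase_of_mem hsI]; omega)
      (fun r => B (s + r)) (fun r => hB _)
    refine ⟨(s, B s) :: l, ?_, ?_⟩
    · intro a ha
      rcases List.mem_cons.1 ha with rfl | ha
      · exact hB s
      · exact hl a ha
    · ext w
      have : shift s w ∈ cyl l ↔ ∀ t ∈ I.erase s, w t ∈ B t := by
        rw [← hlc]
        simp only [Set.mem_ofPred_eq, Finset.mem_image, forall_exists_index, and_imp,
          forall_apply_eq_imp_iff₂, shift_apply]
        refine forall₂_congr fun t ht => ?_
        rw [add_tsub_cancel_of_le (I.min'_le t (Finset.mem_of_mem_erase ht))]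
      simp only [cyl, Set.mem_ofPred_eq, this]
      constructor
      · exact fun h => ⟨h s hsI, fun t ht => h t (Finset.mem_of_mem_erase ht)⟩
      · rintro ⟨h1, h2⟩ t ht
        by_cases hts : t = s
        · rw [hts]; exact h1
        · exact h2 t (Finset.mem_erase.2 ⟨hts, ht⟩)

lemma measurableSet_cyl : ∀ l : List (ℝ≥0 × Set (OnePoint E)), (∀ a ∈ l, MeasurableSet a.2) →
    MeasurableSet (cyl l)
  | [], _ => MeasurableSet.univ
  | (s, B) :: l, h => by
    have h1 : MeasurableSet {w : CadlagPath E | w s ∈ B} :=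
      measurable_eval s (h (s, B) (by simp))
    exact h1.inter (measurable_shift s (measurableSet_cyl l fun a ha => h a (by simp [ha])))

/-- The π-system of cylinder sets. -/
def cylinders (E : Type*) [TopologicalSpace E] : Set (Set (CadlagPath E)) :=
  {S | ∃ (I : Finset ℝ≥0) (B : ℝ≥0 → Set (OnePoint E)), (∀ t, MeasurableSet (B t)) ∧
    S = {w | ∀ t ∈ I, w t ∈ B t}}

/-- Pulling back square cylinders of the product space transfers both the π-system property and the
generation of the σ-algebra. -/
lemma cylinders_eq_preimage :
    cylinders E = {S | ∃ T ∈ squareCylinders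
      (fun _ : ℝ≥0 => {s : Set (OnePoint E) | MeasurableSet s}), toFun ⁻¹' T = S} := by
  ext S
  constructor
  · rintro ⟨I, B, hB, rfl⟩
    refine ⟨(I : Set ℝ≥0).pi B, ⟨I, B, by simpa using hB, rfl⟩, ?_⟩
    ext w
    exact Iff.rfl
  · rintro ⟨_, ⟨I, B, hB, rfl⟩, rfl⟩
    refine ⟨I, B, by simpa using hB, ?_⟩
    ext w
    exact Iff.rfl

lemma isPiSystem_cylinders : IsPiSystem (cylinders E) := by
  rw [cylinders_eq_preimage]
  exact (isPiSystem_squareCylinders (fun _ => MeasurableSpace.isPiSystem_measurableSet)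
    fun _ => MeasurableSet.univ).comap toFun

lemma generateFrom_cylinders :
    (inferInstance : MeasurableSpace (CadlagPath E)) = MeasurableSpace.generateFrom
      (cylinders E) := by
  rw [cylinders_eq_preimage]
  change MeasurableSpace.comap toFun MeasurableSpace.pi = _
  rw [← generateFrom_squareCylinders, MeasurableSpace.comap_generateFrom]
  rfl

end CadlagPath

/-! ### The laws of a Hunt process on path space and their Markov property. -/

namespace PathFamily

variable {E Ω : Type*} [TopologicalSpace E] [MeasurableSpace Ω] {Z : PathFamily E Ω}

/-- The path of a Hunt process as an element of the canonical space. -/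
def path (hZ : Z.IsHunt) (ω : Ω) : CadlagPath E :=
  ⟨fun t => Z.X t ω, fun t => hZ.right_continuous t ω, fun t ht => hZ.left_limits t ω ht⟩

lemma measurable_path (hZ : Z.IsHunt) : Measurable (path hZ) :=
  CadlagPath.measurable_iff.2 fun t => hZ.measurable_X t

lemma pastSigma_le (hZ : Z.IsHunt) (t : ℝ≥0) : Z.pastSigma t ≤ ‹MeasurableSpace Ω› :=
  iSup_le fun s => (hZ.measurable_X s).comap_le

lemma measurable_past (Z : PathFamily E Ω) {s t : ℝ≥0} (h : s ≤ t) :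
    Measurable[Z.pastSigma t] (Z.X s) :=
  Measurable.mono (comap_measurable _)
    (le_iSup (fun s : Set.Iic t => MeasurableSpace.comap (Z.X s) inferInstance) ⟨s, h⟩) le_rfl

/-- The simple Markov property. -/
lemma markov_one (hZ : Z.IsHunt) (x : OnePoint E) (s r : ℝ≥0) {A : Set Ω}
    (hA : MeasurableSet[Z.pastSigma s] A) {B : Set (OnePoint E)} (hB : MeasurableSet B) :
    Z.P x (A ∩ {ω | Z.X (s + r) ω ∈ B}) = ∫⁻ ω in A, Z.P (Z.X s ω) (Z.X r ⁻¹' B) ∂(Z.P x) := by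
  have hmono : ∀ t, s ≤ t → Z.pastSigma s ≤ Z.pastSigma t := fun t h =>
    iSup_le fun u => (measurable_past Z (le_trans u.2 h)).comap_le
  -- A constant time is optional, since `{s < t}` is everything or empty.
  have h := hZ.strong_markov x (fun _ => (s : ℝ≥0∞)) (fun t => by
      by_cases h : (s : ℝ≥0∞) < t <;> simp [h]) A (fun t => by
      by_cases h : (s : ℝ≥0∞) < t
      · simpa [h] using hmono t (by exact_mod_cast h.le) A hA
      · simp [h]) r B hB
  simpa using h

lemma lintegral_markov_one (hZ : Z.IsHunt) (x : OnePoint E) (s r : ℝ≥0) {A : Set Ω}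
    (hA : MeasurableSet[Z.pastSigma s] A) {g : OnePoint E → ℝ≥0∞} (hg : Measurable g) :
    ∫⁻ ω in A, g (Z.X (s + r) ω) ∂(Z.P x) =
      ∫⁻ ω in A, ∫⁻ ω', g (Z.X r ω') ∂(Z.P (Z.X s ω)) ∂(Z.P x) := by
  have hA' := pastSigma_le hZ s A hA
  let κ : ProbabilityTheory.Kernel (OnePoint E) (OnePoint E) :=
    { toFun := fun y => (Z.P y).map (Z.X r)
      measurable' := Measure.measurable_of_measurable_coe _ fun B hB => by
        simp_rw [Measure.map_apply (hZ.measurable_X r) hB]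
        exact hZ.measurable_P r B hB }
  have key : ((Z.P x).restrict A).map (Z.X (s + r)) =
      (((Z.P x).restrict A).map (Z.X s)).bind κ := by
    ext B hB
    rw [Measure.map_apply (hZ.measurable_X _) hB, Measure.bind_apply hB κ.measurable.aemeasurable,
      lintegral_map (κ.measurable_coe hB) (hZ.measurable_X s),
      Measure.restrict_apply (hZ.measurable_X _ hB), Set.inter_comm]
    refine (markov_one hZ x s r hA hB).trans (lintegral_congr fun ω => ?_)
    exact (Measure.map_apply (hZ.measurable_X r) hB).symm
  calc ∫⁻ ω in A, g (Z.X (s + r) ω) ∂(Z.P x)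
      = ∫⁻ y, g y ∂(((Z.P x).restrict A).map (Z.X (s + r))) :=
        (lintegral_map hg (hZ.measurable_X _)).symm
    _ = ∫⁻ y, ∫⁻ z, g z ∂(κ y) ∂(((Z.P x).restrict A).map (Z.X s)) := by
        rw [key, Measure.lintegral_bind κ.measurable.aemeasurable hg.aemeasurable]
    _ = _ := by
        rw [lintegral_map (Measurable.lintegral_kernel hg) (hZ.measurable_X s)]
        refine lintegral_congr fun ω => ?_
        exact lintegral_map hg (hZ.measurable_X r)

-- Measurability in the starting point and the Markov property go together in one induction: the
-- Markov property of the tail, applied at time `s + r`, reduces the longer cylinder to the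
-- expectation of `g` at that single time, and `g` is measurable by the induction hypothesis.
open CadlagPath in
lemma markov_cyl (hZ : Z.IsHunt) : ∀ l : List (ℝ≥0 × Set (OnePoint E)),
    (∀ a ∈ l, MeasurableSet a.2) →
    (Measurable fun x => Z.P x (path hZ ⁻¹' cyl l)) ∧
    ∀ (x : OnePoint E) (s : ℝ≥0) (A : Set Ω), MeasurableSet[Z.pastSigma s] A →
      Z.P x (A ∩ (fun ω => shift s (path hZ ω)) ⁻¹' cyl l) =
        ∫⁻ ω in A, Z.P (Z.X s ω) (path hZ ⁻¹' cyl l) ∂(Z.P x)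
  | [], _ => by
    have := hZ.prob
    simp [cyl]
  | (r, B) :: l, h => by
    have hB : MeasurableSet B := h (r, B) (by simp)
    obtain ⟨hm, hM⟩ := markov_cyl hZ l fun a ha => h a (by simp [ha])
    set g : OnePoint E → ℝ≥0∞ := B.indicator fun y => Z.P y (path hZ ⁻¹' cyl l) with hg
    have hgm : Measurable g := hm.indicator hB
    have step : ∀ (x : OnePoint E) (s : ℝ≥0) (A : Set Ω), MeasurableSet[Z.pastSigma s] A →
        Z.P x (A ∩ (fun ω => shift s (path hZ ω)) ⁻¹' cyl ((r, B) :: l)) =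
          ∫⁻ ω in A, g (Z.X (s + r) ω) ∂(Z.P x) := by
      intro x s A hA
      have hA2 : MeasurableSet[Z.pastSigma (s + r)] (A ∩ Z.X (s + r) ⁻¹' B) := by
        refine MeasurableSet.inter ?_ (measurable_past Z le_rfl hB)
        have : Z.pastSigma s ≤ Z.pastSigma (s + r) :=
          iSup_le fun u => (measurable_past Z (le_trans u.2 le_self_add)).comap_le
        exact this A hA
      have hset : A ∩ (fun ω => shift s (path hZ ω)) ⁻¹' cyl ((r, B) :: l) =
          (A ∩ Z.X (s + r) ⁻¹' B) ∩ (fun ω => shift (s + r) (path hZ ω)) ⁻¹' cyl l := by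
        have e : ∀ ω, shift r (shift s (path hZ ω)) = shift (s + r) (path hZ ω) := fun ω =>
          CadlagPath.ext (funext fun u => by
            change Z.X (s + (r + u)) ω = Z.X (s + r + u) ω
            rw [add_assoc])
        ext ω
        simp only [cyl, Set.mem_inter_iff, Set.mem_preimage, Set.mem_ofPred_eq, e, and_assoc]
        rfl
      rw [hset, hM x (s + r) _ hA2, Set.inter_comm,
        ← Measure.restrict_restrict (hZ.measurable_X _ hB),
        ← lintegral_indicator (hZ.measurable_X _ hB)]
      rfl
    refine ⟨?_, fun x s A hA => ?_⟩
    -- With time 0 and the whole space as past event, `step` computes the probability itself.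
    · have : ∀ x, Z.P x (path hZ ⁻¹' cyl ((r, B) :: l)) = ∫⁻ ω, g (Z.X r ω) ∂(Z.P x) := by
        intro x
        have h0 := step x 0 Set.univ MeasurableSet.univ
        have e : ∀ ω, shift 0 (path hZ ω) = path hZ ω := fun ω =>
          CadlagPath.ext (funext fun u => by simp)
        simpa [e] using h0
      simp_rw [this]
      have h2 : Measurable fun x => (Z.P x).map (Z.X r) :=
        Measure.measurable_of_measurable_coe _ fun B hB => by
          simp_rw [Measure.map_apply (hZ.measurable_X r) hB]
          exact hZ.measurable_P r B hB
      have h3 := (Measure.measurable_lintegral hgm).comp h2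
      have h4 : (fun x => ∫⁻ ω, g (Z.X r ω) ∂(Z.P x)) =
          (fun μ => ∫⁻ y, g y ∂μ) ∘ fun x => (Z.P x).map (Z.X r) :=
        funext fun x => (lintegral_map hgm (hZ.measurable_X r)).symm
      rw [h4]
      exact h3
    · rw [step x s A hA, lintegral_markov_one hZ x s r hA hgm]
      refine lintegral_congr fun ω => ?_
      have h0 := step (Z.X s ω) 0 Set.univ MeasurableSet.univ
      have e : ∀ ω, shift 0 (path hZ ω) = path hZ ω := fun ω =>
        CadlagPath.ext (funext fun u => by simp)
      simpa [e] using h0.symm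

/-- For probability measures, measurable dependence on a parameter need only be tested on a
generating π-system, here the cylinders of `markov_cyl`. -/
lemma measurable_law (hZ : Z.IsHunt) : Measurable fun x => (Z.P x).map (path hZ) := by
  have := hZ.prob
  have : ∀ x, IsProbabilityMeasure ((Z.P x).map (path hZ)) := fun x =>
    Measure.isProbabilityMeasure_map (measurable_path hZ).aemeasurable
  refine Measurable.measure_of_isPiSystem_of_isProbabilityMeasure
    CadlagPath.generateFrom_cylinders CadlagPath.isPiSystem_cylinders ?_
  rintro _ ⟨I, B, hB, rfl⟩
  obtain ⟨l, hl, e⟩ := CadlagPath.exists_cyl_eq _ I rfl B hB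
  rw [e]
  simp_rw [Measure.map_apply (measurable_path hZ) (CadlagPath.measurableSet_cyl l hl)]
  exact (markov_cyl hZ l hl).1

/-- The laws of a Hunt process on the canonical space. -/
def law (hZ : Z.IsHunt) : ProbabilityTheory.Kernel (OnePoint E) (CadlagPath E) where
  toFun x := (Z.P x).map (path hZ)
  measurable' := measurable_law hZ

open CadlagPath in
lemma measurableSet_freeze_preimage (hZ : Z.IsHunt) (s : ℝ≥0) {A : Set (CadlagPath E)}
    (hA : MeasurableSet A) :
    MeasurableSet[Z.pastSigma s] ((fun ω => freeze s (path hZ ω)) ⁻¹' A) := by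
  have : @Measurable _ _ (Z.pastSigma s) _ (fun ω => freeze s (path hZ ω)) :=
    (@CadlagPath.measurable_iff _ _ _ (Z.pastSigma s) _).2 fun t =>
      measurable_past Z (min_le_right t s)
  exact this hA

-- Both sides are finite measures with the same total mass and the same values on cylinders. This
-- lifts the Markov property from finitely many times to the whole future.
open CadlagPath in
lemma markov_set (hZ : Z.IsHunt) (x : OnePoint E) (s : ℝ≥0) {A : Set Ω}
    (hA : MeasurableSet[Z.pastSigma s] A) :
    ((Z.P x).restrict A).map (fun ω => shift s (path hZ ω)) =
      ((Z.P x).restrict A).bind fun ω => law hZ (Z.X s ω) := by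
  have := hZ.prob
  have hm : Measurable fun ω => law hZ (Z.X s ω) := (law hZ).measurable.comp (hZ.measurable_X s)
  have hsm : Measurable fun ω => shift s (path hZ ω) :=
    (measurable_shift s).comp (measurable_path hZ)
  have hlaw : ∀ y, law hZ y Set.univ = 1 := fun y => by
    change (Z.P y).map (path hZ) Set.univ = 1
    rw [Measure.map_apply (measurable_path hZ) MeasurableSet.univ]
    simp
  refine ext_of_generate_finite (cylinders E) generateFrom_cylinders isPiSystem_cylinders ?_ ?_
  · rintro _ ⟨I, B, hB, rfl⟩
    obtain ⟨l, hl, e⟩ := exists_cyl_eq _ I rfl B hB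
    rw [e, Measure.map_apply hsm (measurableSet_cyl l hl),
      Measure.bind_apply (measurableSet_cyl l hl) hm.aemeasurable,
      Measure.restrict_apply (hsm (measurableSet_cyl l hl)), Set.inter_comm,
      (markov_cyl hZ l hl).2 x s A hA]
    refine lintegral_congr fun ω => ?_
    exact (Measure.map_apply (measurable_path hZ) (measurableSet_cyl l hl)).symm
  · rw [Measure.map_apply hsm MeasurableSet.univ,
      Measure.bind_apply MeasurableSet.univ hm.aemeasurable]
    simp [hlaw]

end PathFamily

/-- Markov families of laws on the canonical space of paths with `∞` as a trap. -/
structure IsMarkovLaw {E : Type*} [TopologicalSpace E]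
    (κ : ProbabilityTheory.Kernel (OnePoint E) (CadlagPath E)) : Prop where
  prob : ProbabilityTheory.IsMarkovKernel κ
  normal : ∀ x, ∀ᵐ w ∂(κ x), w 0 = x
  trap : ∀ t : ℝ≥0, ∀ᵐ w ∂(κ OnePoint.infty), w t = OnePoint.infty
  markov : ∀ (x : OnePoint E) (s : ℝ≥0) (H Φ : CadlagPath E → ℝ≥0∞), Measurable H → Measurable Φ →
    ∫⁻ w, H (CadlagPath.freeze s w) * Φ (CadlagPath.shift s w) ∂(κ x) =
      ∫⁻ w, H (CadlagPath.freeze s w) * ∫⁻ w', Φ w' ∂(κ (w s)) ∂(κ x)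

lemma PathFamily.isMarkovLaw_law {E Ω : Type*} [TopologicalSpace E] [T1Space E]
    [MeasurableSpace Ω] {Z : PathFamily E Ω} (hZ : Z.IsHunt) : IsMarkovLaw (law hZ) := by
  have := hZ.prob
  have hpm := measurable_path hZ
  have hsing : ∀ x : OnePoint E, MeasurableSet ({x} : Set (OnePoint E)) := fun x =>
    (isClosed_singleton).measurableSet
  have hae : ∀ (x y : OnePoint E) (t : ℝ≥0), (∀ᵐ ω ∂(Z.P x), Z.X t ω = y) →
      ∀ᵐ w ∂(law hZ x), w t = y := by
    intro x y t h
    change ∀ᵐ w ∂((Z.P x).map (path hZ)), w t = y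
    exact (ae_map_iff hpm.aemeasurable (CadlagPath.measurable_eval t (hsing y))).2 h
  refine ⟨⟨fun x => Measure.isProbabilityMeasure_map hpm.aemeasurable⟩,
    fun x => hae x x 0 (hZ.normal x), fun t => hae _ _ t ?_, fun x s H Φ hH hΦ => ?_⟩
  · filter_upwards [hZ.normal OnePoint.infty] with ω hω
    exact hZ.trap 0 t ω zero_le hω
  · have hΦ' : Measurable fun y => ∫⁻ w', Φ w' ∂(law hZ y) := hΦ.lintegral_kernel
    have hst := CadlagPath.measurable_freeze (E := E) s
    have hsh := CadlagPath.measurable_shift (E := E) s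
    change ∫⁻ w, _ ∂((Z.P x).map (path hZ)) = ∫⁻ w, _ ∂((Z.P x).map (path hZ))
    have hm1 : Measurable fun w => H (CadlagPath.freeze s w) * Φ (CadlagPath.shift s w) :=
      (hH.comp hst).mul (hΦ.comp hsh)
    have hm2 : Measurable fun w : CadlagPath E =>
        H (CadlagPath.freeze s w) * ∫⁻ w', Φ w' ∂(law hZ (w s)) :=
      (hH.comp hst).mul (hΦ'.comp (CadlagPath.measurable_eval s))
    rw [lintegral_map hm1 hpm, lintegral_map hm2 hpm]
    clear hm1 hm2
    -- For an indicator `H` this is `markov_set` on the event that the frozen path lies in `A`; sums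
    -- and increasing limits give the rest.
    refine Measurable.ennreal_induction (motive := fun H => ∫⁻ ω, H (CadlagPath.freeze s (path hZ ω)) *
        Φ (CadlagPath.shift s (path hZ ω)) ∂(Z.P x) = ∫⁻ ω, H (CadlagPath.freeze s (path hZ ω)) *
        ∫⁻ w', Φ w' ∂(law hZ (Z.X s ω)) ∂(Z.P x)) (fun c A hA => ?_) (fun f g _ hf hg ihf ihg => ?_)
        (fun f hf hmono ih => ?_) hH
    · have hA' := measurableSet_freeze_preimage hZ s hA
      have hA2 := pastSigma_le hZ s _ hA'
      have h1 := congrArg (fun μ => ∫⁻ w, Φ w ∂μ) (markov_set hZ x s hA')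
      have hm : Measurable fun ω => law hZ (Z.X s ω) :=
        (law hZ).measurable.comp (hZ.measurable_X s)
      have hsp : Measurable fun ω => CadlagPath.shift s (path hZ ω) := hsh.comp hpm
      rw [lintegral_map hΦ hsp,
        Measure.lintegral_bind hm.aemeasurable hΦ.aemeasurable,
        ← lintegral_indicator hA2, ← lintegral_indicator hA2] at h1
      have e : ∀ (G : Ω → ℝ≥0∞) (ω : Ω),
          A.indicator (fun _ => c) (CadlagPath.freeze s (path hZ ω)) * G ω =
            c * ((fun ω => CadlagPath.freeze s (path hZ ω)) ⁻¹' A).indicator G ω := by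
        intro G ω
        by_cases h : CadlagPath.freeze s (path hZ ω) ∈ A <;> simp [Set.indicator, h]
      refine (lintegral_congr (e fun ω => Φ (CadlagPath.shift s (path hZ ω)))).trans
        (Eq.trans ?_ (lintegral_congr (e fun ω => ∫⁻ w', Φ w' ∂(law hZ (Z.X s ω)))).symm)
      rw [lintegral_const_mul, lintegral_const_mul]
      · congr 1
      · exact (hΦ'.comp (hZ.measurable_X s)).indicator hA2
      · exact (hΦ.comp (hsh.comp hpm)).indicator hA2
    · simp only [Pi.add_apply, add_mul]
      have h1 : Measurable fun ω => f (CadlagPath.freeze s (path hZ ω)) *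
          Φ (CadlagPath.shift s (path hZ ω)) :=
        (hf.comp (hst.comp hpm)).mul (hΦ.comp (hsh.comp hpm))
      have h2 : Measurable fun ω => f (CadlagPath.freeze s (path hZ ω)) *
          ∫⁻ w', Φ w' ∂(law hZ (Z.X s ω)) :=
        (hf.comp (hst.comp hpm)).mul (hΦ'.comp (hZ.measurable_X s))
      rw [lintegral_add_left h1, lintegral_add_left h2]
      exact congrArg₂ _ ihf ihg
    · simp only [ENNReal.iSup_mul]
      rw [lintegral_iSup, lintegral_iSup]
      · exact iSup_congr ih
      · exact fun n => ((hf n).comp (hst.comp hpm)).mul (hΦ'.comp (hZ.measurable_X s))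
      · exact fun i j hij ω => by gcongr; exact hmono hij _
      · exact fun n => ((hf n).comp (hst.comp hpm)).mul (hΦ.comp (hsh.comp hpm))
      · exact fun i j hij ω => by gcongr; exact hmono hij _

/-! ### Measurability of sums over jumps. -/

namespace CadlagPath

lemma nhdsLT_neBot_nnreal {s : ℝ≥0} (hs : 0 < s) : (𝓝[<] s).NeBot :=
  nhdsLT_neBot_of_exists_lt ⟨0, hs⟩

section Defs
variable {E : Type*} [TopologicalSpace E]

/-- The left limit of a path. -/
def leftVal (w : CadlagPath E) (s : ℝ≥0) : OnePoint E := Function.leftLim w.toFun s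

/-- The jump `(w(s-), w(s))` seen through `f`. -/
def jump {R : Type*} [Zero R] (f : E → E → R) (s : ℝ≥0) (w : CadlagPath E) : R :=
  (w.leftVal s).elim 0 fun x => (w s).elim 0 fun y => f x y

/-- The sum of the jumps in `(a, b]` seen through `f`. -/
def jumpSum (f : E → E → ℝ≥0∞) (a b : ℝ≥0) (w : CadlagPath E) : ℝ≥0∞ :=
  ∑' s : Set.Ioc a b, jump f s w

/-- The point measure of the jumps in `(a, b]`. -/
def jumpMeasure [MeasurableSpace E] (a b : ℝ≥0) (w : CadlagPath E) : Measure (E × E) :=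
  Measure.sum fun s : Set.Ioc a b =>
    (w.leftVal s).elim 0 fun x => (w s).elim 0 fun y => Measure.dirac (x, y)

lemma lintegral_jumpMeasure [MeasurableSpace E] {f : E → E → ℝ≥0∞}
    (hf : Measurable (Function.uncurry f)) (a b : ℝ≥0) (w : CadlagPath E) :
    ∫⁻ p, Function.uncurry f p ∂(jumpMeasure a b w) = jumpSum f a b w := by
  rw [jumpMeasure, lintegral_sum_measure]
  refine tsum_congr fun s => ?_
  unfold jump
  rcases w.leftVal s with _ | x
  · exact lintegral_zero_measure _
  · rcases w s with _ | y
    · exact lintegral_zero_measure _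
    · exact lintegral_dirac' _ hf

/-- The canonical inclusion of `E × E` in the square of the compactification. -/
def coe₂ (p : E × E) : OnePoint E × OnePoint E := (↑p.1, ↑p.2)

lemma coe₂_injective : Function.Injective (coe₂ : E × E → _) := by
  rintro ⟨a, b⟩ ⟨c, d⟩ h
  simp only [coe₂, Prod.mk.injEq, OnePoint.coe_eq_coe] at h
  exact Prod.ext h.1 h.2

lemma continuous_coe₂ : Continuous (coe₂ : E × E → _) :=
  (OnePoint.continuous_coe.comp continuous_fst).prodMk (OnePoint.continuous_coe.comp continuous_snd)

lemma isOpenEmbedding_coe₂ : IsOpenEmbedding (coe₂ : E × E → _) :=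
  OnePoint.isOpenEmbedding_coe.prodMap OnePoint.isOpenEmbedding_coe

lemma jump_indicator (K : Set (E × E)) (s : ℝ≥0) (w : CadlagPath E) :
    jump (fun x y => K.indicator (fun _ => (1 : ℝ≥0∞)) (x, y)) s w =
      {r | (w.leftVal r, w r) ∈ coe₂ '' K}.indicator (fun _ => 1) s := by
  have h : ∀ x y : E, ((x : OnePoint E), (y : OnePoint E)) ∈ coe₂ '' K ↔ (x, y) ∈ K := fun x y =>
    coe₂_injective.mem_set_image (a := (x, y))
  have key : ∀ l r : OnePoint E, (l.elim 0 fun x => r.elim 0 fun y =>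
      K.indicator (fun _ => (1 : ℝ≥0∞)) (x, y)) = (coe₂ '' K).indicator (fun _ => 1) (l, r) := by
    intro l r
    rcases l with _ | x
    · rw [Set.indicator_of_notMem]
      · rfl
      · rintro ⟨⟨a, b⟩, -, h⟩
        exact OnePoint.coe_ne_infty a (congrArg Prod.fst h)
    · rcases r with _ | y
      · rw [Set.indicator_of_notMem]
        · rfl
        · rintro ⟨⟨a, b⟩, -, h⟩
          exact OnePoint.coe_ne_infty b (congrArg Prod.snd h)
      · have e : K.indicator (fun _ => (1 : ℝ≥0∞)) (x, y) =
            (coe₂ '' K).indicator (fun _ => 1) ((x : OnePoint E), (y : OnePoint E)) := by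
          by_cases hxy : (x, y) ∈ K
          · rw [Set.indicator_of_mem hxy, Set.indicator_of_mem ((h x y).2 hxy)]
          · rw [Set.indicator_of_notMem hxy, Set.indicator_of_notMem (mt (h x y).1 hxy)]
        exact e
  exact key _ _

end Defs

lemma tsum_Ioc_add (g : ℝ≥0 → ℝ≥0∞) {a b c : ℝ≥0} (hab : a ≤ b) (hbc : b ≤ c) :
    ∑' s : Set.Ioc a c, g s = ∑' s : Set.Ioc a b, g s + ∑' s : Set.Ioc b c, g s := by
  rw [← Set.Ioc_union_Ioc_eq_Ioc hab hbc]
  refine ENNReal.summable.tsum_union_disjoint ?_ ENNReal.summable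
  exact Set.Ioc_disjoint_Ioc_of_le le_rfl

lemma tsum_Ioc_grid (g : ℝ≥0 → ℝ≥0∞) {t : ℕ → ℝ≥0} (ht : Monotone t) (n : ℕ) :
    ∑' s : Set.Ioc (t 0) (t n), g s =
      ∑ i ∈ Finset.range n, ∑' s : Set.Ioc (t i) (t (i + 1)), g s := by
  induction n with
  | zero => simp
  | succ n ih => rw [Finset.sum_range_succ, ← ih, tsum_Ioc_add g (ht (Nat.zero_le n)) (ht (Nat.le_succ n))]

section Metric
variable {E : Type*} [MetricSpace E] [ProperSpace E]

lemma tendsto_left (w : CadlagPath E) {s : ℝ≥0} (hs : 0 < s) :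
    Tendsto w (𝓝[<] s) (𝓝 (w.leftVal s)) := by
  obtain ⟨y, hy⟩ := w.exists_left_lim s hs
  have := nhdsLT_neBot_nnreal hs
  rw [leftVal, leftLim_eq_of_tendsto hy]
  exact hy

lemma leftVal_eq (w : CadlagPath E) {s : ℝ≥0} (hs : 0 < s) {y : OnePoint E}
    (hy : Tendsto w (𝓝[<] s) (𝓝 y)) : w.leftVal s = y := by
  have := nhdsLT_neBot_nnreal hs
  exact leftLim_eq_of_tendsto hy

/-- A left limit at a time just after `s` is a limit of values taken just after `s`; closed
neighbourhoods of `w s` are stable under this passage to the limit. -/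
lemma tendsto_leftVal_right (w : CadlagPath E) (s : ℝ≥0) :
    Tendsto w.leftVal (𝓝[>] s) (𝓝 (w s)) := by
  refine (closed_nhds_basis (w s)).tendsto_right_iff.2 fun C hC => ?_
  have h : w ⁻¹' C ∈ 𝓝[>] s := w.right_cont_Ioi s hC.1
  obtain ⟨b, hb, hsub⟩ := mem_nhdsGT_iff_exists_Ioo_subset.1 h
  filter_upwards [Ioo_mem_nhdsGT hb] with r hr
  have hr0 : 0 < r := lt_of_le_of_lt zero_le hr.1
  have := nhdsLT_neBot_nnreal hr0
  refine hC.2.mem_of_tendsto (w.tendsto_left hr0) ?_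
  filter_upwards [Ioo_mem_nhdsLT hr.1] with u hu
  exact hsub ⟨hu.1, hu.2.trans hr.2⟩

lemma tendsto_leftVal_left (w : CadlagPath E) {s : ℝ≥0} (hs : 0 < s) :
    Tendsto w.leftVal (𝓝[<] s) (𝓝 (w.leftVal s)) := by
  refine (closed_nhds_basis (w.leftVal s)).tendsto_right_iff.2 fun C hC => ?_
  have h : w ⁻¹' C ∈ 𝓝[<] s := w.tendsto_left hs hC.1
  obtain ⟨b, hb, hsub⟩ := (mem_nhdsLT_iff_exists_Ioo_subset' hs).1 h
  filter_upwards [Ioo_mem_nhdsLT hb] with r hr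
  have hr0 : 0 < r := lt_of_le_of_lt zero_le hr.1
  have := nhdsLT_neBot_nnreal hr0
  refine hC.2.mem_of_tendsto (w.tendsto_left hr0) ?_
  filter_upwards [Ioo_mem_nhdsLT hr.1] with u hu
  exact hsub ⟨hu.1, hu.2.trans hr.2⟩

lemma isClosed_coe₂_image {K : Set (E × E)} (hK : IsCompact K) : IsClosed (coe₂ '' K) :=
  (hK.image continuous_coe₂).isClosed

lemma diag_notMem {K : Set (E × E)} (hd : ∀ x, (x, x) ∉ K) (y : OnePoint E) :
    (y, y) ∉ coe₂ '' K := by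
  rintro ⟨⟨a, b⟩, hab, h⟩
  simp only [coe₂, Prod.mk.injEq] at h
  have : a = b := OnePoint.coe_injective (h.1.trans h.2.symm)
  exact hd a (by rw [this] at hab ⊢; exact hab)

/-- From either side of `s` the pair of left limit and value tends to a diagonal point, whereas the
image of `K` is closed and avoids the diagonal, including the point at infinity. -/
lemma eventually_notMem {K : Set (E × E)} (hK : IsCompact K) (hd : ∀ x, (x, x) ∉ K)
    (w : CadlagPath E) (s : ℝ≥0) : ∀ᶠ r in 𝓝[≠] s, (w.leftVal r, w r) ∉ coe₂ '' K := by
  have key : ∀ (l : Filter ℝ≥0) (y : OnePoint E), Tendsto w.leftVal l (𝓝 y) →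
      Tendsto w l (𝓝 y) → ∀ᶠ r in l, (w.leftVal r, w r) ∉ coe₂ '' K := by
    intro l y h1 h2
    exact (h1.prodMk_nhds h2).eventually
      ((isClosed_coe₂_image hK).isOpen_compl.mem_nhds (diag_notMem hd y))
  rw [← nhdsLT_sup_nhdsGT, eventually_sup]
  refine ⟨?_, key _ _ (w.tendsto_leftVal_right s) (w.right_cont_Ioi s)⟩
  rcases eq_or_lt_of_le (zero_le (a := s)) with h | h
  · subst h
    simp [Set.Iio, nhdsWithin]
  · exact key _ _ (w.tendsto_leftVal_left h) (w.tendsto_left h)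

/-- Infinitely many such times in a compact interval would accumulate, against `eventually_notMem`.
-/
lemma finite_jumps {K : Set (E × E)} (hK : IsCompact K) (hd : ∀ x, (x, x) ∉ K)
    (w : CadlagPath E) (a b : ℝ≥0) :
    (Set.Ioc a b ∩ {r | (w.leftVal r, w r) ∈ coe₂ '' K}).Finite := by
  by_contra h
  obtain ⟨s, -, hs⟩ := Set.Infinite.exists_accPt_of_subset_isCompact h (isCompact_Icc (a := a) (b := b))
    (inter_subset_left.trans Ioc_subset_Icc_self)
  rw [accPt_iff_frequently_nhdsNE] at hs
  exact hs ((eventually_notMem hK hd w s).mono fun r hr h2 => hr h2.2)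

/-- Properness makes the closed thickenings of `K` compact, so their images stay closed in the
compactification: the limit cannot escape to infinity, and it lies at distance zero from `K`. -/
lemma mem_of_ultrafilter {K : Set (E × E)} (hK : IsCompact K) {U : Ultrafilter ℕ}
    (hU : (U : Filter ℕ) ≤ atTop) {z : ℕ → OnePoint E × OnePoint E} {l : OnePoint E × OnePoint E}
    (hz : Tendsto z U (𝓝 l))
    (hzK : ∀ k : ℕ, z k ∈ coe₂ '' Metric.thickening (1 / ((k : ℝ) + 1)) K) : l ∈ coe₂ '' K := by
  have h1 : ∀ k : ℕ, l ∈ coe₂ '' Metric.cthickening (1 / ((k : ℝ) + 1)) K := by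
    intro k
    refine (isClosed_coe₂_image hK.cthickening).mem_of_tendsto hz (hU ?_)
    filter_upwards [eventually_ge_atTop k] with j hj
    refine Set.image_mono ?_ (hzK j)
    exact (Metric.thickening_subset_cthickening _ _).trans (Metric.cthickening_mono (by gcongr) _)
  obtain ⟨p, -, hp⟩ := h1 0
  refine ⟨p, ?_, hp⟩
  have h2 : ∀ k : ℕ, Metric.infEDist p K ≤ ENNReal.ofReal (1 / ((k : ℝ) + 1)) := by
    intro k
    obtain ⟨p', hp', h⟩ := h1 k
    rw [coe₂_injective (h.trans hp.symm)] at hp'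
    exact hp'
  have h3 : Tendsto (fun k : ℕ => ENNReal.ofReal (1 / ((k : ℝ) + 1))) atTop (𝓝 0) := by
    rw [← ENNReal.ofReal_zero]
    exact ENNReal.tendsto_ofReal tendsto_one_div_add_atTop_nhds_zero_nat
  have h4 : Metric.infEDist p K = 0 := le_antisymm (ge_of_tendsto' h3 h2) zero_le
  have := Metric.mem_closure_iff_infEDist_zero.2 h4
  rwa [hK.isClosed.closure_eq] at this

/-- A jump in `K` is seen by finer and finer pairs of times of a countable dense set. -/
lemma exists_jump_iff {K : Set (E × E)} (hK : IsCompact K) (hd : ∀ x, (x, x) ∉ K) {Q : Set ℝ≥0}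
    (hQ : Dense Q) (a b : ℝ≥0) (w : CadlagPath E) :
    (∃ r ∈ Set.Ioc a b, (w.leftVal r, w r) ∈ coe₂ '' K) ↔
      ∀ k : ℕ, ∃ u ∈ insert b Q, ∃ v ∈ insert b Q,
        (a ≤ u ∧ u < v ∧ v ≤ b ∧ v < u + 1 / ((k : ℝ≥0) + 1)) ∧
          (w u, w v) ∈ coe₂ '' Metric.thickening (1 / ((k : ℝ) + 1)) K := by
  constructor
  · rintro ⟨r, ⟨har, hrb⟩, hr⟩ k
    have hr0 : 0 < r := lt_of_le_of_lt zero_le har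
    set ε : ℝ≥0 := 1 / ((k : ℝ≥0) + 1) with hε
    have hε0 : 0 < ε := by positivity
    set V := coe₂ '' Metric.thickening (1 / ((k : ℝ) + 1)) K with hV
    have hVo : IsOpen V := isOpenEmbedding_coe₂.isOpenMap _ Metric.isOpen_thickening
    have hrV : (w.leftVal r, w r) ∈ V :=
      Set.image_mono (Metric.self_subset_thickening (by positivity) K) hr
    have h1 : ∀ᶠ p in 𝓝[<] r ×ˢ 𝓝[≥] r, (w p.1, w p.2) ∈ V :=
      ((w.tendsto_left hr0).prodMap (w.right_cont r)) (by
        rw [← nhds_prod_eq]; exact hVo.mem_nhds hrV)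
    have h2 : ∀ᶠ p in 𝓝[<] r ×ˢ 𝓝[≥] r, a < p.1 ∧ p.2 < p.1 + ε := by
      have ho : IsOpen {p : ℝ≥0 × ℝ≥0 | a < p.1 ∧ p.2 < p.1 + ε} :=
        (isOpen_lt continuous_const continuous_fst).inter
          (isOpen_lt (f := fun p : ℝ≥0 × ℝ≥0 => p.2) (g := fun p => p.1 + ε) continuous_snd
          (by fun_prop))
      have : ∀ᶠ p in 𝓝 (r, r), a < p.1 ∧ p.2 < p.1 + ε :=
        ho.mem_nhds ⟨har, by simpa using hε0⟩
      rw [nhds_prod_eq] at this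
      exact this.filter_mono (Filter.prod_mono inf_le_left inf_le_left)
    obtain ⟨pA, hA, pB, hB, hAB⟩ := eventually_prod_iff.1 (h1.and h2)
    obtain ⟨l, hl, hlA⟩ := (mem_nhdsLT_iff_exists_Ioo_subset' hr0).1 hA
    obtain ⟨u, huQ, hu⟩ := hQ.exists_between hl
    -- A jump at `b` itself leaves no room to its right within the interval; this is why `b` is
    -- added to the dense set.
    have hv : ∃ v ∈ insert b Q, r ≤ v ∧ v ≤ b ∧ pB v := by
      rcases eq_or_lt_of_le hrb with rfl | hlt
      · exact ⟨r, Set.mem_insert _ _, le_rfl, le_rfl, mem_of_mem_nhdsWithin Set.self_mem_Ici hB⟩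
      · obtain ⟨c, hc, hcB⟩ := mem_nhdsGE_iff_exists_Ico_subset.1 hB
        obtain ⟨v, hvQ, hv⟩ := hQ.exists_between (lt_min (Set.mem_Ioi.1 hc) hlt)
        exact ⟨v, Set.mem_insert_of_mem _ hvQ, hv.1.le, (hv.2.trans_le (min_le_right _ _)).le,
          hcB ⟨hv.1.le, hv.2.trans_le (min_le_left _ _)⟩⟩
    obtain ⟨v, hvQ, hrv, hvb, hBv⟩ := hv
    have := hAB (hlA ⟨hu.1, hu.2⟩) hBv
    exact ⟨u, Set.mem_insert_of_mem _ huQ, v, hvQ,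
      ⟨this.2.1.le, hu.2.trans_le hrv, hvb, this.2.2⟩, this.1⟩
  · intro h
    choose u _ v _ huv hK' using h
    -- Along an ultrafilter the two times converge to the same `s`, and each of them stays on one
    -- side of `s`. If both are on the same side, the limiting pair is on the diagonal, which `K`
    -- avoids; so `u` is before `s` and `v` is not, and the limit is the jump at `s`.
    set U : Ultrafilter ℕ := hyperfilter ℕ
    have hU : (U : Filter ℕ) ≤ atTop := Nat.hyperfilter_le_atTop
    obtain ⟨s, hs, hus⟩ := (isCompact_Icc (a := a) (b := b)).ultrafilter_le_nhds (U.map u) (by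
      rw [le_principal_iff]
      change ∀ᶠ k in (U : Filter ℕ), u k ∈ Set.Icc a b
      exact Filter.univ_mem' fun k => ⟨(huv k).1, (huv k).2.1.le.trans (huv k).2.2.1⟩)
    have hut : Tendsto u U (𝓝 s) := hus
    have hvt : Tendsto v U (𝓝 s) := by
      have h0 : Tendsto (fun k : ℕ => u k + 1 / ((k : ℝ≥0) + 1)) U (𝓝 (s + 0)) :=
        hut.add (tendsto_one_div_add_atTop_nhds_zero_nat.mono_left hU)
      rw [add_zero] at h0
      exact tendsto_of_tendsto_of_tendsto_of_le_of_le hut h0 (fun k => (huv k).2.1.le)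
        fun k => (huv k).2.2.2.le
    have hge : ∀ (x : ℕ → ℝ≥0), Tendsto x U (𝓝 s) → (∀ᶠ k in (U : Filter ℕ), ¬ x k < s) →
        Tendsto (fun k => w (x k)) U (𝓝 (w s)) := fun x hx h =>
      (w.right_cont s).tendsto.comp (tendsto_nhdsWithin_iff.2 ⟨hx, h.mono fun k hk => not_lt.1 hk⟩)
    have hlt : ∀ (x : ℕ → ℝ≥0), Tendsto x U (𝓝 s) → (∀ᶠ k in (U : Filter ℕ), x k < s) →
        0 < s ∧ Tendsto (fun k => w (x k)) U (𝓝 (w.leftVal s)) := fun x hx h => by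
      have hs0 : 0 < s := by
        obtain ⟨k, hk⟩ := h.exists
        exact lt_of_le_of_lt zero_le hk
      exact ⟨hs0, (w.tendsto_left hs0).comp (tendsto_nhdsWithin_iff.2 ⟨hx, h⟩)⟩
    rcases U.em fun k => u k < s with hu | hu
    · rcases U.em fun k => v k < s with hv | hv
      · exact absurd (mem_of_ultrafilter hK hU ((hlt u hut hu).2.prodMk_nhds (hlt v hvt hv).2) hK')
          (diag_notMem hd _)
      · have := mem_of_ultrafilter hK hU ((hlt u hut hu).2.prodMk_nhds (hge v hvt hv)) hK'
        obtain ⟨k, hk⟩ := hu.exists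
        exact ⟨s, ⟨(huv k).1.trans_lt hk, hs.2⟩, this⟩
    · have hv : ∀ᶠ k in (U : Filter ℕ), ¬ v k < s :=
        hu.mono fun k hk hk' => hk ((huv k).2.1.trans hk')
      exact absurd (mem_of_ultrafilter hK hU ((hge u hut hu).prodMk_nhds (hge v hvt hv)) hK')
          (diag_notMem hd _)

variable [MeasurableSpace E] [BorelSpace E]

lemma measurableEmbedding_coe : MeasurableEmbedding ((↑) : E → OnePoint E) :=
  OnePoint.isOpenEmbedding_coe.measurableEmbedding

lemma measurableSet_exists_jump {K : Set (E × E)} (hK : IsCompact K) (hd : ∀ x, (x, x) ∉ K)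
    (a b : ℝ≥0) :
    MeasurableSet {w : CadlagPath E | ∃ r ∈ Set.Ioc a b, (w.leftVal r, w r) ∈ coe₂ '' K} := by
  obtain ⟨Q, hQc, hQ⟩ := TopologicalSpace.exists_countable_dense ℝ≥0
  have hc : (insert b Q).Countable := hQc.insert b
  simp_rw [exists_jump_iff hK hd hQ a b]
  have hme : MeasurableEmbedding (coe₂ : E × E → _) :=
    measurableEmbedding_coe.prodMap measurableEmbedding_coe
  have : {w : CadlagPath E | ∀ k : ℕ, ∃ u ∈ insert b Q, ∃ v ∈ insert b Q,
        (a ≤ u ∧ u < v ∧ v ≤ b ∧ v < u + 1 / ((k : ℝ≥0) + 1)) ∧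
          (w u, w v) ∈ coe₂ '' Metric.thickening (1 / ((k : ℝ) + 1)) K} =
      ⋂ k : ℕ, ⋃ u ∈ insert b Q, ⋃ v ∈ insert b Q,
        {w : CadlagPath E | (a ≤ u ∧ u < v ∧ v ≤ b ∧ v < u + 1 / ((k : ℝ≥0) + 1)) ∧
          (w u, w v) ∈ coe₂ '' Metric.thickening (1 / ((k : ℝ) + 1)) K} := by
    ext w
    simp only [Set.mem_iInter, Set.mem_iUnion, Set.mem_ofPred_eq, exists_prop]
  rw [this]
  refine MeasurableSet.iInter fun k => ?_
  refine MeasurableSet.biUnion hc fun u _ => MeasurableSet.biUnion hc fun v _ => ?_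
  refine (MeasurableSet.const _).inter ?_
  have h2 : Measurable fun w : CadlagPath E => (w u, w v) :=
    (measurable_eval u).prodMk (measurable_eval v)
  exact h2 (hme.measurableSet_image.2 Metric.isOpen_thickening.measurableSet)

lemma jumpMeasure_apply {B : Set (E × E)} (hB : MeasurableSet B) (a b : ℝ≥0) (w : CadlagPath E) :
    jumpMeasure a b w B =
      ∑' s : Set.Ioc a b, {r | (w.leftVal r, w r) ∈ coe₂ '' B}.indicator (fun _ => 1) (s : ℝ≥0) := by
  have h := lintegral_jumpMeasure (f := fun x y => B.indicator (fun _ => 1) (x, y))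
    (measurable_const.indicator hB) a b w
  have h2 : ∫⁻ p, B.indicator (fun _ => (1 : ℝ≥0∞)) p ∂(jumpMeasure a b w) = jumpMeasure a b w B := by
    rw [lintegral_indicator hB]; simp
  rw [← h2]
  refine Eq.trans h ?_
  exact tsum_congr fun s => jump_indicator B s w

/-- A sum with at most one nonzero term is a truth value, written here as an indicator over `Unit`.
-/
lemma tsum_indicator_of_subsingleton {S T : Set ℝ≥0} (h : (T ∩ S).Subsingleton) :
    ∑' s : T, S.indicator (fun _ => (1 : ℝ≥0∞)) (s : ℝ≥0) =
      {_t : Unit | ∃ r ∈ T, r ∈ S}.indicator (fun _ => 1) () := by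
  by_cases he : ∃ r ∈ T, r ∈ S
  · obtain ⟨r, hrT, hrS⟩ := he
    rw [Set.indicator_of_mem (show () ∈ {_t : Unit | ∃ r ∈ T, r ∈ S} from ⟨r, hrT, hrS⟩),
      tsum_eq_single ⟨r, hrT⟩]
    · exact Set.indicator_of_mem hrS _
    · rintro ⟨r', hr'⟩ hne
      refine Set.indicator_of_notMem (fun hS => hne ?_) _
      exact Subtype.ext (h ⟨hr', hS⟩ ⟨hrT, hrS⟩)
  · rw [Set.indicator_of_notMem (show () ∉ {_t : Unit | ∃ r ∈ T, r ∈ S} from he)]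
    refine ENNReal.tsum_eq_zero.2 fun s => Set.indicator_of_notMem (fun hS => he ⟨s, s.2, hS⟩) _

/-- The uniform grid of `[a, b]`. -/
def grid (a b : ℝ≥0) (n i : ℕ) : ℝ≥0 := a + (b - a) * (i / (n + 1))

lemma grid_mono (a b : ℝ≥0) (n : ℕ) : Monotone (grid a b n) := fun i j h => by
  unfold grid; gcongr

@[simp] lemma grid_zero (a b : ℝ≥0) (n : ℕ) : grid a b n 0 = a := by simp [grid]

lemma grid_last {a b : ℝ≥0} (h : a ≤ b) (n : ℕ) : grid a b n (n + 1) = b := by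
  have : ((n : ℝ≥0) + 1) ≠ 0 := by positivity
  simp [grid, this, h]

lemma grid_succ (a b : ℝ≥0) (n i : ℕ) : grid a b n (i + 1) = grid a b n i + (b - a) / (n + 1) := by
  unfold grid
  push_cast
  ring

/-- The jumps in `K` are finitely many, so a fine grid separates them; their number is then the
number of cells containing a jump, and each of these events is measurable. -/
lemma measurable_jumpMeasure_compact {K : Set (E × E)} (hK : IsCompact K) (hd : ∀ x, (x, x) ∉ K)
    {a b : ℝ≥0} (hab : a ≤ b) : Measurable fun w : CadlagPath E => jumpMeasure a b w K := by
  have hlim : ∀ w : CadlagPath E, Tendsto (fun n : ℕ => ∑ i ∈ Finset.range (n + 1),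
      {w : CadlagPath E | ∃ r ∈ Set.Ioc (grid a b n i) (grid a b n (i + 1)),
        (w.leftVal r, w r) ∈ coe₂ '' K}.indicator (fun _ => (1 : ℝ≥0∞)) w) atTop
      (𝓝 (jumpMeasure a b w K)) := by
    intro w
    set S := {r | (w.leftVal r, w r) ∈ coe₂ '' K} with hS
    have hfin := finite_jumps hK hd w a b
    -- Eventually the mesh is smaller than every gap between two of the jump times.
    have hsep : ∀ᶠ n : ℕ in atTop, ∀ x ∈ Set.Ioc a b ∩ S, ∀ y ∈ Set.Ioc a b ∩ S, x < y →
        x + (b - a) / (n + 1) < y := by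
      rw [Filter.eventually_all_finite hfin]
      intro x _
      rw [Filter.eventually_all_finite hfin]
      intro y _
      by_cases hxy : x < y
      · have h0 : Tendsto (fun n : ℕ => x + (b - a) * (1 / ((n : ℝ≥0) + 1))) atTop
            (𝓝 (x + (b - a) * 0)) :=
          tendsto_const_nhds.add (tendsto_const_nhds.mul tendsto_one_div_add_atTop_nhds_zero_nat)
        rw [mul_zero, add_zero] at h0
        filter_upwards [h0.eventually_lt_const hxy] with n hn _
        rwa [mul_one_div] at hn
      · exact Filter.Eventually.of_forall fun n h => absurd h hxy
    refine tendsto_const_nhds.congr' ?_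
    filter_upwards [hsep] with n hn
    rw [jumpMeasure_apply hK.isClosed.measurableSet]
    have hg := tsum_Ioc_grid (S.indicator fun _ => (1 : ℝ≥0∞)) (grid_mono a b n) (n + 1)
    rw [grid_zero, grid_last hab] at hg
    rw [hg]
    refine Finset.sum_congr rfl fun i hi => ?_
    rw [tsum_indicator_of_subsingleton]
    · simp only [Set.indicator, Set.mem_ofPred_eq, hS]
      rfl
    · have hsub : Set.Ioc (grid a b n i) (grid a b n (i + 1)) ⊆ Set.Ioc a b := by
        refine Set.Ioc_subset_Ioc ?_ ?_
        · exact (grid_zero a b n).symm.trans_le (grid_mono a b n (Nat.zero_le i))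
        · exact (grid_mono a b n (Nat.succ_le_of_lt (Finset.mem_range.1 hi))).trans_eq
            (grid_last hab n)
      have hlt : ∀ x ∈ Set.Ioc (grid a b n i) (grid a b n (i + 1)) ∩ S,
          ∀ y ∈ Set.Ioc (grid a b n i) (grid a b n (i + 1)) ∩ S, ¬ x < y := by
        intro x hx y hy hxy
        have h1 := hn x ⟨hsub hx.1, hx.2⟩ y ⟨hsub hy.1, hy.2⟩ hxy
        have h2 := hy.1.2
        rw [grid_succ] at h2
        exact absurd (h1.trans_le h2) (not_lt.2 (by gcongr; exact hx.1.1.le))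
      intro x hx y hy
      exact le_antisymm (not_lt.1 (hlt y hy x hx)) (not_lt.1 (hlt x hx y hy))
  refine measurable_of_tendsto_metrizable (fun n => ?_) (tendsto_pi_nhds.2 hlim)
  exact Finset.measurable_sum _ fun i _ =>
    measurable_const.indicator (measurableSet_exists_jump hK hd _ _)

/-- Compact sets exhausting the complement of the diagonal. -/
def offDiag (E : Type*) [MetricSpace E] (x₀ : E) (n : ℕ) : Set (E × E) :=
  Metric.closedBall (x₀, x₀) n ∩ {p | 1 / ((n : ℝ) + 1) ≤ dist p.1 p.2}

lemma isCompact_offDiag (x₀ : E) (n : ℕ) : IsCompact (offDiag E x₀ n) :=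
  (isCompact_closedBall _ _).inter_right
    (isClosed_le continuous_const (continuous_fst.dist continuous_snd))

lemma notMem_offDiag (x₀ : E) (n : ℕ) (x : E) : (x, x) ∉ offDiag E x₀ n := by
  rintro ⟨-, h⟩
  simp only [Set.mem_ofPred_eq, dist_self] at h
  have : (0 : ℝ) < 1 / ((n : ℝ) + 1) := by positivity
  linarith

lemma offDiag_mono (x₀ : E) : Monotone (offDiag E x₀) := fun i j h => by
  refine Set.inter_subset_inter (Metric.closedBall_subset_closedBall (by exact_mod_cast h)) ?_
  intro p hp
  simp only [Set.mem_ofPred_eq] at hp ⊢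
  refine le_trans ?_ hp
  gcongr

lemma iUnion_offDiag (x₀ : E) : ⋃ n, offDiag E x₀ n = {p : E × E | p.1 ≠ p.2} := by
  ext p
  simp only [Set.mem_iUnion, Set.mem_ofPred_eq]
  constructor
  · rintro ⟨n, hn⟩ h
    refine notMem_offDiag x₀ n p.1 ?_
    have : (p.1, p.1) = p := Prod.ext rfl h
    rwa [this]
  · intro h
    obtain ⟨n, hn⟩ := exists_nat_ge (dist p (x₀, x₀))
    obtain ⟨k, hk⟩ := exists_nat_one_div_lt (dist_pos.2 h)
    refine ⟨max n k, ?_, ?_⟩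
    · exact Metric.mem_closedBall.2 (hn.trans (by exact_mod_cast le_max_left n k))
    · refine le_trans ?_ hk.le
      gcongr
      exact le_max_right n k

/-- Away from the diagonal and from infinity the jump measure is finite, so that it suffices to test
it on the π-system of closed sets. -/
lemma measurable_jumpMeasure_restrict (x₀ : E) (n : ℕ) {a b : ℝ≥0} (hab : a ≤ b) :
    Measurable fun w : CadlagPath E => (jumpMeasure a b w).restrict (offDiag E x₀ n) := by
  have hfin : ∀ w : CadlagPath E, IsFiniteMeasure ((jumpMeasure a b w).restrict (offDiag E x₀ n)) := by
    intro w
    refine ⟨?_⟩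
    rw [Measure.restrict_apply_univ, jumpMeasure_apply (isCompact_offDiag x₀ n).isClosed.measurableSet,
      tsum_subtype (Set.Ioc a b)]
    simp_rw [Set.indicator_indicator]
    have hf := finite_jumps (isCompact_offDiag x₀ n) (notMem_offDiag x₀ n) w a b
    rw [← tsum_subtype]
    have := hf.to_subtype
    have := Fintype.ofFinite ↑(Set.Ioc a b ∩ {r | (w.leftVal r, w r) ∈ coe₂ '' offDiag E x₀ n})
    rw [tsum_fintype]
    simp
  refine Measurable.measure_of_isPiSystem (S := {s | IsClosed s})
    (BorelSpace.measurable_eq.trans borel_eq_generateFrom_isClosed) isPiSystem_isClosed ?_ ?_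
  · intro C (hC : IsClosed C)
    simp_rw [Measure.restrict_apply hC.measurableSet]
    exact measurable_jumpMeasure_compact ((isCompact_offDiag x₀ n).inter_left hC)
      (fun x hx => notMem_offDiag x₀ n x hx.2) hab
  · simp_rw [Measure.restrict_apply_univ]
    exact measurable_jumpMeasure_compact (isCompact_offDiag x₀ n) (notMem_offDiag x₀ n) hab

/-- The sum of the jumps is a measurable functional of the path. -/
lemma measurable_jumpSum {f : E → E → ℝ≥0∞} (hf : Measurable (Function.uncurry f))
    (hd : ∀ x, f x x = 0) (a b : ℝ≥0) : Measurable (jumpSum f a b) := by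
  rcases lt_or_ge b a with hab | hab
  · have : jumpSum f a b = fun _ => 0 := by
      funext w
      have : IsEmpty (Set.Ioc a b) := by simp [hab.le]
      simp [jumpSum]
    rw [this]
    exact measurable_const
  rcases isEmpty_or_nonempty E with hE | ⟨⟨x₀⟩⟩
  · have : jumpSum f a b = fun _ => 0 := by
      funext w
      refine ENNReal.tsum_eq_zero.2 fun s => ?_
      unfold jump
      rcases w.leftVal s with _ | x
      · rfl
      · exact hE.elim x
    rw [this]
    exact measurable_const
  -- As `f` vanishes on the diagonal, nothing is lost by exhausting the complement of the diagonal
  -- by compact sets.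
  have key : ∀ w : CadlagPath E, jumpSum f a b w =
      ⨆ n, ∫⁻ p, Function.uncurry f p ∂((jumpMeasure a b w).restrict (offDiag E x₀ n)) := by
    intro w
    rw [← lintegral_jumpMeasure hf]
    have hsupp : ∀ p : E × E, p ∉ ⋃ n, offDiag E x₀ n → Function.uncurry f p = 0 := by
      intro p hp
      rw [iUnion_offDiag] at hp
      simp only [Set.mem_ofPred_eq, not_not] at hp
      simp [Function.uncurry, hp, hd]
    have hms : ∀ n, MeasurableSet (offDiag E x₀ n) := fun n =>
      (isCompact_offDiag x₀ n).isClosed.measurableSet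
    rw [← setLIntegral_iUnion_of_directed _ (directed_of_isDirected_le (offDiag_mono x₀)),
      ← lintegral_indicator (MeasurableSet.iUnion hms)]
    refine lintegral_congr fun p => ?_
    by_cases hp : p ∈ ⋃ n, offDiag E x₀ n
    · rw [Set.indicator_of_mem hp]
    · rw [Set.indicator_of_notMem hp, hsupp p hp]
  have : jumpSum f a b = fun w => ⨆ n, ∫⁻ p, Function.uncurry f p
      ∂((jumpMeasure a b w).restrict (offDiag E x₀ n)) := funext key
  rw [this]
  exact Measurable.iSup fun n =>
    (Measure.measurable_lintegral hf).comp (measurable_jumpMeasure_restrict x₀ n hab)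

end Metric
end CadlagPath

/-! ### Signed jump sums, their behaviour under freezing and shifting, joint measurability of
evaluation. -/

namespace CadlagPath

section Basic
variable {E : Type*} [TopologicalSpace E]

lemma jump_map {R S : Type*} [Zero R] [Zero S] (φ : R → S) (hφ : φ 0 = 0) (f : E → E → R)
    (s : ℝ≥0) (w : CadlagPath E) : jump (fun x y => φ (f x y)) s w = φ (jump f s w) := by
  have key : ∀ l r : OnePoint E, (l.elim 0 fun x => r.elim 0 fun y => φ (f x y)) =
      φ (l.elim 0 fun x => r.elim 0 fun y => f x y) := by
    intro l r
    rcases l with _ | x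
    · exact hφ.symm
    · rcases r with _ | y
      · exact hφ.symm
      · rfl
  exact key _ _

lemma jump_mono {f g : E → E → ℝ≥0∞} (h : ∀ x y, f x y ≤ g x y) (s : ℝ≥0) (w : CadlagPath E) :
    jump f s w ≤ jump g s w := by
  have key : ∀ l r : OnePoint E, (l.elim 0 fun x => r.elim 0 fun y => f x y) ≤
      (l.elim 0 fun x => r.elim 0 fun y => g x y) := by
    intro l r
    rcases l with _ | x
    · exact le_rfl
    · rcases r with _ | y
      · exact le_rfl
      · exact h x y
  exact key _ _

lemma jumpSum_mono {f g : E → E → ℝ≥0∞} (h : ∀ x y, f x y ≤ g x y) (a b : ℝ≥0)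
    (w : CadlagPath E) : jumpSum f a b w ≤ jumpSum g a b w :=
  ENNReal.tsum_le_tsum fun s => jump_mono h s w

lemma jumpSum_add (f : E → E → ℝ≥0∞) {a b c : ℝ≥0} (hab : a ≤ b) (hbc : b ≤ c)
    (w : CadlagPath E) : jumpSum f a c w = jumpSum f a b w + jumpSum f b c w :=
  tsum_Ioc_add (fun s => jump f s w) hab hbc

lemma jumpSum_le (f : E → E → ℝ≥0∞) {a b c d : ℝ≥0} (hac : c ≤ a) (hbd : b ≤ d)
    (w : CadlagPath E) : jumpSum f a b w ≤ jumpSum f c d w :=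
  ENNReal.tsum_mono_subtype (fun s => jump f s w) (Set.Ioc_subset_Ioc hac hbd)

lemma jumpSum_eq_zero_of_forall {f : E → E → ℝ≥0∞} {a b : ℝ≥0} {w : CadlagPath E}
    (h : ∀ t, w t = OnePoint.infty) : jumpSum f a b w = 0 := by
  refine ENNReal.tsum_eq_zero.2 fun s => ?_
  unfold jump
  rw [h s]
  rcases w.leftVal s with _ | x <;> rfl

/-- The real-valued sum of the jumps in `(a, b]` seen through `f`. -/
def jumpSumR (f : E → E → ℝ) (a b : ℝ≥0) (w : CadlagPath E) : ℝ :=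
  ∑' s : Set.Ioc a b, jump f s w

/-- The total mass of the jumps seen through `f`. -/
abbrev jumpAbs (f : E → E → ℝ) : ℝ≥0 → ℝ≥0 → CadlagPath E → ℝ≥0∞ :=
  jumpSum fun x y => ENNReal.ofReal |f x y|

lemma ofReal_abs_jump (f : E → E → ℝ) (s : ℝ≥0) (w : CadlagPath E) :
    jump (fun x y => ENNReal.ofReal |f x y|) s w = ENNReal.ofReal |jump f s w| :=
  jump_map (fun r => ENNReal.ofReal |r|) (by simp) f s w

lemma summable_jump_iff (f : E → E → ℝ) (a b : ℝ≥0) (w : CadlagPath E) :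
    (Summable fun s : Set.Ioc a b => jump f s w) ↔ jumpAbs f a b w ≠ ⊤ := by
  rw [← summable_abs_iff]
  unfold jumpAbs jumpSum
  simp_rw [ofReal_abs_jump]
  constructor
  · intro h
    exact h.tsum_ofReal_ne_top
  · intro h
    have := ENNReal.summable_toReal h
    refine this.congr fun s => ?_
    rw [ENNReal.toReal_ofReal (abs_nonneg _)]

lemma jumpSumR_eq (f : E → E → ℝ) {a b : ℝ≥0} {w : CadlagPath E} (h : jumpAbs f a b w ≠ ⊤) :
    jumpSumR f a b w = (jumpSum (fun x y => ENNReal.ofReal (f x y)) a b w).toReal -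
      (jumpSum (fun x y => ENNReal.ofReal (-f x y)) a b w).toReal := by
  have h1 : ∀ s, jump (fun x y => ENNReal.ofReal (f x y)) s w = ENNReal.ofReal (jump f s w) :=
    fun s => jump_map (fun r => ENNReal.ofReal r) (by simp) f s w
  have h2 : ∀ s, jump (fun x y => ENNReal.ofReal (-f x y)) s w = ENNReal.ofReal (-jump f s w) :=
    fun s => jump_map (fun r => ENNReal.ofReal (-r)) (by simp) f s w
  have hs := (summable_jump_iff f a b w).2 h
  have hp : (∑' s : Set.Ioc a b, ENNReal.ofReal (jump f s w)) ≠ ⊤ := hs.tsum_ofReal_ne_top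
  have hn : (∑' s : Set.Ioc a b, ENNReal.ofReal (-jump f s w)) ≠ ⊤ := hs.neg.tsum_ofReal_ne_top
  unfold jumpSumR jumpSum
  simp_rw [h1, h2]
  rw [ENNReal.tsum_toReal_eq fun s => ENNReal.ofReal_ne_top,
    ENNReal.tsum_toReal_eq fun s => ENNReal.ofReal_ne_top,
    ← (ENNReal.summable_toReal hp).tsum_sub (ENNReal.summable_toReal hn)]
  refine tsum_congr fun s => ?_
  rw [ENNReal.toReal_ofReal', ENNReal.toReal_ofReal']
  exact (max_zero_sub_max_neg_zero_eq_self _).symm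

lemma jumpSumR_eq_zero_of_top (f : E → E → ℝ) {a b : ℝ≥0} {w : CadlagPath E}
    (h : jumpAbs f a b w = ⊤) : jumpSumR f a b w = 0 := by
  refine tsum_eq_zero_of_not_summable fun hs => ?_
  exact (summable_jump_iff f a b w).1 hs h

lemma abs_jumpSumR_le (f : E → E → ℝ) (a b : ℝ≥0) (w : CadlagPath E) :
    |jumpSumR f a b w| ≤ (jumpAbs f a b w).toReal := by
  by_cases h : jumpAbs f a b w = ⊤
  · simp [jumpSumR_eq_zero_of_top f h, h]
  · have hs := (summable_jump_iff f a b w).2 h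
    have h1 : |jumpSumR f a b w| ≤ ∑' s : Set.Ioc a b, |jump f s w| := by
      have := norm_tsum_le_tsum_norm (f := fun s : Set.Ioc a b => jump f s w) hs.norm
      exact this
    refine h1.trans (le_of_eq ?_)
    unfold jumpAbs jumpSum
    simp_rw [ofReal_abs_jump]
    rw [ENNReal.tsum_toReal_eq fun s => ENNReal.ofReal_ne_top]
    exact tsum_congr fun s => (ENNReal.toReal_ofReal (abs_nonneg _)).symm

lemma tsum_Ioc_addR {g : ℝ≥0 → ℝ} {a b c : ℝ≥0} (hab : a ≤ b) (hbc : b ≤ c)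
    (hg : Summable fun s : Set.Ioc a c => g s) :
    ∑' s : Set.Ioc a c, g s = ∑' s : Set.Ioc a b, g s + ∑' s : Set.Ioc b c, g s := by
  have h1 : Summable fun s : Set.Ioc a b => g s := by
    exact hg.comp_injective (i := Set.inclusion (Set.Ioc_subset_Ioc le_rfl hbc))
      (Set.inclusion_injective _)
  have h2 : Summable fun s : Set.Ioc b c => g s := by
    exact hg.comp_injective (i := Set.inclusion (Set.Ioc_subset_Ioc hab le_rfl))
      (Set.inclusion_injective _)
  rw [← Set.Ioc_union_Ioc_eq_Ioc hab hbc]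
  exact h1.tsum_union_disjoint (Set.Ioc_disjoint_Ioc_of_le le_rfl) h2

lemma jumpSumR_add {f : E → E → ℝ} {a b c : ℝ≥0} (hab : a ≤ b) (hbc : b ≤ c)
    {w : CadlagPath E} (h : Summable fun s : Set.Ioc a c => jump f s w) :
    jumpSumR f a c w = jumpSumR f a b w + jumpSumR f b c w :=
  tsum_Ioc_addR (g := fun s => jump f s w) hab hbc h

end Basic

section Metric
variable {E : Type*} [MetricSpace E] [ProperSpace E]

lemma leftVal_freeze (w : CadlagPath E) {r s : ℝ≥0} (hr : 0 < r) (hrs : r ≤ s) :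
    (freeze s w).leftVal r = w.leftVal r := by
  refine leftVal_eq _ hr ((w.tendsto_left hr).congr' ?_)
  filter_upwards [self_mem_nhdsWithin] with u hu
  have hu' : u < r := hu
  simp [min_eq_left (hu'.le.trans hrs)]

lemma leftVal_shift (w : CadlagPath E) {r : ℝ≥0} (s : ℝ≥0) (hr : 0 < r) :
    (shift s w).leftVal r = w.leftVal (s + r) := by
  refine leftVal_eq _ hr ((w.tendsto_left (s := s + r) (by positivity)).comp
    (tendsto_nhdsWithin_iff.2 ⟨?_, ?_⟩))
  · exact ((continuous_const.add continuous_id).tendsto r).mono_left inf_le_left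
  · filter_upwards [self_mem_nhdsWithin] with u hu
    have hu' : u < r := hu
    simpa using hu'

lemma jump_freeze {R : Type*} [Zero R] (f : E → E → R) (w : CadlagPath E) {r s : ℝ≥0} (hr : 0 < r)
    (hrs : r ≤ s) : jump f r (freeze s w) = jump f r w := by
  unfold jump
  rw [leftVal_freeze w hr hrs, freeze_apply, min_eq_left hrs]

lemma jump_shift {R : Type*} [Zero R] (f : E → E → R) (w : CadlagPath E) {r : ℝ≥0} (s : ℝ≥0)
    (hr : 0 < r) : jump f r (shift s w) = jump f (s + r) w := by
  unfold jump
  rw [leftVal_shift w s hr, shift_apply]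

lemma jumpSum_freeze (f : E → E → ℝ≥0∞) (w : CadlagPath E) {a b s : ℝ≥0} (hbs : b ≤ s) :
    jumpSum f a b (freeze s w) = jumpSum f a b w :=
  tsum_congr fun r => jump_freeze f w (lt_of_le_of_lt zero_le r.2.1) (r.2.2.trans hbs)

lemma jumpSumR_freeze (f : E → E → ℝ) (w : CadlagPath E) {a b s : ℝ≥0} (hbs : b ≤ s) :
    jumpSumR f a b (freeze s w) = jumpSumR f a b w :=
  tsum_congr fun r => jump_freeze f w (lt_of_le_of_lt zero_le r.2.1) (r.2.2.trans hbs)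

/-- Translation of half-open intervals. -/
def IocShift (s a b : ℝ≥0) : Set.Ioc a b ≃ Set.Ioc (s + a) (s + b) where
  toFun r := ⟨s + r, add_lt_add_right r.2.1 s, add_le_add_right r.2.2 s⟩
  invFun r := ⟨r - s, lt_tsub_iff_left.2 r.2.1, tsub_le_iff_left.2 r.2.2⟩
  left_inv r := Subtype.ext (by simp)
  right_inv r := Subtype.ext (add_tsub_cancel_of_le (le_self_add.trans r.2.1.le))

lemma jumpSum_shift (f : E → E → ℝ≥0∞) (w : CadlagPath E) (s a b : ℝ≥0) :
    jumpSum f a b (shift s w) = jumpSum f (s + a) (s + b) w := by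
  unfold jumpSum
  rw [← (IocShift s a b).tsum_eq fun r => jump f r w]
  exact tsum_congr fun r => jump_shift f w s (lt_of_le_of_lt zero_le r.2.1)

lemma jumpSumR_shift (f : E → E → ℝ) (w : CadlagPath E) (s a b : ℝ≥0) :
    jumpSumR f a b (shift s w) = jumpSumR f (s + a) (s + b) w := by
  unfold jumpSumR
  rw [← (IocShift s a b).tsum_eq fun r => jump f r w]
  exact tsum_congr fun r => jump_shift f w s (lt_of_le_of_lt zero_le r.2.1)

variable [MeasurableSpace E] [BorelSpace E]

lemma measurable_jumpAbs {f : E → E → ℝ} (hf : Measurable (Function.uncurry f))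
    (hd : ∀ x, f x x = 0) (a b : ℝ≥0) : Measurable (jumpAbs f a b) := by
  refine measurable_jumpSum ?_ (by simp [hd]) a b
  have : Measurable fun p : E × E => ENNReal.ofReal |Function.uncurry f p| := by fun_prop
  exact this

lemma measurable_jumpSumR {f : E → E → ℝ} (hf : Measurable (Function.uncurry f))
    (hd : ∀ x, f x x = 0) (a b : ℝ≥0) : Measurable (jumpSumR f a b) := by
  classical
  have h1 := measurable_jumpAbs hf hd a b
  have h2 : Measurable (jumpSum (fun x y => ENNReal.ofReal (f x y)) a b) := by
    refine measurable_jumpSum ?_ (by simp [hd]) a b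
    have : Measurable fun p : E × E => ENNReal.ofReal (Function.uncurry f p) := by fun_prop
    exact this
  have h3 : Measurable (jumpSum (fun x y => ENNReal.ofReal (-f x y)) a b) := by
    refine measurable_jumpSum ?_ (by simp [hd]) a b
    have : Measurable fun p : E × E => ENNReal.ofReal (-Function.uncurry f p) := by fun_prop
    exact this
  have : jumpSumR f a b = fun w => if jumpAbs f a b w = ⊤ then 0 else
      (jumpSum (fun x y => ENNReal.ofReal (f x y)) a b w).toReal -
      (jumpSum (fun x y => ENNReal.ofReal (-f x y)) a b w).toReal := by
    funext w
    split_ifs with h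
    · exact jumpSumR_eq_zero_of_top f h
    · exact jumpSumR_eq f h
  rw [this]
  exact Measurable.ite (h1 (measurableSet_singleton ⊤)) measurable_const
    (h2.ennreal_toReal.sub h3.ennreal_toReal)

lemma measurable_elim {R : Type*} [MeasurableSpace R] [Zero R] {g : E → R} (hg : Measurable g) :
    Measurable fun y : OnePoint E => y.elim 0 g := by
  classical
  intro s hs
  have h : (fun y : OnePoint E => y.elim 0 g) ⁻¹' s =
      ((↑) '' (g ⁻¹' s)) ∪ (if (0 : R) ∈ s then {OnePoint.infty} else ∅) := by
    ext y
    induction y using OnePoint.rec with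
    | infty => by_cases h : (0 : R) ∈ s <;> simp [h]
    | coe x => by_cases h : (0 : R) ∈ s <;> simp [h]
  rw [h]
  refine (measurableEmbedding_coe.measurableSet_image.2 (hg hs)).union ?_
  split_ifs
  · exact isClosed_singleton.measurableSet
  · exact MeasurableSet.empty

lemma measurable_elim_eval {R : Type*} [MeasurableSpace R] [Zero R] {g : E → R}
    (hg : Measurable g) (t : ℝ≥0) : Measurable fun w : CadlagPath E => (w t).elim 0 g :=
  (measurable_elim hg).comp (measurable_eval t)

/-- A countable base of `E` together with the complements of the closed balls of integer radius,
which are compact because `E` is proper. It serves to make the compactification metrizable, so that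
pointwise limits of measurable maps are measurable. -/
instance instSecondCountableOnePoint : SecondCountableTopology (OnePoint E) := by
  rcases isEmpty_or_nonempty E with hE | ⟨⟨x₀⟩⟩
  · have : Finite (OnePoint E) := by
      have : Fintype (Option E) := inferInstance
      exact Finite.of_fintype (Option E)
    infer_instance
  set 𝓑 := TopologicalSpace.countableBasis E
  have hB := TopologicalSpace.isBasis_countableBasis E
  have hbasis : TopologicalSpace.IsTopologicalBasis
      (((fun U : Set E => ((↑) '' U : Set (OnePoint E))) '' 𝓑) ∪
        Set.range fun n : ℕ => (((↑) '' Metric.closedBall x₀ (n : ℝ) : Set (OnePoint E)))ᶜ) := by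
    refine TopologicalSpace.isTopologicalBasis_of_isOpen_of_nhds ?_ ?_
    · rintro _ (⟨U, hU, rfl⟩ | ⟨n, rfl⟩)
      · exact OnePoint.isOpen_image_coe.2 (hB.isOpen hU)
      · exact OnePoint.isOpen_compl_image_coe.2
          ⟨Metric.isClosed_closedBall, isCompact_closedBall _ _⟩
    · intro y U hy hU
      induction y using OnePoint.rec with
      | coe x =>
        obtain ⟨V, hV, hxV, hVU⟩ := hB.exists_subset_of_mem_open (a := x) hy
          (hU.preimage OnePoint.continuous_coe)
        exact ⟨_, Or.inl ⟨V, hV, rfl⟩, Set.mem_image_of_mem _ hxV, Set.image_subset_iff.2 hVU⟩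
      | infty =>
        have hc := ((OnePoint.isOpen_iff_of_mem hy).1 hU).2
        obtain ⟨r, hr⟩ := hc.isBounded.subset_closedBall x₀
        obtain ⟨n, hn⟩ := exists_nat_ge r
        refine ⟨_, Or.inr ⟨n, rfl⟩, OnePoint.infty_notMem_image_coe, ?_⟩
        intro z hz
        induction z using OnePoint.rec with
        | infty => exact hy
        | coe x =>
          by_contra hxU
          exact hz (Set.mem_image_of_mem _ (Metric.closedBall_subset_closedBall hn (hr hxU)))
  exact hbasis.secondCountableTopology
    (((TopologicalSpace.countable_countableBasis E).image _).union (Set.countable_range _))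

/-- By right-continuity the value at a time is the limit of the values at slightly later times that
take countably many values; adding 1 to the integer part keeps them strictly later. -/
lemma measurable_eval_uncurry :
    Measurable fun q : ℝ≥0 × CadlagPath E => q.2 q.1 := by
  let _ := TopologicalSpace.metrizableSpaceMetric (OnePoint E)
  have h1 : ∀ n : ℕ, Measurable fun q : ℝ≥0 × CadlagPath E =>
      q.2 (((⌊q.1 * (n + 1)⌋₊ : ℝ≥0) + 1) / (n + 1)) := by
    intro n
    have h2 : Measurable fun q : ℕ × CadlagPath E => q.2 (((q.1 : ℝ≥0) + 1) / (n + 1)) :=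
      measurable_from_prod_countable_right fun k => measurable_eval (((k : ℝ≥0) + 1) / (n + 1))
    have h3 : Measurable fun q : ℝ≥0 × CadlagPath E => (⌊q.1 * (n + 1)⌋₊, q.2) := by
      refine Measurable.prodMk ?_ measurable_snd
      exact Nat.measurable_floor.comp (measurable_fst.mul_const _)
    exact h2.comp h3
  refine measurable_of_tendsto_metrizable h1 (tendsto_pi_nhds.2 fun q => ?_)
  refine (q.2.right_cont_Ioi q.1).tendsto.comp (tendsto_nhdsWithin_iff.2 ⟨?_, ?_⟩)
  · have h0 : Tendsto (fun n : ℕ => q.1 + 1 / ((n : ℝ≥0) + 1)) atTop (𝓝 (q.1 + 0)) :=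
      tendsto_const_nhds.add tendsto_one_div_add_atTop_nhds_zero_nat
    rw [add_zero] at h0
    refine tendsto_of_tendsto_of_tendsto_of_le_of_le tendsto_const_nhds h0 (fun n => ?_) fun n => ?_
    · have : q.1 * ((n : ℝ≥0) + 1) < (⌊q.1 * (n + 1)⌋₊ : ℝ≥0) + 1 := Nat.lt_floor_add_one _
      exact ((lt_div_iff₀ (by positivity)).2 this).le
    · have : (⌊q.1 * ((n : ℝ≥0) + 1)⌋₊ : ℝ≥0) ≤ q.1 * (n + 1) := Nat.floor_le zero_le
      rw [add_div]
      gcongr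
      exact (div_le_iff₀ (by positivity)).2 this
  · refine Filter.Eventually.of_forall fun n => ?_
    have : q.1 * ((n : ℝ≥0) + 1) < (⌊q.1 * (n + 1)⌋₊ : ℝ≥0) + 1 := Nat.lt_floor_add_one _
    exact (lt_div_iff₀ (by positivity)).2 this

end Metric
end CadlagPath

/-! ### The Markov property for functionals that couple past and future. -/

section Markov
open CadlagPath ProbabilityTheory
variable {E : Type*} [MetricSpace E] [ProperSpace E] [MeasurableSpace E] [BorelSpace E]
  {κ : Kernel (OnePoint E) (CadlagPath E)}

/-- The joint law of past and future is a composition product, so any function of both can be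
integrated over the future first. The frozen path still knows `w s`, its value at time `s`. -/
lemma IsMarkovLaw.map_eq (hκ : IsMarkovLaw κ) (x : OnePoint E) (s : ℝ≥0) :
    (κ x).map (fun w => (freeze s w, shift s w)) =
      ((κ x).map (freeze s)) ⊗ₘ (κ.comap (fun w => w s) (measurable_eval s)) := by
  have := hκ.prob
  have hpm : Measurable fun w : CadlagPath E => (freeze s w, shift s w) :=
    (measurable_freeze s).prodMk (measurable_shift s)
  have := Measure.isProbabilityMeasure_map (μ := κ x) (measurable_freeze s).aemeasurable
  have := Measure.isProbabilityMeasure_map (μ := κ x) hpm.aemeasurable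
  refine Measure.ext_prod fun {A B} hA hB => ?_
  rw [Measure.map_apply hpm (hA.prod hB), Measure.compProd_apply_prod hA hB,
    setLIntegral_map hA (Kernel.measurable_coe _ hB) (measurable_freeze s)]
  have h := hκ.markov x s (A.indicator fun _ => 1) (B.indicator fun _ => 1)
    (measurable_const.indicator hA) (measurable_const.indicator hB)
  have e1 : ∫⁻ w, A.indicator (fun _ => (1 : ℝ≥0∞)) (freeze s w) *
      B.indicator (fun _ => 1) (shift s w) ∂(κ x) =
      κ x ((fun w => (freeze s w, shift s w)) ⁻¹' A ×ˢ B) := by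
    rw [← lintegral_indicator_one (hpm (hA.prod hB))]
    refine lintegral_congr fun w => ?_
    by_cases h1 : freeze s w ∈ A <;> by_cases h2 : shift s w ∈ B <;>
      simp [Set.indicator, h1, h2]
  rw [← e1, h, ← lintegral_indicator (measurable_freeze s hA)]
  refine lintegral_congr fun w => ?_
  by_cases h1 : freeze s w ∈ A
  · have h2 : w ∈ freeze s ⁻¹' A := h1
    simp only [Set.indicator_of_mem h1, Set.indicator_of_mem h2, one_mul, Kernel.comap_apply]
    rw [freeze_apply, min_self]
    exact (lintegral_indicator_one hB)
  · have h2 : w ∉ freeze s ⁻¹' A := h1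
    simp [Set.indicator_of_notMem h1, Set.indicator_of_notMem h2]

lemma IsMarkovLaw.lintegral_eq (hκ : IsMarkovLaw κ) (x : OnePoint E) (s : ℝ≥0)
    {Ψ : CadlagPath E → CadlagPath E → ℝ≥0∞} (hΨ : Measurable (Function.uncurry Ψ)) :
    ∫⁻ w, Ψ (freeze s w) (shift s w) ∂(κ x) =
      ∫⁻ w, ∫⁻ w', Ψ (freeze s w) w' ∂(κ (w s)) ∂(κ x) := by
  have := hκ.prob
  have hpm : Measurable fun w : CadlagPath E => (freeze s w, shift s w) :=
    (measurable_freeze s).prodMk (measurable_shift s)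
  have := Measure.isProbabilityMeasure_map (μ := κ x) (measurable_freeze s).aemeasurable
  have h := lintegral_map (μ := κ x) hΨ hpm
  refine h.symm.trans ?_
  rw [hκ.map_eq x s, Measure.lintegral_compProd hΨ, lintegral_map ?_ (measurable_freeze s)]
  · refine lintegral_congr fun w => ?_
    simp [Function.uncurry]
  · exact Measurable.lintegral_kernel_prod_right' hΨ

lemma IsMarkovLaw.integral_eq (hκ : IsMarkovLaw κ) (x : OnePoint E) (s : ℝ≥0)
    {Ψ : CadlagPath E → CadlagPath E → ℝ} (hΨ : Measurable (Function.uncurry Ψ))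
    (hi : Integrable (fun w => Ψ (freeze s w) (shift s w)) (κ x)) :
    ∫ w, Ψ (freeze s w) (shift s w) ∂(κ x) =
      ∫ w, ∫ w', Ψ (freeze s w) w' ∂(κ (w s)) ∂(κ x) := by
  have := hκ.prob
  have hpm : Measurable fun w : CadlagPath E => (freeze s w, shift s w) :=
    (measurable_freeze s).prodMk (measurable_shift s)
  have := Measure.isProbabilityMeasure_map (μ := κ x) (measurable_freeze s).aemeasurable
  have h := integral_map (μ := κ x) hpm.aemeasurable (f := Function.uncurry Ψ)
    hΨ.aestronglyMeasurable
  refine h.symm.trans ?_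
  have hi' : Integrable (Function.uncurry Ψ) ((κ x).map fun w => (freeze s w, shift s w)) :=
    (integrable_map_measure hΨ.aestronglyMeasurable hpm.aemeasurable).2 hi
  rw [hκ.map_eq x s] at hi' ⊢
  rw [Measure.integral_compProd hi', integral_map (measurable_freeze s).aemeasurable]
  · refine integral_congr_ae (Filter.Eventually.of_forall fun w => ?_)
    simp [Function.uncurry]
  · exact (hΨ.stronglyMeasurable.integral_kernel_prod_right').aestronglyMeasurable

end Markov

/-! ### Grid approximation of times, and expansions of the exponential of a sum. -/

namespace CadlagPath

/-- The smallest point of the uniform grid of `[0, t]` to the right of `s`. -/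
def gridCeil (t : ℝ≥0) (n : ℕ) (s : ℝ≥0) : ℝ≥0 := t * (⌈s * (n + 1) / t⌉₊ / (n + 1))

lemma grid_zero_eq (t : ℝ≥0) (n i : ℕ) : grid 0 t n i = t * (i / (n + 1)) := by simp [grid]

lemma gridCeil_eq {t : ℝ≥0} (ht : 0 < t) {n i : ℕ} {s : ℝ≥0}
    (hs : s ∈ Set.Ioc (grid 0 t n i) (grid 0 t n (i + 1))) :
    gridCeil t n s = grid 0 t n (i + 1) := by
  rw [grid_zero_eq, grid_zero_eq] at hs
  have hn : (0 : ℝ≥0) < (n : ℝ≥0) + 1 := by positivity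
  have h1 : (i : ℝ≥0) < s * (n + 1) / t := by
    rw [lt_div_iff₀ ht]
    have := mul_lt_mul_of_pos_right hs.1 hn
    calc (i : ℝ≥0) * t = t * (i / (n + 1)) * (n + 1) := by field_simp
      _ < _ := this
  have h2 : s * (n + 1) / t ≤ ((i + 1 : ℕ) : ℝ≥0) := by
    rw [div_le_iff₀ ht]
    have := mul_le_mul_of_nonneg_right hs.2 hn.le
    calc s * (n + 1) ≤ t * (((i + 1 : ℕ) : ℝ≥0) / (n + 1)) * (n + 1) := this
      _ = _ := by field_simp
  have h3 : ⌈s * (n + 1) / t⌉₊ = i + 1 := by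
    rw [Nat.ceil_eq_iff (by omega)]
    exact ⟨by simpa using h1, h2⟩
  rw [gridCeil, h3, grid_zero_eq]

lemma le_gridCeil {t : ℝ≥0} (ht : 0 < t) (n : ℕ) (s : ℝ≥0) : s ≤ gridCeil t n s := by
  have h := Nat.le_ceil (s * ((n : ℝ≥0) + 1) / t)
  rw [div_le_iff₀ ht] at h
  have hn : (0 : ℝ≥0) < (n : ℝ≥0) + 1 := by positivity
  rw [gridCeil, ← mul_div_assoc, le_div_iff₀ hn, mul_comm t]
  exact h

lemma gridCeil_le {t : ℝ≥0} (ht : 0 < t) (n : ℕ) {s : ℝ≥0} (hs : s ≤ t) : gridCeil t n s ≤ t := by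
  have hn : (0 : ℝ≥0) < (n : ℝ≥0) + 1 := by positivity
  have h : ⌈s * ((n : ℝ≥0) + 1) / t⌉₊ ≤ n + 1 := by
    rw [Nat.ceil_le, div_le_iff₀ ht, mul_comm]
    push_cast
    gcongr
  have h2 : ((⌈s * ((n : ℝ≥0) + 1) / t⌉₊ : ℝ≥0)) / (n + 1) ≤ 1 := by
    rw [div_le_one hn]; exact_mod_cast h
  calc gridCeil t n s ≤ t * 1 := mul_le_mul_of_nonneg_left h2 zero_le
    _ = t := mul_one t

lemma gridCeil_self {t : ℝ≥0} (ht : 0 < t) (n : ℕ) : gridCeil t n t = t :=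
  le_antisymm (gridCeil_le ht n le_rfl) (le_gridCeil ht n t)

lemma tendsto_gridCeil {t : ℝ≥0} (ht : 0 < t) (s : ℝ≥0) :
    Tendsto (fun n => gridCeil t n s) atTop (𝓝 s) := by
  have h0 : Tendsto (fun n : ℕ => s + t * (1 / ((n : ℝ≥0) + 1))) atTop (𝓝 (s + t * 0)) :=
    tendsto_const_nhds.add (tendsto_const_nhds.mul tendsto_one_div_add_atTop_nhds_zero_nat)
  rw [mul_zero, add_zero] at h0
  refine tendsto_of_tendsto_of_tendsto_of_le_of_le tendsto_const_nhds h0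
    (fun n => le_gridCeil ht n s) fun n => ?_
  have hn : (0 : ℝ≥0) < (n : ℝ≥0) + 1 := by positivity
  have h := (Nat.ceil_lt_add_one (zero_le (a := s * ((n : ℝ≥0) + 1) / t))).le
  calc gridCeil t n s ≤ t * ((s * ((n : ℝ≥0) + 1) / t + 1) / (n + 1)) := by
        unfold gridCeil; gcongr
    _ = s + t * (1 / ((n : ℝ≥0) + 1)) := by field_simp

lemma tsum_gridCeil {t : ℝ≥0} (ht : 0 < t) (G : ℝ≥0 → ℝ≥0 → ℝ≥0∞) (n : ℕ) :
    ∑' s : Set.Ioc 0 t, G (gridCeil t n s) s = ∑ i ∈ Finset.range (n + 1),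
      ∑' s : Set.Ioc (grid 0 t n i) (grid 0 t n (i + 1)), G (grid 0 t n (i + 1)) s := by
  have hg := tsum_Ioc_grid (fun s => G (gridCeil t n s) s) (grid_mono 0 t n) (n + 1)
  rw [grid_zero, grid_last zero_le] at hg
  rw [hg]
  exact Finset.sum_congr rfl fun i _ => tsum_congr fun s => by rw [gridCeil_eq ht s.2]

lemma summable_Ioc_sub {g : ℝ≥0 → ℝ} {a b c d : ℝ≥0} (hac : c ≤ a) (hbd : b ≤ d)
    (h : Summable fun s : Set.Ioc c d => g s) : Summable fun s : Set.Ioc a b => g s :=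
  h.comp_injective (i := Set.inclusion (Set.Ioc_subset_Ioc hac hbd)) (Set.inclusion_injective _)

lemma tsum_gridCeilR {t : ℝ≥0} (ht : 0 < t) (G : ℝ≥0 → ℝ≥0 → ℝ) (n : ℕ)
    (hG : Summable fun s : Set.Ioc 0 t => G (gridCeil t n s) s) :
    ∑' s : Set.Ioc 0 t, G (gridCeil t n s) s = ∑ i ∈ Finset.range (n + 1),
      ∑' s : Set.Ioc (grid 0 t n i) (grid 0 t n (i + 1)), G (grid 0 t n (i + 1)) s := by
  have key : ∀ k ≤ n + 1, ∑' s : Set.Ioc 0 (grid 0 t n k), G (gridCeil t n s) s =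
      ∑ i ∈ Finset.range k,
        ∑' s : Set.Ioc (grid 0 t n i) (grid 0 t n (i + 1)), G (gridCeil t n s) s := by
    intro k
    induction k with
    | zero => intro _; simp
    | succ k ih =>
      intro hk
      rw [Finset.sum_range_succ, ← ih (by omega)]
      refine tsum_Ioc_addR (g := fun s => G (gridCeil t n s) s) zero_le (grid_mono 0 t n (Nat.le_succ k)) ?_
      exact summable_Ioc_sub (g := fun s => G (gridCeil t n s) s) le_rfl
        ((grid_mono 0 t n hk).trans_eq (grid_last zero_le n)) hG
  have h := key (n + 1) le_rfl
  rw [grid_last zero_le] at h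
  rw [h]
  exact Finset.sum_congr rfl fun i _ => tsum_congr fun s => by rw [gridCeil_eq ht s.2]

lemma tsum_Ioc_eq_indicator (g : ℝ≥0 → ℝ) (a b : ℝ≥0) :
    ∑' s : Set.Ioc a b, g s = ∑' s, (Set.Ioc a b).indicator g s := tsum_subtype _ _

lemma summable_Ioc_iff (g : ℝ≥0 → ℝ) (a b : ℝ≥0) :
    (Summable fun s : Set.Ioc a b => g s) ↔ Summable ((Set.Ioc a b).indicator g) :=
  summable_subtype_iff_indicator

lemma abs_indicator_Ioc_le (g : ℝ≥0 → ℝ) {s t : ℝ≥0} (r : ℝ≥0) :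
    |(Set.Ioc s t).indicator g r| ≤ |(Set.Ioc 0 t).indicator g r| := by
  by_cases h : r ∈ Set.Ioc s t
  · rw [Set.indicator_of_mem h, Set.indicator_of_mem (show r ∈ Set.Ioc 0 t from ⟨lt_of_le_of_lt zero_le h.1, h.2⟩)]
  · rw [Set.indicator_of_notMem h, abs_zero]
    exact abs_nonneg _

/-- Right-continuity of the tails of a convergent sum over times. -/
lemma tendsto_tail {g : ℝ≥0 → ℝ} {t s : ℝ≥0} (hg : Summable fun s : Set.Ioc 0 t => g s)
    {u : ℕ → ℝ≥0} (hu : Tendsto u atTop (𝓝 s)) (hsu : ∀ n, s ≤ u n) :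
    Tendsto (fun n => ∑' r : Set.Ioc (u n) t, g r) atTop (𝓝 (∑' r : Set.Ioc s t, g r)) := by
  simp_rw [tsum_Ioc_eq_indicator]
  refine tendsto_tsum_of_dominated_convergence
    (bound := fun r => |(Set.Ioc 0 t).indicator g r|) ?_ (fun r => ?_) ?_
  · exact ((summable_Ioc_iff g 0 t).1 hg).abs
  · refine tendsto_const_nhds.congr' ?_
    rcases lt_or_ge s r with h | h
    · filter_upwards [hu.eventually_lt_const h] with n hn
      by_cases hr : r ≤ t
      · rw [Set.indicator_of_mem (show r ∈ Set.Ioc s t from ⟨h, hr⟩),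
          Set.indicator_of_mem (show r ∈ Set.Ioc (u n) t from ⟨hn, hr⟩)]
      · rw [Set.indicator_of_notMem (show r ∉ Set.Ioc s t from fun h => hr h.2),
          Set.indicator_of_notMem (show r ∉ Set.Ioc (u n) t from fun h => hr h.2)]
    · refine Filter.Eventually.of_forall fun n => ?_
      beta_reduce
      rw [Set.indicator_of_notMem (show r ∉ Set.Ioc s t from fun h' => absurd h'.1 (not_lt.2 h)),
        Set.indicator_of_notMem (show r ∉ Set.Ioc (u n) t from
          fun h' => absurd h'.1 (not_lt.2 (h.trans (hsu n))))]
  · exact Filter.Eventually.of_forall fun n r => abs_indicator_Ioc_le g r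

/-- Telescoping, by adding times from the right: a new smallest time `a` multiplies the left side by
e^{-g a} = 1 + (e^{-g a} - 1), and the terms of the later times do not see `a`. -/
lemma exp_neg_sum_finset (g : ℝ≥0 → ℝ) (S : Finset ℝ≥0) :
    Real.exp (-∑ s ∈ S, g s) = 1 + ∑ s ∈ S, (Real.exp (-g s) - 1) *
      Real.exp (-∑ r ∈ S with s < r, g r) := by
  induction S using Finset.induction_on_min with
  | empty => simp
  | insert a S ha ih =>
    have haS : a ∉ S := fun h => lt_irrefl a (ha a h)
    rw [Finset.sum_insert haS, Finset.sum_insert haS]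
    have h1 : ∑ r ∈ insert a S with a < r, g r = ∑ r ∈ S, g r := by
      congr 1
      ext r
      simp only [Finset.mem_filter, Finset.mem_insert]
      exact ⟨fun h => h.1.resolve_left h.2.ne', fun h => ⟨Or.inr h, ha r h⟩⟩
    have h2 : ∀ s ∈ S, ∑ r ∈ insert a S with s < r, g r = ∑ r ∈ S with s < r, g r := by
      intro s hs
      rw [Finset.filter_insert, if_neg (not_lt.2 (ha s hs).le)]
    have h3 : ∑ s ∈ S, (Real.exp (-g s) - 1) * Real.exp (-∑ r ∈ insert a S with s < r, g r) =
        ∑ s ∈ S, (Real.exp (-g s) - 1) * Real.exp (-∑ r ∈ S with s < r, g r) :=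
      Finset.sum_congr rfl fun s hs => by rw [h2 s hs]
    rw [h1, h3, neg_add, Real.exp_add]
    linear_combination ih

lemma abs_exp_sub_one_le (x : ℝ) : |Real.exp x - 1| ≤ Real.exp |x| - 1 := by
  rcases le_total 0 x with h | h
  · rw [abs_of_nonneg h, abs_of_nonneg]
    linarith [Real.one_le_exp h]
  · rw [abs_of_nonpos h, abs_of_nonpos (by linarith [Real.exp_le_one_iff.2 h])]
    have h1 := Real.add_one_le_exp x
    have h2 := Real.add_one_le_exp (-x)
    linarith

lemma exp_sub_one_le_mul {x y : ℝ} (hx : 0 ≤ x) (hxy : x ≤ y) :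
    Real.exp x - 1 ≤ x * Real.exp y := by
  have h1 := Real.add_one_le_exp (-x)
  have h2 : Real.exp x * Real.exp (-x) = 1 := by rw [← Real.exp_add]; simp
  have h3 : Real.exp x - 1 ≤ x * Real.exp x := by nlinarith [Real.exp_pos x]
  exact h3.trans (by gcongr)

/-- Expansion of the exponential of a sum along its last-exit decomposition. -/
lemma exp_neg_tsum {g : ℝ≥0 → ℝ} {t : ℝ≥0} (hg : Summable fun s : Set.Ioc 0 t => g s) :
    Real.exp (-∑' s : Set.Ioc 0 t, g s) = 1 + ∑' s : Set.Ioc 0 t, (Real.exp (-g s) - 1) *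
      Real.exp (-∑' r : Set.Ioc (s : ℝ≥0) t, g r) := by
  classical
  set g0 := (Set.Ioc 0 t).indicator g with hg0
  have hs0 : Summable g0 := (summable_Ioc_iff g 0 t).1 hg
  have hs1 : Summable fun s => |g0 s| := hs0.abs
  set A := ∑' s, |g0 s| with hA
  have htail : ∀ s, Summable ((Set.Ioc s t).indicator g) := fun s =>
    Summable.of_norm_bounded hs1 fun r => abs_indicator_Ioc_le g r
  have hrhs : ∑' s : Set.Ioc 0 t, (Real.exp (-g s) - 1) *
      Real.exp (-∑' r : Set.Ioc (s : ℝ≥0) t, g r) = ∑' s, (Real.exp (-g0 s) - 1) *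
      Real.exp (-∑' r, (Set.Ioc s t).indicator g r) := by
    rw [tsum_Ioc_eq_indicator fun s => (Real.exp (-g s) - 1) *
      Real.exp (-∑' r : Set.Ioc (s : ℝ≥0) t, g r)]
    refine tsum_congr fun s => ?_
    by_cases h : s ∈ Set.Ioc 0 t
    · rw [Set.indicator_of_mem h, hg0, Set.indicator_of_mem h, tsum_Ioc_eq_indicator]
    · rw [Set.indicator_of_notMem h, hg0, Set.indicator_of_notMem h]
      simp
  rw [hrhs, tsum_Ioc_eq_indicator]
  have hL : Tendsto (fun S : Finset ℝ≥0 => Real.exp (-∑ s ∈ S, g0 s)) atTop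
      (𝓝 (Real.exp (-∑' s, g0 s))) := (Real.continuous_exp.tendsto _).comp (show Tendsto (fun S : Finset ℝ≥0 => ∑ s ∈ S, g0 s) atTop (𝓝 (∑' s, g0 s)) from hs0.hasSum).neg
  have hfilt : ∀ (S : Finset ℝ≥0) (s : ℝ≥0), 0 < s →
      ∑ r ∈ S with s < r, g0 r = ∑ r ∈ S, (Set.Ioc s t).indicator g r := by
    intro S s hs
    rw [Finset.sum_filter]
    refine Finset.sum_congr rfl fun r _ => ?_
    by_cases hsr : s < r
    · rw [if_pos hsr, hg0]
      by_cases hrt : r ≤ t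
      · rw [Set.indicator_of_mem (show r ∈ Set.Ioc 0 t from ⟨hs.trans hsr, hrt⟩),
          Set.indicator_of_mem (show r ∈ Set.Ioc s t from ⟨hsr, hrt⟩)]
      · rw [Set.indicator_of_notMem (show r ∉ Set.Ioc 0 t from fun h => hrt h.2),
          Set.indicator_of_notMem (show r ∉ Set.Ioc s t from fun h => hrt h.2)]
    · rw [if_neg hsr, Set.indicator_of_notMem (show r ∉ Set.Ioc s t from fun h => hsr h.1)]
  -- The finite identity passes to the limit by dominated convergence: every partial sum is at most
  -- `A` in absolute value, and |e^{-x} - 1| ≤ |x| e^A when |x| ≤ A.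
  have hR : Tendsto (fun S : Finset ℝ≥0 => 1 + ∑' s, (S : Set ℝ≥0).indicator (fun s =>
      (Real.exp (-g0 s) - 1) * Real.exp (-∑ r ∈ S with s < r, g0 r)) s) atTop
      (𝓝 (1 + ∑' s, (Real.exp (-g0 s) - 1) *
        Real.exp (-∑' r, (Set.Ioc s t).indicator g r))) := by
    refine tendsto_const_nhds.add (tendsto_tsum_of_dominated_convergence
      (bound := fun s => |g0 s| * Real.exp A * Real.exp A) ?_ (fun s => ?_) ?_)
    · exact (hs1.mul_right _).mul_right _
    · by_cases h : s ∈ Set.Ioc 0 t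
      · have h1 : Tendsto (fun S : Finset ℝ≥0 => (Real.exp (-g0 s) - 1) *
            Real.exp (-∑ r ∈ S with s < r, g0 r)) atTop (𝓝 ((Real.exp (-g0 s) - 1) *
            Real.exp (-∑' r, (Set.Ioc s t).indicator g r))) := by
          simp_rw [hfilt _ s h.1]
          exact tendsto_const_nhds.mul ((Real.continuous_exp.tendsto _).comp (Tendsto.neg
            (show Tendsto (fun S : Finset ℝ≥0 => ∑ r ∈ S, (Set.Ioc s t).indicator g r) atTop _ from
              (htail s).hasSum)))
        refine h1.congr' ?_
        filter_upwards [eventually_ge_atTop {s}] with S hS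
        rw [Set.indicator_of_mem (show s ∈ (S : Set ℝ≥0) from hS (Finset.mem_singleton_self s))]
      · have : g0 s = 0 := Set.indicator_of_notMem h _
        simp only [this, Set.indicator]
        simp
    · refine Filter.Eventually.of_forall fun S s => ?_
      by_cases hsS : s ∈ (S : Set ℝ≥0)
      · rw [Set.indicator_of_mem hsS, norm_mul, Real.norm_eq_abs, Real.norm_eq_abs, Real.abs_exp]
        have h1 : |g0 s| ≤ A := hs1.le_tsum s fun _ _ => abs_nonneg _
        have h2 : -∑ r ∈ S with s < r, g0 r ≤ A := by
          calc -∑ r ∈ S with s < r, g0 r ≤ |∑ r ∈ S with s < r, g0 r| := neg_le_abs _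
            _ ≤ ∑ r ∈ S with s < r, |g0 r| := Finset.abs_sum_le_sum_abs _ _
            _ ≤ A := hs1.sum_le_tsum _ fun _ _ => abs_nonneg _
        have h3 := abs_exp_sub_one_le (-g0 s)
        rw [abs_neg] at h3
        have h4 := exp_sub_one_le_mul (abs_nonneg _) h1
        gcongr
        exact h3.trans h4
      · rw [Set.indicator_of_notMem hsS, norm_zero]
        positivity
  refine tendsto_nhds_unique hL (hR.congr fun S => ?_)
  rw [exp_neg_sum_finset, ← sum_eq_tsum_indicator]

/-- The truncation at `k` keeps expectations finite later on. The telescoping becomes an inequality,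
because min(g a + S, k) ≤ g a + min(S, k) for nonnegative `g a`. -/
lemma exp_min_sum_finset {g : ℝ≥0 → ℝ} (hg : ∀ s, 0 ≤ g s) (k : ℝ) (hk : 0 ≤ k)
    (S : Finset ℝ≥0) : Real.exp (min (∑ s ∈ S, g s) k) ≤ 1 + ∑ s ∈ S, (Real.exp (g s) - 1) *
      Real.exp (min (∑ r ∈ S with s < r, g r) k) := by
  induction S using Finset.induction_on_min with
  | empty => simp [hk]
  | insert a S ha ih =>
    have haS : a ∉ S := fun h => lt_irrefl a (ha a h)
    rw [Finset.sum_insert haS, Finset.sum_insert haS]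
    have h1 : ∑ r ∈ insert a S with a < r, g r = ∑ r ∈ S, g r := by
      congr 1
      ext r
      simp only [Finset.mem_filter, Finset.mem_insert]
      exact ⟨fun h => h.1.resolve_left h.2.ne', fun h => ⟨Or.inr h, ha r h⟩⟩
    have h2 : ∀ s ∈ S, ∑ r ∈ insert a S with s < r, g r = ∑ r ∈ S with s < r, g r := by
      intro s hs
      rw [Finset.filter_insert, if_neg (not_lt.2 (ha s hs).le)]
    have h5 : ∑ s ∈ S, (Real.exp (g s) - 1) *
        Real.exp (min (∑ r ∈ insert a S with s < r, g r) k) =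
        ∑ s ∈ S, (Real.exp (g s) - 1) * Real.exp (min (∑ r ∈ S with s < r, g r) k) :=
      Finset.sum_congr rfl fun s hs => by rw [h2 s hs]
    rw [h1, h5]
    have h3 : min (g a + ∑ s ∈ S, g s) k ≤ g a + min (∑ s ∈ S, g s) k := by
      rcases le_total (∑ s ∈ S, g s) k with h | h
      · rw [min_eq_left h]; exact min_le_left _ _
      · rw [min_eq_right h]; exact (min_le_right _ _).trans (by linarith [hg a])
    have h4 := Real.exp_le_exp.2 h3
    rw [Real.exp_add] at h4
    linarith

lemma exp_min_tsum_le {g : ℝ≥0 → ℝ} (hg : ∀ s, 0 ≤ g s) {t : ℝ≥0} (k : ℝ) (hk : 0 ≤ k)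
    (hs : Summable fun s : Set.Ioc 0 t => g s) :
    ENNReal.ofReal (Real.exp (min (∑' s : Set.Ioc 0 t, g s) k)) ≤
      1 + ∑' s : Set.Ioc 0 t, ENNReal.ofReal (Real.exp (g s) - 1) *
        ENNReal.ofReal (Real.exp (min (∑' r : Set.Ioc (s : ℝ≥0) t, g r) k)) := by
  classical
  have hlim : Tendsto (fun S : Finset (Set.Ioc 0 t) =>
      ENNReal.ofReal (Real.exp (min (∑ s ∈ S, g s) k))) atTop
      (𝓝 (ENNReal.ofReal (Real.exp (min (∑' s : Set.Ioc 0 t, g s) k)))) := by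
    refine ENNReal.tendsto_ofReal ((Real.continuous_exp.tendsto _).comp ?_)
    exact (hs.hasSum).min tendsto_const_nhds
  refine le_of_tendsto' hlim fun S => ?_
  set S' : Finset ℝ≥0 := S.map (Function.Embedding.subtype _) with hS'
  have h1 : ∑ s ∈ S, g s = ∑ s ∈ S', g s := by rw [hS', Finset.sum_map]; rfl
  have hpos : ∀ s, 0 ≤ Real.exp (g s) - 1 := fun s => by linarith [Real.one_le_exp (hg s)]
  rw [h1]
  refine (ENNReal.ofReal_le_ofReal (exp_min_sum_finset hg k hk S')).trans ?_
  rw [ENNReal.ofReal_add zero_le_one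
    (Finset.sum_nonneg fun s _ => mul_nonneg (hpos s) (Real.exp_pos _).le), ENNReal.ofReal_one,
    ENNReal.ofReal_sum_of_nonneg fun s _ => mul_nonneg (hpos s) (Real.exp_pos _).le, hS',
    Finset.sum_map, ← hS']
  refine add_le_add le_rfl (le_trans (Finset.sum_le_sum fun s _ => ?_) (ENNReal.sum_le_tsum S))
  rw [ENNReal.ofReal_mul (hpos _)]
  have hle : ∑ r ∈ S' with (s : ℝ≥0) < r, g r ≤ ∑' r : Set.Ioc (s : ℝ≥0) t, g r := by
    rw [tsum_Ioc_eq_indicator]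
    have e : ∑ r ∈ S' with (s : ℝ≥0) < r, g r =
        ∑ r ∈ S' with (s : ℝ≥0) < r, (Set.Ioc (s : ℝ≥0) t).indicator g r := by
      refine Finset.sum_congr rfl fun r hr => ?_
      obtain ⟨hr1, hr2⟩ := Finset.mem_filter.1 hr
      obtain ⟨q, -, hq⟩ := Finset.mem_map.1 hr1
      have hq' : (q : ℝ≥0) = r := hq
      rw [Set.indicator_of_mem (show r ∈ Set.Ioc (s : ℝ≥0) t from ⟨hr2, hq' ▸ q.2.2⟩)]
    rw [e]
    refine Summable.sum_le_tsum _ (fun r _ => Set.indicator_nonneg (fun r _ => hg r) r) ?_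
    exact (summable_Ioc_iff g s t).1 (summable_Ioc_sub zero_le le_rfl hs)
  exact mul_le_mul_right (ENNReal.ofReal_le_ofReal (Real.exp_le_exp.2 (min_le_min_right k hle))) _

lemma tsum_liminf_le {ι : Type*} (f : ℕ → ι → ℝ≥0∞) :
    ∑' i, liminf (fun n => f n i) atTop ≤ liminf (fun n => ∑' i, f n i) atTop := by
  let _ : MeasurableSpace ι := ⊤
  simp_rw [← lintegral_count]
  exact lintegral_liminf_le fun n => measurable_from_top

lemma liminf_le_const {u : ℕ → ℝ≥0∞} {c : ℝ≥0∞} (h : ∀ n, u n ≤ c) : liminf u atTop ≤ c :=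
  (liminf_le_liminf (Filter.Eventually.of_forall h)).trans_eq (liminf_const c)

lemma toReal_jumpAbs {E : Type*} [TopologicalSpace E] (F : E → E → ℝ) (a b : ℝ≥0)
    (w : CadlagPath E) : (jumpAbs F a b w).toReal = ∑' s : Set.Ioc a b, |jump F s w| := by
  unfold jumpAbs jumpSum
  simp_rw [ofReal_abs_jump]
  rw [ENNReal.tsum_toReal_eq fun s => ENNReal.ofReal_ne_top]
  exact tsum_congr fun s => ENNReal.toReal_ofReal (abs_nonneg _)

end CadlagPath

/-! ### Khasminskii's lemma. -/

section Khasminskii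
open CadlagPath ProbabilityTheory
variable {E : Type*} [MetricSpace E] [ProperSpace E] [MeasurableSpace E] [BorelSpace E]
  {κ : Kernel (OnePoint E) (CadlagPath E)}

/-- The weight `exp |F| - 1`. -/
def expWeight (F : E → E → ℝ) (x y : E) : ℝ≥0∞ := ENNReal.ofReal (Real.exp |F x y| - 1)

lemma measurable_expWeight {F : E → E → ℝ} (hF : Measurable (Function.uncurry F)) :
    Measurable (Function.uncurry (expWeight F)) := by
  have : Measurable fun p : E × E => ENNReal.ofReal (Real.exp |Function.uncurry F p| - 1) := by
    fun_prop
  exact this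

lemma expWeight_diag {F : E → E → ℝ} (hd : ∀ x, F x x = 0) (x : E) : expWeight F x x = 0 := by
  simp [expWeight, hd]

lemma jumpAbs_le_expWeight (F : E → E → ℝ) (a b : ℝ≥0) (w : CadlagPath E) :
    jumpAbs F a b w ≤ jumpSum (expWeight F) a b w :=
  jumpSum_mono (fun x y => ENNReal.ofReal_le_ofReal (by linarith [Real.add_one_le_exp |F x y|])) a b w

/-- The jumps of a cell belong to the path frozen at its right end point, and the remaining jumps to
the path shifted by it. The Markov property bounds the factor `φ` by its worst expectation,
monotonicity of `φ` allowing the remaining time to be enlarged to `t`; the cells then add up to the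
whole jump sum. -/
lemma IsMarkovLaw.lintegral_grid_le (hκ : IsMarkovLaw κ) {F : E → E → ℝ} {G : E → E → ℝ≥0∞}
    (hF : Measurable (Function.uncurry F)) (hd : ∀ x, F x x = 0)
    (hGm : ∀ a b, Measurable (jumpSum G a b)) {t : ℝ≥0}
    (hAfin : ∀ y, ∀ᵐ w ∂(κ y), jumpAbs F 0 t w < ⊤) {φ : ℝ≥0∞ → ℝ≥0∞} (hφm : Measurable φ)
    (hφ : ∀ a b, a ≤ b → b < ⊤ → φ a ≤ φ b) (y : OnePoint E) (n : ℕ) :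
    ∫⁻ w, ∑ i ∈ Finset.range (n + 1), jumpSum G (grid 0 t n i) (grid 0 t n (i + 1)) w *
          φ (jumpAbs F (grid 0 t n (i + 1)) t w) ∂(κ y) ≤
      (∫⁻ w, jumpSum G 0 t w ∂(κ y)) * ⨆ y, ∫⁻ w, φ (jumpAbs F 0 t w) ∂(κ y) := by
  have := hκ.prob
  have hAm := measurable_jumpAbs hF hd
  set U := ⨆ y, ∫⁻ w, φ (jumpAbs F 0 t w) ∂(κ y) with hU
  have h1 : ∀ i ∈ Finset.range (n + 1),
      ∫⁻ w, jumpSum G (grid 0 t n i) (grid 0 t n (i + 1)) w *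
        φ (jumpAbs F (grid 0 t n (i + 1)) t w) ∂(κ y) ≤
      ∫⁻ w, jumpSum G (grid 0 t n i) (grid 0 t n (i + 1)) w * U ∂(κ y) := by
    intro i hi
    set u := grid 0 t n (i + 1) with hu
    have hut : u ≤ t := (grid_mono 0 t n (Nat.succ_le_of_lt (Finset.mem_range.1 hi))).trans_eq
      (grid_last zero_le n)
    have h2 := hκ.markov y u (jumpSum G (grid 0 t n i) u)
      (fun w => φ (jumpAbs F 0 (t - u) w)) (hGm _ _) (hφm.comp (hAm _ _))
    have h3 : ∀ w : CadlagPath E, jumpAbs F 0 (t - u) (shift u w) = jumpAbs F u t w := by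
      intro w
      refine (jumpSum_shift _ w u 0 (t - u)).trans ?_
      rw [add_zero, add_tsub_cancel_of_le hut]
    simp_rw [h3, jumpSum_freeze _ _ (le_refl u)] at h2
    rw [h2]
    refine lintegral_mono fun w => ?_
    refine mul_le_mul_right (le_trans (lintegral_mono_ae (g := fun w => φ (jumpAbs F 0 t w)) ?_)
      (le_iSup (fun y => ∫⁻ w, φ (jumpAbs F 0 t w) ∂(κ y)) (w u))) _
    filter_upwards [hAfin (w u)] with w' hw'
    exact hφ _ _ (jumpSum_le _ le_rfl tsub_le_self w') hw'
  calc ∫⁻ w, ∑ i ∈ Finset.range (n + 1), jumpSum G (grid 0 t n i) (grid 0 t n (i + 1)) w *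
          φ (jumpAbs F (grid 0 t n (i + 1)) t w) ∂(κ y)
      = ∑ i ∈ Finset.range (n + 1),
        ∫⁻ w, jumpSum G (grid 0 t n i) (grid 0 t n (i + 1)) w *
        φ (jumpAbs F (grid 0 t n (i + 1)) t w) ∂(κ y) :=
        lintegral_finsetSum _ fun i _ => (hGm _ _).mul (hφm.comp (hAm _ _))
    _ ≤ ∑ i ∈ Finset.range (n + 1),
        ∫⁻ w, jumpSum G (grid 0 t n i) (grid 0 t n (i + 1)) w * U ∂(κ y) :=
        Finset.sum_le_sum h1
    _ = (∫⁻ w, jumpSum G 0 t w ∂(κ y)) * U := by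
        rw [← lintegral_finsetSum _ fun i _ => (hGm _ _).mul_const _,
          ← lintegral_mul_const _ (hGm _ _)]
        refine lintegral_congr fun w => ?_
        rw [← Finset.sum_mul]
        congr 1
        have hg := tsum_Ioc_grid (fun s => jump G s w) (grid_mono 0 t n) (n + 1)
        rw [grid_zero, grid_last zero_le] at hg
        exact hg.symm

/-- In the truncated expansion the tail after a jump time `s` is the limit of the tails after the
grid points to the right of `s`; Fatou's lemma for the sum over jumps takes the limit outside. -/
lemma exp_min_le_liminf {F : E → E → ℝ} {t : ℝ≥0} (ht : 0 < t) (k : ℕ) {w : CadlagPath E}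
    (hw : jumpAbs F 0 t w < ⊤) :
    ENNReal.ofReal (Real.exp (min (jumpAbs F 0 t w).toReal k)) ≤
      1 + liminf (fun n => ∑ i ∈ Finset.range (n + 1),
        jumpSum (expWeight F) (grid 0 t n i) (grid 0 t n (i + 1)) w *
          ENNReal.ofReal (Real.exp (min (jumpAbs F (grid 0 t n (i + 1)) t w).toReal k))) atTop := by
  have hsum : Summable fun s : Set.Ioc 0 t => |jump F s w| :=
    ((summable_jump_iff F 0 t w).2 hw.ne).abs
  have h1 := exp_min_tsum_le (g := fun s => |jump F s w|) (fun s => abs_nonneg _) (k : ℝ)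
    (Nat.cast_nonneg k) hsum
  have h3 : ∀ s, jump (expWeight F) s w = ENNReal.ofReal (Real.exp |jump F s w| - 1) :=
    fun s => jump_map (fun r => ENNReal.ofReal (Real.exp |r| - 1)) (by simp) F s w
  set φ : ℝ≥0 → ℝ≥0∞ := fun u =>
    ENNReal.ofReal (Real.exp (min (jumpAbs F u t w).toReal k)) with hφ
  have hφ' : ∀ u, φ u = ENNReal.ofReal (Real.exp (min (∑' r : Set.Ioc u t, |jump F r w|) k)) :=
    fun u => by rw [hφ]; beta_reduce; rw [toReal_jumpAbs]
  change φ 0 ≤ 1 + liminf (fun n => ∑ i ∈ Finset.range (n + 1),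
    jumpSum (expWeight F) (grid 0 t n i) (grid 0 t n (i + 1)) w * φ (grid 0 t n (i + 1))) atTop
  clear_value φ
  have h4 : ∀ n, ∑ i ∈ Finset.range (n + 1),
        jumpSum (expWeight F) (grid 0 t n i) (grid 0 t n (i + 1)) w * φ (grid 0 t n (i + 1)) =
      ∑' s : Set.Ioc 0 t, jump (expWeight F) s w * φ (gridCeil t n s) := by
    intro n
    refine Eq.trans ?_ (tsum_gridCeil ht (fun u s => jump (expWeight F) s w * φ u) n).symm
    refine Finset.sum_congr rfl fun i _ => ?_
    unfold jumpSum
    rw [ENNReal.tsum_mul_right]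
  have h5 : φ 0 ≤ 1 + ∑' s : Set.Ioc 0 t, jump (expWeight F) s w * φ s := by
    rw [hφ' 0]
    refine h1.trans (le_of_eq ?_)
    congr 1
    exact tsum_congr fun s => by rw [h3, hφ']
  refine h5.trans (add_le_add le_rfl ?_)
  have h6 : (fun n => ∑ i ∈ Finset.range (n + 1),
        jumpSum (expWeight F) (grid 0 t n i) (grid 0 t n (i + 1)) w * φ (grid 0 t n (i + 1))) =
      fun n => ∑' s : Set.Ioc 0 t, jump (expWeight F) s w * φ (gridCeil t n s) := funext h4
  rw [h6]
  refine le_trans (ENNReal.tsum_le_tsum fun s => ?_) (tsum_liminf_le _)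
  refine le_of_eq (Tendsto.liminf_eq ?_).symm
  refine ENNReal.Tendsto.const_mul ?_ (Or.inr (by rw [h3]; exact ENNReal.ofReal_ne_top))
  have h7 : Tendsto (fun n => ∑' r : Set.Ioc (gridCeil t n s) t, |jump F r w|) atTop
      (𝓝 (∑' r : Set.Ioc (s : ℝ≥0) t, |jump F r w|)) :=
    tendsto_tail (g := fun r => |jump F r w|) hsum (tendsto_gridCeil ht s)
      fun n => le_gridCeil ht n s
  have h8 : Continuous fun x : ℝ => ENNReal.ofReal (Real.exp (min x k)) :=
    ENNReal.continuous_ofReal.comp (by fun_prop)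
  have h9 := (h8.tendsto _).comp h7
  rw [hφ' s]
  exact h9.congr fun n => (hφ' _).symm

lemma le_two_of_le_one_add_half {U : ℝ≥0∞} (hU : U ≠ ⊤) (h : U ≤ 1 + 1 / 2 * U) : U ≤ 2 := by
  have h1 : U.toReal ≤ 1 + 1 / 2 * U.toReal := by
    have h2 := ENNReal.toReal_mono (by finiteness) h
    rw [ENNReal.toReal_add (by simp) (by finiteness), ENNReal.toReal_mul] at h2
    simpa using h2
  rw [← ENNReal.ofReal_toReal hU]
  calc ENNReal.ofReal U.toReal ≤ ENNReal.ofReal 2 := ENNReal.ofReal_le_ofReal (by linarith)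
    _ = 2 := by simp

/-- Khasminskii's lemma for the sum of the jumps. -/
lemma IsMarkovLaw.exp_le_two (hκ : IsMarkovLaw κ) {F : E → E → ℝ}
    (hF : Measurable (Function.uncurry F)) (hd : ∀ x, F x x = 0) {t : ℝ≥0} (ht : 0 < t)
    (hG : ∀ x, ∫⁻ w, jumpSum (expWeight F) 0 t w ∂(κ x) ≤ 1 / 2) (x : OnePoint E) :
    ∫⁻ w, ENNReal.ofReal (Real.exp (jumpAbs F 0 t w).toReal) ∂(κ x) ≤ 2 := by
  have := hκ.prob
  have hGm := measurable_jumpSum (measurable_expWeight hF) (expWeight_diag hd)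
  have hAm := measurable_jumpAbs hF hd
  have hAfin : ∀ y, ∀ᵐ w ∂(κ y), jumpAbs F 0 t w < ⊤ := fun y => by
    filter_upwards [ae_lt_top (hGm 0 t) (ne_top_of_le_ne_top (by simp) (hG y))] with w hw using
      (jumpAbs_le_expWeight F 0 t w).trans_lt hw
  have hbd : ∀ k : ℕ, ∀ y,
      ∫⁻ w, ENNReal.ofReal (Real.exp (min (jumpAbs F 0 t w).toReal k)) ∂(κ y) ≤ 2 := by
    intro k
    set U := ⨆ y, ∫⁻ w, ENNReal.ofReal (Real.exp (min (jumpAbs F 0 t w).toReal k)) ∂(κ y) with hU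
    have hφm : Measurable fun a : ℝ≥0∞ => ENNReal.ofReal (Real.exp (min a.toReal k)) := by fun_prop
    -- Finiteness of `U`, obtained from the truncation, is what allows U/2 to be absorbed in U ≤ 1 +
    -- U/2; the bound 2 does not depend on `k`.
    have hUtop : U ≠ ⊤ := by
      refine ne_top_of_le_ne_top (ENNReal.ofReal_ne_top (r := Real.exp k)) (iSup_le fun y => ?_)
      refine (lintegral_mono (g := fun _ => ENNReal.ofReal (Real.exp k)) fun w =>
        ENNReal.ofReal_le_ofReal (Real.exp_le_exp.2 (min_le_right _ _))).trans ?_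
      simp
    refine fun y => (le_iSup (fun y =>
      ∫⁻ w, ENNReal.ofReal (Real.exp (min (jumpAbs F 0 t w).toReal k)) ∂(κ y)) y).trans
      (le_two_of_le_one_add_half hUtop (iSup_le fun y => ?_))
    calc ∫⁻ w, ENNReal.ofReal (Real.exp (min (jumpAbs F 0 t w).toReal k)) ∂(κ y)
        ≤ ∫⁻ w, 1 + liminf (fun n => ∑ i ∈ Finset.range (n + 1),
          jumpSum (expWeight F) (grid 0 t n i) (grid 0 t n (i + 1)) w *
          ENNReal.ofReal (Real.exp (min (jumpAbs F (grid 0 t n (i + 1)) t w).toReal k))) atTop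
            ∂(κ y) := by
          refine lintegral_mono_ae ?_
          filter_upwards [hAfin y] with w hw using exp_min_le_liminf ht k hw
      _ = 1 + ∫⁻ w, liminf (fun n => ∑ i ∈ Finset.range (n + 1),
          jumpSum (expWeight F) (grid 0 t n i) (grid 0 t n (i + 1)) w *
          ENNReal.ofReal (Real.exp (min (jumpAbs F (grid 0 t n (i + 1)) t w).toReal k))) atTop
            ∂(κ y) := by
          rw [lintegral_add_left measurable_const]; simp
      _ ≤ 1 + liminf (fun n => ∫⁻ w, ∑ i ∈ Finset.range (n + 1),
          jumpSum (expWeight F) (grid 0 t n i) (grid 0 t n (i + 1)) w *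
          ENNReal.ofReal (Real.exp (min (jumpAbs F (grid 0 t n (i + 1)) t w).toReal k)) ∂(κ y))
            atTop := by
          refine add_le_add le_rfl (lintegral_liminf_le fun n => ?_)
          exact Finset.measurable_sum _ fun i _ => (hGm _ _).mul (hφm.comp (hAm _ _))
      _ ≤ 1 + 1 / 2 * U := by
          refine add_le_add le_rfl (liminf_le_const fun n => ?_)
          refine (hκ.lintegral_grid_le hF hd hGm hAfin hφm (fun a b hab hb => ?_) y n).trans
            (mul_le_mul_left (hG y) U)
          exact ENNReal.ofReal_le_ofReal (Real.exp_le_exp.2 (min_le_min_right _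
            (ENNReal.toReal_mono hb.ne hab)))
  have hlim : ∀ w, ENNReal.ofReal (Real.exp (jumpAbs F 0 t w).toReal) =
      liminf (fun k : ℕ => ENNReal.ofReal (Real.exp (min (jumpAbs F 0 t w).toReal k))) atTop := by
    intro w
    refine (Tendsto.liminf_eq ?_).symm
    refine tendsto_const_nhds.congr' ?_
    obtain ⟨k0, hk0⟩ := exists_nat_ge (jumpAbs F 0 t w).toReal
    filter_upwards [eventually_ge_atTop k0] with k hk
    rw [min_eq_left (hk0.trans (by exact_mod_cast hk))]
  simp_rw [hlim]
  refine (lintegral_liminf_le fun k => ?_).trans ?_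
  · have := hAm 0 t
    fun_prop
  · exact liminf_le_const fun k => hbd k x

end Khasminskii

open CadlagPath ProbabilityTheory

/-! ### An integrable variable dominating all the grid sums. -/

section Dominating
variable {E : Type*} [MetricSpace E] [ProperSpace E] [MeasurableSpace E] [BorelSpace E]

/-- The jump weight `exp (-F) - 1`. -/
def expJump (F : E → E → ℝ) (x y : E) : ℝ := Real.exp (-F x y) - 1

lemma abs_expJump_le (F : E → E → ℝ) (x y : E) : |expJump F x y| ≤ Real.exp |F x y| - 1 := by
  have := abs_exp_sub_one_le (-F x y)
  rwa [abs_neg] at this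

lemma jump_expJump (F : E → E → ℝ) (s : ℝ≥0) (w : CadlagPath E) :
    jump (expJump F) s w = Real.exp (-jump F s w) - 1 :=
  jump_map (fun r => Real.exp (-r) - 1) (by simp) F s w

lemma jump_expWeight (F : E → E → ℝ) (s : ℝ≥0) (w : CadlagPath E) :
    jump (expWeight F) s w = ENNReal.ofReal (Real.exp |jump F s w| - 1) :=
  jump_map (fun r => ENNReal.ofReal (Real.exp |r| - 1)) (by simp) F s w

lemma exp_abs_sub_one_nonneg (x : ℝ) : 0 ≤ Real.exp |x| - 1 := by
  linarith [Real.one_le_exp (abs_nonneg x)]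

/-- The tail of the absolute jumps. -/
def absTail (F : E → E → ℝ) (t s : ℝ≥0) (w : CadlagPath E) : ℝ :=
  ∑' r : Set.Ioc s t, |jump F r w|

lemma summable_expWeight {F : E → E → ℝ} {t : ℝ≥0} {w : CadlagPath E}
    (hw : jumpSum (expWeight F) 0 t w ≠ ⊤) :
    Summable fun s : Set.Ioc 0 t => Real.exp |jump F s w| - 1 := by
  unfold jumpSum at hw
  simp_rw [jump_expWeight] at hw
  refine (ENNReal.summable_toReal hw).congr fun s => ?_
  rw [ENNReal.toReal_ofReal (exp_abs_sub_one_nonneg _)]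

lemma toReal_jumpSum_expWeight (F : E → E → ℝ) (a t : ℝ≥0) (w : CadlagPath E) :
    (jumpSum (expWeight F) a t w).toReal = ∑' s : Set.Ioc a t, (Real.exp |jump F s w| - 1) := by
  unfold jumpSum
  simp_rw [jump_expWeight]
  rw [ENNReal.tsum_toReal_eq fun s => ENNReal.ofReal_ne_top]
  exact tsum_congr fun s => ENNReal.toReal_ofReal (exp_abs_sub_one_nonneg _)

lemma summable_jump {F : E → E → ℝ} {t : ℝ≥0} {w : CadlagPath E}
    (hw : jumpSum (expWeight F) 0 t w ≠ ⊤) : Summable fun s : Set.Ioc 0 t => jump F s w := by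
  rw [summable_jump_iff]
  exact ne_top_of_le_ne_top hw (jumpAbs_le_expWeight F 0 t w)

lemma absTail_anti {F : E → E → ℝ} {t : ℝ≥0} {w : CadlagPath E}
    (hw : jumpSum (expWeight F) 0 t w ≠ ⊤) {s u : ℝ≥0} (hsu : s ≤ u) :
    absTail F t u w ≤ absTail F t s w := by
  unfold absTail
  rw [← toReal_jumpAbs, ← toReal_jumpAbs]
  refine ENNReal.toReal_mono ?_ (jumpSum_le _ hsu le_rfl w)
  exact ne_top_of_le_ne_top hw ((jumpSum_le _ zero_le le_rfl w).trans
    (jumpAbs_le_expWeight F 0 t w))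

/-- The expansion applied to -|F| telescopes, so the dominating series has a closed form. Its value
is integrable by Khasminskii's lemma and does not depend on any grid. -/
lemma hasSum_dominating {F : E → E → ℝ} {t : ℝ≥0} {w : CadlagPath E}
    (hw : jumpSum (expWeight F) 0 t w ≠ ⊤) (B B' : ℝ) :
    HasSum (fun s : Set.Ioc 0 t => (Real.exp |jump F s w| - 1) *
      (B * Real.exp (absTail F t s w) + B'))
      (B * (Real.exp (absTail F t 0 w) - 1) + B' * (jumpSum (expWeight F) 0 t w).toReal) := by
  have hs := summable_expWeight hw
  have hj := summable_jump hw
  have h1 : Summable fun s : Set.Ioc 0 t => (Real.exp |jump F s w| - 1) *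
      Real.exp (absTail F t s w) := by
    refine Summable.of_nonneg_of_le (fun s => mul_nonneg (exp_abs_sub_one_nonneg _)
      (Real.exp_pos _).le) (fun s => ?_) (hs.mul_right (Real.exp (absTail F t 0 w)))
    exact mul_le_mul_of_nonneg_left (Real.exp_le_exp.2 (absTail_anti hw zero_le))
      (exp_abs_sub_one_nonneg _)
  have h2 := exp_neg_tsum (g := fun s => -|jump F s w|) (t := t) hj.abs.neg
  have h3 : ∑' s : Set.Ioc 0 t, (Real.exp |jump F s w| - 1) * Real.exp (absTail F t s w) =
      Real.exp (absTail F t 0 w) - 1 := by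
    have e : ∀ s : ℝ≥0, -∑' r : Set.Ioc s t, -|jump F r w| = absTail F t s w := fun s => by
      rw [tsum_neg, neg_neg]; rfl
    rw [e 0] at h2
    rw [h2, add_sub_cancel_left]
    refine tsum_congr fun s => ?_
    rw [e, neg_neg]
  have h4 := (h1.hasSum.mul_left B).add (hs.hasSum.mul_left B')
  rw [h3, ← toReal_jumpSum_expWeight] at h4
  have e : (fun s : Set.Ioc 0 t => (Real.exp |jump F s w| - 1) *
      (B * Real.exp (absTail F t s w) + B')) = fun s : Set.Ioc 0 t =>
      B * ((Real.exp |jump F s w| - 1) * Real.exp (absTail F t s w)) +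
        B' * (Real.exp |jump F s w| - 1) := funext fun s => by ring
  rw [e]
  exact h4

end Dominating

/-! ### Uniqueness for the Duhamel equation in probabilistic form. -/

section FeynmanKac
variable {E : Type*} [MetricSpace E] [ProperSpace E] [MeasurableSpace E] [BorelSpace E]
  {κ : Kernel (OnePoint E) (CadlagPath E)} {F : E → E → ℝ} {g : E → ℝ}

/-- The random variable `exp (-A_t) g(X_t)` on path space. -/
def fkWeight (F : E → E → ℝ) (g : E → ℝ) (t : ℝ≥0) (w : CadlagPath E) : ℝ :=
  Real.exp (-jumpSumR F 0 t w) * (w t).elim 0 g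

lemma measurable_fkWeight (hF : Measurable (Function.uncurry F)) (hd : ∀ x, F x x = 0)
    (hg : Measurable g) (t : ℝ≥0) : Measurable (fkWeight F g t) :=
  (Real.measurable_exp.comp (measurable_jumpSumR hF hd 0 t).neg).mul (measurable_elim_eval hg t)

lemma abs_elim_le {f : E → ℝ} {B : ℝ} (hB : 0 ≤ B) (hf : ∀ x, |f x| ≤ B) (y : OnePoint E) :
    |y.elim 0 f| ≤ B := by
  induction y using OnePoint.rec with
  | infty => simpa using hB
  | coe x => exact hf x

lemma fkWeight_shift {t u : ℝ≥0} (hut : u ≤ t) (w : CadlagPath E) :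
    fkWeight F g (t - u) (shift u w) = Real.exp (-jumpSumR F u t w) * (w t).elim 0 g := by
  unfold fkWeight
  rw [jumpSumR_shift, shift_apply, add_zero, add_tsub_cancel_of_le hut]

lemma neg_jumpSumR_le_absTail {t : ℝ≥0} (u : ℝ≥0) (w : CadlagPath E) :
    -jumpSumR F u t w ≤ absTail F t u w := by
  unfold absTail
  rw [← toReal_jumpAbs]
  exact (neg_le_abs _).trans (abs_jumpSumR_le F u t w)

lemma abs_fkWeight_shift_le {B : ℝ} (hB : 0 ≤ B) (hg : ∀ x, |g x| ≤ B) (t u : ℝ≥0)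
    (w : CadlagPath E) : |Real.exp (-jumpSumR F u t w) * (w t).elim 0 g| ≤
      B * Real.exp (absTail F t u w) := by
  rw [abs_mul, Real.abs_exp, mul_comm B]
  exact mul_le_mul (Real.exp_le_exp.2 (neg_jumpSumR_le_absTail u w)) (abs_elim_le hB hg _)
    (abs_nonneg _) (Real.exp_pos _).le

lemma fkWeight_eq {t : ℝ≥0} {w : CadlagPath E} (hw : jumpSum (expWeight F) 0 t w ≠ ⊤) :
    fkWeight F g t w = (w t).elim 0 g + ∑' s : Set.Ioc 0 t, jump (expJump F) s w *
      (Real.exp (-jumpSumR F s t w) * (w t).elim 0 g) := by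
  have h := exp_neg_tsum (g := fun s => jump F s w) (summable_jump hw)
  unfold fkWeight
  have e : jumpSumR F 0 t w = ∑' s : Set.Ioc 0 t, jump F s w := rfl
  rw [e, h, add_mul, one_mul, ← tsum_mul_right]
  congr 1
  refine tsum_congr fun s => ?_
  rw [jump_expJump, mul_assoc]
  rfl

variable {h : ℝ≥0 → E → ℝ} {B B' : ℝ} {t : ℝ≥0}

/-- The difference between the Feynman-Kac weight restarted at time `u` and its candidate value. -/
def fkDefect (F : E → E → ℝ) (g : E → ℝ) (h : ℝ≥0 → E → ℝ) (t u : ℝ≥0) (w : CadlagPath E) : ℝ :=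
  Real.exp (-jumpSumR F u t w) * (w t).elim 0 g - (w u).elim 0 (h (t - u))

lemma abs_fkDefect_le (hB : 0 ≤ B) (hB' : 0 ≤ B') (hg : ∀ x, |g x| ≤ B) (hh : ∀ s x, |h s x| ≤ B')
    (u : ℝ≥0) (w : CadlagPath E) : |fkDefect F g h t u w| ≤ B * Real.exp (absTail F t u w) + B' :=
  (abs_sub _ _).trans (add_le_add (abs_fkWeight_shift_le hB hg t u w) (abs_elim_le hB' (hh _) _))

lemma abs_jump_expJump_le (s : ℝ≥0) (w : CadlagPath E) :
    |jump (expJump F) s w| ≤ Real.exp |jump F s w| - 1 := by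
  rw [jump_expJump]
  have := abs_exp_sub_one_le (-jump F s w)
  rwa [abs_neg] at this

/-- The right side does not involve `u`, because the tail after `u` is at most the tail after `s`;
so one bound serves for every grid. -/
lemma abs_jump_mul_fkDefect_le (hB : 0 ≤ B) (hB' : 0 ≤ B') (hg : ∀ x, |g x| ≤ B)
    (hh : ∀ s x, |h s x| ≤ B') {w : CadlagPath E} (hw : jumpSum (expWeight F) 0 t w ≠ ⊤)
    {s u : ℝ≥0} (hsu : s ≤ u) :
    |jump (expJump F) s w * fkDefect F g h t u w| ≤
      (Real.exp |jump F s w| - 1) * (B * Real.exp (absTail F t s w) + B') := by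
  rw [abs_mul]
  refine mul_le_mul (abs_jump_expJump_le s w) ((abs_fkDefect_le hB hB' hg hh u w).trans ?_)
    (abs_nonneg _) (exp_abs_sub_one_nonneg _)
  have := absTail_anti hw hsu
  gcongr

lemma summable_jump_mul_fkDefect (hB : 0 ≤ B) (hB' : 0 ≤ B') (hg : ∀ x, |g x| ≤ B)
    (hh : ∀ s x, |h s x| ≤ B') {w : CadlagPath E} (hw : jumpSum (expWeight F) 0 t w ≠ ⊤)
    {v : ℝ≥0 → ℝ≥0} (hv : ∀ s, s ≤ v s) :
    Summable fun s : Set.Ioc 0 t => jump (expJump F) s w * fkDefect F g h t (v s) w := by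
  have hle : ∀ s : Set.Ioc 0 t, ‖jump (expJump F) s w * fkDefect F g h t (v s) w‖ ≤
      (Real.exp |jump F s w| - 1) * (B * Real.exp (absTail F t s w) + B') := fun s => by
    rw [Real.norm_eq_abs]
    exact abs_jump_mul_fkDefect_le hB hB' hg hh hw (hv s)
  exact Summable.of_norm_bounded (hasSum_dominating hw B B').summable hle

lemma abs_tsum_fkDefect_le (hB : 0 ≤ B) (hB' : 0 ≤ B') (hg : ∀ x, |g x| ≤ B)
    (hh : ∀ s x, |h s x| ≤ B') {w : CadlagPath E} (hw : jumpSum (expWeight F) 0 t w ≠ ⊤)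
    {v : ℝ≥0 → ℝ≥0} (hv : ∀ s, s ≤ v s) :
    |∑' s : Set.Ioc 0 t, jump (expJump F) s w * fkDefect F g h t (v s) w| ≤
      B * (Real.exp (absTail F t 0 w) - 1) + B' * (jumpSum (expWeight F) 0 t w).toReal := by
  rw [← (hasSum_dominating hw B B').tsum_eq]
  have hle : ∀ s : Set.Ioc 0 t, ‖jump (expJump F) s w * fkDefect F g h t (v s) w‖ ≤
      (Real.exp |jump F s w| - 1) * (B * Real.exp (absTail F t s w) + B') := fun s => by
    rw [Real.norm_eq_abs]
    exact abs_jump_mul_fkDefect_le hB hB' hg hh hw (hv s)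
  exact tsum_of_norm_bounded (hasSum_dominating hw B B').summable.hasSum hle

lemma tendsto_elim_right {w : CadlagPath E} {s : ℝ≥0} {v : ℝ≥0 → E → ℝ} {y : E} (hy : w s = y)
    (hv : ContinuousAt (Function.uncurry v) (s, y)) {u : ℕ → ℝ≥0} (hu : Tendsto u atTop (𝓝 s))
    (hsu : ∀ n, s ≤ u n) :
    Tendsto (fun n => (w (u n)).elim 0 (v (u n))) atTop (𝓝 (v s y)) := by
  have h1 : Tendsto (fun n => w (u n)) atTop (𝓝 (w s)) :=
    (w.right_cont s).tendsto.comp (tendsto_nhdsWithin_iff.2 ⟨hu, Eventually.of_forall hsu⟩)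
  rw [hy] at h1
  have h2 : ∀ᶠ n in atTop, w (u n) ∈ Set.range ((↑) : E → OnePoint E) :=
    h1 (OnePoint.isOpen_range_coe.mem_nhds (Set.mem_range_self y))
  let z : ℕ → E := fun n => (w (u n)).elim y id
  have hz : ∀ n, w (u n) ∈ Set.range ((↑) : E → OnePoint E) → w (u n) = (z n : OnePoint E) := by
    rintro n ⟨q, hq⟩
    simp [z, ← hq]
  have h3 : Tendsto z atTop (𝓝 y) := by
    rw [OnePoint.isOpenEmbedding_coe.isInducing.tendsto_nhds_iff]
    refine h1.congr' ?_
    filter_upwards [h2] with n hn using hz n hn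
  have h4 : Tendsto (fun n => v (u n) (z n)) atTop (𝓝 (v s y)) :=
    hv.tendsto.comp (hu.prodMk_nhds h3)
  refine h4.congr' ?_
  filter_upwards [h2] with n hn
  rw [hz n hn]
  rfl

/-- Tails and paths are right-continuous, and `h` is continuous at positive remaining times. At `s =
t` there may be no continuity, as `g` is only measurable, but there the grid point is `t` itself;
and a jump to the cemetery has weight zero. -/
lemma tendsto_jump_mul_fkDefect {t0 : ℝ≥0} (htt : t ≤ t0)
    (hc : ∀ r y, 0 < r → r < t0 → ContinuousAt (Function.uncurry h) (r, y)) {w : CadlagPath E}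
    (hw : jumpSum (expWeight F) 0 t w ≠ ⊤) {s : ℝ≥0} (hs : s ∈ Set.Ioc 0 t) :
    Tendsto (fun n => jump (expJump F) s w * fkDefect F g h t (gridCeil t n s) w) atTop
      (𝓝 (jump (expJump F) s w * fkDefect F g h t s w)) := by
  have ht : 0 < t := hs.1.trans_le hs.2
  by_cases hj : jump (expJump F) s w = 0
  · simp [hj]
  refine tendsto_const_nhds.mul (Tendsto.sub ?_ ?_)
  · refine Tendsto.mul ?_ tendsto_const_nhds
    exact (Real.continuous_exp.tendsto _).comp (tendsto_tail (g := fun r => jump F r w)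
      (summable_jump hw) (tendsto_gridCeil ht s) fun n => le_gridCeil ht n s).neg
  · rcases hs.2.lt_or_eq with hst | hst
    · have hy : ∃ y : E, w s = y := by
        by_contra hno
        have : w s = OnePoint.infty := by
          generalize w s = z at hno
          induction z using OnePoint.rec with
          | infty => rfl
          | coe x => exact absurd ⟨x, rfl⟩ hno
        refine hj ?_
        unfold jump
        rw [this]
        rcases w.leftVal s with _ | x <;> rfl
      obtain ⟨y, hy⟩ := hy
      have hc2 : ContinuousAt (Function.uncurry fun r => h (t - r)) (s, y) := by
        have h1 := hc (t - s) y (tsub_pos_of_lt hst)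
          ((tsub_lt_self ht hs.1).trans_le htt)
        have h2 : ContinuousAt (fun p : ℝ≥0 × E => (t - p.1, p.2)) (s, y) := by fun_prop
        exact ContinuousAt.comp (f := fun p : ℝ≥0 × E => (t - p.1, p.2)) h1 h2
      rw [hy]
      exact tendsto_elim_right hy hc2 (tendsto_gridCeil ht s) fun n => le_gridCeil ht n s
    · subst hst
      simp_rw [gridCeil_self ht]
      exact tendsto_const_nhds

/-- The defect of the candidate `h` for the Feynman-Kac semigroup. -/
def fkError (κ : Kernel (OnePoint E) (CadlagPath E)) (F : E → E → ℝ) (g : E → ℝ)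
    (h : ℝ≥0 → E → ℝ) (r : ℝ≥0) (y : OnePoint E) : ℝ :=
  ∫ w, fkWeight F g r w ∂(κ y) - y.elim 0 (h r)

lemma measurable_expJump (hF : Measurable (Function.uncurry F)) :
    Measurable (Function.uncurry (expJump F)) := by
  have : Measurable fun p : E × E => Real.exp (-Function.uncurry F p) - 1 := by fun_prop
  exact this

lemma expJump_diag (hd : ∀ x, F x x = 0) (x : E) : expJump F x x = 0 := by simp [expJump, hd]

lemma ae_jumpSum_ne_top (hF : Measurable (Function.uncurry F)) (hd : ∀ x, F x x = 0)
    (hG : ∀ x, ∫⁻ w, jumpSum (expWeight F) 0 t w ∂(κ x) ≤ 1 / 2) (x : OnePoint E) :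
    ∀ᵐ w ∂(κ x), jumpSum (expWeight F) 0 t w ≠ ⊤ := by
  filter_upwards [ae_lt_top (measurable_jumpSum (measurable_expWeight hF) (expWeight_diag hd) 0 t)
    (ne_top_of_le_ne_top (by simp) (hG x))] with w hw using hw.ne

lemma absTail_eq (t u : ℝ≥0) (w : CadlagPath E) : absTail F t u w = (jumpAbs F u t w).toReal :=
  (toReal_jumpAbs F u t w).symm

lemma measurable_absTail (hF : Measurable (Function.uncurry F)) (hd : ∀ x, F x x = 0)
    (t u : ℝ≥0) : Measurable (absTail F t u) := by
  have h := (measurable_jumpAbs hF hd u t).ennreal_toReal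
  have e : absTail F t u = fun w => (jumpAbs F u t w).toReal := funext (absTail_eq t u)
  rw [e]
  exact h

lemma IsMarkovLaw.integrable_exp_absTail (hκ : IsMarkovLaw κ) (hF : Measurable (Function.uncurry F))
    (hd : ∀ x, F x x = 0) (ht : 0 < t)
    (hG : ∀ x, ∫⁻ w, jumpSum (expWeight F) 0 t w ∂(κ x) ≤ 1 / 2) (x : OnePoint E) :
    Integrable (fun w => Real.exp (absTail F t 0 w)) (κ x) ∧
      ∫ w, Real.exp (absTail F t 0 w) ∂(κ x) ≤ 2 := by
  have h1 := hκ.exp_le_two hF hd ht hG x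
  simp_rw [← absTail_eq] at h1
  have hm : Measurable fun w => Real.exp (absTail F t 0 w) :=
    Real.measurable_exp.comp (measurable_absTail hF hd t 0)
  have hi : Integrable (fun w => Real.exp (absTail F t 0 w)) (κ x) := by
    refine ⟨hm.aestronglyMeasurable, ?_⟩
    rw [hasFiniteIntegral_iff_ofReal (Eventually.of_forall fun w => (Real.exp_pos _).le)]
    exact h1.trans_lt (by simp)
  refine ⟨hi, ?_⟩
  rw [integral_eq_lintegral_of_nonneg_ae (Eventually.of_forall fun w => (Real.exp_pos _).le)
    hm.aestronglyMeasurable]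
  exact ENNReal.toReal_mono (by simp) h1

lemma integrable_toReal_jumpSum (hF : Measurable (Function.uncurry F)) (hd : ∀ x, F x x = 0)
    (hG : ∀ x, ∫⁻ w, jumpSum (expWeight F) 0 t w ∂(κ x) ≤ 1 / 2) (x : OnePoint E) :
    Integrable (fun w => (jumpSum (expWeight F) 0 t w).toReal) (κ x) ∧
      ∫ w, (jumpSum (expWeight F) 0 t w).toReal ∂(κ x) ≤ 1 / 2 := by
  have hm := measurable_jumpSum (measurable_expWeight hF) (expWeight_diag hd) 0 t
  have hne : ∫⁻ w, jumpSum (expWeight F) 0 t w ∂(κ x) ≠ ⊤ :=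
    ne_top_of_le_ne_top (by simp) (hG x)
  refine ⟨integrable_toReal_of_lintegral_ne_top hm.aemeasurable hne, ?_⟩
  rw [integral_toReal hm.aemeasurable (ae_lt_top hm hne)]
  refine (ENNReal.toReal_mono (by simp) (hG x)).trans (by simp)

lemma IsMarkovLaw.integrable_dominating (hκ : IsMarkovLaw κ) (hF : Measurable (Function.uncurry F))
    (hd : ∀ x, F x x = 0) (ht : 0 < t)
    (hG : ∀ x, ∫⁻ w, jumpSum (expWeight F) 0 t w ∂(κ x) ≤ 1 / 2) (B B' : ℝ) (x : OnePoint E) :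
    Integrable (fun w => B * (Real.exp (absTail F t 0 w) - 1) +
      B' * (jumpSum (expWeight F) 0 t w).toReal) (κ x) := by
  have := hκ.prob
  exact (((hκ.integrable_exp_absTail hF hd ht hG x).1.sub (integrable_const 1)).const_mul B).add
    ((integrable_toReal_jumpSum hF hd hG x).1.const_mul B')

lemma IsMarkovLaw.integrable_fkWeight (hκ : IsMarkovLaw κ) (hF : Measurable (Function.uncurry F))
    (hd : ∀ x, F x x = 0) (hg : Measurable g) (hB : 0 ≤ B) (hgB : ∀ x, |g x| ≤ B) (ht : 0 < t)
    (hG : ∀ x, ∫⁻ w, jumpSum (expWeight F) 0 t w ∂(κ x) ≤ 1 / 2) (x : OnePoint E) :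
    Integrable (fkWeight F g t) (κ x) ∧ |∫ w, fkWeight F g t w ∂(κ x)| ≤ 2 * B := by
  obtain ⟨h1, h2⟩ := hκ.integrable_exp_absTail hF hd ht hG x
  have h3 : Integrable (fkWeight F g t) (κ x) := by
    refine (h1.const_mul B).mono' (measurable_fkWeight hF hd hg t).aestronglyMeasurable
      (Eventually.of_forall fun w => ?_)
    rw [Real.norm_eq_abs]
    exact abs_fkWeight_shift_le hB hgB t 0 w
  refine ⟨h3, (abs_integral_le_integral_abs).trans ?_⟩
  calc ∫ w, |fkWeight F g t w| ∂(κ x) ≤ ∫ w, B * Real.exp (absTail F t 0 w) ∂(κ x) :=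
        integral_mono h3.abs (h1.const_mul B) fun w => abs_fkWeight_shift_le hB hgB t 0 w
    _ = B * ∫ w, Real.exp (absTail F t 0 w) ∂(κ x) := integral_const_mul _ _
    _ ≤ 2 * B := by nlinarith

lemma measurable_fkDefect (hF : Measurable (Function.uncurry F)) (hd : ∀ x, F x x = 0)
    (hg : Measurable g) (hh : ∀ s, Measurable (h s)) (t u : ℝ≥0) :
    Measurable (fkDefect F g h t u) :=
  ((Real.measurable_exp.comp (measurable_jumpSumR hF hd u t).neg).mul
    (measurable_elim_eval hg t)).sub (measurable_elim_eval (hh (t - u)) u)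

lemma abs_cell_le (hB : 0 ≤ B) (hB' : 0 ≤ B') (hgB : ∀ x, |g x| ≤ B) (hhB : ∀ s x, |h s x| ≤ B')
    {w : CadlagPath E} (hw : jumpSum (expWeight F) 0 t w ≠ ⊤) {a u : ℝ≥0} (hut : u ≤ t) :
    |jumpSumR (expJump F) a u w * fkDefect F g h t u w| ≤
      B * (Real.exp (absTail F t 0 w) - 1) + B' * (jumpSum (expWeight F) 0 t w).toReal := by
  have hdom := hasSum_dominating hw B B'
  rw [← hdom.tsum_eq]
  have hpos : ∀ s : ℝ≥0, 0 ≤ (Real.exp |jump F s w| - 1) * (B * Real.exp (absTail F t s w) + B') :=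
    fun s => mul_nonneg (exp_abs_sub_one_nonneg _) (by positivity)
  have hs := summable_Ioc_sub (g := fun s => (Real.exp |jump F s w| - 1) *
    (B * Real.exp (absTail F t s w) + B')) (zero_le (a := a)) hut hdom.summable
  calc |jumpSumR (expJump F) a u w * fkDefect F g h t u w|
      = |∑' s : Set.Ioc a u, jump (expJump F) s w * fkDefect F g h t u w| := by
        rw [tsum_mul_right]; rfl
    _ ≤ ∑' s : Set.Ioc a u, (Real.exp |jump F s w| - 1) *
          (B * Real.exp (absTail F t s w) + B') :=
        tsum_of_norm_bounded hs.hasSum fun s => by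
          rw [Real.norm_eq_abs]
          exact abs_jump_mul_fkDefect_le hB hB' hgB hhB hw s.2.2
    _ ≤ _ := Summable.tsum_le_tsum_of_inj (Set.inclusion (Set.Ioc_subset_Ioc zero_le hut))
        (Set.inclusion_injective _) (fun s _ => hpos s) (fun s => le_rfl) hs hdom.summable

lemma jumpSumR_expJump_le (a u : ℝ≥0) {w : CadlagPath E} (hw : jumpSum (expWeight F) a u w ≠ ⊤) :
    |jumpSumR (expJump F) a u w| ≤ (jumpSum (expWeight F) a u w).toReal := by
  refine (abs_jumpSumR_le _ a u w).trans (ENNReal.toReal_mono hw (jumpSum_mono (fun x y => ?_) a u w))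
  exact ENNReal.ofReal_le_ofReal (abs_expJump_le F x y)

/-- On a cell of the grid, the defect may be replaced by the error at its right end point. -/
lemma IsMarkovLaw.abs_integral_cell_le (hκ : IsMarkovLaw κ) (hF : Measurable (Function.uncurry F))
    (hd : ∀ x, F x x = 0) (hg : Measurable g) (hB : 0 ≤ B) (hgB : ∀ x, |g x| ≤ B) (ht : 0 < t)
    (hG : ∀ x, ∫⁻ w, jumpSum (expWeight F) 0 t w ∂(κ x) ≤ 1 / 2)
    (hh : ∀ s, Measurable (h s)) (hB' : 0 ≤ B') (hhB : ∀ s x, |h s x| ≤ B')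
    {C : ℝ} {a u : ℝ≥0} (hut : u ≤ t) (hC : ∀ y, |fkError κ F g h (t - u) y| ≤ C) (hC0 : 0 ≤ C)
    (x : OnePoint E) :
    Integrable (fun w => jumpSumR (expJump F) a u w * fkDefect F g h t u w) (κ x) ∧
    |∫ w, jumpSumR (expJump F) a u w * fkDefect F g h t u w ∂(κ x)| ≤
      ∫ w, C * (jumpSum (expWeight F) a u w).toReal ∂(κ x) := by
  have := hκ.prob
  have hEm := measurable_expJump hF
  have hEd := expJump_diag hd
  have hRm := measurable_jumpSumR hEm hEd
  -- The first argument stands for the path frozen at `u`, the second for the path shifted by `u`,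
  -- which has the time `t - u` left to run.
  let Ψ : CadlagPath E → CadlagPath E → ℝ := fun w1 w2 =>
    jumpSumR (expJump F) a u w1 * (fkWeight F g (t - u) w2 - (w2 0).elim 0 (h (t - u)))
  have hΨ : Measurable (Function.uncurry Ψ) :=
    ((hRm a u).comp measurable_fst).mul (((measurable_fkWeight hF hd hg (t - u)).comp
      measurable_snd).sub ((measurable_elim_eval (hh (t - u)) 0).comp measurable_snd))
  have e1 : ∀ w, Ψ (freeze u w) (shift u w) = jumpSumR (expJump F) a u w * fkDefect F g h t u w := by
    intro w
    change jumpSumR (expJump F) a u (freeze u w) * (fkWeight F g (t - u) (shift u w) -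
      (shift u w 0).elim 0 (h (t - u))) = _
    rw [jumpSumR_freeze _ _ le_rfl, fkWeight_shift hut, shift_apply, add_zero]
    rfl
  have hae := ae_jumpSum_ne_top hF hd hG
  have hi : Integrable (fun w => jumpSumR (expJump F) a u w * fkDefect F g h t u w) (κ x) := by
    refine (hκ.integrable_dominating hF hd ht hG B B' x).mono'
      ((hRm a u).mul (measurable_fkDefect hF hd hg hh t u)).aestronglyMeasurable ?_
    filter_upwards [hae x] with w hw
    exact abs_cell_le hB hB' hgB hhB hw hut
  refine ⟨hi, ?_⟩
  have e2 := hκ.integral_eq x u hΨ (hi.congr (Eventually.of_forall fun w => (e1 w).symm))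
  simp_rw [e1] at e2
  rw [e2]
  have hwi : ∀ y, Integrable (fkWeight F g (t - u)) (κ y) := by
    intro y
    -- At the last grid point no time is left and the exponential bound, stated for positive times,
    -- is replaced by the bound on `g`.
    rcases (zero_le (a := t - u)).eq_or_lt with h0 | h0
    · rw [← h0]
      refine Integrable.of_bound (measurable_fkWeight hF hd hg 0).aestronglyMeasurable B
        (Eventually.of_forall fun w => ?_)
      have : jumpSumR F 0 0 w = 0 := by simp [jumpSumR]
      simp only [fkWeight, this, neg_zero, Real.exp_zero, one_mul]
      exact abs_elim_le hB hgB _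
    · refine (hκ.integrable_fkWeight hF hd hg hB hgB h0 (fun y => ?_) y).1
      exact (lintegral_mono fun w => jumpSum_le _ le_rfl tsub_le_self w).trans (hG y)
  have e3 : ∀ w, ∫ w', Ψ (freeze u w) w' ∂(κ (w u)) =
      jumpSumR (expJump F) a u w * fkError κ F g h (t - u) (w u) := by
    intro w
    simp only [Ψ]
    rw [integral_const_mul, jumpSumR_freeze _ _ le_rfl]
    congr 1
    have hn : (fun w' : CadlagPath E => (w' 0).elim 0 (h (t - u))) =ᵐ[κ (w u)]
        fun _ => (w u).elim 0 (h (t - u)) := by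
      filter_upwards [hκ.normal (w u)] with w' hw'
      rw [hw']
    rw [integral_sub (hwi _) ((integrable_congr hn).2 (integrable_const _)), integral_congr_ae hn]
    simp [fkError]
  simp_rw [e3]
  have hJi : Integrable (fun w => (jumpSum (expWeight F) a u w).toReal) (κ x) := by
    have hm := measurable_jumpSum (measurable_expWeight hF) (expWeight_diag hd)
    refine (integrable_toReal_jumpSum hF hd hG x).1.mono' (hm a u).ennreal_toReal.aestronglyMeasurable ?_
    filter_upwards [hae x] with w hw
    rw [Real.norm_eq_abs, abs_of_nonneg ENNReal.toReal_nonneg]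
    exact ENNReal.toReal_mono hw (jumpSum_le _ zero_le hut w)
  refine (abs_integral_le_integral_abs).trans (integral_mono_of_nonneg
    (Eventually.of_forall fun w => abs_nonneg _) (hJi.const_mul C) ?_)
  filter_upwards [hae x] with w hw
  rw [abs_mul, mul_comm]
  exact mul_le_mul (hC _) (jumpSumR_expJump_le a u (ne_top_of_le_ne_top hw
    (jumpSum_le _ zero_le hut w))) (abs_nonneg _) hC0

/-- Subtracting the Duhamel equation from the expansion of the weight leaves the expectation of ∑
(e^{-F} - 1) times the defect at the jump time. On a grid the Markov property turns each defect into
an error, which is at most `C`, and the expectation of ∑ (e^{|F|} - 1) is at most 1/2. -/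
lemma IsMarkovLaw.abs_fkError_le_half (hκ : IsMarkovLaw κ) (hF : Measurable (Function.uncurry F))
    (hd : ∀ x, F x x = 0) (hg : Measurable g) (hB : 0 ≤ B) (hgB : ∀ x, |g x| ≤ B) {t0 : ℝ≥0}
    (hG : ∀ x, ∫⁻ w, jumpSum (expWeight F) 0 t0 w ∂(κ x) ≤ 1 / 2)
    (hh : ∀ s, Measurable (h s)) (hB' : 0 ≤ B') (hhB : ∀ s x, |h s x| ≤ B')
    (hc : ∀ r y, 0 < r → r < t0 → ContinuousAt (Function.uncurry h) (r, y)) (h0 : h 0 = g)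
    (hduh : ∀ t, 0 < t → t ≤ t0 → ∀ x : E, h t x = ∫ w, ((w t).elim 0 g +
      ∑' s : Set.Ioc 0 t, jump (expJump F) s w * (w s).elim 0 (h (t - s))) ∂(κ x))
    {C : ℝ} (hC : ∀ r ≤ t0, ∀ y, |fkError κ F g h r y| ≤ C) :
    ∀ r ≤ t0, ∀ y, |fkError κ F g h r y| ≤ C / 2 := by
  have := hκ.prob
  have hC0 : 0 ≤ C := (abs_nonneg _).trans (hC 0 zero_le OnePoint.infty)
  intro t htt x
  rcases (zero_le (a := t)).eq_or_lt with ht | ht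
  · have : fkError κ F g h t x = 0 := by
      have hn : fkWeight F g t =ᵐ[κ x] fun _ => x.elim 0 (h t) := by
        filter_upwards [hκ.normal x] with w hw
        rw [← ht, fkWeight, hw, h0]
        simp [jumpSumR]
      rw [fkError, integral_congr_ae hn]
      simp
    rw [this]; simpa using by linarith
  induction x using OnePoint.rec with
  | infty =>
    have : fkError κ F g h t OnePoint.infty = 0 := by
      have hn : fkWeight F g t =ᵐ[κ OnePoint.infty] fun _ => 0 := by
        filter_upwards [hκ.trap t] with w hw
        rw [fkWeight, hw]
        simp
      rw [fkError, integral_congr_ae hn]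
      simp
    rw [this]; simpa using by linarith
  | coe x =>
  have hGt : ∀ x, ∫⁻ w, jumpSum (expWeight F) 0 t w ∂(κ x) ≤ 1 / 2 := fun y =>
    (lintegral_mono fun w => jumpSum_le _ le_rfl htt w).trans (hG y)
  have hae := ae_jumpSum_ne_top hF hd hGt
  have hRm := measurable_jumpSumR (measurable_expJump hF) (expJump_diag hd)
  have hdom := hκ.integrable_dominating hF hd ht hGt B B' x
  -- `R n` evaluates the defect at the grid point following each jump time; its limit `Rinf`
  -- evaluates it at the jump time.
  let R : ℕ → CadlagPath E → ℝ := fun n w => ∑ i ∈ Finset.range (n + 1),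
    jumpSumR (expJump F) (grid 0 t n i) (grid 0 t n (i + 1)) w *
      fkDefect F g h t (grid 0 t n (i + 1)) w
  have hRmeas : ∀ n, Measurable (R n) := fun n => Finset.measurable_sum _ fun i _ =>
    (hRm _ _).mul (measurable_fkDefect hF hd hg hh t _)
  have hR : ∀ n w, jumpSum (expWeight F) 0 t w ≠ ⊤ → R n w =
      ∑' s : Set.Ioc 0 t, jump (expJump F) s w * fkDefect F g h t (gridCeil t n s) w := by
    intro n w hw
    rw [tsum_gridCeilR ht (fun u s => jump (expJump F) s w * fkDefect F g h t u w) n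
      (summable_jump_mul_fkDefect (v := fun s => gridCeil t n s) hB hB' hgB hhB hw
        fun s => le_gridCeil ht n s)]
    refine Finset.sum_congr rfl fun i _ => ?_
    rw [tsum_mul_right]
    rfl
  let Rinf : CadlagPath E → ℝ := fun w =>
    ∑' s : Set.Ioc 0 t, jump (expJump F) s w * fkDefect F g h t s w
  have hlim : ∀ᵐ w ∂(κ x), Tendsto (fun n => R n w) atTop (𝓝 (Rinf w)) := by
    filter_upwards [hae x] with w hw
    simp_rw [hR _ w hw]
    refine tendsto_tsum_of_dominated_convergence (bound := fun s : Set.Ioc 0 t =>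
      (Real.exp |jump F s w| - 1) * (B * Real.exp (absTail F t s w) + B'))
      (hasSum_dominating hw B B').summable
      (fun s => tendsto_jump_mul_fkDefect htt hc hw s.2) (Eventually.of_forall fun n s => ?_)
    rw [Real.norm_eq_abs]
    exact abs_jump_mul_fkDefect_le hB hB' hgB hhB hw (le_gridCeil ht n s)
  have hint : Tendsto (fun n => ∫ w, R n w ∂(κ x)) atTop (𝓝 (∫ w, Rinf w ∂(κ x))) := by
    refine tendsto_integral_of_dominated_convergence _
      (fun n => (hRmeas n).aestronglyMeasurable) hdom (fun n => ?_) hlim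
    filter_upwards [hae x] with w hw
    rw [hR n w hw, Real.norm_eq_abs]
    exact abs_tsum_fkDefect_le (v := fun s => gridCeil t n s) hB hB' hgB hhB hw
      fun s => le_gridCeil ht n s
  have hRle : ∀ n, |∫ w, R n w ∂(κ x)| ≤ C / 2 := by
    intro n
    have hcell : ∀ i ∈ Finset.range (n + 1), grid 0 t n (i + 1) ≤ t := fun i hi =>
      (grid_mono 0 t n (Nat.succ_le_of_lt (Finset.mem_range.1 hi))).trans_eq (grid_last zero_le n)
    have hk := fun i (hi : i ∈ Finset.range (n + 1)) => hκ.abs_integral_cell_le hF hd hg hB hgB ht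
      hGt hh hB' hhB (a := grid 0 t n i) (hcell i hi)
      (hC (t - grid 0 t n (i + 1)) (tsub_le_self.trans htt)) hC0 x
    have hJm := measurable_jumpSum (measurable_expWeight hF) (expWeight_diag hd)
    have hJi := integrable_toReal_jumpSum hF hd hGt x
    have hJi' : ∀ i ∈ Finset.range (n + 1), Integrable (fun w => C * (jumpSum (expWeight F)
        (grid 0 t n i) (grid 0 t n (i + 1)) w).toReal) (κ x) := by
      intro i hi
      refine (hJi.1.mono' (hJm _ _).ennreal_toReal.aestronglyMeasurable ?_).const_mul C
      filter_upwards [hae x] with w hw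
      rw [Real.norm_eq_abs, abs_of_nonneg ENNReal.toReal_nonneg]
      exact ENNReal.toReal_mono hw (jumpSum_le _ zero_le (hcell i hi) w)
    have hsum : ∀ᵐ w ∂(κ x), ∑ i ∈ Finset.range (n + 1), C * (jumpSum (expWeight F)
        (grid 0 t n i) (grid 0 t n (i + 1)) w).toReal =
        C * (jumpSum (expWeight F) 0 t w).toReal := by
      filter_upwards [hae x] with w hw
      have e : jumpSum (expWeight F) 0 t w = ∑ i ∈ Finset.range (n + 1),
          jumpSum (expWeight F) (grid 0 t n i) (grid 0 t n (i + 1)) w := by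
        have hgd := tsum_Ioc_grid (fun s => jump (expWeight F) s w) (grid_mono 0 t n) (n + 1)
        rwa [grid_zero, grid_last zero_le] at hgd
      rw [← Finset.mul_sum, e, ENNReal.toReal_sum]
      intro i hi
      exact ne_top_of_le_ne_top hw (jumpSum_le _ zero_le (hcell i hi) w)
    calc |∫ w, R n w ∂(κ x)|
        = |∑ i ∈ Finset.range (n + 1), ∫ w, jumpSumR (expJump F) (grid 0 t n i)
            (grid 0 t n (i + 1)) w * fkDefect F g h t (grid 0 t n (i + 1)) w ∂(κ x)| := by
          rw [← integral_finsetSum _ fun i hi => (hk i hi).1]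
      _ ≤ ∑ i ∈ Finset.range (n + 1), ∫ w, C * (jumpSum (expWeight F)
            (grid 0 t n i) (grid 0 t n (i + 1)) w).toReal ∂(κ x) :=
          (Finset.abs_sum_le_sum_abs _ _).trans (Finset.sum_le_sum fun i hi => (hk i hi).2)
      _ = ∫ w, C * (jumpSum (expWeight F) 0 t w).toReal ∂(κ x) := by
          rw [← integral_finsetSum _ hJi', integral_congr_ae hsum]
      _ ≤ C / 2 := by
          rw [integral_const_mul]
          nlinarith [hJi.2]
  have herr : fkError κ F g h t x = ∫ w, Rinf w ∂(κ x) := by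
    have h1 := (hκ.integrable_fkWeight hF hd hg hB hgB ht hGt x).1
    let S : CadlagPath E → ℝ := fun w => (w t).elim 0 g +
      ∑' s : Set.Ioc 0 t, jump (expJump F) s w * (w s).elim 0 (h (t - s))
    -- By `fkWeight_eq`, the integrand of the Duhamel equation is the weight minus the sum of the
    -- defects.
    have hS : S =ᵐ[κ x] fun w => fkWeight F g t w - Rinf w := by
      filter_upwards [hae x] with w hw
      have hs1 := summable_jump_mul_fkDefect (F := F) (g := g) (h := h) (t := t) (w := w)
        (v := fun s => s) hB hB' hgB hhB hw fun s => le_rfl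
      have hs2 : Summable fun s : Set.Ioc 0 t => jump (expJump F) s w *
          (Real.exp (-jumpSumR F s t w) * (w t).elim 0 g) := by
        -- With the zero candidate the defect is the restarted weight alone.
        have := summable_jump_mul_fkDefect (F := F) (g := g) (h := fun _ _ => 0) (t := t) (w := w)
          (v := fun s => s) hB hB' hgB (fun s x => by simpa using hB') hw fun s => le_rfl
        refine this.congr fun s => ?_
        unfold fkDefect
        congr 1
        have hz : ∀ y : OnePoint E, y.elim 0 (fun _ : E => (0 : ℝ)) = 0 := fun y => by
          rcases y with _ | y <;> rfl
        exact (sub_eq_self.2 (hz _))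
      simp only [S, Rinf]
      rw [fkWeight_eq hw, add_sub_assoc, ← hs2.tsum_sub hs1]
      congr 1
      refine tsum_congr fun s => ?_
      unfold fkDefect
      ring
    have hRi : Integrable Rinf (κ x) := by
      have hm : AEStronglyMeasurable Rinf (κ x) :=
        aestronglyMeasurable_of_tendsto_ae atTop (fun n => (hRmeas n).aestronglyMeasurable) hlim
      refine hdom.mono' hm ?_
      filter_upwards [hae x] with w hw
      exact abs_tsum_fkDefect_le (v := fun s => s) hB hB' hgB hhB hw fun s => le_rfl
    have h2 := hduh t ht htt x
    rw [integral_congr_ae hS, integral_sub h1 hRi] at h2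
    change ∫ w, fkWeight F g t w ∂(κ x) - h t x = _
    rw [h2]; ring
  rw [herr]
  exact le_of_tendsto hint.abs (Eventually.of_forall hRle)

/-- A bounded, continuous solution of the Duhamel equation is the Feynman-Kac semigroup. -/
theorem IsMarkovLaw.integral_fkWeight_eq (hκ : IsMarkovLaw κ) (hF : Measurable (Function.uncurry F))
    (hd : ∀ x, F x x = 0) (hg : Measurable g) (hB : 0 ≤ B) (hgB : ∀ x, |g x| ≤ B) {t0 : ℝ≥0}
    (hG : ∀ x, ∫⁻ w, jumpSum (expWeight F) 0 t0 w ∂(κ x) ≤ 1 / 2)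
    (hh : ∀ s, Measurable (h s)) (hB' : 0 ≤ B') (hhB : ∀ s x, |h s x| ≤ B')
    (hc : ∀ r y, 0 < r → r < t0 → ContinuousAt (Function.uncurry h) (r, y)) (h0 : h 0 = g)
    (hduh : ∀ t, 0 < t → t ≤ t0 → ∀ x : E, h t x = ∫ w, ((w t).elim 0 g +
      ∑' s : Set.Ioc 0 t, jump (expJump F) s w * (w s).elim 0 (h (t - s))) ∂(κ x))
    (htt : t ≤ t0) (x : E) : ∫ w, fkWeight F g t w ∂(κ x) = h t x := by
  have := hκ.prob
  -- The crude bound 2B + B', from Khasminskii's lemma and the bound on `h`, is halved at each step.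
  have key : ∀ n : ℕ, ∀ r ≤ t0, ∀ y, |fkError κ F g h r y| ≤ (2 * B + B') / 2 ^ n := by
    intro n
    induction n with
    | zero =>
      intro r hr y
      rw [pow_zero, div_one]
      refine (abs_sub _ _).trans (add_le_add ?_ (abs_elim_le hB' (hhB r) y))
      rcases (zero_le (a := r)).eq_or_lt with hr0 | hr0
      · have hb : ∀ w, |fkWeight F g r w| ≤ B := by
          intro w
          rw [← hr0]
          have : jumpSumR F 0 0 w = 0 := by simp [jumpSumR]
          simp only [fkWeight, this, neg_zero, Real.exp_zero, one_mul]
          exact abs_elim_le hB hgB _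
        have := norm_integral_le_of_norm_le_const (μ := κ y) (f := fkWeight F g r) (C := B)
          (Eventually.of_forall hb)
        simp only [probReal_univ, mul_one, Real.norm_eq_abs] at this
        linarith
      · refine (hκ.integrable_fkWeight hF hd hg hB hgB hr0 (fun z => ?_) y).2
        exact (lintegral_mono fun w => jumpSum_le _ le_rfl hr w).trans (hG z)
    | succ n ih =>
      have := hκ.abs_fkError_le_half hF hd hg hB hgB hG hh hB' hhB hc h0 hduh ih
      intro r hr y
      refine (this r hr y).trans (le_of_eq ?_)
      rw [pow_succ, div_div]
  have h1 : |fkError κ F g h t x| ≤ 0 := by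
    have h2 : Tendsto (fun n : ℕ => (2 * B + B') / 2 ^ n) atTop (𝓝 0) := by
      have := (tendsto_pow_atTop_nhds_zero_of_lt_one (r := (1 / 2 : ℝ)) (by norm_num)
        (by norm_num)).const_mul (2 * B + B')
      rw [mul_zero] at this
      refine this.congr fun n => ?_
      rw [one_div, inv_pow, div_eq_mul_inv]
    exact ge_of_tendsto' h2 fun n => key n t htt x
  have h3 : fkError κ F g h t x = 0 := abs_nonpos_iff.1 h1
  unfold fkError at h3
  exact sub_eq_zero.1 h3

end FeynmanKac

/-! ### The stable profile and the three-point inequality. -/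

section Profile

/-- The profile `t / (t^{1/α} ∨ r)^D` of the heat kernel of a stable process. -/
def prof (D α t r : ℝ) : ℝ := t / (max (t ^ (1 / α)) r) ^ D

variable {D α : ℝ}

/-- The minimum is t^{1/α} / (t^{1/α} ∨ r), and the exponents -d/α and (d + α)/α add up to 1. -/
lemma stableProfile_eq {d : ℕ} {α t r : ℝ} (hα : 0 < α) (ht : 0 < t) (hr : 0 ≤ r) :
    stableProfile d α t r = prof ((d : ℝ) + α) α t r := by
  have htp : 0 < t ^ (1 / α) := Real.rpow_pos_of_pos ht _
  have hm : 0 < max (t ^ (1 / α)) r := lt_max_of_lt_left htp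
  have h1 : (if r = 0 then 1 else min 1 (t ^ (1 / α) / r)) = t ^ (1 / α) / max (t ^ (1 / α)) r := by
    split_ifs with h
    · rw [h, max_eq_left htp.le, div_self htp.ne']
    · have hr' : 0 < r := lt_of_le_of_ne hr (Ne.symm h)
      rcases le_total (t ^ (1 / α)) r with hle | hle
      · rw [max_eq_right hle, min_eq_right ((div_le_one hr').2 hle)]
      · rw [max_eq_left hle, div_self htp.ne', min_eq_left ((one_le_div hr').2 hle)]
  rw [stableProfile, h1, prof, Real.div_rpow htp.le hm.le, ← mul_div_assoc, ← Real.rpow_mul ht.le,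
    ← Real.rpow_add ht]
  congr 1
  have : -((d : ℝ) / α) + 1 / α * ((d : ℝ) + α) = 1 := by field_simp; ring
  rw [this, Real.rpow_one]

lemma prof_base_pos {α t : ℝ} (ht : 0 < t) (r : ℝ) : 0 < max (t ^ (1 / α)) r :=
  lt_max_of_lt_left (Real.rpow_pos_of_pos ht _)

lemma prof_pos {t : ℝ} (ht : 0 < t) (r : ℝ) : 0 < prof D α t r :=
  div_pos ht (Real.rpow_pos_of_pos (prof_base_pos ht r) _)

lemma prof_nonneg {t : ℝ} (ht : 0 < t) (r : ℝ) : 0 ≤ prof D α t r := (prof_pos ht r).le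

lemma prof_anti (hD : 0 < D) {t r r' : ℝ} (ht : 0 < t) (h : r ≤ r') :
    prof D α t r' ≤ prof D α t r := by
  unfold prof
  have := prof_base_pos (α := α) ht r
  have h1 : max (t ^ (1 / α)) r ≤ max (t ^ (1 / α)) r' := max_le_max le_rfl h
  exact div_le_div_of_nonneg_left ht.le (Real.rpow_pos_of_pos this _)
    (Real.rpow_le_rpow this.le h1 hD.le)

/-- The doubling, shift and one-third comparisons that follow all reduce to comparing the bases
t^{1/α} ∨ r. -/
lemma prof_le_of_base {c s t r r' : ℝ} (hD : 0 < D) (ht : 0 < t) (hs : 0 < s) (hst : s ≤ t)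
    (hc : 0 < c) (h : max (t ^ (1 / α)) r' ≤ c * max (s ^ (1 / α)) r) :
    prof D α s r ≤ c ^ D * prof D α t r' := by
  unfold prof
  have h1 := prof_base_pos (α := α) ht r'
  have h2 := prof_base_pos (α := α) hs r
  have h3 : (max (t ^ (1 / α)) r') ^ D ≤ c ^ D * (max (s ^ (1 / α)) r) ^ D := by
    rw [← Real.mul_rpow hc.le h2.le]
    exact Real.rpow_le_rpow h1.le h hD.le
  rw [← mul_div_assoc, div_le_div_iff₀ (Real.rpow_pos_of_pos h2 _) (Real.rpow_pos_of_pos h1 _)]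
  have h4 := Real.rpow_pos_of_pos h1 D
  calc s * (max (t ^ (1 / α)) r') ^ D ≤ t * (c ^ D * (max (s ^ (1 / α)) r) ^ D) := by gcongr
    _ = _ := by ring

lemma prof_half (hD : 0 < D) (hα : 0 < α) {s t r : ℝ} (hs : 0 < s) (hst : s ≤ t)
    (h2 : t ≤ 2 * s) : prof D α s r ≤ (2 ^ (1 / α)) ^ D * prof D α t r := by
  have ht := hs.trans_le hst
  have hα' : 0 ≤ 1 / α := by positivity
  refine prof_le_of_base hD ht hs hst (by positivity) (max_le ?_ ?_)
  · calc t ^ (1 / α) ≤ (2 * s) ^ (1 / α) := Real.rpow_le_rpow ht.le h2 hα'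
      _ = 2 ^ (1 / α) * s ^ (1 / α) := Real.mul_rpow (by norm_num) hs.le
      _ ≤ _ := by gcongr; exact le_max_left _ _
  · have h1 : (1 : ℝ) ≤ 2 ^ (1 / α) := Real.one_le_rpow (by norm_num) hα'
    calc r ≤ max (s ^ (1 / α)) r := le_max_right _ _
      _ = 1 * max (s ^ (1 / α)) r := (one_mul _).symm
      _ ≤ _ := mul_le_mul_of_nonneg_right h1 (prof_base_pos hs r).le

lemma prof_mul_le (hD : 0 < D) (hα : 0 < α) {s t : ℝ} (hs : 0 < s) (hst : s ≤ t) (r : ℝ) :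
    prof D α t r ≤ t / s * prof D α s r := by
  unfold prof
  have ht := hs.trans_le hst
  have h2 := prof_base_pos (α := α) hs r
  have h1 : max (s ^ (1 / α)) r ≤ max (t ^ (1 / α)) r :=
    max_le_max (Real.rpow_le_rpow hs.le hst (by positivity)) le_rfl
  calc t / (max (t ^ (1 / α)) r) ^ D ≤ t / (max (s ^ (1 / α)) r) ^ D :=
        div_le_div_of_nonneg_left ht.le (Real.rpow_pos_of_pos h2 _)
          (Real.rpow_le_rpow h2.le h1 hD.le)
    _ = t / s * (s / (max (s ^ (1 / α)) r) ^ D) := by field_simp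

lemma prof_shift (hD : 0 < D) {s r r' : ℝ} (hs : 0 < s) (h : r' ≤ r + s ^ (1 / α)) :
    prof D α s r ≤ 2 ^ D * prof D α s r' := by
  refine prof_le_of_base hD hs hs le_rfl (by norm_num) (max_le ?_ ?_)
  · have := le_max_left (s ^ (1 / α)) r
    have := prof_base_pos (α := α) hs r
    linarith
  · have := le_max_left (s ^ (1 / α)) r
    have := le_max_right (s ^ (1 / α)) r
    linarith

lemma prof_third (hD : 0 < D) {s t r r' : ℝ} (hs : 0 < s) (hst : s ≤ t) (h : t ^ (1 / α) ≤ r)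
    (h3 : r ≤ 3 * r') : prof D α s r' ≤ 3 ^ D * prof D α t r := by
  refine prof_le_of_base hD (hs.trans_le hst) hs hst (by norm_num) ?_
  rw [max_eq_right h]
  exact h3.trans (mul_le_mul_of_nonneg_left (le_max_right _ _) (by norm_num))

lemma prof_eq_zero {t r : ℝ} (h : r ≤ t ^ (1 / α)) (ht : 0 < t) :
    prof D α t r = prof D α t 0 := by
  unfold prof
  rw [max_eq_left h, max_eq_left (Real.rpow_pos_of_pos ht _).le]

/-- The constant of the three point inequality. -/
def threePointConst (D α : ℝ) : ℝ := max ((2 ^ (1 / α)) ^ D) (3 ^ D)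

lemma threePointConst_pos : 0 < threePointConst D α :=
  lt_max_of_lt_right (Real.rpow_pos_of_pos (by norm_num) _)

/-- When d(x, z) ≤ t^{1/α} the distance plays no role, and one of `s`, `t - s` is at least t/2.
Otherwise one of the three legs from x to z through u and w is at least a third of the distance: an
outer leg gives one of the first two alternatives, the middle leg the last. -/
lemma prof_three_point (hD : 0 < D) (hα : 0 < α) {E : Type*} [MetricSpace E] {s t : ℝ} (hs : 0 < s)
    (hst : s < t) (x u w z : E) :
    prof D α s (dist x u) ≤ threePointConst D α * prof D α t (dist x z) ∨
    prof D α (t - s) (dist w z) ≤ threePointConst D α * prof D α t (dist x z) ∨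
    1 / dist u w ^ D ≤ threePointConst D α / t * prof D α t (dist x z) := by
  have ht := hs.trans hst
  have hts : 0 < t - s := sub_pos.2 hst
  have hC1 : (2 ^ (1 / α)) ^ D ≤ threePointConst D α := le_max_left _ _
  have hC2 : (3 : ℝ) ^ D ≤ threePointConst D α := le_max_right _ _
  have hp := prof_nonneg (D := D) (α := α) ht (dist x z)
  rcases le_total (dist x z) (t ^ (1 / α)) with hr | hr
  · rw [prof_eq_zero hr ht] at hp ⊢
    rcases le_total t (2 * s) with h | h
    · refine Or.inl ((prof_anti hD hs dist_nonneg).trans ((prof_half hD hα hs hst.le h).trans ?_))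
      gcongr
    · refine Or.inr (Or.inl ((prof_anti hD hts dist_nonneg).trans
        ((prof_half hD hα hts (t := t) (by linarith) (by linarith)).trans ?_)))
      gcongr
  · have htri : dist x z ≤ dist x u + dist u w + dist w z := dist_triangle4 x u w z
    rcases le_total (dist x z) (3 * dist x u) with h1 | h1
    · refine Or.inl ((prof_third hD hs hst.le hr h1).trans ?_)
      gcongr
    rcases le_total (dist x z) (3 * dist w z) with h2 | h2
    · refine Or.inr (Or.inl ((prof_third hD hts (by linarith) hr h2).trans ?_))
      gcongr
    refine Or.inr (Or.inr ?_)
    have h3 : dist x z ≤ 3 * dist u w := by linarith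
    have hr0 : 0 < dist x z := (Real.rpow_pos_of_pos ht _).trans_le hr
    have hu0 : 0 < dist u w := by linarith
    unfold prof
    rw [max_eq_right hr]
    have h4 : dist x z ^ D ≤ 3 ^ D * dist u w ^ D := by
      rw [← Real.mul_rpow (by norm_num) hu0.le]
      exact Real.rpow_le_rpow hr0.le h3 hD.le
    have hxz := Real.rpow_pos_of_pos hr0 D
    have huw := Real.rpow_pos_of_pos hu0 D
    have e : threePointConst D α / t * (t / dist x z ^ D) = threePointConst D α / dist x z ^ D := by
      field_simp
    rw [e, div_le_div_iff₀ huw hxz, one_mul]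
    exact h4.trans (by gcongr)

lemma measurable_prof : Measurable fun q : ℝ × ℝ => prof D α q.1 q.2 := by
  unfold prof
  fun_prop

@[fun_prop]
lemma Measurable.prof {Ω : Type*} [MeasurableSpace Ω] {f g : Ω → ℝ} (hf : Measurable f)
    (hg : Measurable g) : Measurable fun a => prof D α (f a) (g a) :=
  measurable_prof.comp (hf.prodMk hg)

@[fun_prop]
lemma AEMeasurable.prof {Ω : Type*} [MeasurableSpace Ω] {μ : Measure Ω} {f g : Ω → ℝ}
    (hf : AEMeasurable f μ) (hg : AEMeasurable g μ) :
    AEMeasurable (fun a => prof D α (f a) (g a)) μ :=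
  measurable_prof.comp_aemeasurable (hf.prodMk hg)

end Profile

/-! ### Space-time convolution through a jump kernel. -/

section Kernels
variable {E : Type*} [MetricSpace E] [ProperSpace E] [MeasurableSpace E] [BorelSpace E]
  {m : Measure E} [SFinite m] {D α : ℝ}

/-- The space-time convolution of the kernels `P` and `k` through the jump kernel `J`. -/
def kconv (m : Measure E) (P : ℝ → E → E → ℝ≥0∞) (J : E → E → ℝ≥0∞) (k : ℝ → E → E → ℝ≥0∞)
    (t : ℝ) (x z : E) : ℝ≥0∞ :=
  ∫⁻ s in Set.Ioo 0 t, ∫⁻ u, ∫⁻ w, P s x u * J u w * k (t - s) w z ∂m ∂m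

/-- The profile as a kernel. -/
def rho (D α : ℝ) (t : ℝ) (x y : E) : ℝ≥0∞ := ENNReal.ofReal (prof D α t (dist x y))

/-- Joint measurability of a time-dependent kernel. -/
def MeasKernel (k : ℝ → E → E → ℝ≥0∞) : Prop := Measurable fun q : ℝ × E × E => k q.1 q.2.1 q.2.2

lemma measKernel_rho : MeasKernel (rho D α : ℝ → E → E → ℝ≥0∞) := by
  have h : Measurable fun q : ℝ × E × E => (q.1, dist q.2.1 q.2.2) := by fun_prop
  have h2 : Measurable fun q : ℝ × E × E => prof D α q.1 (dist q.2.1 q.2.2) := measurable_prof.comp h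
  exact h2.ennreal_ofReal

lemma rho_comm (t : ℝ) (x y : E) : rho D α t x y = rho D α t y x := by
  rw [rho, rho, dist_comm]

variable {P k : ℝ → E → E → ℝ≥0∞} {J : E → E → ℝ≥0∞}

lemma measurable_kconv_integrand (hP : MeasKernel P) (hJ : Measurable (Function.uncurry J))
    (hk : MeasKernel k) : Measurable fun q : (ℝ × E × E) × ℝ × E × E =>
      P q.2.1 q.1.2.1 q.2.2.1 * J q.2.2.1 q.2.2.2 * k (q.1.1 - q.2.1) q.2.2.2 q.1.2.2 := by
  have h1 : Measurable fun q : (ℝ × E × E) × ℝ × E × E => P q.2.1 q.1.2.1 q.2.2.1 :=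
    hP.comp (g := fun q : ℝ × E × E => P q.1 q.2.1 q.2.2)
      (f := fun q : (ℝ × E × E) × ℝ × E × E => (q.2.1, q.1.2.1, q.2.2.1)) (by fun_prop)
  have h2 : Measurable fun q : (ℝ × E × E) × ℝ × E × E => J q.2.2.1 q.2.2.2 :=
    hJ.comp (f := fun q : (ℝ × E × E) × ℝ × E × E => (q.2.2.1, q.2.2.2)) (by fun_prop)
  have h3 : Measurable fun q : (ℝ × E × E) × ℝ × E × E => k (q.1.1 - q.2.1) q.2.2.2 q.1.2.2 :=
    hk.comp (g := fun q : ℝ × E × E => k q.1 q.2.1 q.2.2)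
      (f := fun q : (ℝ × E × E) × ℝ × E × E => (q.1.1 - q.2.1, q.2.2.2, q.1.2.2)) (by fun_prop)
  exact (h1.mul h2).mul h3

lemma kconv_eq (hP : MeasKernel P) (hJ : Measurable (Function.uncurry J)) (hk : MeasKernel k)
    (t : ℝ) (x z : E) : kconv m P J k t x z = ∫⁻ q : ℝ × E × E, (Set.Ioo 0 t).indicator
      (fun s => P s x q.2.1 * J q.2.1 q.2.2 * k (t - s) q.2.2 z) q.1
        ∂(volume.prod (m.prod m)) := by
  have hm : Measurable fun q : ℝ × E × E => P q.1 x q.2.1 * J q.2.1 q.2.2 * k (t - q.1) q.2.2 z :=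
    (measurable_kconv_integrand hP hJ hk).comp (f := fun q : ℝ × E × E => ((t, x, z), q))
      (by fun_prop)
  have hm2 : Measurable fun q : ℝ × E × E => (Set.Ioo 0 t).indicator
      (fun s => P s x q.2.1 * J q.2.1 q.2.2 * k (t - s) q.2.2 z) q.1 := by
    have := hm.indicator (measurable_fst measurableSet_Ioo :
      MeasurableSet (Prod.fst ⁻¹' (Set.Ioo 0 t) : Set (ℝ × E × E)))
    exact this
  rw [lintegral_prod _ hm2.aemeasurable, kconv, ← lintegral_indicator measurableSet_Ioo]
  refine lintegral_congr fun s => ?_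
  by_cases hs : s ∈ Set.Ioo 0 t
  · simp only [Set.indicator_of_mem hs]
    have hms : Measurable fun q : E × E => P s x q.1 * J q.1 q.2 * k (t - s) q.2 z :=
      hm.comp (measurable_prodMk_left (x := s))
    exact (lintegral_prod _ hms.aemeasurable).symm
  · simp only [Set.indicator_of_notMem hs]
    simp

lemma measKernel_kconv (hP : MeasKernel P) (hJ : Measurable (Function.uncurry J))
    (hk : MeasKernel k) : MeasKernel (kconv m P J k) := by
  unfold MeasKernel
  simp_rw [kconv_eq hP hJ hk]
  refine Measurable.lintegral_prod_right' (f := fun q : (ℝ × E × E) × ℝ × E × E =>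
    (Set.Ioo 0 q.1.1).indicator (fun s => P s q.1.2.1 q.2.2.1 * J q.2.2.1 q.2.2.2 *
      k (q.1.1 - s) q.2.2.2 q.1.2.2) q.2.1) ?_
  have hS : MeasurableSet {q : (ℝ × E × E) × ℝ × E × E | 0 < q.2.1 ∧ q.2.1 < q.1.1} :=
    (measurableSet_lt measurable_const (measurable_fst.comp measurable_snd)).inter
      (measurableSet_lt (measurable_fst.comp measurable_snd)
        (measurable_fst.comp measurable_fst))
  exact (measurable_kconv_integrand hP hJ hk).indicator hS

lemma setLIntegral_Ioo_reflect (f : ℝ → ℝ≥0∞) (t : ℝ) :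
    ∫⁻ s in Set.Ioo 0 t, f (t - s) = ∫⁻ s in Set.Ioo 0 t, f s := by
  rw [← lintegral_indicator measurableSet_Ioo, ← lintegral_indicator measurableSet_Ioo,
    ← lintegral_sub_left_eq_self _ t]
  refine lintegral_congr fun s => ?_
  by_cases hs : s ∈ Set.Ioo 0 t
  · rw [Set.indicator_of_mem (show t - s ∈ Set.Ioo 0 t from ⟨by linarith [hs.2], by linarith [hs.1]⟩),
      Set.indicator_of_mem hs, sub_sub_cancel]
  · rw [Set.indicator_of_notMem (show t - s ∉ Set.Ioo 0 t from fun h =>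
      hs ⟨by linarith [h.2], by linarith [h.1]⟩), Set.indicator_of_notMem hs]

end Kernels

/-! ### Geometric decay of the iterated convolutions. -/

section Bounds
variable {E : Type*} [MetricSpace E] [ProperSpace E] [MeasurableSpace E] [BorelSpace E]
  {m : Measure E} [SFinite m] {D α : ℝ}

/-- The modulus of the Kato class. -/
def katoMod (m : Measure E) (D α : ℝ) (V : E → ℝ≥0∞) (t : ℝ) : ℝ≥0∞ :=
  ⨆ x, ∫⁻ s in Set.Ioo 0 t, ∫⁻ u, rho D α s x u * V u ∂m

/-- A jump kernel of stable type whose two marginals are in the Kato class. -/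
structure IsKatoJump (m : Measure E) (D α : ℝ) (J : E → E → ℝ≥0∞) (A : ℝ≥0∞) (Λ : ℝ) : Prop where
  hD : 0 < D
  hα : 0 < α
  hΛ : 0 ≤ Λ
  hA : A ≠ ⊤
  meas : Measurable (Function.uncurry J)
  le_div : ∀ u w, J u w ≤ ENNReal.ofReal (Λ * (1 / dist u w ^ D))
  mass : ∀ t, 0 < t → ∀ x, ∫⁻ y, rho D α t x y ∂m ≤ A
  kato_out : Tendsto (katoMod m D α fun u => ∫⁻ w, J u w ∂m) (𝓝[>] 0) (𝓝 0)
  kato_in : Tendsto (katoMod m D α fun w => ∫⁻ u, J u w ∂m) (𝓝[>] 0) (𝓝 0)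

variable {J : E → E → ℝ≥0∞} {A : ℝ≥0∞} {Λ : ℝ} {k : ℝ → E → E → ℝ≥0∞}

/-- Each alternative of the three-point inequality produces one of the three terms; their sum is
free of case distinctions and can be integrated. `K` stands for the value of the next kernel at `(t
- s, w, z)`. -/
lemma rho_three_point_le (h : IsKatoJump m D α J A Λ) {c K : ℝ≥0∞} {s t : ℝ} (hs : 0 < s)
    (hst : s < t) (x u w z : E) (hK : K ≤ c * rho D α (t - s) w z) :
    rho D α s x u * J u w * K ≤ ENNReal.ofReal (threePointConst D α) * rho D α t x z *
      (c * (rho D α s x u * J u w) + c * (J u w * rho D α (t - s) w z) +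
        ENNReal.ofReal (Λ / t) * (rho D α s x u * K)) := by
  set C0 := ENNReal.ofReal (threePointConst D α) with hC0
  have hC : 0 ≤ threePointConst D α := threePointConst_pos.le
  have ht := hs.trans hst
  rcases prof_three_point h.hD h.hα hs hst x u w z with h1 | h1 | h1
  · have h2 : rho D α s x u ≤ C0 * rho D α t x z := by
      rw [hC0, rho, rho, ← ENNReal.ofReal_mul hC]
      exact ENNReal.ofReal_le_ofReal h1
    calc rho D α s x u * J u w * K ≤ (C0 * rho D α t x z) * J u w * (c * rho D α (t - s) w z) := by
          gcongr
      _ = C0 * rho D α t x z * (c * (J u w * rho D α (t - s) w z)) := by ring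
      _ ≤ _ := by
        gcongr
        exact le_add_self.trans le_self_add
  · have h2 : rho D α (t - s) w z ≤ C0 * rho D α t x z := by
      rw [hC0, rho, rho, ← ENNReal.ofReal_mul hC]
      exact ENNReal.ofReal_le_ofReal h1
    calc rho D α s x u * J u w * K ≤ rho D α s x u * J u w * (c * (C0 * rho D α t x z)) := by
          gcongr
          exact hK.trans (by gcongr)
      _ = C0 * rho D α t x z * (c * (rho D α s x u * J u w)) := by ring
      _ ≤ _ := by
        gcongr
        exact le_self_add.trans le_self_add
  · have h2 : J u w ≤ C0 * rho D α t x z * ENNReal.ofReal (Λ / t) := by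
      refine (h.le_div u w).trans ?_
      rw [hC0, rho, ← ENNReal.ofReal_mul hC,
        ← ENNReal.ofReal_mul (mul_nonneg hC (prof_nonneg ht _))]
      refine ENNReal.ofReal_le_ofReal ((mul_le_mul_of_nonneg_left h1 h.hΛ).trans_eq ?_)
      field_simp
    calc rho D α s x u * J u w * K ≤
        rho D α s x u * (C0 * rho D α t x z * ENNReal.ofReal (Λ / t)) * K := by gcongr
      _ = C0 * rho D α t x z * (ENNReal.ofReal (Λ / t) * (rho D α s x u * K)) := by ring
      _ ≤ _ := by
        gcongr
        exact le_add_self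

lemma katoMod_mono (V : E → ℝ≥0∞) {s t : ℝ} (hst : s ≤ t) :
    katoMod m D α V s ≤ katoMod m D α V t :=
  iSup_mono fun _ => lintegral_mono_set (Set.Ioo_subset_Ioo le_rfl hst)

lemma lintegral_rho_out (h : IsKatoJump m D α J A Λ) (t : ℝ) (x : E) :
    ∫⁻ s in Set.Ioo 0 t, ∫⁻ u, ∫⁻ w, rho D α s x u * J u w ∂m ∂m ≤
      katoMod m D α (fun u => ∫⁻ w, J u w ∂m) t := by
  have hJ := h.meas
  refine le_trans (le_of_eq ?_) (le_iSup (fun x =>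
    ∫⁻ s in Set.Ioo 0 t, ∫⁻ u, rho D α s x u * ∫⁻ w, J u w ∂m ∂m) x)
  refine lintegral_congr fun s => lintegral_congr fun u => ?_
  rw [lintegral_const_mul _ (by fun_prop)]

lemma lintegral_rho_in (h : IsKatoJump m D α J A Λ) (t : ℝ) (z : E) :
    ∫⁻ s in Set.Ioo 0 t, ∫⁻ u, ∫⁻ w, J u w * rho D α (t - s) w z ∂m ∂m ≤
      katoMod m D α (fun w => ∫⁻ u, J u w ∂m) t := by
  have hJ := h.meas
  have hr : Measurable fun q : ℝ × E × E => rho D α q.1 q.2.1 q.2.2 := measKernel_rho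
  refine le_trans (le_of_eq ?_) (le_iSup (fun x =>
    ∫⁻ s in Set.Ioo 0 t, ∫⁻ w, rho D α s x w * ∫⁻ u, J u w ∂m ∂m) z)
  rw [← setLIntegral_Ioo_reflect]
  refine lintegral_congr fun s => ?_
  rw [lintegral_lintegral_swap (by fun_prop)]
  refine lintegral_congr fun w => ?_
  rw [lintegral_mul_const _ (by fun_prop), mul_comm, rho_comm, sub_sub_cancel]

/-- The first two terms integrate to Kato moduli, small with `t0`. In the third, 1/t cancels the
length of the time interval and leaves the masses `A` and `i`: its coefficient is not small, so the
mass bound `i` has to be followed separately from the pointwise bound `c`. -/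
lemma kconv_le (h : IsKatoJump m D α J A Λ) (hk : MeasKernel k) {c i : ℝ≥0∞} {t0 t : ℝ}
    (hc : ∀ t, 0 < t → t ≤ t0 → ∀ x z, k t x z ≤ c * rho D α t x z)
    (hi : ∀ t, 0 < t → t ≤ t0 → ∀ z, ∫⁻ x, k t x z ∂m ≤ i) (ht : 0 < t) (htt : t ≤ t0) (x z : E) :
    kconv m (rho D α) J k t x z ≤ ENNReal.ofReal (threePointConst D α) *
      (c * (katoMod m D α (fun u => ∫⁻ w, J u w ∂m) t0 +
        katoMod m D α (fun w => ∫⁻ u, J u w ∂m) t0) + ENNReal.ofReal Λ * A * i) *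
      rho D α t x z := by
  have hJ := h.meas
  have hr : Measurable fun q : ℝ × E × E => rho D α q.1 q.2.1 q.2.2 := measKernel_rho
  unfold MeasKernel at hk
  set C0 := ENNReal.ofReal (threePointConst D α) with hC0
  calc kconv m (rho D α) J k t x z
      ≤ ∫⁻ s in Set.Ioo 0 t, ∫⁻ u, ∫⁻ w, C0 * rho D α t x z *
        (c * (rho D α s x u * J u w) + c * (J u w * rho D α (t - s) w z) +
        ENNReal.ofReal (Λ / t) * (rho D α s x u * k (t - s) w z)) ∂m ∂m := by
        refine setLIntegral_mono' measurableSet_Ioo fun s hs => ?_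
        refine lintegral_mono fun u => lintegral_mono fun w => ?_
        exact rho_three_point_le h hs.1 hs.2 x u w z
          (hc _ (sub_pos.2 hs.2) (by linarith [hs.1]) w z)
    _ = C0 * rho D α t x z * (c * (∫⁻ s in Set.Ioo 0 t, ∫⁻ u, ∫⁻ w, rho D α s x u * J u w ∂m ∂m) +
          c * (∫⁻ s in Set.Ioo 0 t, ∫⁻ u, ∫⁻ w, J u w * rho D α (t - s) w z ∂m ∂m) +
          ENNReal.ofReal (Λ / t) * ∫⁻ s in Set.Ioo 0 t, ∫⁻ u, ∫⁻ w,
            rho D α s x u * k (t - s) w z ∂m ∂m) := by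
        rw [← lintegral_const_mul _ (by fun_prop), ← lintegral_const_mul _ (by fun_prop),
          ← lintegral_const_mul _ (by fun_prop), ← lintegral_add_left (by fun_prop),
          ← lintegral_add_left (by fun_prop), ← lintegral_const_mul _ (by fun_prop)]
        refine lintegral_congr fun s => ?_
        rw [← lintegral_const_mul _ (by fun_prop), ← lintegral_const_mul _ (by fun_prop),
          ← lintegral_const_mul _ (by fun_prop), ← lintegral_add_left (by fun_prop),
          ← lintegral_add_left (by fun_prop), ← lintegral_const_mul _ (by fun_prop)]
        refine lintegral_congr fun u => ?_
        rw [← lintegral_const_mul _ (by fun_prop), ← lintegral_const_mul _ (by fun_prop),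
          ← lintegral_const_mul _ (by fun_prop), ← lintegral_add_left (by fun_prop),
          ← lintegral_add_left (by fun_prop), ← lintegral_const_mul _ (by fun_prop)]
    _ ≤ C0 * rho D α t x z * (c * katoMod m D α (fun u => ∫⁻ w, J u w ∂m) t0 +
          c * katoMod m D α (fun w => ∫⁻ u, J u w ∂m) t0 +
          ENNReal.ofReal (Λ / t) * (A * i * ENNReal.ofReal t)) := by
        gcongr
        · exact (lintegral_rho_out h t x).trans (katoMod_mono _ htt)
        · exact (lintegral_rho_in h t z).trans (katoMod_mono _ htt)
        · calc ∫⁻ s in Set.Ioo 0 t, ∫⁻ u, ∫⁻ w, rho D α s x u * k (t - s) w z ∂m ∂m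
              ≤ ∫⁻ s in Set.Ioo 0 t, A * i := by
                refine setLIntegral_mono' measurableSet_Ioo fun s hs => ?_
                calc ∫⁻ u, ∫⁻ w, rho D α s x u * k (t - s) w z ∂m ∂m
                    ≤ ∫⁻ u, rho D α s x u * i ∂m := by
                      refine lintegral_mono fun u => ?_
                      rw [lintegral_const_mul _ (by fun_prop)]
                      gcongr
                      exact hi _ (sub_pos.2 hs.2) (by linarith [hs.1]) z
                  _ = (∫⁻ u, rho D α s x u ∂m) * i := lintegral_mul_const _ (by fun_prop)
                  _ ≤ A * i := by gcongr; exact h.mass s hs.1 x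
            _ = A * i * ENNReal.ofReal t := by simp
    _ = _ := by
        have e : ENNReal.ofReal (Λ / t) * ENNReal.ofReal t = ENNReal.ofReal Λ := by
          rw [← ENNReal.ofReal_mul (div_nonneg h.hΛ ht.le), div_mul_cancel₀ _ ht.ne']
        rw [← e]
        ring

/-- Integrating out the starting point costs only `A`, whatever the place of the jump; the mass is
thus reduced to a potential of the incoming marginal. -/
lemma lintegral_kconv_le (h : IsKatoJump m D α J A Λ) (hk : MeasKernel k) (t : ℝ) (z : E) :
    ∫⁻ x, kconv m (rho D α) J k t x z ∂m ≤
      A * ∫⁻ s in Set.Ioo 0 t, ∫⁻ w, (∫⁻ u, J u w ∂m) * k s w z ∂m := by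
  have hJ := h.meas
  have hr : Measurable fun q : ℝ × E × E => rho D α q.1 q.2.1 q.2.2 := measKernel_rho
  unfold MeasKernel at hk
  unfold kconv
  rw [lintegral_lintegral_swap (by fun_prop),
    ← setLIntegral_Ioo_reflect (fun s => ∫⁻ w, (∫⁻ u, J u w ∂m) * k s w z ∂m) t,
    ← lintegral_const_mul _ (by fun_prop)]
  refine setLIntegral_mono' measurableSet_Ioo fun s hs => ?_
  rw [lintegral_lintegral_swap (by fun_prop)]
  calc ∫⁻ u, ∫⁻ x, ∫⁻ w, rho D α s x u * J u w * k (t - s) w z ∂m ∂m ∂m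
      ≤ ∫⁻ u, ∫⁻ w, A * (J u w * k (t - s) w z) ∂m ∂m := by
        refine lintegral_mono fun u => ?_
        rw [lintegral_lintegral_swap (by fun_prop)]
        refine lintegral_mono fun w => ?_
        simp_rw [mul_assoc]
        rw [lintegral_mul_const _ (by fun_prop)]
        gcongr
        simp_rw [rho_comm s _ u]
        exact h.mass s hs.1 u
    _ = A * ∫⁻ w, (∫⁻ u, J u w ∂m) * k (t - s) w z ∂m := by
        rw [lintegral_lintegral_swap (by fun_prop), ← lintegral_const_mul _ (by fun_prop)]
        refine lintegral_congr fun w => ?_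
        rw [lintegral_const_mul _ (by fun_prop), lintegral_mul_const _ (by fun_prop)]

/-- In the variables s and r = t - s the triangle is contained in the square. -/
lemma lintegral_triangle_le {φ : ℝ → ℝ → ℝ≥0∞} (hφ : Measurable (Function.uncurry φ)) (t0 : ℝ) :
    ∫⁻ t in Set.Ioo 0 t0, ∫⁻ s in Set.Ioo 0 t, φ s (t - s) ≤
      ∫⁻ s in Set.Ioo 0 t0, ∫⁻ r in Set.Ioo 0 t0, φ s r := by
  have hi : Measurable fun q : ℝ × ℝ => (Set.Ioo 0 t0).indicator (fun r => φ q.1 r) q.2 := by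
    have := (hφ.indicator (measurable_snd measurableSet_Ioo :
      MeasurableSet (Prod.snd ⁻¹' (Set.Ioo 0 t0) : Set (ℝ × ℝ))))
    exact this
  have hi2 : Measurable fun q : ℝ × ℝ => (Set.Ioo 0 t0).indicator (fun r => φ q.2 r) (q.1 - q.2) :=
    hi.comp (f := fun q : ℝ × ℝ => (q.2, q.1 - q.2)) (by fun_prop)
  calc ∫⁻ t in Set.Ioo 0 t0, ∫⁻ s in Set.Ioo 0 t, φ s (t - s)
      ≤ ∫⁻ t, ∫⁻ s in Set.Ioo 0 t0, (Set.Ioo 0 t0).indicator (fun r => φ s r) (t - s) := by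
        rw [← lintegral_indicator measurableSet_Ioo]
        refine lintegral_mono fun t => ?_
        by_cases ht : t ∈ Set.Ioo 0 t0
        · rw [Set.indicator_of_mem ht]
          refine (setLIntegral_mono' measurableSet_Ioo fun s hs => ?_).trans
            (lintegral_mono_set (Set.Ioo_subset_Ioo le_rfl ht.2.le))
          rw [Set.indicator_of_mem (show t - s ∈ Set.Ioo 0 t0 from
            ⟨sub_pos.2 hs.2, by linarith [hs.1, ht.2]⟩)]
        · rw [Set.indicator_of_notMem ht]
          exact zero_le
    _ = ∫⁻ s in Set.Ioo 0 t0, ∫⁻ t, (Set.Ioo 0 t0).indicator (fun r => φ s r) (t - s) := by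
        rw [lintegral_lintegral_swap hi2.aemeasurable]
    _ = _ := by
        refine lintegral_congr fun s => ?_
        rw [lintegral_sub_right_eq_self (fun t => (Set.Ioo 0 t0).indicator (fun r => φ s r) t) s,
          lintegral_indicator measurableSet_Ioo]

/-- Convolution multiplies the potential of the incoming marginal by at most its Kato modulus. This
makes the masses of the iterates decay without any pointwise estimate. -/
lemma lintegral_in_kconv_le (h : IsKatoJump m D α J A Λ) (hk : MeasKernel k) (t0 : ℝ) (z : E) :
    ∫⁻ t in Set.Ioo 0 t0, ∫⁻ x, (∫⁻ u, J u x ∂m) * kconv m (rho D α) J k t x z ∂m ≤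
      katoMod m D α (fun w => ∫⁻ u, J u w ∂m) t0 *
        ∫⁻ s in Set.Ioo 0 t0, ∫⁻ w, (∫⁻ u, J u w ∂m) * k s w z ∂m := by
  have hJ := h.meas
  have hr : Measurable fun q : ℝ × E × E => rho D α q.1 q.2.1 q.2.2 := measKernel_rho
  unfold MeasKernel at hk
  set V : E → ℝ≥0∞ := fun w => ∫⁻ u, J u w ∂m with hV
  have hVm : Measurable V := by fun_prop
  change ∫⁻ t in Set.Ioo 0 t0, ∫⁻ x, V x * kconv m (rho D α) J k t x z ∂m ≤
      katoMod m D α V t0 * ∫⁻ s in Set.Ioo 0 t0, ∫⁻ w, V w * k s w z ∂m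
  let φ : ℝ → ℝ → ℝ≥0∞ := fun s r =>
    ∫⁻ u, ∫⁻ w, (∫⁻ x, V x * rho D α s x u ∂m) * J u w * k r w z ∂m ∂m
  have hφ : Measurable (Function.uncurry φ) := by
    change Measurable fun q : ℝ × ℝ =>
      ∫⁻ u, ∫⁻ w, (∫⁻ x, V x * rho D α q.1 x u ∂m) * J u w * k q.2 w z ∂m ∂m
    fun_prop
  have e1 : ∀ t, ∫⁻ x, V x * kconv m (rho D α) J k t x z ∂m =
      ∫⁻ s in Set.Ioo 0 t, φ s (t - s) := by
    intro t
    unfold kconv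
    have e2 : ∀ x, V x * ∫⁻ s in Set.Ioo 0 t, ∫⁻ u, ∫⁻ w, rho D α s x u * J u w * k (t - s) w z
        ∂m ∂m = ∫⁻ s in Set.Ioo 0 t, ∫⁻ u, ∫⁻ w, V x * rho D α s x u * J u w * k (t - s) w z
        ∂m ∂m := by
      intro x
      rw [← lintegral_const_mul _ (by fun_prop)]
      refine lintegral_congr fun s => ?_
      rw [← lintegral_const_mul _ (by fun_prop)]
      refine lintegral_congr fun u => ?_
      rw [← lintegral_const_mul _ (by fun_prop)]
      refine lintegral_congr fun w => ?_
      ring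
    simp_rw [e2]
    rw [lintegral_lintegral_swap (by fun_prop)]
    refine lintegral_congr fun s => ?_
    rw [lintegral_lintegral_swap (by fun_prop)]
    refine lintegral_congr fun u => ?_
    rw [lintegral_lintegral_swap (by fun_prop)]
    refine lintegral_congr fun w => ?_
    rw [lintegral_mul_const _ (by fun_prop), lintegral_mul_const _ (by fun_prop)]
  simp_rw [e1]
  -- Passing to the square decouples the time before the jump from the time after it, so the former
  -- integrates to a Kato modulus.
  refine (lintegral_triangle_le hφ t0).trans ?_
  rw [lintegral_lintegral_swap (by fun_prop), ← lintegral_const_mul _ (by fun_prop)]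
  refine lintegral_mono fun r => ?_
  change ∫⁻ s in Set.Ioo 0 t0, ∫⁻ u, ∫⁻ w, (∫⁻ x, V x * rho D α s x u ∂m) * J u w * k r w z ∂m ∂m ≤ _
  rw [lintegral_lintegral_swap (by fun_prop)]
  calc ∫⁻ u, (∫⁻ s in Set.Ioo 0 t0, ∫⁻ w, (∫⁻ x, V x * rho D α s x u ∂m) * J u w * k r w z ∂m) ∂m
      ≤ ∫⁻ u, ∫⁻ w, katoMod m D α V t0 * (J u w * k r w z) ∂m ∂m := by
        refine lintegral_mono fun u => ?_
        rw [lintegral_lintegral_swap (by fun_prop)]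
        refine lintegral_mono fun w => ?_
        simp_rw [mul_assoc]
        rw [lintegral_mul_const _ (by fun_prop)]
        gcongr
        refine le_trans (le_of_eq ?_) (le_iSup (fun x =>
          ∫⁻ s in Set.Ioo 0 t0, ∫⁻ u, rho D α s x u * V u ∂m) u)
        refine lintegral_congr fun s => lintegral_congr fun x => ?_
        rw [mul_comm, rho_comm]
    _ = katoMod m D α V t0 * ∫⁻ w, V w * k r w z ∂m := by
        rw [lintegral_lintegral_swap (by fun_prop), ← lintegral_const_mul _ (by fun_prop)]
        refine lintegral_congr fun w => ?_
        rw [lintegral_const_mul _ (by fun_prop), lintegral_mul_const _ (by fun_prop)]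

/-- The iterated convolutions of `b * rho` through `J`. -/
def kIter (m : Measure E) (D α : ℝ) (J : E → E → ℝ≥0∞) (b : ℝ≥0∞) : ℕ → ℝ → E → E → ℝ≥0∞
  | 0 => fun t x z => b * rho D α t x z
  | n + 1 => fun t x z => b * kconv m (rho D α) J (kIter m D α J b n) t x z

lemma measKernel_kIter (hJ : Measurable (Function.uncurry J)) (b : ℝ≥0∞) (n : ℕ) :
    MeasKernel (kIter m D α J b n) := by
  induction n with
  | zero => exact Measurable.const_mul measKernel_rho b
  | succ n ih => exact Measurable.const_mul (measKernel_kconv measKernel_rho hJ ih) b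

lemma IsKatoJump.exists_time (h : IsKatoJump m D α J A Λ) {b : ℝ≥0∞} (hb : b ≠ ⊤) :
    ∃ t0 : ℝ, 0 < t0 ∧ b * katoMod m D α (fun w => ∫⁻ u, J u w ∂m) t0 ≤ 1 / 4 ∧
      b * (ENNReal.ofReal (threePointConst D α) * (katoMod m D α (fun u => ∫⁻ w, J u w ∂m) t0 +
        katoMod m D α (fun w => ∫⁻ u, J u w ∂m) t0)) ≤ 1 / 4 := by
  have h1 := ENNReal.Tendsto.const_mul h.kato_in (Or.inr hb)
  have h2 := ENNReal.Tendsto.const_mul (ENNReal.Tendsto.const_mul (h.kato_out.add h.kato_in)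
    (Or.inr (ENNReal.ofReal_ne_top (r := threePointConst D α)))) (Or.inr hb)
  simp only [add_zero, mul_zero] at h1 h2
  have hq : (0 : ℝ≥0∞) < 1 / 4 := by simp
  obtain ⟨t0, ⟨h3, h4⟩, h5⟩ := ((h1.eventually_le_const hq).and
    (h2.eventually_le_const hq)).and self_mem_nhdsWithin |>.exists
  exact ⟨t0, h5, h3, h4⟩

/-- Potentials of the iterates decay like 4^{-(n+1)} (`hg`), hence their masses like 4^{-n} (`hi`).
With this decay, the term of `kconv_le` that is not small acts as a source of order 4^{-n} in the
recursion for the pointwise bounds, which therefore decay like 2^{-n} (`hc`). -/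
lemma IsKatoJump.exists_kIter_le (h : IsKatoJump m D α J A Λ) {b : ℝ≥0∞} (hb : b ≠ ⊤) :
    ∃ t0 : ℝ, 0 < t0 ∧ ∃ B : ℝ, 0 < B ∧ ∀ n t, 0 < t → t ≤ t0 → ∀ x z,
      kIter m D α J b n t x z ≤ ENNReal.ofReal B * (1 / 2) ^ n * rho D α t x z := by
  obtain ⟨t0, ht0, h1, h2⟩ := h.exists_time hb
  set C0 := ENNReal.ofReal (threePointConst D α) with hC0
  set η := katoMod m D α (fun u => ∫⁻ w, J u w ∂m) t0
  set η' := katoMod m D α (fun w => ∫⁻ u, J u w ∂m) t0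
  set K : ℝ≥0∞ := b * C0 * ENNReal.ofReal Λ * A * b * A with hK
  have hKtop : K ≠ ⊤ := by
    have := h.hA
    finiteness
  -- The summand 4K gives K ≤ B0/4: the contraction and the source each use a quarter, and together
  -- they give the factor 1/2.
  set B0 : ℝ≥0∞ := b + 4 * K with hB0
  have hB0top : B0 ≠ ⊤ := by finiteness
  have hr : Measurable fun q : ℝ × E × E => rho D α q.1 q.2.1 q.2.2 := measKernel_rho
  have hJ := h.meas
  have hg : ∀ n z, ∫⁻ s in Set.Ioo 0 t0, ∫⁻ w, (∫⁻ u, J u w ∂m) * kIter m D α J b n s w z ∂m ≤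
      (1 / 4) ^ (n + 1) := by
    intro n
    induction n with
    | zero =>
      intro z
      refine le_trans ?_ (h1.trans_eq (by simp))
      calc ∫⁻ s in Set.Ioo 0 t0, ∫⁻ w, (∫⁻ u, J u w ∂m) * (b * rho D α s w z) ∂m
          = b * ∫⁻ s in Set.Ioo 0 t0, ∫⁻ w, rho D α s z w * ∫⁻ u, J u w ∂m ∂m := by
            rw [← lintegral_const_mul _ (by fun_prop)]
            refine lintegral_congr fun s => ?_
            rw [← lintegral_const_mul _ (by fun_prop)]
            refine lintegral_congr fun w => ?_
            rw [rho_comm s w z]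
            ring
        _ ≤ b * η' := by
            gcongr
            exact le_iSup (fun x => ∫⁻ s in Set.Ioo 0 t0, ∫⁻ w, rho D α s x w * ∫⁻ u, J u w ∂m ∂m) z
    | succ n ih =>
      intro z
      have hk := measKernel_kIter (m := m) (D := D) (α := α) hJ b n
      have hkc := measKernel_kconv (m := m) (measKernel_rho (D := D) (α := α)) hJ hk
      unfold MeasKernel at hkc
      calc ∫⁻ s in Set.Ioo 0 t0, ∫⁻ w, (∫⁻ u, J u w ∂m) *
            (b * kconv m (rho D α) J (kIter m D α J b n) s w z) ∂m
          = b * ∫⁻ s in Set.Ioo 0 t0, ∫⁻ w, (∫⁻ u, J u w ∂m) *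
            kconv m (rho D α) J (kIter m D α J b n) s w z ∂m := by
            rw [← lintegral_const_mul _ (by fun_prop)]
            refine lintegral_congr fun s => ?_
            rw [← lintegral_const_mul _ (by fun_prop)]
            refine lintegral_congr fun w => ?_
            ring
        _ ≤ b * (η' * (1 / 4) ^ (n + 1)) := by
            gcongr
            exact (lintegral_in_kconv_le h hk t0 z).trans (by gcongr; exact ih z)
        _ = (b * η') * (1 / 4) ^ (n + 1) := by ring
        _ ≤ (1 / 4) * (1 / 4) ^ (n + 1) := by gcongr
        _ = (1 / 4) ^ (n + 1 + 1) := by ring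
  have hi : ∀ n t, 0 < t → t ≤ t0 → ∀ z, ∫⁻ x, kIter m D α J b n t x z ∂m ≤
      b * A * (1 / 4) ^ n := by
    intro n t ht htt z
    cases n with
    | zero =>
      simp only [kIter, pow_zero, mul_one]
      rw [lintegral_const_mul _ (by fun_prop)]
      gcongr
      simp_rw [rho_comm t _ z]
      exact h.mass t ht z
    | succ n =>
      have hk := measKernel_kIter (m := m) (D := D) (α := α) hJ b n
      have hkc := measKernel_kconv (m := m) (measKernel_rho (D := D) (α := α)) hJ hk
      unfold MeasKernel at hkc
      simp only [kIter]
      rw [lintegral_const_mul _ (by fun_prop), mul_assoc]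
      gcongr
      refine (lintegral_kconv_le h hk t z).trans ?_
      gcongr
      exact (lintegral_mono_set (Set.Ioo_subset_Ioo le_rfl htt)).trans (hg n z)
  have hc : ∀ n t, 0 < t → t ≤ t0 → ∀ x z,
      kIter m D α J b n t x z ≤ (B0 * (1 / 2) ^ n) * rho D α t x z := by
    intro n
    induction n with
    | zero =>
      intro t ht htt x z
      simp only [kIter, pow_zero, mul_one]
      gcongr
      exact le_self_add
    | succ n ih =>
      intro t ht htt x z
      have hk := measKernel_kIter (m := m) (D := D) (α := α) hJ b n
      simp only [kIter]
      calc b * kconv m (rho D α) J (kIter m D α J b n) t x z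
          ≤ b * (C0 * (B0 * (1 / 2) ^ n * (η + η') + ENNReal.ofReal Λ * A * (b * A * (1 / 4) ^ n)) *
            rho D α t x z) := by
            gcongr
            exact kconv_le h hk ih (hi n) ht htt x z
        _ = ((b * (C0 * (η + η'))) * (B0 * (1 / 2) ^ n) + K * (1 / 4) ^ n) * rho D α t x z := by
            rw [hK]; ring
        _ ≤ ((1 / 4) * (B0 * (1 / 2) ^ n) + (1 / 4) * B0 * (1 / 2) ^ n) * rho D α t x z := by
            have h5 : K ≤ 1 / 4 * B0 := by
              rw [hB0, mul_add, ← mul_assoc]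
              have : (1 / 4 : ℝ≥0∞) * 4 = 1 := by
                rw [one_div]; exact ENNReal.inv_mul_cancel (by norm_num) (by norm_num)
              rw [this, one_mul]
              exact le_add_self
            gcongr
            norm_num
        _ = (B0 * (1 / 2) ^ (n + 1)) * rho D α t x z := by
            have : (1 / 4 + 1 / 4 : ℝ≥0∞) = 1 / 2 := by
              rw [ENNReal.div_add_div_same]
              rw [ENNReal.div_eq_div_iff] <;> norm_num
            rw [mul_assoc (1 / 4) B0, ← add_mul, this]
            ring
  refine ⟨t0, ht0, B0.toReal + 1, by positivity, fun n t ht htt x z => (hc n t ht htt x z).trans ?_⟩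
  gcongr
  rw [ENNReal.ofReal_add ENNReal.toReal_nonneg zero_le_one, ENNReal.ofReal_toReal hB0top]
  exact le_self_add

end Bounds

/-! ### Signed convolutions cut off near both ends of the time interval. -/

section Real
variable {E : Type*} [MetricSpace E] [ProperSpace E] [MeasurableSpace E] [BorelSpace E]
  {m : Measure E} [SFinite m] {D α : ℝ}

/-- A real kernel on `(0, t0)` that is jointly continuous and dominated by a multiple of the
profile. -/
structure IsProfKernel (D α t0 c : ℝ) (k : ℝ → E → E → ℝ) : Prop where
  meas : Measurable fun q : ℝ × E × E => k q.1 q.2.1 q.2.2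
  bound : ∀ t, 0 < t → t < t0 → ∀ x z, |k t x z| ≤ c * prof D α t (dist x z)
  cont : ContinuousOn (fun q : ℝ × E × E => k q.1 q.2.1 q.2.2) (Set.Ioo 0 t0 ×ˢ Set.univ)

/-- The integrand of the space-time convolution of `p` and `k` through the jump kernel `j`. -/
def convFun (p : ℝ → E → E → ℝ) (j : E → E → ℝ) (k : ℝ → E → E → ℝ) (t : ℝ) (x z : E)
    (q : ℝ × E × E) : ℝ := p q.1 x q.2.1 * j q.2.1 q.2.2 * k (t - q.1) q.2.2 z

/-- The space-time convolution restricted to the times in `(δ, t - δ)`. -/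
def rconv (m : Measure E) (p : ℝ → E → E → ℝ) (j : E → E → ℝ) (k : ℝ → E → E → ℝ) (δ t : ℝ)
    (x z : E) : ℝ :=
  ∫ q : ℝ × E × E, (Set.Ioo δ (t - δ)).indicator (fun s => convFun p j k t x z (s, q.2)) q.1
    ∂(volume.prod (m.prod m))

variable {p k : ℝ → E → E → ℝ} {j : E → E → ℝ} {t0 b c Λ : ℝ} {A : ℝ≥0∞}

/-- The absolute value of a real jump kernel. -/
def absJump (j : E → E → ℝ) (u w : E) : ℝ≥0∞ := ENNReal.ofReal |j u w|

lemma measurable_convFun (hp : Measurable fun q : ℝ × E × E => p q.1 q.2.1 q.2.2)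
    (hj : Measurable (Function.uncurry j)) (hk : Measurable fun q : ℝ × E × E => k q.1 q.2.1 q.2.2) :
    Measurable fun q : (ℝ × E × E) × ℝ × E × E => convFun p j k q.1.1 q.1.2.1 q.1.2.2 q.2 := by
  unfold convFun
  fun_prop

lemma measurable_ind_convFun (hp : Measurable fun q : ℝ × E × E => p q.1 q.2.1 q.2.2)
    (hj : Measurable (Function.uncurry j)) (hk : Measurable fun q : ℝ × E × E => k q.1 q.2.1 q.2.2)
    (δ : ℝ) :
    Measurable fun q : (ℝ × E × E) × ℝ × E × E => (Set.Ioo δ (q.1.1 - δ)).indicator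
      (fun s => convFun p j k q.1.1 q.1.2.1 q.1.2.2 (s, q.2.2)) q.2.1 := by
  have hS : MeasurableSet {q : (ℝ × E × E) × ℝ × E × E | δ < q.2.1 ∧ q.2.1 < q.1.1 - δ} :=
    (measurableSet_lt measurable_const (measurable_fst.comp measurable_snd)).inter
      (measurableSet_lt (measurable_fst.comp measurable_snd)
        ((measurable_fst.comp measurable_fst).sub_const δ))
  exact (measurable_convFun hp hj hk).indicator hS

lemma measurable_rconv (hp : Measurable fun q : ℝ × E × E => p q.1 q.2.1 q.2.2)
    (hj : Measurable (Function.uncurry j)) (hk : Measurable fun q : ℝ × E × E => k q.1 q.2.1 q.2.2)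
    (δ : ℝ) : Measurable fun q : ℝ × E × E => rconv m p j k δ q.1 q.2.1 q.2.2 := by
  have := (measurable_ind_convFun hp hj hk δ).stronglyMeasurable.integral_prod_right'
    (ν := (volume : Measure ℝ).prod (m.prod m))
  exact this.measurable

lemma measurable_ind_convFun_right (hp : Measurable fun q : ℝ × E × E => p q.1 q.2.1 q.2.2)
    (hj : Measurable (Function.uncurry j)) (hk : Measurable fun q : ℝ × E × E => k q.1 q.2.1 q.2.2)
    (δ t : ℝ) (x z : E) :
    Measurable fun q : ℝ × E × E => (Set.Ioo δ (t - δ)).indicator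
      (fun s => convFun p j k t x z (s, q.2)) q.1 :=
  (measurable_ind_convFun hp hj hk δ).comp (f := fun q : ℝ × E × E => ((t, x, z), q)) (by fun_prop)

/-- The total variation of the convolution is controlled by the convolution of the majorants. -/
lemma lintegral_convFun_le (hj : Measurable (Function.uncurry j))
    (hpb : ∀ t, 0 < t → ∀ x z, |p t x z| ≤ b * prof D α t (dist x z)) (hb : 0 ≤ b)
    {K : ℝ → E → E → ℝ≥0∞} (hK : MeasKernel K) {t1 : ℝ}
    (hk : ∀ t, 0 < t → t < t1 → ∀ x z, ENNReal.ofReal |k t x z| ≤ K t x z)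
    {t : ℝ} (htt : t ≤ t1) (x z : E) :
    ∫⁻ q : ℝ × E × E, ‖(Set.Ioo 0 t).indicator (fun s => convFun p j k t x z (s, q.2)) q.1‖ₑ
      ∂(volume.prod (m.prod m)) ≤ ENNReal.ofReal b * kconv m (rho D α) (absJump j) K t x z := by
  have hJ : Measurable (Function.uncurry (absJump j)) := by
    change Measurable fun q : E × E => ENNReal.ofReal |Function.uncurry j q|
    fun_prop
  have hr : Measurable fun q : ℝ × E × E => rho D α q.1 q.2.1 q.2.2 := measKernel_rho
  rw [kconv_eq measKernel_rho hJ hK]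
  unfold MeasKernel at hK
  have hm : Measurable fun q : ℝ × E × E =>
      rho D α q.1 x q.2.1 * absJump j q.2.1 q.2.2 * K (t - q.1) q.2.2 z := by fun_prop
  have hm2 : Measurable fun q : ℝ × E × E => (Set.Ioo 0 t).indicator
      (fun s => rho D α s x q.2.1 * absJump j q.2.1 q.2.2 * K (t - s) q.2.2 z) q.1 := by
    have := hm.indicator (measurable_fst measurableSet_Ioo :
      MeasurableSet (Prod.fst ⁻¹' (Set.Ioo 0 t) : Set (ℝ × E × E)))
    exact this
  rw [← lintegral_const_mul _ hm2]
  refine lintegral_mono fun q => ?_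
  by_cases hs : q.1 ∈ Set.Ioo 0 t
  · simp only [Set.indicator_of_mem hs, convFun]
    rw [Real.enorm_eq_ofReal_abs, abs_mul, abs_mul, ENNReal.ofReal_mul (by positivity),
      ENNReal.ofReal_mul (abs_nonneg _), ← mul_assoc, ← mul_assoc]
    gcongr
    · refine (ENNReal.ofReal_le_ofReal (hpb _ hs.1 x q.2.1)).trans ?_
      rw [ENNReal.ofReal_mul hb]; rfl
    · rfl
    · exact hk _ (sub_pos.2 hs.2) (by linarith [hs.1]) _ _
  · simp [Set.indicator_of_notMem hs]

/-- Moving the centre by at most δ^{1/α} changes the profile by a constant factor. It provides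
dominating functions that are uniform for times above δ and starting points near a given one. -/
lemma prof_near (hD : 0 < D) (hα : 0 < α) {δ s T : ℝ} (hδ : 0 < δ) (hs : δ ≤ s) (hT : s ≤ T)
    {x y : E} (hxy : dist x y ≤ δ ^ (1 / α)) (u : E) :
    prof D α s (dist x u) ≤ T / δ * 2 ^ D * prof D α δ (dist y u) := by
  have h1 := prof_mul_le hD hα hδ hs (dist x u)
  have h2 : prof D α δ (dist x u) ≤ 2 ^ D * prof D α δ (dist y u) := by
    refine prof_shift hD hδ ?_
    have := dist_triangle_left y u x
    linarith
  have h3 := prof_nonneg (D := D) (α := α) hδ (dist x u)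
  have h4 : 0 ≤ T / δ := div_nonneg (hδ.le.trans (hs.trans hT)) hδ.le
  calc prof D α s (dist x u) ≤ s / δ * prof D α δ (dist x u) := h1
    _ ≤ T / δ * (2 ^ D * prof D α δ (dist y u)) := by gcongr
    _ = _ := by ring

lemma prof_le_const (hD : 0 < D) (hα : 0 < α) {δ s T r : ℝ} (hδ : 0 < δ) (hs : δ ≤ s) (hT : s ≤ T)
    (hr : 0 ≤ r) : prof D α s r ≤ T / δ * prof D α δ 0 := by
  have h3 := prof_nonneg (D := D) (α := α) hδ 0
  calc prof D α s r ≤ prof D α s 0 := prof_anti hD (hδ.trans_le hs) hr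
    _ ≤ s / δ * prof D α δ 0 := prof_mul_le hD hα hδ hs 0
    _ ≤ T / δ * prof D α δ 0 := by gcongr

/-- Finiteness at a fixed time of the potential of a Kato function. -/
lemma lintegral_rho_ne_top (hD : 0 < D) (hα : 0 < α) {V : E → ℝ≥0∞} (hV : Measurable V) {δ : ℝ}
    (hδ : 0 < δ) (h : katoMod m D α V (2 * δ) ≠ ⊤) (x : E) : ∫⁻ u, rho D α δ x u * V u ∂m ≠ ⊤ := by
  have hr : Measurable fun q : ℝ × E × E => rho D α q.1 q.2.1 q.2.2 := measKernel_rho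
  set c : ℝ≥0∞ := ENNReal.ofReal ((2 ^ (1 / α)) ^ D) with hc
  -- Between δ and 2δ the profile dominates, up to a constant, the profile at time δ; so the
  -- potential over this interval controls δ times the value at δ.
  have h1 : ENNReal.ofReal δ * ∫⁻ u, rho D α δ x u * V u ∂m ≤ c * katoMod m D α V (2 * δ) := by
    calc ENNReal.ofReal δ * ∫⁻ u, rho D α δ x u * V u ∂m
        = ∫⁻ s in Set.Ioo δ (2 * δ), ∫⁻ u, rho D α δ x u * V u ∂m := by
          rw [setLIntegral_const, Real.volume_Ioo, mul_comm]
          congr 2; ring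
      _ ≤ ∫⁻ s in Set.Ioo δ (2 * δ), c * ∫⁻ u, rho D α s x u * V u ∂m := by
          refine setLIntegral_mono' measurableSet_Ioo fun s hs => ?_
          rw [← lintegral_const_mul _ (by fun_prop)]
          refine lintegral_mono fun u => ?_
          rw [← mul_assoc]
          gcongr
          rw [hc, rho, rho, ← ENNReal.ofReal_mul (by positivity)]
          exact ENNReal.ofReal_le_ofReal (prof_half hD hα hδ hs.1.le hs.2.le)
      _ = c * ∫⁻ s in Set.Ioo δ (2 * δ), ∫⁻ u, rho D α s x u * V u ∂m :=
          lintegral_const_mul _ (by fun_prop)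
      _ ≤ c * katoMod m D α V (2 * δ) := by
          gcongr
          exact (lintegral_mono_set (Set.Ioo_subset_Ioo hδ.le le_rfl)).trans
            (le_iSup (fun x => ∫⁻ s in Set.Ioo 0 (2 * δ), ∫⁻ u, rho D α s x u * V u ∂m) x)
  intro htop
  rw [htop, ENNReal.mul_top (by simpa using hδ)] at h1
  exact absurd (top_le_iff.1 h1) (ENNReal.mul_ne_top ENNReal.ofReal_ne_top h)

lemma IsProfKernel.continuousAt (hk : IsProfKernel D α t0 c k) {t : ℝ} (ht : 0 < t) (htt : t < t0)
    (x z : E) : ContinuousAt (fun q : ℝ × E × E => k q.1 q.2.1 q.2.2) (t, x, z) :=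
  hk.cont.continuousAt ((isOpen_Ioo.prod isOpen_univ).mem_nhds ⟨⟨ht, htt⟩, Set.mem_univ _⟩)

lemma measurable_absJump (hj : Measurable (Function.uncurry j)) :
    Measurable (Function.uncurry (absJump j)) := by
  change Measurable fun q : E × E => ENNReal.ofReal |Function.uncurry j q|
  fun_prop

/-- The moving end point of the cut disturbs continuity only for the single time `t - δ`, which is
negligible in the integral. -/
lemma continuousAt_ind_convFun
    (hpc : ContinuousOn (fun q : ℝ × E × E => p q.1 q.2.1 q.2.2) (Set.Ioi 0 ×ˢ Set.univ))
    (hk : IsProfKernel D α t0 c k) {δ t : ℝ} (hδ : 0 < δ) (htt : t < t0) (x z : E)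
    {q : ℝ × E × E} (hq : q.1 ≠ t - δ) :
    ContinuousAt (fun v : ℝ × E × E => (Set.Ioo δ (v.1 - δ)).indicator
      (fun s => convFun p j k v.1 v.2.1 v.2.2 (s, q.2)) q.1) (t, x, z) := by
  have hfst : ContinuousAt (fun v : ℝ × E × E => v.1 - δ) (t, x, z) := by fun_prop
  rcases le_or_gt q.1 δ with h1 | h1
  · refine (continuousAt_const (y := (0 : ℝ))).congr (Eventually.of_forall fun v => ?_)
    beta_reduce
    rw [Set.indicator_of_notMem fun h => absurd h.1 (not_lt.2 h1)]
  rcases lt_or_gt_of_ne hq with h2 | h2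
  · have hp1 : ContinuousAt (fun v : ℝ × E × E => p q.1 v.2.1 q.2.1) (t, x, z) := by
      have h3 := hpc.continuousAt ((isOpen_Ioi.prod isOpen_univ).mem_nhds
        (show (q.1, x, q.2.1) ∈ Set.Ioi (0 : ℝ) ×ˢ (Set.univ : Set (E × E)) from
          ⟨hδ.trans h1, Set.mem_univ _⟩))
      exact ContinuousAt.comp (x := (t, x, z)) (f := fun v : ℝ × E × E => (q.1, v.2.1, q.2.1)) h3 (by fun_prop)
    have hk1 : ContinuousAt (fun v : ℝ × E × E => k (v.1 - q.1) q.2.2 v.2.2) (t, x, z) := by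
      have h3 := hk.continuousAt (t := t - q.1) (by linarith) (by linarith) q.2.2 z
      exact ContinuousAt.comp (x := (t, x, z)) (f := fun v : ℝ × E × E => (v.1 - q.1, q.2.2, v.2.2)) h3 (by fun_prop)
    refine ((hp1.mul continuousAt_const).mul hk1 (f := fun v : ℝ × E × E =>
      p q.1 v.2.1 q.2.1 * j q.2.1 q.2.2)).congr ?_
    filter_upwards [hfst.eventually_const_lt h2] with v hv
    rw [Set.indicator_of_mem (show q.1 ∈ Set.Ioo δ (v.1 - δ) from ⟨h1, hv⟩)]
    rfl
  · refine (continuousAt_const (y := (0 : ℝ))).congr ?_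
    filter_upwards [hfst.eventually_lt_const h2] with v hv
    rw [Set.indicator_of_notMem fun h => absurd h.2 (not_lt.2 hv.le)]

lemma integrable_dominating_cut (hJ : IsKatoJump m D α (absJump j) A Λ)
    (hj : Measurable (Function.uncurry j)) {δ : ℝ} (hδ : 0 < δ)
    (hfin : katoMod m D α (fun u => ∫⁻ w, absJump j u w ∂m) (2 * δ) ≠ ⊤) (t0 C : ℝ) (x : E) :
    Integrable (fun q : ℝ × E × E => (Set.Ioo 0 t0).indicator
      (fun _ => C * (prof D α δ (dist x q.2.1) * |j q.2.1 q.2.2|)) q.1)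
      (volume.prod (m.prod m)) := by
  have hJm := measurable_absJump hj
  have hpm : Measurable fun u : E => prof D α δ (dist x u) :=
    measurable_prof.comp (f := fun u : E => (δ, dist x u)) (by fun_prop)
  have hf : Measurable fun q : E × E => prof D α δ (dist x q.1) * |j q.1 q.2| := by fun_prop
  have h1 : Integrable (fun q : E × E => prof D α δ (dist x q.1) * |j q.1 q.2|) (m.prod m) := by
    refine ⟨hf.aestronglyMeasurable, ?_⟩
    rw [hasFiniteIntegral_iff_ofReal (Eventually.of_forall fun q =>
      mul_nonneg (prof_nonneg hδ _) (abs_nonneg _)), lintegral_prod _ (by fun_prop)]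
    refine lt_of_le_of_lt (le_of_eq ?_) (lintegral_rho_ne_top (m := m) hJ.hD hJ.hα
      (V := fun u => ∫⁻ w, absJump j u w ∂m) (by fun_prop) hδ hfin x).lt_top
    refine lintegral_congr fun u => ?_
    rw [← lintegral_const_mul _ (by fun_prop)]
    refine lintegral_congr fun w => ?_
    rw [ENNReal.ofReal_mul (prof_nonneg hδ _)]
    rfl
  have h2 : Integrable ((Set.Ioo 0 t0).indicator fun _ : ℝ => C) volume :=
    (integrable_indicator_iff measurableSet_Ioo).2 (integrableOn_const (by simp))
  refine (h2.mul_prod h1).congr (Eventually.of_forall fun q => ?_)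
  by_cases hq : q.1 ∈ Set.Ioo 0 t0
  · simp only [Set.indicator_of_mem hq]
  · simp only [Set.indicator_of_notMem hq, zero_mul]

/-- After the cut both kernels run for a time at least δ: the second is bounded, the first is
dominated by the profile at time δ, and the Kato condition makes the product with |j| integrable. -/
lemma continuousAt_rconv_cut (hJ : IsKatoJump m D α (absJump j) A Λ)
    (hj : Measurable (Function.uncurry j)) (hpm : Measurable fun q : ℝ × E × E => p q.1 q.2.1 q.2.2)
    (hpc : ContinuousOn (fun q : ℝ × E × E => p q.1 q.2.1 q.2.2) (Set.Ioi 0 ×ˢ Set.univ))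
    (hpb : ∀ t, 0 < t → ∀ x z, |p t x z| ≤ b * prof D α t (dist x z)) (hb : 0 ≤ b) (hc : 0 ≤ c)
    (hk : IsProfKernel D α t0 c k) {δ t : ℝ} (hδ : 0 < δ)
    (hfin : katoMod m D α (fun u => ∫⁻ w, absJump j u w ∂m) (2 * δ) ≠ ⊤) (htt : t < t0) (x z : E) :
    ContinuousAt (fun v : ℝ × E × E => rconv m p j k δ v.1 v.2.1 v.2.2) (t, x, z) := by
  unfold rconv
  refine continuousAt_of_dominated (bound := fun q : ℝ × E × E => (Set.Ioo 0 t0).indicator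
      (fun _ => (b * (t0 / δ * 2 ^ D)) * (c * (t0 / δ * prof D α δ 0)) *
        (prof D α δ (dist x q.2.1) * |j q.2.1 q.2.2|)) q.1) ?_ ?_
      (integrable_dominating_cut hJ hj hδ hfin _ _ x) ?_
  · exact Eventually.of_forall fun v =>
      (measurable_ind_convFun_right hpm hj hk.meas δ v.1 v.2.1 v.2.2).aestronglyMeasurable
  · have h1 : ∀ᶠ v : ℝ × E × E in 𝓝 (t, x, z), v.1 < t0 :=
      continuousAt_fst.eventually_lt_const htt
    have h2 : ∀ᶠ v : ℝ × E × E in 𝓝 (t, x, z), dist v.2.1 x < δ ^ (1 / α) := by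
      have : ContinuousAt (fun v : ℝ × E × E => dist v.2.1 x) (t, x, z) := by fun_prop
      refine this.eventually_lt_const ?_
      simpa using Real.rpow_pos_of_pos hδ _
    filter_upwards [h1, h2] with v hv1 hv2
    refine Eventually.of_forall fun q => ?_
    by_cases hq : q.1 ∈ Set.Ioo δ (v.1 - δ)
    · have hq0 : 0 < q.1 := hδ.trans hq.1
      have hqt : q.1 < t0 := by linarith [hq.2]
      have hr0 : δ < v.1 - q.1 := by linarith [hq.2]
      have hrt : v.1 - q.1 < t0 := by linarith
      rw [Set.indicator_of_mem hq, Set.indicator_of_mem (show q.1 ∈ Set.Ioo 0 t0 from ⟨hq0, hqt⟩),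
        convFun, Real.norm_eq_abs, abs_mul, abs_mul]
      have e1 : |p q.1 v.2.1 q.2.1| ≤ b * (t0 / δ * 2 ^ D) * prof D α δ (dist x q.2.1) := by
        rw [mul_assoc]
        exact (hpb _ hq0 _ _).trans (mul_le_mul_of_nonneg_left
          (prof_near hJ.hD hJ.hα hδ hq.1.le hqt.le hv2.le _) hb)
      have e2 : |k (v.1 - q.1) q.2.2 v.2.2| ≤ c * (t0 / δ * prof D α δ 0) :=
        (hk.bound _ (hδ.trans hr0) hrt _ _).trans (mul_le_mul_of_nonneg_left
          (prof_le_const hJ.hD hJ.hα hδ hr0.le hrt.le dist_nonneg) hc)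
      calc |p q.1 v.2.1 q.2.1| * |j q.2.1 q.2.2| * |k (v.1 - q.1) q.2.2 v.2.2|
          ≤ (b * (t0 / δ * 2 ^ D) * prof D α δ (dist x q.2.1)) * |j q.2.1 q.2.2| *
            (c * (t0 / δ * prof D α δ 0)) := by
            have := (abs_nonneg _).trans e1
            gcongr
        _ = _ := by ring
    · rw [Set.indicator_of_notMem hq, norm_zero]
      refine Set.indicator_nonneg (fun s hs => ?_) _
      have := prof_nonneg (D := D) (α := α) hδ 0
      have := prof_nonneg (D := D) (α := α) hδ (dist x q.2.1)
      have : 0 < t0 := hs.1.trans hs.2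
      positivity
  · have h1 : ∀ᵐ s : ℝ, s ≠ t - δ := by
      rw [ae_iff]
      simp
    filter_upwards [Measure.quasiMeasurePreserving_fst.ae h1] with q hq
    exact continuousAt_ind_convFun hpc hk hδ htt x z hq

end Real

/-! ### Joint continuity of the full convolution. -/

section Convolution
variable {E : Type*} [MetricSpace E] [ProperSpace E] [MeasurableSpace E] [BorelSpace E]
  {m : Measure E} [SFinite m] {D α : ℝ}
  {p k : ℝ → E → E → ℝ} {j : E → E → ℝ} {t0 b c Λ : ℝ} {A : ℝ≥0∞}

lemma lintegral_indicator_time {φ : ℝ → E → E → ℝ≥0∞} (hφ : MeasKernel φ) {S : Set ℝ}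
    (hS : MeasurableSet S) : ∫⁻ q : ℝ × E × E, S.indicator (fun s => φ s q.2.1 q.2.2) q.1
      ∂(volume.prod (m.prod m)) = ∫⁻ s in S, ∫⁻ u, ∫⁻ w, φ s u w ∂m ∂m := by
  unfold MeasKernel at hφ
  have hm2 : Measurable fun q : ℝ × E × E => S.indicator (fun s => φ s q.2.1 q.2.2) q.1 := by
    have := hφ.indicator (measurable_fst hS : MeasurableSet (Prod.fst ⁻¹' S : Set (ℝ × E × E)))
    exact this
  rw [lintegral_prod _ hm2.aemeasurable, ← lintegral_indicator hS]
  refine lintegral_congr fun s => ?_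
  by_cases hs : s ∈ S
  · simp only [Set.indicator_of_mem hs]
    have hms : Measurable fun q : E × E => φ s q.1 q.2 := by fun_prop
    exact lintegral_prod _ hms.aemeasurable
  · simp only [Set.indicator_of_notMem hs]
    simp

lemma setLIntegral_Ioo_reflect' (f : ℝ → ℝ≥0∞) (a t : ℝ) :
    ∫⁻ s in Set.Ioo (t - a) t, f (t - s) = ∫⁻ s in Set.Ioo 0 a, f s := by
  rw [← lintegral_indicator measurableSet_Ioo, ← lintegral_indicator measurableSet_Ioo,
    ← lintegral_sub_left_eq_self _ t]
  refine lintegral_congr fun s => ?_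
  by_cases hs : s ∈ Set.Ioo 0 a
  · rw [Set.indicator_of_mem (show t - s ∈ Set.Ioo (t - a) t from
      ⟨by linarith [hs.2], by linarith [hs.1]⟩), Set.indicator_of_mem hs, sub_sub_cancel]
  · rw [Set.indicator_of_notMem (show t - s ∉ Set.Ioo (t - a) t from fun h =>
      hs ⟨by linarith [h.2], by linarith [h.1]⟩), Set.indicator_of_notMem hs]

lemma integrable_convFun (hj : Measurable (Function.uncurry j))
    (hpm : Measurable fun q : ℝ × E × E => p q.1 q.2.1 q.2.2)
    (hpb : ∀ t, 0 < t → ∀ x z, |p t x z| ≤ b * prof D α t (dist x z)) (hb : 0 ≤ b)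
    (hkm : Measurable fun q : ℝ × E × E => k q.1 q.2.1 q.2.2)
    {K : ℝ → E → E → ℝ≥0∞} (hK : MeasKernel K) {t1 : ℝ}
    (hk : ∀ t, 0 < t → t < t1 → ∀ x z, ENNReal.ofReal |k t x z| ≤ K t x z)
    {t : ℝ} (htt : t ≤ t1) (x z : E) (hfin : kconv m (rho D α) (absJump j) K t x z ≠ ⊤) :
    Integrable (fun q : ℝ × E × E => (Set.Ioo 0 t).indicator
      (fun s => convFun p j k t x z (s, q.2)) q.1) (volume.prod (m.prod m)) := by
  have h1 := measurable_ind_convFun_right hpm hj hkm 0 t x z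
  rw [sub_zero] at h1
  refine ⟨h1.aestronglyMeasurable, ?_⟩
  exact (lintegral_convFun_le hj hpb hb hK hk htt x z).trans_lt
    (ENNReal.mul_ne_top ENNReal.ofReal_ne_top hfin).lt_top

lemma rconv_zero (t : ℝ) (x z : E) : rconv m p j k 0 t x z =
    ∫ q : ℝ × E × E, (Set.Ioo 0 t).indicator (fun s => convFun p j k t x z (s, q.2)) q.1
      ∂(volume.prod (m.prod m)) := by
  rw [rconv, sub_zero]

/-- On the removed times one kernel runs for at least τ and is bounded, while the other forms a
potential over a short interval. Taking 2δ lets open intervals cover the removed times, including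
the end points of the cut. -/
lemma enorm_rconv_sub_le (hJ : IsKatoJump m D α (absJump j) A Λ)
    (hj : Measurable (Function.uncurry j)) (hpm : Measurable fun q : ℝ × E × E => p q.1 q.2.1 q.2.2)
    (hpb : ∀ t, 0 < t → ∀ x z, |p t x z| ≤ b * prof D α t (dist x z)) (hb : 0 ≤ b) (hc : 0 ≤ c)
    (hk : IsProfKernel D α t0 c k) {δ τ t : ℝ} (hδ : 0 < δ) (hτ : 0 < τ) (hτt : τ ≤ t - δ)
    (htt : t ≤ t0) (x z : E)
    (hi : Integrable (fun q : ℝ × E × E => (Set.Ioo 0 t).indicator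
      (fun s => convFun p j k t x z (s, q.2)) q.1) (volume.prod (m.prod m))) :
    ‖rconv m p j k 0 t x z - rconv m p j k δ t x z‖ₑ ≤
      ENNReal.ofReal (b * c * (t0 / τ * prof D α τ 0)) *
        (katoMod m D α (fun u => ∫⁻ w, absJump j u w ∂m) (2 * δ) +
          katoMod m D α (fun w => ∫⁻ u, absJump j u w ∂m) (2 * δ)) := by
  have hJm := measurable_absJump hj
  have hr : Measurable fun q : ℝ × E × E => rho D α q.1 q.2.1 q.2.2 := measKernel_rho
  set β : ℝ := t0 / τ * prof D α τ 0 with hβ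
  have hτ0 : τ ≤ t0 := by linarith
  have ht0 : 0 < t0 := hτ.trans_le hτ0
  have hβ0 : 0 ≤ β := mul_nonneg (by positivity) (prof_nonneg hτ 0)
  have hδi : Integrable (fun q : ℝ × E × E => (Set.Ioo δ (t - δ)).indicator
      (fun s => convFun p j k t x z (s, q.2)) q.1) (volume.prod (m.prod m)) := by
    refine hi.mono (measurable_ind_convFun_right hpm hj hk.meas δ t x z).aestronglyMeasurable
      (Eventually.of_forall fun q => ?_)
    by_cases hq : q.1 ∈ Set.Ioo δ (t - δ)
    · rw [Set.indicator_of_mem hq, Set.indicator_of_mem (show q.1 ∈ Set.Ioo 0 t from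
        ⟨hδ.trans hq.1, by linarith [hq.2]⟩)]
    · rw [Set.indicator_of_notMem hq, norm_zero]
      exact norm_nonneg _
  rw [rconv_zero, rconv, ← integral_sub hi hδi]
  refine (enorm_integral_le_lintegral_enorm _).trans ?_
  have hφ1 : MeasKernel fun s u w => rho D α s x u * absJump j u w := by
    unfold MeasKernel; fun_prop
  have hφ2 : MeasKernel fun s u w => absJump j u w * rho D α (t - s) w z := by
    unfold MeasKernel; fun_prop
  have hm1 : Measurable fun q : ℝ × E × E => (Set.Ioo 0 (2 * δ)).indicator
      (fun s => rho D α s x q.2.1 * absJump j q.2.1 q.2.2) q.1 :=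
    Measurable.indicator hφ1 (measurable_fst measurableSet_Ioo :
      MeasurableSet (Prod.fst ⁻¹' (Set.Ioo 0 (2 * δ)) : Set (ℝ × E × E)))
  have hm2 : Measurable fun q : ℝ × E × E => (Set.Ioo (t - 2 * δ) t).indicator
      (fun s => absJump j q.2.1 q.2.2 * rho D α (t - s) q.2.2 z) q.1 :=
    Measurable.indicator hφ2 (measurable_fst measurableSet_Ioo :
      MeasurableSet (Prod.fst ⁻¹' (Set.Ioo (t - 2 * δ) t) : Set (ℝ × E × E)))
  calc ∫⁻ q : ℝ × E × E, ‖(Set.Ioo 0 t).indicator (fun s => convFun p j k t x z (s, q.2)) q.1 -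
        (Set.Ioo δ (t - δ)).indicator (fun s => convFun p j k t x z (s, q.2)) q.1‖ₑ
        ∂(volume.prod (m.prod m))
      ≤ ∫⁻ q : ℝ × E × E, ENNReal.ofReal (b * c * β) * ((Set.Ioo 0 (2 * δ)).indicator
          (fun s => rho D α s x q.2.1 * absJump j q.2.1 q.2.2) q.1 +
        (Set.Ioo (t - 2 * δ) t).indicator
          (fun s => absJump j q.2.1 q.2.2 * rho D α (t - s) q.2.2 z) q.1)
          ∂(volume.prod (m.prod m)) := by
        refine lintegral_mono fun q => ?_
        by_cases h1 : q.1 ∈ Set.Ioo 0 t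
        · by_cases h2 : q.1 ∈ Set.Ioo δ (t - δ)
          · rw [Set.indicator_of_mem h1, Set.indicator_of_mem h2, sub_self, enorm_zero]
            exact zero_le
          rw [Set.indicator_of_mem h1, Set.indicator_of_notMem h2, sub_zero, convFun,
            Real.enorm_eq_ofReal_abs, abs_mul, abs_mul]
          have e1 := hpb q.1 h1.1 x q.2.1
          have e2 := hk.bound (t - q.1) (sub_pos.2 h1.2) (by linarith [h1.1]) q.2.2 z
          rcases le_or_gt q.1 δ with h3 | h3
          · refine le_trans ?_ (mul_le_mul_right le_self_add _)
            rw [Set.indicator_of_mem (show q.1 ∈ Set.Ioo 0 (2 * δ) from ⟨h1.1, by linarith⟩), rho,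
              absJump, ← ENNReal.ofReal_mul (prof_nonneg h1.1 _), ← ENNReal.ofReal_mul (by positivity)]
            refine ENNReal.ofReal_le_ofReal ?_
            have e3 : prof D α (t - q.1) (dist q.2.2 z) ≤ β :=
              prof_le_const hJ.hD hJ.hα hτ (by linarith) (by linarith [h1.1]) dist_nonneg
            have e4 := prof_nonneg (D := D) (α := α) h1.1 (dist x q.2.1)
            calc |p q.1 x q.2.1| * |j q.2.1 q.2.2| * |k (t - q.1) q.2.2 z|
                ≤ (b * prof D α q.1 (dist x q.2.1)) * |j q.2.1 q.2.2| * (c * β) := by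
                  have := e2.trans (mul_le_mul_of_nonneg_left e3 hc)
                  gcongr
              _ = _ := by ring
          · have h4 : t - δ ≤ q.1 := not_lt.1 fun h => h2 ⟨h3, h⟩
            refine le_trans ?_ (mul_le_mul_right le_add_self _)
            have htq := sub_pos.2 h1.2
            rw [Set.indicator_of_mem (show q.1 ∈ Set.Ioo (t - 2 * δ) t from
              ⟨by linarith, h1.2⟩), rho, absJump, ← ENNReal.ofReal_mul (abs_nonneg _),
              ← ENNReal.ofReal_mul (by positivity)]
            refine ENNReal.ofReal_le_ofReal ?_
            have e3 : prof D α q.1 (dist x q.2.1) ≤ β :=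
              prof_le_const hJ.hD hJ.hα hτ (by linarith) (by linarith [h1.2]) dist_nonneg
            have e4 := prof_nonneg (D := D) (α := α) htq (dist q.2.2 z)
            calc |p q.1 x q.2.1| * |j q.2.1 q.2.2| * |k (t - q.1) q.2.2 z|
                ≤ (b * β) * |j q.2.1 q.2.2| * (c * prof D α (t - q.1) (dist q.2.2 z)) := by
                  have := e1.trans (mul_le_mul_of_nonneg_left e3 hb)
                  gcongr
              _ = _ := by ring
        · rw [Set.indicator_of_notMem h1, Set.indicator_of_notMem fun h => h1
            ⟨hδ.trans h.1, by linarith [h.2]⟩, sub_zero, enorm_zero]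
          exact zero_le
    _ = ENNReal.ofReal (b * c * β) * ((∫⁻ s in Set.Ioo 0 (2 * δ), ∫⁻ u, ∫⁻ w,
          rho D α s x u * absJump j u w ∂m ∂m) + ∫⁻ s in Set.Ioo (t - 2 * δ) t, ∫⁻ u, ∫⁻ w,
          absJump j u w * rho D α (t - s) w z ∂m ∂m) := by
        have hm12 : Measurable fun q : ℝ × E × E => (Set.Ioo 0 (2 * δ)).indicator
            (fun s => rho D α s x q.2.1 * absJump j q.2.1 q.2.2) q.1 + (Set.Ioo (t - 2 * δ) t).indicator
            (fun s => absJump j q.2.1 q.2.2 * rho D α (t - s) q.2.2 z) q.1 := hm1.add hm2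
        rw [lintegral_const_mul _ hm12, lintegral_add_left hm1,
          lintegral_indicator_time hφ1 measurableSet_Ioo,
          lintegral_indicator_time hφ2 measurableSet_Ioo]
    _ ≤ _ := by
        gcongr
        · exact lintegral_rho_out hJ _ x
        · refine le_trans (le_of_eq ?_) (lintegral_rho_in hJ (2 * δ) z)
          rw [setLIntegral_Ioo_reflect' (fun s => ∫⁻ u, ∫⁻ w, absJump j u w * rho D α s w z ∂m ∂m),
            setLIntegral_Ioo_reflect (fun s => ∫⁻ u, ∫⁻ w, absJump j u w * rho D α s w z ∂m ∂m)]

lemma ofReal_abs_le_rho {t : ℝ} (hc : 0 ≤ c) {x z : E} {r : ℝ}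
    (h : |r| ≤ c * prof D α t (dist x z)) :
    ENNReal.ofReal |r| ≤ ENNReal.ofReal c * rho D α t x z := by
  rw [rho, ← ENNReal.ofReal_mul hc]
  exact ENNReal.ofReal_le_ofReal h

lemma kconv_rho_ne_top (hJ : IsKatoJump m D α (absJump j) A Λ)
    (hη : katoMod m D α (fun u => ∫⁻ w, absJump j u w ∂m) t0 ≠ ⊤)
    (hη' : katoMod m D α (fun w => ∫⁻ u, absJump j u w ∂m) t0 ≠ ⊤) {C : ℝ≥0∞} (hC : C ≠ ⊤) {t : ℝ}
    (ht : 0 < t) (htt : t ≤ t0) (x z : E) :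
    kconv m (rho D α) (absJump j) (fun t x z => C * rho D α t x z) t x z ≠ ⊤ := by
  have hr : Measurable fun q : ℝ × E × E => rho D α q.1 q.2.1 q.2.2 := measKernel_rho
  have hA := hJ.hA
  have hK : MeasKernel fun t (x z : E) => C * rho D α t x z := Measurable.const_mul measKernel_rho C
  refine ne_top_of_le_ne_top ?_ (kconv_le hJ hK (c := C) (i := C * A) (t0 := t0)
    (fun _ _ _ _ _ => le_rfl) (fun t ht _ z => ?_) ht htt x z)
  · have : rho D α t x z ≠ ⊤ := ENNReal.ofReal_ne_top
    finiteness
  · rw [lintegral_const_mul _ (by fun_prop)]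
    gcongr
    simp_rw [rho_comm t _ z]
    exact hJ.mass t ht z

/-- The convolution is a locally uniform limit of its cuts, the error depending on the Kato moduli
at 2δ only. Near time `t` all times exceed t/2, so δ < t/4 leaves room for τ = t/4. -/
lemma continuousOn_rconv (hJ : IsKatoJump m D α (absJump j) A Λ)
    (hη : katoMod m D α (fun u => ∫⁻ w, absJump j u w ∂m) t0 ≠ ⊤)
    (hη' : katoMod m D α (fun w => ∫⁻ u, absJump j u w ∂m) t0 ≠ ⊤)
    (hj : Measurable (Function.uncurry j)) (hpm : Measurable fun q : ℝ × E × E => p q.1 q.2.1 q.2.2)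
    (hpc : ContinuousOn (fun q : ℝ × E × E => p q.1 q.2.1 q.2.2) (Set.Ioi 0 ×ˢ Set.univ))
    (hpb : ∀ t, 0 < t → ∀ x z, |p t x z| ≤ b * prof D α t (dist x z)) (hb : 0 ≤ b) (hc : 0 ≤ c)
    (hk : IsProfKernel D α t0 c k) :
    ContinuousOn (fun v : ℝ × E × E => rconv m p j k 0 v.1 v.2.1 v.2.2)
      (Set.Ioo 0 t0 ×ˢ Set.univ) := by
  rintro ⟨t, x, z⟩ ⟨⟨ht, htt⟩, -⟩
  refine ContinuousAt.continuousWithinAt ?_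
  refine continuousAt_of_locally_uniform_approx_of_continuousAt fun W hW => ?_
  obtain ⟨ε, hε, hεW⟩ := mem_uniformity_edist.1 hW
  set M : ℝ≥0∞ := ENNReal.ofReal (b * c * (t0 / (t / 4) * prof D α (t / 4) 0)) with hM
  have hlim : Tendsto (fun δ : ℝ => M * (katoMod m D α (fun u => ∫⁻ w, absJump j u w ∂m) (2 * δ) +
      katoMod m D α (fun w => ∫⁻ u, absJump j u w ∂m) (2 * δ))) (𝓝[>] 0) (𝓝 0) := by
    have h2 : Tendsto (fun δ : ℝ => 2 * δ) (𝓝[>] 0) (𝓝[>] 0) := by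
      refine tendsto_nhdsWithin_iff.2 ⟨?_, ?_⟩
      · have : Tendsto (fun δ : ℝ => 2 * δ) (𝓝 0) (𝓝 (2 * 0)) := by
          exact (continuous_const.mul continuous_id).tendsto 0
        rw [mul_zero] at this
        exact this.mono_left nhdsWithin_le_nhds
      · filter_upwards [self_mem_nhdsWithin] with δ hδ
        exact mul_pos two_pos (Set.mem_Ioi.1 hδ)
    have := ENNReal.Tendsto.const_mul ((hJ.kato_out.comp h2).add (hJ.kato_in.comp h2))
      (Or.inr (ENNReal.ofReal_ne_top (r := b * c * (t0 / (t / 4) * prof D α (t / 4) 0))))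
    simpa using this
  have hsmall : ∀ᶠ δ : ℝ in 𝓝[>] 0, δ < t / 4 :=
    (eventually_lt_nhds (by positivity)).filter_mono nhdsWithin_le_nhds
  obtain ⟨δ, ⟨h1, h2⟩, hδ⟩ :=
    ((hlim.eventually_lt_const hε).and hsmall).and self_mem_nhdsWithin |>.exists
  have hδ0 : 0 < δ := hδ
  have hnb : ∀ᶠ v : ℝ × E × E in 𝓝 (t, x, z), v.1 ∈ Set.Ioo (t / 2) t0 :=
    continuousAt_fst (p := ((t, x, z) : ℝ × E × E)) (Ioo_mem_nhds (by simpa using by linarith) htt)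
  refine ⟨_, hnb, fun v => rconv m p j k δ v.1 v.2.1 v.2.2, ?_, fun v hv => hεW ?_⟩
  · refine continuousAt_rconv_cut hJ hj hpm hpc hpb hb hc hk hδ0 ?_ htt x z
    exact ne_top_of_le_ne_top hη (katoMod_mono _ (by linarith))
  · have hv1 : t / 2 < v.1 := hv.1
    have hv2 : v.1 < t0 := hv.2
    have hv0 : 0 < v.1 := by linarith
    rw [edist_eq_enorm_sub]
    refine lt_of_le_of_lt (enorm_rconv_sub_le hJ hj hpm hpb hb hc hk hδ0 (τ := t / 4)
      (by positivity) (by linarith) hv2.le v.2.1 v.2.2 ?_) h1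
    refine integrable_convFun hj hpm hpb hb hk.meas (K := fun t x z => ENNReal.ofReal c * rho D α t x z)
      (Measurable.const_mul measKernel_rho _) (t1 := t0) (fun t ht htt x z => ?_) hv2.le _ _ ?_
    · exact ofReal_abs_le_rho hc (hk.bound t ht htt x z)
    · exact kconv_rho_ne_top hJ hη hη' ENNReal.ofReal_ne_top hv0 hv2.le _ _

end Convolution

/-! ### The Neumann series. -/

section Neumann
variable {E : Type*} [MetricSpace E] [ProperSpace E] [MeasurableSpace E] [BorelSpace E]
  {m : Measure E} [SFinite m] {D α : ℝ}
  {p k : ℝ → E → E → ℝ} {j : E → E → ℝ} {t0 b c Λ : ℝ} {A : ℝ≥0∞}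

/-- A jointly continuous kernel on `(0, ∞)` dominated by a multiple of the profile. -/
structure IsHeatKernel (D α b : ℝ) (p : ℝ → E → E → ℝ) : Prop where
  pos : 0 ≤ b
  meas : Measurable fun q : ℝ × E × E => p q.1 q.2.1 q.2.2
  bound : ∀ t, 0 < t → ∀ x z, |p t x z| ≤ b * prof D α t (dist x z)
  cont : ContinuousOn (fun q : ℝ × E × E => p q.1 q.2.1 q.2.2) (Set.Ioi 0 ×ˢ Set.univ)

/-- The terms of the Neumann series of the Duhamel equation. -/
def pIter (m : Measure E) (p : ℝ → E → E → ℝ) (j : E → E → ℝ) : ℕ → ℝ → E → E → ℝ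
  | 0 => p
  | n + 1 => fun t x z => rconv m p j (pIter m p j n) 0 t x z

lemma measurable_pIter (hp : IsHeatKernel D α b p) (hj : Measurable (Function.uncurry j)) (n : ℕ) :
    Measurable fun q : ℝ × E × E => pIter m p j n q.1 q.2.1 q.2.2 := by
  induction n with
  | zero => exact hp.meas
  | succ n ih => exact measurable_rconv hp.meas hj ih 0

lemma ofReal_pIter_le (hp : IsHeatKernel D α b p) (hj : Measurable (Function.uncurry j)) (n : ℕ) :
    ∀ t, 0 < t → ∀ x z, ENNReal.ofReal |pIter m p j n t x z| ≤
      kIter m D α (absJump j) (ENNReal.ofReal b) n t x z := by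
  induction n with
  | zero => exact fun t ht x z => ofReal_abs_le_rho hp.pos (hp.bound t ht x z)
  | succ n ih =>
    intro t ht x z
    change ENNReal.ofReal |rconv m p j (pIter m p j n) 0 t x z| ≤ _
    rw [rconv_zero, ← Real.enorm_eq_ofReal_abs]
    exact (enorm_integral_le_lintegral_enorm _).trans (lintegral_convFun_le hj hp.bound hp.pos
      (measKernel_kIter (measurable_absJump hj) _ n) (t1 := t) (fun t ht _ => ih t ht) le_rfl x z)

lemma measurable_indicator_of_continuousOn {f : ℝ × E × E → ℝ} {I : Set ℝ} (hI : MeasurableSet I)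
    (hf : ContinuousOn f (I ×ˢ Set.univ)) :
    Measurable fun q : ℝ × E × E => I.indicator (fun t => f (t, q.2)) q.1 := by
  classical
  have h := hf.measurable_piecewise (g := fun _ => 0) continuousOn_const
    (hI.prod MeasurableSet.univ)
  have e : (fun q : ℝ × E × E => I.indicator (fun t => f (t, q.2)) q.1) =
      (I ×ˢ (Set.univ : Set (E × E))).piecewise f fun _ => 0 := by
    funext q
    by_cases hq : q.1 ∈ I
    · have hq' : q ∈ I ×ˢ (Set.univ : Set (E × E)) := ⟨hq, Set.mem_univ _⟩
      rw [Set.indicator_of_mem hq, Set.piecewise_eq_of_mem _ _ _ hq']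
    · have hq' : q ∉ I ×ˢ (Set.univ : Set (E × E)) := fun h => hq h.1
      rw [Set.indicator_of_notMem hq, Set.piecewise_eq_of_notMem _ _ _ hq']
  rw [e]
  exact h

/-- Existence, continuity and upper bound of the solution of the Duhamel equation. -/
theorem IsKatoJump.exists_solution (hJ : IsKatoJump m D α (absJump j) A Λ)
    (hj : Measurable (Function.uncurry j)) (hp : IsHeatKernel D α b p) :
    ∃ t0 : ℝ, 0 < t0 ∧ katoMod m D α (fun u => ∫⁻ w, absJump j u w ∂m) t0 ≠ ⊤ ∧
      katoMod m D α (fun w => ∫⁻ u, absJump j u w ∂m) t0 ≠ ⊤ ∧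
      ∃ C : ℝ, 0 < C ∧ ∃ q : ℝ → E → E → ℝ, IsProfKernel D α t0 C q ∧
        ∀ t, 0 < t → t < t0 → ∀ x z, q t x z = p t x z + rconv m p j q 0 t x z := by
  obtain ⟨t1, ht1, B, hB, hk⟩ := hJ.exists_kIter_le (b := ENNReal.ofReal b) ENNReal.ofReal_ne_top
  have hfin : ∀ᶠ t : ℝ in 𝓝[>] 0, t ≤ t1 ∧ katoMod m D α (fun u => ∫⁻ w, absJump j u w ∂m) t < ⊤ ∧
      katoMod m D α (fun w => ∫⁻ u, absJump j u w ∂m) t < ⊤ :=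
    ((eventually_le_nhds ht1).filter_mono nhdsWithin_le_nhds).and
      ((hJ.kato_out.eventually_lt_const ENNReal.zero_lt_top).and
        (hJ.kato_in.eventually_lt_const ENNReal.zero_lt_top))
  obtain ⟨t0, ⟨ht01, hη, hη'⟩, ht0⟩ := (hfin.and self_mem_nhdsWithin).exists
  have ht0 : 0 < t0 := ht0
  refine ⟨t0, ht0, hη.ne, hη'.ne, 2 * B, by positivity, ?_⟩
  set f := pIter m p j with hf
  have hfk : ∀ n t, 0 < t → t ≤ t0 → ∀ x z,
      kIter m D α (absJump j) (ENNReal.ofReal b) n t x z ≤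
        ENNReal.ofReal (B * (1 / 2) ^ n * prof D α t (dist x z)) := by
    intro n t ht htt x z
    refine (hk n t ht (htt.trans ht01) x z).trans (le_of_eq ?_)
    rw [rho, ENNReal.ofReal_mul (by positivity), ENNReal.ofReal_mul hB.le,
      ENNReal.ofReal_pow (by norm_num)]
    congr 3
    rw [ENNReal.ofReal_div_of_pos two_pos]
    simp
  have hfb : ∀ n t, 0 < t → t ≤ t0 → ∀ x z, |f n t x z| ≤ B * (1 / 2) ^ n * prof D α t (dist x z) := by
    intro n t ht htt x z
    have h1 := (ofReal_pIter_le (m := m) hp hj n t ht x z).trans (hfk n t ht htt x z)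
    have := prof_nonneg (D := D) (α := α) ht (dist x z)
    exact (ENNReal.ofReal_le_ofReal_iff (by positivity)).1 h1
  have hprof : ∀ n, IsProfKernel D α t0 (B * (1 / 2) ^ n) (f n) := by
    intro n
    induction n with
    | zero => exact ⟨hp.meas, fun t ht htt => hfb 0 t ht htt.le,
        hp.cont.mono (Set.prod_mono (fun t ht => ht.1) le_rfl)⟩
    | succ n ih => exact ⟨measurable_pIter hp hj _, fun t ht htt => hfb (n + 1) t ht htt.le,
        continuousOn_rconv hJ hη.ne hη'.ne hj hp.meas hp.cont hp.bound hp.pos (by positivity) ih⟩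
  have hgeo : HasSum (fun n : ℕ => (1 / 2 : ℝ) ^ n) 2 := hasSum_geometric_two
  have hsum : ∀ t, 0 < t → t ≤ t0 → ∀ x z, Summable fun n => f n t x z := fun t ht htt x z =>
    Summable.of_norm_bounded (((hgeo.mul_left B).mul_right _).summable) fun n => hfb n t ht htt x z
  have hScont : ContinuousOn (fun q : ℝ × E × E => ∑' n, f n q.1 q.2.1 q.2.2)
      (Set.Ioo 0 t0 ×ˢ Set.univ) := by
    rintro ⟨t, x, z⟩ ⟨⟨ht, htt⟩, -⟩
    refine ContinuousAt.continuousWithinAt ?_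
    have hU : Set.Ioo (t / 2) t0 ×ˢ (Set.univ : Set (E × E)) ∈ 𝓝 (t, x, z) :=
      (isOpen_Ioo.prod isOpen_univ).mem_nhds ⟨⟨by linarith, htt⟩, Set.mem_univ _⟩
    refine ContinuousOn.continuousAt (continuousOn_tsum
      (u := fun n => B * (1 / 2) ^ n * (t0 / (t / 2) * prof D α (t / 2) 0)) (fun n => ?_) ?_ ?_) hU
    · exact (hprof n).cont.mono (Set.prod_mono (Set.Ioo_subset_Ioo (by linarith) le_rfl) le_rfl)
    · exact ((hgeo.mul_left B).mul_right _).summable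
    · rintro n ⟨s, y, y'⟩ ⟨⟨hs, hst⟩, -⟩
      have hs' : t / 2 < s := hs
      refine (hfb n s (by linarith) (le_of_lt hst) y y').trans ?_
      gcongr
      exact prof_le_const hJ.hD hJ.hα (by linarith) hs'.le (le_of_lt hst) dist_nonneg
  -- Outside (0, t0) the series is not controlled; setting `q` to zero there keeps it measurable
  -- everywhere.
  let q : ℝ → E → E → ℝ := fun t x z => (Set.Ioo 0 t0).indicator (fun t => ∑' n, f n t x z) t
  have hq : ∀ t, 0 < t → t < t0 → ∀ x z, q t x z = ∑' n, f n t x z := fun t ht htt x z =>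
    Set.indicator_of_mem (show t ∈ Set.Ioo 0 t0 from ⟨ht, htt⟩) _
  refine ⟨q, ⟨measurable_indicator_of_continuousOn measurableSet_Ioo hScont, fun t ht htt x z => ?_, ?_⟩,
    fun t ht htt x z => ?_⟩
  · rw [hq t ht htt]
    have h1 : ‖∑' n, f n t x z‖ ≤ B * 2 * prof D α t (dist x z) := tsum_of_norm_bounded
      ((hgeo.mul_left B).mul_right (prof D α t (dist x z))) fun n => hfb n t ht htt.le x z
    rw [Real.norm_eq_abs] at h1
    rwa [mul_comm 2 B]
  · refine hScont.congr fun v hv => hq _ hv.1.1 hv.1.2 _ _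
  · rw [hq t ht htt, (hsum t ht htt.le x z).tsum_eq_zero_add]
    have hfi : ∀ n, Integrable (fun v : ℝ × E × E => (Set.Ioo 0 t).indicator
        (fun s => convFun p j (f n) t x z (s, v.2)) v.1) (volume.prod (m.prod m)) := by
      intro n
      refine integrable_convFun hj hp.meas hp.bound hp.pos (hprof n).meas
        (K := fun t x z => ENNReal.ofReal (B * (1 / 2) ^ n) * rho D α t x z)
        (Measurable.const_mul measKernel_rho _) (t1 := t0) (fun t ht htt x z => ?_) htt.le _ _ ?_
      · exact ofReal_abs_le_rho (by positivity) (hfb n t ht htt.le x z)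
      · exact kconv_rho_ne_top hJ hη.ne hη'.ne ENNReal.ofReal_ne_top ht htt.le _ _
    -- The total variation in the n-th convolution is bounded by the (n+1)-st iterate of the
    -- majorants; this geometric bound allows the sum and the convolution to be exchanged.
    have hfn : Summable fun n => ∫ v : ℝ × E × E, ‖(Set.Ioo 0 t).indicator
        (fun s => convFun p j (f n) t x z (s, v.2)) v.1‖ ∂(volume.prod (m.prod m)) := by
      refine Summable.of_nonneg_of_le (fun n => integral_nonneg fun v => norm_nonneg _) (fun n => ?_)
        ((summable_nat_add_iff 1).2 ((hgeo.mul_left B).mul_right (prof D α t (dist x z))).summable)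
      have h1 := (lintegral_convFun_le (m := m) hj hp.bound hp.pos
        (measKernel_kIter (measurable_absJump hj) _ n) (t1 := t)
        (fun t ht _ => ofReal_pIter_le hp hj n t ht) le_rfl x z).trans (hfk (n + 1) t ht htt.le x z)
      rw [integral_norm_eq_lintegral_enorm (hfi n).aestronglyMeasurable]
      refine ENNReal.toReal_le_of_le_ofReal ?_ h1
      have := prof_nonneg (D := D) (α := α) ht (dist x z)
      positivity
    have h2 := (hasSum_integral_of_summable_integral_norm hfi hfn).tsum_eq
    have h3 : ∀ n, f (n + 1) t x z = ∫ v : ℝ × E × E, (Set.Ioo 0 t).indicator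
        (fun s => convFun p j (f n) t x z (s, v.2)) v.1 ∂(volume.prod (m.prod m)) := fun n =>
      rconv_zero t x z
    simp_rw [h3]
    rw [h2, rconv_zero]
    congr 1
    refine integral_congr_ae (Eventually.of_forall fun v => ?_)
    by_cases hv : v.1 ∈ Set.Ioo 0 t
    · simp only [Set.indicator_of_mem hv, convFun]
      rw [tsum_mul_left, hq _ (sub_pos.2 hv.2) (by linarith [hv.1])]
    · simp only [Set.indicator_of_notMem hv]
      exact tsum_zero

end Neumann

/-! ### The Lévy system for functions that depend on time. -/

section Intensity
open CadlagPath ProbabilityTheory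
variable {E : Type*} [MetricSpace E] [ProperSpace E] [MeasurableSpace E] [BorelSpace E]
  {κ : Kernel (OnePoint E) (CadlagPath E)} {m : Measure E} [SFinite m]
  {p : ℝ → E → E → ℝ} {n : E → E → ℝ} {t : ℝ≥0}

/-- The intensity, seen through `f`, of the jumps of a process started from `x`. -/
def intensity (m : Measure E) (p : ℝ → E → E → ℝ) (n : E → E → ℝ) (S : Set ℝ)
    (f : ℝ → E → E → ℝ≥0∞) (x : E) : ℝ≥0∞ :=
  ∫⁻ s in S, ∫⁻ u, ∫⁻ w, ENNReal.ofReal (p s x u) * ENNReal.ofReal (n u w) * f s u w ∂m ∂m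

/-- The family of laws `κ` has transition density `p` and jumps according to the density `n`. -/
structure HasJumpDensity (κ : Kernel (OnePoint E) (CadlagPath E)) (m : Measure E)
    (p : ℝ → E → E → ℝ) (n : E → E → ℝ) : Prop where
  meas_p : Measurable fun q : ℝ × E × E => p q.1 q.2.1 q.2.2
  nonneg_p : ∀ t, 0 < t → ∀ x y, 0 ≤ p t x y
  meas_n : Measurable (Function.uncurry n)
  nonneg_n : ∀ u w, 0 ≤ n u w
  density : ∀ t : ℝ≥0, 0 < t → ∀ (x : E) (g : E → ℝ≥0∞), Measurable g →
    ∫⁻ w, (w t).elim 0 g ∂(κ x) = ∫⁻ y, ENNReal.ofReal (p t x y) * g y ∂m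
  levy : ∀ f : E → E → ℝ≥0∞, Measurable (Function.uncurry f) → (∀ x, f x x = 0) →
    ∀ (x : E) (t : ℝ≥0), 0 < t →
      ∫⁻ w, jumpSum f 0 t w ∂(κ x) = intensity m p n (Set.Ioc 0 t) (fun _ => f) x

/-- Difference of the formulas on (0, b] and (0, a]; finiteness makes the cancellation legitimate.
-/
lemma HasJumpDensity.levy_Ioc (h : HasJumpDensity κ m p n) {f : E → E → ℝ≥0∞}
    (hf : Measurable (Function.uncurry f)) (hd : ∀ x, f x x = 0) {a b : ℝ≥0} (hab : a ≤ b)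
    (hb : 0 < b) (x : E) (hfin : ∫⁻ w, jumpSum f 0 b w ∂(κ x) ≠ ⊤) :
    ∫⁻ w, jumpSum f a b w ∂(κ x) = intensity m p n (Set.Ioc a b) (fun _ => f) x := by
  rcases (zero_le (a := a)).eq_or_lt with ha | ha
  · rw [← ha]; exact h.levy f hf hd x b hb
  have h1 : ∫⁻ w, jumpSum f 0 b w ∂(κ x) =
      ∫⁻ w, jumpSum f 0 a w ∂(κ x) + ∫⁻ w, jumpSum f a b w ∂(κ x) := by
    rw [← lintegral_add_left (measurable_jumpSum hf hd 0 a)]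
    exact lintegral_congr fun w => jumpSum_add f zero_le hab w
  have h2 : intensity m p n (Set.Ioc 0 b) (fun _ => f) x =
      intensity m p n (Set.Ioc 0 a) (fun _ => f) x + intensity m p n (Set.Ioc a b) (fun _ => f) x := by
    unfold intensity
    rw [← lintegral_union measurableSet_Ioc (Set.Ioc_disjoint_Ioc_of_le le_rfl),
      Set.Ioc_union_Ioc_eq_Ioc (by positivity) (by exact_mod_cast hab)]
  rw [h.levy f hf hd x b hb] at h1 hfin
  rw [h2, h.levy f hf hd x a ha] at h1
  rw [h2] at hfin
  exact ((ENNReal.add_right_inj (ENNReal.add_ne_top.1 hfin).1).1 h1).symm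

lemma measurable_gridCeil (t : ℝ≥0) (n : ℕ) : Measurable (gridCeil t n) := by
  unfold gridCeil
  have : Measurable fun s : ℝ≥0 => ⌈s * (n + 1) / t⌉₊ := Nat.measurable_ceil.comp (by fun_prop)
  fun_prop

lemma tendsto_tsum_ennreal {ι : Type*} {f : ℕ → ι → ℝ≥0∞} {g b : ι → ℝ≥0∞}
    (hb : ∑' i, b i ≠ ⊤) (hf : ∀ n i, f n i ≤ b i)
    (hlim : ∀ i, Tendsto (fun n => f n i) atTop (𝓝 (g i))) :
    Tendsto (fun n => ∑' i, f n i) atTop (𝓝 (∑' i, g i)) := by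
  let _ : MeasurableSpace ι := ⊤
  simp_rw [← lintegral_count]
  refine tendsto_lintegral_of_dominated_convergence b (fun n => measurable_from_top)
    (fun n => Eventually.of_forall (hf n)) ?_ (Eventually.of_forall hlim)
  rwa [lintegral_count]

lemma tendsto_jump {φ : ℕ → E → E → ℝ≥0∞} {ψ : E → E → ℝ≥0∞}
    (h : ∀ u v, Tendsto (fun n => φ n u v) atTop (𝓝 (ψ u v))) (s : ℝ≥0) (w : CadlagPath E) :
    Tendsto (fun n => jump (φ n) s w) atTop (𝓝 (jump ψ s w)) := by
  have key : ∀ l r : OnePoint E, Tendsto (fun n => l.elim (0 : ℝ≥0∞) fun x => r.elim 0 fun y => φ n x y)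
      atTop (𝓝 (l.elim 0 fun x => r.elim 0 fun y => ψ x y)) := by
    intro l r
    rcases l with _ | l
    · exact tendsto_const_nhds
    rcases r with _ | r
    · exact tendsto_const_nhds
    exact h l r
  exact key _ _

/-- The intensity of the jumps for functions that depend on time. -/
lemma HasJumpDensity.levy_time (h : HasJumpDensity κ m p n) {φ : ℝ≥0 → E → E → ℝ≥0∞}
    {G : E → E → ℝ≥0∞} (ht : 0 < t)
    (hφ : Measurable fun q : ℝ≥0 × E × E => φ q.1 q.2.1 q.2.2) (hφd : ∀ s x, φ s x x = 0)
    (hG : Measurable (Function.uncurry G)) (hGd : ∀ x, G x x = 0) (hφG : ∀ s u w, φ s u w ≤ G u w)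
    (x : E) (hfin : ∫⁻ w, jumpSum G 0 t w ∂(κ x) ≠ ⊤)
    (hlim : ∀ s ∈ Set.Ioc 0 t, ∀ u w,
      Tendsto (fun i => φ (gridCeil t i s) u w) atTop (𝓝 (φ s u w))) :
    ∫⁻ w, ∑' s : Set.Ioc 0 t, jump (φ s) s w ∂(κ x) =
      intensity m p n (Set.Ioc 0 t) (fun s => φ s.toNNReal) x ∧
    AEMeasurable (fun w => ∑' s : Set.Ioc 0 t, jump (φ s) s w) (κ x) := by
  have hφs : ∀ s, Measurable (Function.uncurry (φ s)) := fun s =>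
    hφ.comp (f := fun q : E × E => (s, q)) (by fun_prop)
  have hGm := measurable_jumpSum hG hGd
  -- On each cell the function is frozen at the right end point, so that the Lévy system for
  -- functions independent of time applies cell by cell.
  let S : ℕ → CadlagPath E → ℝ≥0∞ := fun i w => ∑ a ∈ Finset.range (i + 1),
    jumpSum (φ (grid 0 t i (a + 1))) (grid 0 t i a) (grid 0 t i (a + 1)) w
  have hSm : ∀ i, Measurable (S i) := fun i => Finset.measurable_sum _ fun a _ =>
    measurable_jumpSum (hφs _) (hφd _) _ _
  have hS : ∀ i w, S i w = ∑' s : Set.Ioc 0 t, jump (φ (gridCeil t i s)) s w := fun i w =>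
    (tsum_gridCeil ht (fun r s => jump (φ r) s w) i).symm
  have hSG : ∀ i w, S i w ≤ jumpSum G 0 t w := by
    intro i w
    rw [hS]
    exact ENNReal.tsum_le_tsum fun s => jump_mono (hφG _) s w
  have hae : ∀ᵐ w ∂(κ x), jumpSum G 0 t w ≠ ⊤ := by
    filter_upwards [ae_lt_top (hGm 0 t) hfin] with w hw using hw.ne
  have hSlim : ∀ᵐ w ∂(κ x), Tendsto (fun i => S i w) atTop
      (𝓝 (∑' s : Set.Ioc 0 t, jump (φ s) s w)) := by
    filter_upwards [hae] with w hw
    simp_rw [hS]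
    exact tendsto_tsum_ennreal (b := fun s : Set.Ioc 0 t => jump G s w) hw
      (fun i s => jump_mono (hφG _) s w) fun s => tendsto_jump (hlim s s.2) s w
  refine ⟨?_, aemeasurable_of_tendsto_metrizable_ae atTop (fun i => (hSm i).aemeasurable) hSlim⟩
  have h1 : Tendsto (fun i => ∫⁻ w, S i w ∂(κ x)) atTop
      (𝓝 (∫⁻ w, ∑' s : Set.Ioc 0 t, jump (φ s) s w ∂(κ x))) :=
    tendsto_lintegral_of_dominated_convergence' _ (fun i => (hSm i).aemeasurable)
      (fun i => Eventually.of_forall (hSG i)) hfin hSlim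
  let ψ : ℕ → ℝ → E → E → ℝ≥0∞ := fun i s => φ (gridCeil t i s.toNNReal)
  have hp := h.meas_p
  have hn := h.meas_n
  have hψm : ∀ i, MeasKernel fun s u w => ENNReal.ofReal (p s x u) * ENNReal.ofReal (n u w) * ψ i s u w := by
    intro i
    have h3 : Measurable fun q : ℝ × E × E => ψ i q.1 q.2.1 q.2.2 :=
      hφ.comp (f := fun q : ℝ × E × E => (gridCeil t i q.1.toNNReal, q.2))
        (((measurable_gridCeil t i).comp (by fun_prop)).prodMk measurable_snd)
    unfold MeasKernel
    fun_prop
  have hGk : MeasKernel fun s u w => ENNReal.ofReal (p s x u) * ENNReal.ofReal (n u w) * G u w := by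
    unfold MeasKernel
    fun_prop
  have h0m : MeasKernel fun s u w =>
      ENNReal.ofReal (p s x u) * ENNReal.ofReal (n u w) * φ s.toNNReal u w := by
    have h3 : Measurable fun q : ℝ × E × E => φ q.1.toNNReal q.2.1 q.2.2 :=
      hφ.comp (f := fun q : ℝ × E × E => (q.1.toNNReal, q.2)) (by fun_prop)
    unfold MeasKernel
    fun_prop
  have h2 : ∀ i, ∫⁻ w, S i w ∂(κ x) = intensity m p n (Set.Ioc 0 t) (ψ i) x := by
    intro i
    have hgt : ∀ a ∈ Finset.range (i + 1), grid 0 t i (a + 1) ≤ t := fun a ha =>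
      (grid_mono 0 t i (Nat.succ_le_of_lt (Finset.mem_range.1 ha))).trans_eq (grid_last zero_le i)
    have hg0 : ∀ a, 0 < grid 0 t i (a + 1) := fun a => by
      rw [grid_zero_eq]
      positivity
    have h3 : ∀ a ∈ Finset.range (i + 1), ∫⁻ w, jumpSum (φ (grid 0 t i (a + 1))) (grid 0 t i a)
        (grid 0 t i (a + 1)) w ∂(κ x) =
        intensity m p n (Set.Ioc (grid 0 t i a) (grid 0 t i (a + 1))) (ψ i) x := by
      intro a ha
      rw [h.levy_Ioc (hφs _) (hφd _) (grid_mono 0 t i (Nat.le_succ a)) (hg0 a) x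
        (ne_top_of_le_ne_top hfin (lintegral_mono fun w => ?_))]
      · refine setLIntegral_congr_fun measurableSet_Ioc fun s hs => ?_
        have : gridCeil t i s.toNNReal = grid 0 t i (a + 1) := by
          refine gridCeil_eq ht ⟨?_, ?_⟩
          · exact Real.lt_toNNReal_iff_coe_lt.2 hs.1
          · exact Real.toNNReal_le_iff_le_coe.2 hs.2
        simp only [ψ, this]
      · exact (jumpSum_mono (hφG _) _ _ w).trans (jumpSum_le _ le_rfl (hgt a ha) w)
    rw [lintegral_finsetSum _ fun a _ => measurable_jumpSum (hφs _) (hφd _) _ _,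
      Finset.sum_congr rfl h3]
    have key : ∀ N, ∑ a ∈ Finset.range N, intensity m p n
        (Set.Ioc (grid 0 t i a) (grid 0 t i (a + 1))) (ψ i) x =
        intensity m p n (Set.Ioc 0 (grid 0 t i N)) (ψ i) x := by
      intro N
      induction N with
      | zero => simp [intensity, grid_zero]
      | succ N ih =>
        rw [Finset.sum_range_succ, ih]
        unfold intensity
        rw [← lintegral_union measurableSet_Ioc (Set.Ioc_disjoint_Ioc_of_le le_rfl),
          Set.Ioc_union_Ioc_eq_Ioc (by positivity) (by exact_mod_cast grid_mono 0 t i (Nat.le_succ N))]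
    rw [key, grid_last zero_le]
  have h4 : Tendsto (fun i => intensity m p n (Set.Ioc 0 t) (ψ i) x) atTop
      (𝓝 (intensity m p n (Set.Ioc 0 t) (fun s => φ s.toNNReal) x)) := by
    unfold intensity
    simp_rw [← lintegral_indicator_time (hψm _) measurableSet_Ioc]
    rw [← lintegral_indicator_time h0m measurableSet_Ioc]
    have hI : MeasurableSet (Prod.fst ⁻¹' (Set.Ioc 0 (t : ℝ)) : Set (ℝ × E × E)) :=
      measurable_fst measurableSet_Ioc
    refine tendsto_lintegral_of_dominated_convergence (fun q : ℝ × E × E =>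
      (Set.Ioc 0 (t : ℝ)).indicator (fun s => ENNReal.ofReal (p s x q.2.1) *
        ENNReal.ofReal (n q.2.1 q.2.2) * G q.2.1 q.2.2) q.1)
      (fun i => Measurable.indicator (hψm i) hI) (fun i => Eventually.of_forall fun q => ?_) ?_
      (Eventually.of_forall fun q => ?_)
    · by_cases hq : q.1 ∈ Set.Ioc 0 (t : ℝ)
      · simp only [Set.indicator_of_mem hq]
        gcongr
        exact hφG _ _ _
      · simp only [Set.indicator_of_notMem hq, le_refl]
    · rw [lintegral_indicator_time hGk measurableSet_Ioc]
      rw [h.levy G hG hGd x t ht] at hfin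
      exact hfin
    · by_cases hq : q.1 ∈ Set.Ioc 0 (t : ℝ)
      · simp only [Set.indicator_of_mem hq]
        refine ENNReal.Tendsto.const_mul (hlim _ ⟨Real.toNNReal_pos.2 hq.1, ?_⟩ _ _)
          (Or.inr (by finiteness))
        exact Real.toNNReal_le_iff_le_coe.2 hq.2
      · simp only [Set.indicator_of_notMem hq]
        exact tendsto_const_nhds
  exact tendsto_nhds_unique h1 ((tendsto_congr h2).2 h4)

lemma tsum_jump_eq {φ : ℝ≥0 → E → E → ℝ} {G : E → E → ℝ≥0∞}
    (hφG : ∀ s u w, ENNReal.ofReal |φ s u w| ≤ G u w) {w : CadlagPath E}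
    (hw : jumpSum G 0 t w ≠ ⊤) : ∑' s : Set.Ioc 0 t, jump (φ s) s w =
      (∑' s : Set.Ioc 0 t, jump (fun u w => ENNReal.ofReal (φ s u w)) s w).toReal -
        (∑' s : Set.Ioc 0 t, jump (fun u w => ENNReal.ofReal (-φ s u w)) s w).toReal := by
  have h1 : ∀ s, jump (fun u w => ENNReal.ofReal (φ s u w)) s w = ENNReal.ofReal (jump (φ s) s w) :=
    fun s => jump_map (fun r => ENNReal.ofReal r) (by simp) (φ s) s w
  have h2 : ∀ s, jump (fun u w => ENNReal.ofReal (-φ s u w)) s w = ENNReal.ofReal (-jump (φ s) s w) :=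
    fun s => jump_map (fun r => ENNReal.ofReal (-r)) (by simp) (φ s) s w
  have h3 : ∀ s, ENNReal.ofReal |jump (φ s) s w| ≤ jump G s w := fun s => by
    rw [← ofReal_abs_jump]
    exact jump_mono (hφG s) s w
  have hp : (∑' s : Set.Ioc 0 t, ENNReal.ofReal (jump (φ s) s w)) ≠ ⊤ :=
    ne_top_of_le_ne_top hw (ENNReal.tsum_le_tsum fun s =>
      (ENNReal.ofReal_le_ofReal (le_abs_self _)).trans (h3 s))
  have hn : (∑' s : Set.Ioc 0 t, ENNReal.ofReal (-jump (φ s) s w)) ≠ ⊤ :=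
    ne_top_of_le_ne_top hw (ENNReal.tsum_le_tsum fun s =>
      (ENNReal.ofReal_le_ofReal (neg_le_abs _)).trans (h3 s))
  simp_rw [h1, h2]
  rw [ENNReal.tsum_toReal_eq fun s => ENNReal.ofReal_ne_top,
    ENNReal.tsum_toReal_eq fun s => ENNReal.ofReal_ne_top,
    ← (ENNReal.summable_toReal hp).tsum_sub (ENNReal.summable_toReal hn)]
  refine tsum_congr fun s => ?_
  rw [ENNReal.toReal_ofReal', ENNReal.toReal_ofReal']
  exact (max_zero_sub_max_neg_zero_eq_self _).symm

/-- The signed version of the intensity formula for functions that depend on time. -/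
lemma HasJumpDensity.integral_levy_time (h : HasJumpDensity κ m p n) {φ : ℝ≥0 → E → E → ℝ}
    {G : E → E → ℝ≥0∞} (ht : 0 < t)
    (hφ : Measurable fun q : ℝ≥0 × E × E => φ q.1 q.2.1 q.2.2) (hφd : ∀ s x, φ s x x = 0)
    (hG : Measurable (Function.uncurry G)) (hGd : ∀ x, G x x = 0)
    (hφG : ∀ s u w, ENNReal.ofReal |φ s u w| ≤ G u w)
    (x : E) (hfin : ∫⁻ w, jumpSum G 0 t w ∂(κ x) ≠ ⊤)
    (hlim : ∀ s ∈ Set.Ioc 0 t, ∀ u w,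
      Tendsto (fun i => φ (gridCeil t i s) u w) atTop (𝓝 (φ s u w))) :
    Integrable (fun w => ∑' s : Set.Ioc 0 t, jump (φ s) s w) (κ x) ∧
    ∫ w, ∑' s : Set.Ioc 0 t, jump (φ s) s w ∂(κ x) =
      ∫ q : ℝ × E × E, (Set.Ioc 0 (t : ℝ)).indicator (fun s => p s x q.2.1 * n q.2.1 q.2.2 *
        φ s.toNNReal q.2.1 q.2.2) q.1 ∂(volume.prod (m.prod m)) := by
  have hp := h.meas_p
  have hn := h.meas_n
  have hI : MeasurableSet (Prod.fst ⁻¹' (Set.Ioc 0 (t : ℝ)) : Set (ℝ × E × E)) :=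
    measurable_fst measurableSet_Ioc
  have hφr : Measurable fun q : ℝ × E × E => φ q.1.toNNReal q.2.1 q.2.2 :=
    hφ.comp (f := fun q : ℝ × E × E => (q.1.toNNReal, q.2)) (by fun_prop)
  have hGfin : intensity m p n (Set.Ioc 0 t) (fun _ => G) x ≠ ⊤ := by
    rwa [h.levy G hG hGd x t ht] at hfin
  obtain ⟨e1, m1⟩ := h.levy_time (φ := fun s u w => ENNReal.ofReal (φ s u w)) ht (by fun_prop)
    (by simp [hφd]) hG hGd (fun s u w => (ENNReal.ofReal_le_ofReal (le_abs_self _)).trans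
      (hφG s u w)) x hfin fun s hs u w => ENNReal.tendsto_ofReal (hlim s hs u w)
  obtain ⟨e2, m2⟩ := h.levy_time (φ := fun s u w => ENNReal.ofReal (-φ s u w)) ht (by fun_prop)
    (by simp [hφd]) hG hGd (fun s u w => (ENNReal.ofReal_le_ofReal (neg_le_abs _)).trans
      (hφG s u w)) x hfin fun s hs u w => ENNReal.tendsto_ofReal (hlim s hs u w).neg
  have hle : ∀ ψ : ℝ → E → E → ℝ≥0∞, (∀ s u w, ψ s u w ≤ G u w) →
      intensity m p n (Set.Ioc 0 t) ψ x ≠ ⊤ := fun ψ hψ =>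
    ne_top_of_le_ne_top hGfin (lintegral_mono fun s => lintegral_mono fun u =>
      lintegral_mono fun w => mul_le_mul_right (hψ s u w) _)
  have f1 := hle (fun s u w => ENNReal.ofReal (φ s.toNNReal u w)) fun s u w =>
    (ENNReal.ofReal_le_ofReal (le_abs_self _)).trans (hφG _ u w)
  have f2 := hle (fun s u w => ENNReal.ofReal (-φ s.toNNReal u w)) fun s u w =>
    (ENNReal.ofReal_le_ofReal (neg_le_abs _)).trans (hφG _ u w)
  have hae : ∀ᵐ w ∂(κ x), ∑' s : Set.Ioc 0 t, jump (φ s) s w =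
      (∑' s : Set.Ioc 0 t, jump (fun u w => ENNReal.ofReal (φ s u w)) s w).toReal -
        (∑' s : Set.Ioc 0 t, jump (fun u w => ENNReal.ofReal (-φ s u w)) s w).toReal := by
    filter_upwards [ae_lt_top (measurable_jumpSum hG hGd 0 t) hfin] with w hw
    exact tsum_jump_eq hφG hw.ne
  have i1 := integrable_toReal_of_lintegral_ne_top m1 (by rw [e1]; exact f1)
  have i2 := integrable_toReal_of_lintegral_ne_top m2 (by rw [e2]; exact f2)
  refine ⟨(i1.sub i2).congr (hae.mono fun w hw => hw.symm), ?_⟩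
  rw [integral_congr_ae hae, integral_sub i1 i2,
    integral_toReal m1 (ae_lt_top' m1 (by rw [e1]; exact f1)),
    integral_toReal m2 (ae_lt_top' m2 (by rw [e2]; exact f2)), e1, e2]
  have hr : ∀ ψ : ℝ → E → E → ℝ, (Measurable fun q : ℝ × E × E => ψ q.1 q.2.1 q.2.2) →
      ∫⁻ q : ℝ × E × E, ENNReal.ofReal ((Set.Ioc 0 (t : ℝ)).indicator (fun s => p s x q.2.1 *
        n q.2.1 q.2.2 * ψ s q.2.1 q.2.2) q.1) ∂(volume.prod (m.prod m)) =
      intensity m p n (Set.Ioc 0 t) (fun s u w => ENNReal.ofReal (ψ s u w)) x := by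
    intro ψ hψ
    have hm : MeasKernel fun s u w =>
        ENNReal.ofReal (p s x u) * ENNReal.ofReal (n u w) * ENNReal.ofReal (ψ s u w) := by
      unfold MeasKernel
      fun_prop
    unfold intensity
    rw [← lintegral_indicator_time hm measurableSet_Ioc]
    refine lintegral_congr fun q => ?_
    by_cases hq : q.1 ∈ Set.Ioc 0 (t : ℝ)
    · simp only [Set.indicator_of_mem hq]
      have h3 := h.nonneg_p q.1 hq.1 x q.2.1
      have h4 := h.nonneg_n q.2.1 q.2.2
      rw [ENNReal.ofReal_mul (mul_nonneg h3 h4), ENNReal.ofReal_mul h3]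
    · simp only [Set.indicator_of_notMem hq, ENNReal.ofReal_zero]
  have hmeas : Measurable fun q : ℝ × E × E => (Set.Ioc 0 (t : ℝ)).indicator
      (fun s => p s x q.2.1 * n q.2.1 q.2.2 * φ s.toNNReal q.2.1 q.2.2) q.1 := by
    have h5 : Measurable fun q : ℝ × E × E =>
        p q.1 x q.2.1 * n q.2.1 q.2.2 * φ q.1.toNNReal q.2.1 q.2.2 := by fun_prop
    exact h5.indicator hI
  have hneg : ∀ q : ℝ × E × E, -(Set.Ioc 0 (t : ℝ)).indicator (fun s => p s x q.2.1 *
      n q.2.1 q.2.2 * φ s.toNNReal q.2.1 q.2.2) q.1 = (Set.Ioc 0 (t : ℝ)).indicator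
      (fun s => p s x q.2.1 * n q.2.1 q.2.2 * -φ s.toNNReal q.2.1 q.2.2) q.1 := by
    intro q
    by_cases hq : q.1 ∈ Set.Ioc 0 (t : ℝ)
    · simp only [Set.indicator_of_mem hq]; ring
    · simp only [Set.indicator_of_notMem hq, neg_zero]
  have r1 := hr (fun s => φ s.toNNReal) hφr
  have r2 := hr (fun s u w => -φ s.toNNReal u w) hφr.neg
  have hint : Integrable (fun q : ℝ × E × E => (Set.Ioc 0 (t : ℝ)).indicator
      (fun s => p s x q.2.1 * n q.2.1 q.2.2 * φ s.toNNReal q.2.1 q.2.2) q.1)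
      (volume.prod (m.prod m)) := by
    refine ⟨hmeas.aestronglyMeasurable, ?_⟩
    have h6 : ∀ r : ℝ, ‖r‖ₑ = ENNReal.ofReal r + ENNReal.ofReal (-r) := fun r => by
      rw [Real.enorm_eq_ofReal_abs]
      rcases le_total 0 r with hr | hr
      · rw [abs_of_nonneg hr, ENNReal.ofReal_of_nonpos (neg_nonpos.2 hr), add_zero]
      · rw [abs_of_nonpos hr, ENNReal.ofReal_of_nonpos hr, zero_add]
    unfold HasFiniteIntegral
    simp_rw [h6]
    rw [lintegral_add_left hmeas.ennreal_ofReal, r1]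
    simp_rw [hneg]
    rw [r2]
    exact ENNReal.add_lt_top.2 ⟨f1.lt_top, f2.lt_top⟩
  rw [integral_eq_lintegral_pos_part_sub_lintegral_neg_part hint, r1]
  simp_rw [hneg]
  rw [r2]

/-- The trap property holds almost surely at each fixed time; a countable dense set of times and
right-continuity give it at all times at once, and a path that is constantly at infinity contributes
no jump. -/
lemma IsMarkovLaw.jumpSum_infty (hκ : IsMarkovLaw κ) (f : E → E → ℝ≥0∞) (t : ℝ≥0) :
    ∫⁻ w, jumpSum f 0 t w ∂(κ OnePoint.infty) = 0 := by
  have hD : ∀ᵐ w ∂(κ OnePoint.infty), ∀ s ∈ TopologicalSpace.denseSeq ℝ≥0 '' Set.univ,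
      w s = OnePoint.infty := by
    rw [Set.image_univ]
    exact (ae_ball_iff (Set.countable_range _)).2 fun s _ => hκ.trap s
  have h0 : ∀ᵐ w ∂(κ OnePoint.infty), jumpSum f 0 t w = 0 := by
    filter_upwards [hD] with w hw
    refine jumpSum_eq_zero_of_forall fun s => ?_
    by_contra hne
    have h1 : ∀ᶠ r in 𝓝[≥] s, w r ≠ OnePoint.infty :=
      (w.right_cont s).eventually_ne hne
    obtain ⟨u, hu, hsub⟩ := (mem_nhdsGE_iff_exists_Ico_subset' (show s < s + 1 by simp)).1 h1
    obtain ⟨r, hr⟩ := (TopologicalSpace.denseRange_denseSeq ℝ≥0).exists_mem_open isOpen_Ioo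
      (Set.nonempty_Ioo.2 hu)
    exact hsub ⟨hr.1.le, hr.2⟩ (hw _ ⟨r, Set.mem_univ _, rfl⟩)
  rw [lintegral_congr_ae h0]
  simp

end Intensity

/-! ### Kernels acting on bounded functions. -/

section Apply
variable {E : Type*} [MetricSpace E] [ProperSpace E] [MeasurableSpace E] [BorelSpace E]
  {m : Measure E} [SFinite m] {D α : ℝ}
  {p k : ℝ → E → E → ℝ} {j : E → E → ℝ} {t0 b c Λ B : ℝ} {A : ℝ≥0∞} {g : E → ℝ}

/-- The action of a kernel on a function. -/
def kApply (m : Measure E) (k : ℝ → E → E → ℝ) (g : E → ℝ) (t : ℝ) (x : E) : ℝ :=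
  ∫ z, k t x z * g z ∂m

/-- The profile is integrable, uniformly in time and space. -/
structure HasMass (m : Measure E) (D α : ℝ) (A : ℝ≥0∞) : Prop where
  hD : 0 < D
  hα : 0 < α
  hA : A ≠ ⊤
  mass : ∀ t, 0 < t → ∀ x, ∫⁻ y, rho D α t x y ∂m ≤ A

lemma IsKatoJump.hasMass {J : E → E → ℝ≥0∞} (h : IsKatoJump m D α J A Λ) : HasMass m D α A :=
  ⟨h.hD, h.hα, h.hA, h.mass⟩

lemma HasMass.integrable_prof (h : HasMass m D α A) {t : ℝ} (ht : 0 < t) (x : E) :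
    Integrable (fun z => prof D α t (dist x z)) m ∧
      ∫ z, prof D α t (dist x z) ∂m ≤ A.toReal := by
  have hm : Measurable fun z => prof D α t (dist x z) := by fun_prop
  have h0 : ∀ z, 0 ≤ prof D α t (dist x z) := fun z => prof_nonneg ht _
  refine ⟨⟨hm.aestronglyMeasurable, ?_⟩, ?_⟩
  · rw [hasFiniteIntegral_iff_ofReal (Eventually.of_forall h0)]
    exact (h.mass t ht x).trans_lt h.hA.lt_top
  · rw [integral_eq_lintegral_of_nonneg_ae (Eventually.of_forall h0) hm.aestronglyMeasurable]
    exact ENNReal.toReal_mono h.hA (h.mass t ht x)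

lemma measurable_kApply (hk : Measurable fun q : ℝ × E × E => k q.1 q.2.1 q.2.2)
    (hg : Measurable g) : Measurable fun q : ℝ × E => kApply m k g q.1 q.2 := by
  have h1 : Measurable fun q : (ℝ × E) × E => k q.1.1 q.1.2 q.2 * g q.2 := by fun_prop
  exact (h1.stronglyMeasurable.integral_prod_right' (ν := m)).measurable

lemma IsProfKernel.integrable_mul (hk : IsProfKernel D α t0 c k) (h : HasMass m D α A)
    (hg : Measurable g) (hgB : ∀ x, |g x| ≤ B) {t : ℝ} (ht : 0 < t) (htt : t < t0)
    (x : E) : Integrable (fun z => k t x z * g z) m := by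
  have hkm := hk.meas
  refine (((h.integrable_prof ht x).1.const_mul c).mul_const B).mono'
    (Measurable.aestronglyMeasurable (by fun_prop)) (Eventually.of_forall fun z => ?_)
  rw [Real.norm_eq_abs, abs_mul]
  exact mul_le_mul (hk.bound t ht htt x z) (hgB z) (abs_nonneg _)
    ((abs_nonneg _).trans (hk.bound t ht htt x z))

lemma IsProfKernel.abs_kApply_le (hk : IsProfKernel D α t0 c k) (h : HasMass m D α A) (hc : 0 ≤ c)
    (hB : 0 ≤ B) (hgB : ∀ x, |g x| ≤ B) {t : ℝ} (ht : 0 < t) (htt : t < t0) (x : E) :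
    |kApply m k g t x| ≤ c * B * A.toReal := by
  obtain ⟨h1, h2⟩ := h.integrable_prof ht x
  calc |kApply m k g t x| ≤ ∫ z, |k t x z * g z| ∂m := abs_integral_le_integral_abs
    _ ≤ ∫ z, c * B * prof D α t (dist x z) ∂m := by
        refine integral_mono_of_nonneg (Eventually.of_forall fun z => abs_nonneg _)
          (h1.const_mul _) (Eventually.of_forall fun z => ?_)
        beta_reduce
        rw [abs_mul, mul_right_comm]
        exact mul_le_mul (hk.bound t ht htt x z) (hgB z) (abs_nonneg _)
          ((abs_nonneg _).trans (hk.bound t ht htt x z))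
    _ = c * B * ∫ z, prof D α t (dist x z) ∂m := integral_const_mul _ _
    _ ≤ _ := by gcongr

lemma IsProfKernel.continuousAt_kApply (hk : IsProfKernel D α t0 c k) (h : HasMass m D α A)
    (hc : 0 ≤ c) (hg : Measurable g) (hgB : ∀ x, |g x| ≤ B) {t : ℝ} (ht : 0 < t)
    (htt : t < t0) (x : E) : ContinuousAt (fun v : ℝ × E => kApply m k g v.1 v.2) (t, x) := by
  have hkm := hk.meas
  have hδ : 0 < t / 2 := by positivity
  refine continuousAt_of_dominated (bound := fun z =>
    c * (t0 / (t / 2) * 2 ^ D * prof D α (t / 2) (dist x z)) * B) ?_ ?_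
    ((((h.integrable_prof hδ x).1.const_mul _).const_mul c).mul_const B) ?_
  · exact Eventually.of_forall fun v => Measurable.aestronglyMeasurable (by fun_prop)
  · have h1 : ∀ᶠ v : ℝ × E in 𝓝 (t, x), v.1 ∈ Set.Ioo (t / 2) t0 :=
      continuousAt_fst (p := ((t, x) : ℝ × E)) (Ioo_mem_nhds (by simpa using by linarith) htt)
    have h2 : ∀ᶠ v : ℝ × E in 𝓝 (t, x), dist v.2 x < (t / 2) ^ (1 / α) := by
      have : ContinuousAt (fun v : ℝ × E => dist v.2 x) (t, x) := by fun_prop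
      refine this.eventually_lt_const ?_
      simpa using Real.rpow_pos_of_pos hδ _
    filter_upwards [h1, h2] with v hv1 hv2
    refine Eventually.of_forall fun z => ?_
    have hb := hk.bound v.1 (hδ.trans hv1.1) hv1.2 v.2 z
    rw [Real.norm_eq_abs, abs_mul]
    have h3 := mul_le_mul_of_nonneg_left
      (prof_near h.hD h.hα hδ hv1.1.le hv1.2.le hv2.le z) hc
    exact mul_le_mul (hb.trans h3) (hgB z) (abs_nonneg _) ((abs_nonneg _).trans (hb.trans h3))
  · refine Eventually.of_forall fun z => ContinuousAt.mul ?_ continuousAt_const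
    exact ContinuousAt.comp (x := ((t, x) : ℝ × E)) (f := fun v : ℝ × E => (v.1, v.2, z))
      (hk.continuousAt ht htt x z) (by fun_prop)

/-- Applying a convolution to a function. -/
lemma integral_rconv_mul (hJ : IsKatoJump m D α (absJump j) A Λ)
    (hη : katoMod m D α (fun u => ∫⁻ w, absJump j u w ∂m) t0 ≠ ⊤)
    (hη' : katoMod m D α (fun w => ∫⁻ u, absJump j u w ∂m) t0 ≠ ⊤)
    (hj : Measurable (Function.uncurry j)) (hp : IsHeatKernel D α b p) (hc : 0 ≤ c)
    (hk : IsProfKernel D α t0 c k) (hg : Measurable g) (hgB : ∀ x, |g x| ≤ B) {t : ℝ}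
    (ht : 0 < t) (htt : t < t0) (x : E) :
    Integrable (fun z => rconv m p j k 0 t x z * g z) m ∧
    ∫ z, rconv m p j k 0 t x z * g z ∂m = ∫ q : ℝ × E × E, (Set.Ioo 0 t).indicator
      (fun s => p s x q.2.1 * j q.2.1 q.2.2 * kApply m k g (t - s) q.2.2) q.1
        ∂(volume.prod (m.prod m)) := by
  have hJm := measurable_absJump hj
  have hr : Measurable fun q : ℝ × E × E => rho D α q.1 q.2.1 q.2.2 := measKernel_rho
  have hKm : MeasKernel fun t (x z : E) => ENNReal.ofReal c * rho D α t x z :=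
    Measurable.const_mul measKernel_rho _
  have hkc := measKernel_kconv (m := m) (measKernel_rho (D := D) (α := α)) hJm hKm
  unfold MeasKernel at hkc
  have hA := hJ.hA
  have hbd : ∀ z, ∫⁻ q : ℝ × E × E, ‖(Set.Ioo 0 t).indicator
      (fun s => convFun p j k t x z (s, q.2)) q.1‖ₑ ∂(volume.prod (m.prod m)) ≤ ENNReal.ofReal b *
        kconv m (rho D α) (absJump j) (fun t x z => ENNReal.ofReal c * rho D α t x z) t x z :=
    fun z => lintegral_convFun_le hj hp.bound hp.pos hKm (t1 := t0)
      (fun t ht htt x z => ofReal_abs_le_rho hc (hk.bound t ht htt x z)) htt.le x z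
  have hconv : ∫⁻ z, kconv m (rho D α) (absJump j)
      (fun t x z => ENNReal.ofReal c * rho D α t x z) t x z ∂m < ⊤ := by
    have h1 := fun z => kconv_le hJ hKm (c := ENNReal.ofReal c) (i := ENNReal.ofReal c * A)
      (t0 := t0) (fun _ _ _ _ _ => le_rfl) (fun t ht _ z => by
        rw [lintegral_const_mul _ (by fun_prop)]
        gcongr
        simp_rw [rho_comm t _ z]
        exact hJ.mass t ht z) ht htt.le x z
    refine (lintegral_mono h1).trans_lt ?_
    rw [lintegral_const_mul _ (by fun_prop)]
    have := ne_top_of_le_ne_top hA (hJ.mass t ht x)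
    exact (by finiteness : _ ≠ (⊤ : ℝ≥0∞)).lt_top
  let f : E → ℝ × E × E → ℝ := fun z q =>
    (Set.Ioo 0 t).indicator (fun s => convFun p j k t x z (s, q.2)) q.1 * g z
  have hfm : Measurable (Function.uncurry f) := by
    have h1 := measurable_ind_convFun hp.meas hj hk.meas 0
    have h2 : Measurable fun q : E × ℝ × E × E => (Set.Ioo 0 (t - 0)).indicator
        (fun s => convFun p j k t x q.1 (s, q.2.2)) q.2.1 :=
      h1.comp (f := fun q : E × ℝ × E × E => ((t, x, q.1), q.2)) (by fun_prop)
    rw [sub_zero] at h2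
    exact h2.mul (hg.comp measurable_fst)
  -- Absolute convergence for Fubini: the convolution of majorants is at most a multiple of the
  -- profile, which has finite mass in `z`.
  have hfi : Integrable (Function.uncurry f) (m.prod (volume.prod (m.prod m))) := by
    refine ⟨hfm.aestronglyMeasurable, ?_⟩
    unfold HasFiniteIntegral
    rw [lintegral_prod _ hfm.enorm.aemeasurable]
    calc ∫⁻ z, ∫⁻ q, ‖Function.uncurry f (z, q)‖ₑ ∂(volume.prod (m.prod m)) ∂m
        ≤ ∫⁻ z, ENNReal.ofReal b * kconv m (rho D α) (absJump j)
          (fun t x z => ENNReal.ofReal c * rho D α t x z) t x z * ENNReal.ofReal B ∂m := by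
          refine lintegral_mono fun z => ?_
          simp only [Function.uncurry, f, enorm_mul]
          have h3 : ‖g z‖ₑ ≤ ENNReal.ofReal B := by
            rw [Real.enorm_eq_ofReal_abs]
            exact ENNReal.ofReal_le_ofReal (hgB z)
          rw [lintegral_mul_const' _ _ (by finiteness)]
          exact mul_le_mul' (hbd z) h3
      _ < ⊤ := by
          rw [lintegral_mul_const _ (by fun_prop), lintegral_const_mul _ (by fun_prop)]
          have := hconv.ne
          exact (by finiteness : _ ≠ (⊤ : ℝ≥0∞)).lt_top
  have e1 : ∀ z, rconv m p j k 0 t x z * g z = ∫ q, f z q ∂(volume.prod (m.prod m)) := fun z => by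
    rw [rconv_zero, ← integral_mul_const]
  simp_rw [e1]
  refine ⟨hfi.integral_prod_left, ?_⟩
  rw [integral_integral_swap hfi]
  refine integral_congr_ae (Eventually.of_forall fun q => ?_)
  by_cases hq : q.1 ∈ Set.Ioo 0 t
  · simp only [f, Set.indicator_of_mem hq, convFun, kApply]
    rw [← integral_const_mul]
    refine integral_congr_ae (Eventually.of_forall fun z => ?_)
    beta_reduce
    ring
  · simp only [f, Set.indicator_of_notMem hq, zero_mul, integral_zero]

end Apply

/-! ### The Feynman-Kac density for small times. -/

section Local
open CadlagPath ProbabilityTheory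
variable {E : Type*} [MetricSpace E] [ProperSpace E] [MeasurableSpace E] [BorelSpace E]
  {κ : Kernel (OnePoint E) (CadlagPath E)} {m : Measure E} [SFinite m] {D α : ℝ}
  {p : ℝ → E → E → ℝ} {n : E → E → ℝ} {b Λ B : ℝ} {A : ℝ≥0∞} {F : E → E → ℝ} {g : E → ℝ}

lemma IsKatoJump.mono {J J' : E → E → ℝ≥0∞} (h : IsKatoJump m D α J A Λ)
    (hJ' : Measurable (Function.uncurry J')) (hle : ∀ u w, J' u w ≤ J u w) :
    IsKatoJump m D α J' A Λ where
  hD := h.hD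
  hα := h.hα
  hΛ := h.hΛ
  hA := h.hA
  meas := hJ'
  le_div u w := (hle u w).trans (h.le_div u w)
  mass := h.mass
  kato_out := by
    refine tendsto_of_tendsto_of_tendsto_of_le_of_le tendsto_const_nhds h.kato_out
      (fun t => zero_le) fun t => ?_
    unfold katoMod
    gcongr with x s u w
    exact lintegral_mono fun _ => hle _ _
  kato_in := by
    refine tendsto_of_tendsto_of_tendsto_of_le_of_le tendsto_const_nhds h.kato_in
      (fun t => zero_le) fun t => ?_
    unfold katoMod
    gcongr with x s u w
    exact lintegral_mono fun _ => hle _ _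

lemma jumpSum_const_mul (c : ℝ≥0∞) (f : E → E → ℝ≥0∞) (a b : ℝ≥0) (w : CadlagPath E) :
    jumpSum (fun x y => c * f x y) a b w = c * jumpSum f a b w := by
  unfold jumpSum
  rw [← ENNReal.tsum_mul_left]
  exact tsum_congr fun s => jump_map (fun r => c * r) (by simp) f s w

/-- The jump kernel of the Feynman-Kac perturbation. -/
def fkJump (F n : E → E → ℝ) (u w : E) : ℝ := expJump F u w * n u w

/-- The dominating jump kernel of the Feynman-Kac perturbation. -/
def fkJumpBound (F n : E → E → ℝ) (u w : E) : ℝ≥0∞ := ENNReal.ofReal (n u w) * expWeight F u w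

lemma measurable_fkJump (hF : Measurable (Function.uncurry F)) (hn : Measurable (Function.uncurry n)) :
    Measurable (Function.uncurry (fkJump F n)) := (measurable_expJump hF).mul hn

lemma IsKatoJump.fkJump (h : IsKatoJump m D α (fkJumpBound F n) A Λ)
    (hF : Measurable (Function.uncurry F)) (hn : Measurable (Function.uncurry n))
    (hn0 : ∀ u w, 0 ≤ n u w) : IsKatoJump m D α (absJump (fkJump F n)) A Λ := by
  refine h.mono (measurable_absJump (measurable_fkJump hF hn)) fun u w => ?_
  unfold absJump _root_.fkJump fkJumpBound expWeight
  rw [← ENNReal.ofReal_mul (hn0 u w), abs_mul, abs_of_nonneg (hn0 u w), mul_comm]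
  exact ENNReal.ofReal_le_ofReal (mul_le_mul_of_nonneg_left (abs_expJump_le F u w) (hn0 u w))

/-- The Lévy system rewrites the expectation as a Kato potential of the outgoing marginal; this is
what makes the hypothesis 1/2 of Khasminskii's lemma available for small times. -/
lemma HasJumpDensity.lintegral_expWeight_le (h : HasJumpDensity κ m p n) (hκ : IsMarkovLaw κ)
    (hp : IsHeatKernel D α b p) (hF : Measurable (Function.uncurry F)) (hd : ∀ x, F x x = 0)
    {t : ℝ≥0} (ht : 0 < t) (x : OnePoint E) :
    ∫⁻ w, jumpSum (expWeight F) 0 t w ∂(κ x) ≤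
      ENNReal.ofReal b * katoMod m D α (fun u => ∫⁻ w, fkJumpBound F n u w ∂m) t := by
  rcases x with _ | x
  · exact (hκ.jumpSum_infty _ _).trans_le zero_le
  refine (h.levy _ (measurable_expWeight hF) (expWeight_diag hd) x t ht).trans_le ?_
  have hJm : Measurable (Function.uncurry (fkJumpBound F n)) :=
    (h.meas_n.ennreal_ofReal).mul (measurable_expWeight hF)
  have hJ2 : ∀ u, Measurable (fkJumpBound F n u) := fun u => hJm.of_uncurry_left
  have hρ := measKernel_rho (E := E) (D := D) (α := α)
  unfold MeasKernel at hρ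
  have hle : intensity m p n (Set.Ioc 0 t) (fun _ => expWeight F) x ≤
      ∫⁻ s in Set.Ioo (0 : ℝ) t, ENNReal.ofReal b *
        (∫⁻ u, rho D α s x u * (∫⁻ w, fkJumpBound F n u w ∂m) ∂m) := by
    unfold intensity
    rw [← restrict_Ioo_eq_restrict_Ioc]
    refine setLIntegral_mono' measurableSet_Ioo fun s hs => ?_
    rw [← lintegral_const_mul' _ _ ENNReal.ofReal_ne_top]
    refine lintegral_mono fun u => ?_
    beta_reduce
    rw [← mul_assoc, ← lintegral_const_mul _ (hJ2 u)]
    refine lintegral_mono fun w => ?_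
    beta_reduce
    rw [mul_assoc]
    refine mul_le_mul_left ?_ _
    refine (ENNReal.ofReal_le_ofReal (le_abs_self _)).trans ?_
    exact ofReal_abs_le_rho hp.pos (hp.bound s hs.1 x u)
  refine hle.trans ?_
  rw [lintegral_const_mul' _ _ ENNReal.ofReal_ne_top]
  exact mul_le_mul_right (le_iSup (fun x => ∫⁻ s in Set.Ioo (0 : ℝ) t,
    ∫⁻ u, rho D α s x u * (∫⁻ w, fkJumpBound F n u w ∂m) ∂m) x) _

lemma HasMass.integrable_heat_mul (hA : HasMass m D α A) (hp : IsHeatKernel D α b p)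
    (hg : Measurable g) (hgB : ∀ x, |g x| ≤ B) {t : ℝ} (ht : 0 < t) (x : E) :
    Integrable (fun z => p t x z * g z) m := by
  have hk : IsProfKernel D α (t + 1) b p :=
    ⟨hp.meas, fun s hs _ => hp.bound s hs, hp.cont.mono (Set.prod_mono (fun s hs => hs.1) subset_rfl)⟩
  exact hk.integrable_mul hA hg hgB ht (by linarith) x

lemma integrable_elim (hκ : IsMarkovLaw κ) (hg : Measurable g) (hB : 0 ≤ B)
    (hgB : ∀ x, |g x| ≤ B) (t : ℝ≥0) (x : OnePoint E) :
    Integrable (fun w : CadlagPath E => (w t).elim 0 g) (κ x) := by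
  have := hκ.prob
  exact Integrable.of_bound (measurable_elim_eval hg t).aestronglyMeasurable B
    (Eventually.of_forall fun w => abs_elim_le hB hgB _)

lemma HasJumpDensity.integral_density (h : HasJumpDensity κ m p n) (hκ : IsMarkovLaw κ)
    (hA : HasMass m D α A) (hp : IsHeatKernel D α b p)
    (hg : Measurable g) (hB : 0 ≤ B) (hgB : ∀ x, |g x| ≤ B) {t : ℝ≥0} (ht : 0 < t) (x : E) :
    ∫ w, (w t).elim 0 g ∂(κ x) = ∫ y, p t x y * g y ∂m := by
  have ht' : (0 : ℝ) < t := ht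
  rw [integral_eq_lintegral_pos_part_sub_lintegral_neg_part (integrable_elim hκ hg hB hgB t x),
    integral_eq_lintegral_pos_part_sub_lintegral_neg_part (hA.integrable_heat_mul hp hg hgB ht' x)]
  have key : ∀ φ : ℝ → ℝ≥0∞, Measurable φ → φ 0 = 0 →
      ∫⁻ w : CadlagPath E, φ ((w t).elim 0 g) ∂(κ x) =
        ∫⁻ y, ENNReal.ofReal (p t x y) * φ (g y) ∂m := by
    intro φ hφ h0
    rw [← h.density t ht x (fun y => φ (g y)) (hφ.comp hg)]
    refine lintegral_congr fun w => ?_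
    rcases w t with _ | y
    · exact h0
    · rfl
  have e1 := key (fun r => ENNReal.ofReal r) (by fun_prop) (by simp)
  have e2 := key (fun r => ENNReal.ofReal (-r)) (by fun_prop) (by simp)
  beta_reduce at e1 e2
  rw [e1, e2]
  congr 2 <;> refine lintegral_congr fun y => ?_
  · rw [ENNReal.ofReal_mul (h.nonneg_p t ht' x y)]
  · rw [← ENNReal.ofReal_mul (h.nonneg_p t ht' x y), mul_neg]

/-- The analytic solution `q` applied to `g` satisfies the probabilistic Duhamel equation:
`HasJumpDensity.integral_levy_time` turns the expected jump sum into a space-time integral, and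
`integral_rconv_mul` recognizes the convolution in it. Uniqueness then identifies it with the
Feynman-Kac operator. -/
lemma HasJumpDensity.exists_local_density (h : HasJumpDensity κ m p n) (hκ : IsMarkovLaw κ)
    (hp : IsHeatKernel D α b p) (hF : Measurable (Function.uncurry F)) (hd : ∀ x, F x x = 0)
    (hJ : IsKatoJump m D α (fkJumpBound F n) A Λ) :
    ∃ τ : ℝ≥0, 0 < τ ∧ (∀ x : OnePoint E, ∫⁻ w, jumpSum (expWeight F) 0 τ w ∂(κ x) ≤ 1 / 2) ∧
      ∃ c : ℝ, 0 < c ∧ ∃ q : ℝ → E → E → ℝ, IsProfKernel D α τ c q ∧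
        ∀ (g : E → ℝ) (B : ℝ), Measurable g → 0 ≤ B → (∀ x, |g x| ≤ B) → ∀ t : ℝ≥0, 0 < t → t < τ →
          ∀ x : E, ∫ w, fkWeight F g t w ∂(κ x) = ∫ z, q t x z * g z ∂m := by
  have hj := measurable_fkJump hF h.meas_n
  have hA := hJ.hasMass
  obtain ⟨t1, ht1, hη, hη', c, hc, q, hq, hqe⟩ :=
    (hJ.fkJump hF h.meas_n h.nonneg_n).exists_solution hj hp
  have h2 : ∀ᶠ t : ℝ in 𝓝[>] 0, ENNReal.ofReal b *
      katoMod m D α (fun u => ∫⁻ w, fkJumpBound F n u w ∂m) t ≤ 1 / 2 := by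
    have := ENNReal.Tendsto.const_mul hJ.kato_out (Or.inr (ENNReal.ofReal_ne_top (r := b)))
    rw [mul_zero] at this
    exact this.eventually_le_const (by simp)
  -- Staying strictly below `t1` makes the candidate continuous at every positive time up to and
  -- including τ.
  have h3 : ∀ᶠ t : ℝ in 𝓝[>] 0, t < t1 := (eventually_lt_nhds ht1).filter_mono nhdsWithin_le_nhds
  obtain ⟨τ', ⟨hτ1, hτ2⟩, hτ0⟩ := ((h2.and h3).and self_mem_nhdsWithin).exists
  have hτ0 : 0 < τ' := hτ0
  lift τ' to ℝ≥0 using hτ0.le with τ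
  have hτ0 : 0 < τ := hτ0
  have hexp : ∀ x : OnePoint E, ∫⁻ w, jumpSum (expWeight F) 0 τ w ∂(κ x) ≤ 1 / 2 := fun x =>
    (h.lintegral_expWeight_le hκ hp hF hd hτ0 x).trans hτ1
  refine ⟨τ, hτ0, hexp, c, hc, q, ⟨hq.meas, fun t ht htt => hq.bound t ht (htt.trans hτ2),
    hq.cont.mono (Set.prod_mono (Set.Ioo_subset_Ioo_right hτ2.le) subset_rfl)⟩, ?_⟩
  intro g B hg hB hgB t ht htτ x
  have := hκ.prob
  classical
  -- The uniqueness theorem asks for a bounded candidate at all times, equal to `g` at time 0; the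
  -- value zero beyond `t1` plays no role.
  set f : ℝ≥0 → E → ℝ := fun r y => if r = 0 then g y else
    if (r : ℝ) < t1 then kApply m q g r y else 0 with hf
  have hf0 : f 0 = g := by ext y; simp [hf]
  have hf1 : ∀ r : ℝ≥0, 0 < r → (r : ℝ) < t1 → ∀ y, f r y = kApply m q g r y := by
    intro r hr hr1 y
    simp [hf, hr.ne', hr1]
  set B' : ℝ := B + c * B * A.toReal
  have hB' : 0 ≤ B' := by positivity
  have hBc : 0 ≤ c * B * A.toReal := by positivity
  have hfB : ∀ r y, |f r y| ≤ B' := by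
    intro r y
    by_cases h0 : r = 0
    · rw [h0, hf0]; exact (hgB y).trans (by simp [B', hBc])
    by_cases h1 : (r : ℝ) < t1
    · have hr0 : 0 < r := pos_iff_ne_zero.2 h0
      rw [hf1 r hr0 h1]
      exact (hq.abs_kApply_le hA hc.le hB hgB hr0 h1 y).trans (by simp [B', hB])
    · simp [hf, h0, h1, hB']
  have hqm := hq.meas
  have hkm := measurable_kApply (m := m) hqm hg
  have hfm : Measurable fun v : ℝ≥0 × E => f v.1 v.2 := by
    refine Measurable.ite (measurable_fst (measurableSet_singleton 0)) (hg.comp measurable_snd) ?_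
    refine Measurable.ite (measurableSet_lt (by fun_prop) measurable_const) ?_ measurable_const
    exact hkm.comp (f := fun v : ℝ≥0 × E => ((v.1 : ℝ), v.2)) (by fun_prop)
  have hfc : ∀ (r : ℝ≥0) (y : E), 0 < r → (r : ℝ) < t1 → ContinuousAt (Function.uncurry f) (r, y) := by
    intro r y hr hr1
    have h1 := hq.continuousAt_kApply hA hc.le hg hgB (t := r) hr hr1 y
    have h2 : ContinuousAt (fun v : ℝ≥0 × E => kApply m q g v.1 v.2) (r, y) :=
      ContinuousAt.comp (x := (r, y)) (f := fun v : ℝ≥0 × E => ((v.1 : ℝ), v.2)) h1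
        (Continuous.continuousAt (by fun_prop))
    refine h2.congr ?_
    have e1 : ∀ᶠ v : ℝ≥0 × E in 𝓝 (r, y), 0 < v.1 :=
      continuousAt_fst.eventually (eventually_gt_nhds hr)
    have e2 : ∀ᶠ v : ℝ≥0 × E in 𝓝 (r, y), (v.1 : ℝ) < t1 :=
      (Continuous.continuousAt (f := fun v : ℝ≥0 × E => (v.1 : ℝ)) (by fun_prop)).eventually
        (eventually_lt_nhds hr1)
    filter_upwards [e1, e2] with v hv1 hv2
    exact (hf1 v.1 hv1 hv2 v.2).symm
  have hτ1' : ∀ r : ℝ≥0, r ≤ τ → (r : ℝ) < t1 := fun r hr => lt_of_le_of_lt (by exact_mod_cast hr) hτ2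
  have key := hκ.integral_fkWeight_eq (h := f) hF hd hg hB hgB hexp
    (fun r => hfm.comp (f := fun y : E => (r, y)) (by fun_prop)) hB' hfB
    (fun r y hr hrt => hfc r y hr (hτ1' r hrt.le)) hf0 ?_ htτ.le x
  · rw [key, hf1 t ht (hτ1' t htτ.le), kApply]
  intro r hr hrτ y
  have hrR : (0 : ℝ) < r := hr
  have hr1 := hτ1' r hrτ
  set G : E → E → ℝ≥0∞ := fun u w => ENNReal.ofReal B' * expWeight F u w
  have hGm : Measurable (Function.uncurry G) := (measurable_expWeight hF).const_mul _
  have hfin : ∫⁻ w, jumpSum G 0 r w ∂(κ y) ≠ ⊤ := by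
    have e : ∀ w, jumpSum G 0 r w ≤ ENNReal.ofReal B' * jumpSum (expWeight F) 0 τ w := fun w => by
      rw [jumpSum_const_mul]
      exact mul_le_mul_right (jumpSum_le _ le_rfl hrτ w) _
    refine ((lintegral_mono e).trans_lt ?_).ne
    rw [lintegral_const_mul' _ _ ENNReal.ofReal_ne_top]
    exact ENNReal.mul_lt_top ENNReal.ofReal_lt_top ((hexp y).trans_lt (by simp))
  have hem := measurable_expJump hF
  set φ : ℝ≥0 → E → E → ℝ := fun s u w => expJump F u w * f (r - s) w with hφ
  have hφm : Measurable fun v : ℝ≥0 × E × E => φ v.1 v.2.1 v.2.2 :=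
    (hem.comp (f := fun v : ℝ≥0 × E × E => (v.2.1, v.2.2)) (by fun_prop)).mul
      (hfm.comp (f := fun v : ℝ≥0 × E × E => (r - v.1, v.2.2)) (by fun_prop))
  have hφd : ∀ s u, φ s u u = 0 := fun s u => by simp [φ, expJump_diag hd]
  have hGd : ∀ u, G u u = 0 := fun u => by simp [G, expWeight_diag hd]
  have hφG : ∀ s u w, ENNReal.ofReal |φ s u w| ≤ G u w := by
    intro s u w
    simp only [G, φ, expWeight]
    rw [← ENNReal.ofReal_mul hB', abs_mul, mul_comm]
    exact ENNReal.ofReal_le_ofReal (mul_le_mul (hfB _ _) (abs_expJump_le F u w) (abs_nonneg _) hB')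
  have hlim : ∀ s ∈ Set.Ioc 0 r, ∀ u w,
      Tendsto (fun i => φ (gridCeil r i s) u w) atTop (𝓝 (φ s u w)) := by
    intro s hs u w
    refine Tendsto.const_mul _ ?_
    rcases hs.2.eq_or_lt with hsr | hsr
    · simp_rw [hsr, gridCeil_self hr]
      exact tendsto_const_nhds
    · have hc1 := hfc (r - s) w (tsub_pos_of_lt hsr)
        (lt_of_le_of_lt (by exact_mod_cast tsub_le_self) hr1)
      have hc2 : Tendsto (fun i => (r - gridCeil r i s, w)) atTop (𝓝 (r - s, w)) :=
        (tendsto_const_nhds.sub (tendsto_gridCeil hr s)).prodMk_nhds tendsto_const_nhds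
      exact hc1.tendsto.comp hc2
  obtain ⟨i1, i2⟩ := h.integral_levy_time hr hφm hφd hGm hGd hφG y hfin hlim
  have hjj : ∀ s w, jump (φ s) s w =
      jump (expJump F) s w * (w s).elim 0 (f (r - s)) := by
    intro s w
    unfold jump
    rcases w.leftVal s with _ | u
    · exact (zero_mul _).symm
    rcases w s with _ | v
    · exact (zero_mul _).symm
    · rfl
  simp_rw [hjj] at i1 i2
  rw [integral_add (integrable_elim hκ hg hB hgB r y) i1, i2,
    h.integral_density hκ hA hp hg hB hgB hr y, hf1 r hr hr1, kApply]
  obtain ⟨i3, i4⟩ := integral_rconv_mul (hJ.fkJump hF h.meas_n h.nonneg_n) hη hη' hj hp hc.le hq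
    hg hgB hrR hr1 y
  simp_rw [hqe r hrR hr1 y, add_mul]
  rw [integral_add (hA.integrable_heat_mul hp hg hgB hrR y) i3, i4]
  congr 1
  refine integral_congr_ae ?_
  -- The Lévy system integrates over (0, r] and the convolution over (0, r).
  have hne : ∀ᵐ v : ℝ × E × E ∂(volume.prod (m.prod m)), v.1 ≠ r :=
    Measure.quasiMeasurePreserving_fst.ae (Measure.ae_ne volume (r : ℝ))
  filter_upwards [hne] with v hv
  by_cases hvI : v.1 ∈ Set.Ioo (0 : ℝ) r
  · have hv2 : v.1 ∈ Set.Ioc (0 : ℝ) r := ⟨hvI.1, hvI.2.le⟩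
    rw [Set.indicator_of_mem hvI, Set.indicator_of_mem hv2]
    have e1 : ((r - v.1.toNNReal : ℝ≥0) : ℝ) = r - v.1 := by
      rw [NNReal.coe_sub (Real.toNNReal_le_iff_le_coe.2 hvI.2.le), Real.coe_toNNReal _ hvI.1.le]
    have e2 : 0 < r - v.1.toNNReal := by
      rw [← NNReal.coe_pos, e1]; linarith [hvI.2]
    simp only [φ]
    rw [hf1 _ e2 (by rw [e1]; linarith [hvI.1]), e1, fkJump]
    ring
  · have hv2 : v.1 ∉ Set.Ioc (0 : ℝ) r := fun hh => hvI ⟨hh.1, lt_of_le_of_ne hh.2 hv⟩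
    rw [Set.indicator_of_notMem hvI, Set.indicator_of_notMem hv2]

end Local

/-! ### Exponential moments for all times and the semigroup property. -/

section Semigroup
open CadlagPath ProbabilityTheory
variable {E : Type*} [MetricSpace E] [ProperSpace E] [MeasurableSpace E] [BorelSpace E]
  {κ : Kernel (OnePoint E) (CadlagPath E)} {F : E → E → ℝ} {g : E → ℝ} {B : ℝ} {s t : ℝ≥0}
  {K K' : ℝ≥0∞}

/-- The exponential of the total mass of the jumps seen through `F`. -/
def expAbs (F : E → E → ℝ) (t : ℝ≥0) (w : CadlagPath E) : ℝ≥0∞ := EReal.exp (jumpAbs F 0 t w)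

lemma measurable_expAbs (hF : Measurable (Function.uncurry F)) (hd : ∀ x, F x x = 0) (t : ℝ≥0) :
    Measurable (expAbs F t) :=
  EReal.measurable_exp.comp
    (measurable_coe_ennreal_ereal.comp (measurable_jumpAbs hF hd 0 t))

lemma expAbs_of_ne_top {w : CadlagPath E} (h : jumpAbs F 0 t w ≠ ⊤) :
    expAbs F t w = ENNReal.ofReal (Real.exp (jumpAbs F 0 t w).toReal) := by
  unfold expAbs
  rw [← EReal.exp_coe, EReal.coe_ennreal_toReal h]

lemma expAbs_of_eq_top {w : CadlagPath E} (h : jumpAbs F 0 t w = ⊤) : expAbs F t w = ⊤ := by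
  unfold expAbs
  rw [h, EReal.coe_ennreal_top, EReal.exp_top]

/-- With values in [0, ∞] the exponential is multiplicative without any summability; the convergence
of the jump sum over long times is afterwards deduced from the finiteness of the moment. -/
lemma expAbs_add (s t : ℝ≥0) (w : CadlagPath E) :
    expAbs F (s + t) w = expAbs F s (freeze s w) * expAbs F t (shift s w) := by
  unfold expAbs
  rw [← EReal.exp_add, ← EReal.coe_ennreal_add]
  unfold jumpAbs
  rw [jumpSum_freeze _ _ le_rfl, jumpSum_shift, add_zero, ← jumpSum_add _ zero_le le_self_add]

/-- The exponential moments up to time `t` are bounded by `K`. -/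
def ExpMoment (κ : Kernel (OnePoint E) (CadlagPath E)) (F : E → E → ℝ) (t : ℝ≥0) (K : ℝ≥0∞) : Prop :=
  ∀ x, ∫⁻ w, expAbs F t w ∂(κ x) ≤ K

lemma ExpMoment.mono (h : ExpMoment κ F t K) (hst : s ≤ t) : ExpMoment κ F s K := fun x =>
  (lintegral_mono fun w => EReal.exp_monotone
    (EReal.coe_ennreal_le_coe_ennreal_iff.2 (jumpSum_le _ le_rfl hst w))).trans (h x)

/-- The Markov property at time `s`, the second bound being uniform in the point reached, the
cemetery included. Iterated, it carries the bound 2 for small times to all times. -/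
lemma ExpMoment.add (hκ : IsMarkovLaw κ) (hF : Measurable (Function.uncurry F))
    (hd : ∀ x, F x x = 0) (h : ExpMoment κ F s K) (h' : ExpMoment κ F t K') :
    ExpMoment κ F (s + t) (K * K') := by
  intro x
  have hs := measurable_expAbs hF hd s
  have ht := measurable_expAbs hF hd t
  have e := hκ.lintegral_eq x s (Ψ := fun w w' => expAbs F s w * expAbs F t w')
    ((hs.comp measurable_fst).mul (ht.comp measurable_snd))
  simp_rw [expAbs_add]
  rw [e]
  calc ∫⁻ w, ∫⁻ w', expAbs F s (freeze s w) * expAbs F t w' ∂(κ (w s)) ∂(κ x)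
      ≤ ∫⁻ w, expAbs F s w * K' ∂(κ x) := by
        refine lintegral_mono fun w => ?_
        beta_reduce
        rw [lintegral_const_mul _ ht]
        have e1 : expAbs F s (freeze s w) = expAbs F s w := by
          unfold expAbs jumpAbs
          rw [jumpSum_freeze _ _ le_rfl]
        rw [e1]
        exact mul_le_mul_right (h' _) _
    _ = (∫⁻ w, expAbs F s w ∂(κ x)) * K' := lintegral_mul_const _ hs
    _ ≤ K * K' := mul_le_mul_left (h x) _

lemma expMoment_two (hκ : IsMarkovLaw κ) (hF : Measurable (Function.uncurry F))
    (hd : ∀ x, F x x = 0) (ht : 0 < t)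
    (hG : ∀ x, ∫⁻ w, jumpSum (expWeight F) 0 t w ∂(κ x) ≤ 1 / 2) : ExpMoment κ F t 2 := by
  intro x
  refine le_trans (le_of_eq (lintegral_congr_ae ?_)) (hκ.exp_le_two hF hd ht hG x)
  filter_upwards [ae_jumpSum_ne_top hF hd hG x] with w hw
  exact expAbs_of_ne_top (ne_top_of_le_ne_top hw (jumpAbs_le_expWeight F 0 t w))

lemma ExpMoment.ae_ne_top (h : ExpMoment κ F t K) (hK : K ≠ ⊤)
    (hF : Measurable (Function.uncurry F)) (hd : ∀ x, F x x = 0) (x : OnePoint E) :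
    ∀ᵐ w ∂(κ x), jumpAbs F 0 t w ≠ ⊤ := by
  filter_upwards [ae_lt_top (measurable_expAbs hF hd t) (ne_top_of_le_ne_top hK (h x))] with w hw h0
  exact hw.ne (expAbs_of_eq_top h0)

lemma ExpMoment.integrable_exp (h : ExpMoment κ F t K) (hK : K ≠ ⊤)
    (hF : Measurable (Function.uncurry F)) (hd : ∀ x, F x x = 0) (x : OnePoint E) :
    Integrable (fun w => Real.exp (jumpAbs F 0 t w).toReal) (κ x) := by
  have hm : Measurable fun w => Real.exp (jumpAbs F 0 t w).toReal :=
    Real.measurable_exp.comp (measurable_jumpAbs hF hd 0 t).ennreal_toReal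
  refine ⟨hm.aestronglyMeasurable, ?_⟩
  rw [hasFiniteIntegral_iff_ofReal (Eventually.of_forall fun w => (Real.exp_pos _).le)]
  refine lt_of_le_of_lt (le_of_eq (lintegral_congr_ae ?_)) ((h x).trans_lt hK.lt_top)
  filter_upwards [h.ae_ne_top hK hF hd x] with w hw
  exact (expAbs_of_ne_top hw).symm

lemma abs_fkWeight_le (hB : 0 ≤ B) (hgB : ∀ x, |g x| ≤ B) (w : CadlagPath E) :
    |fkWeight F g t w| ≤ B * Real.exp (jumpAbs F 0 t w).toReal := by
  unfold fkWeight
  rw [abs_mul, Real.abs_exp, mul_comm B]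
  exact mul_le_mul (Real.exp_le_exp.2 ((neg_le_abs _).trans (abs_jumpSumR_le F 0 t w)))
    (abs_elim_le hB hgB _) (abs_nonneg _) (Real.exp_pos _).le

lemma ExpMoment.integrable_fkWeight (h : ExpMoment κ F t K) (hK : K ≠ ⊤)
    (hF : Measurable (Function.uncurry F)) (hd : ∀ x, F x x = 0) (hg : Measurable g) (hB : 0 ≤ B)
    (hgB : ∀ x, |g x| ≤ B) (x : OnePoint E) : Integrable (fkWeight F g t) (κ x) :=
  ((h.integrable_exp hK hF hd x).const_mul B).mono'
    (measurable_fkWeight hF hd hg t).aestronglyMeasurable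
    (Eventually.of_forall fun w => abs_fkWeight_le hB hgB w)

lemma IsMarkovLaw.integral_fkWeight_infty (hκ : IsMarkovLaw κ) :
    ∫ w, fkWeight F g t w ∂(κ OnePoint.infty) = 0 := by
  refine (integral_congr_ae ?_).trans (integral_zero _ _)
  filter_upwards [hκ.trap t] with w hw
  unfold fkWeight
  rw [hw]
  exact mul_zero _

/-- The semigroup property of the Feynman-Kac operators. -/
lemma ExpMoment.integral_fkWeight_add (hκ : IsMarkovLaw κ) (hs : ExpMoment κ F s K) (hK : K ≠ ⊤)
    (ht : ExpMoment κ F t K') (hK' : K' ≠ ⊤) (hF : Measurable (Function.uncurry F))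
    (hd : ∀ x, F x x = 0) (hg : Measurable g) (hB : 0 ≤ B) (hgB : ∀ x, |g x| ≤ B) (x : OnePoint E) :
    ∫ w, fkWeight F g (s + t) w ∂(κ x) =
      ∫ w, fkWeight F (fun y : E => ∫ w', fkWeight F g t w' ∂(κ y)) s w ∂(κ x) := by
  have hst := hs.add hκ hF hd ht
  have hKK : K * K' ≠ ⊤ := ENNReal.mul_ne_top hK hK'
  have hsplit : ∀ᵐ w ∂(κ x), fkWeight F g (s + t) w =
      Real.exp (-jumpSumR F 0 s (freeze s w)) * fkWeight F g t (shift s w) := by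
    filter_upwards [hst.ae_ne_top hKK hF hd x] with w hw
    have h1 := fkWeight_shift (F := F) (g := g) (show s ≤ s + t from le_self_add) w
    rw [add_tsub_cancel_left] at h1
    rw [h1, jumpSumR_freeze _ _ le_rfl, fkWeight, jumpSumR_add zero_le
      (le_self_add : s ≤ s + t) ((summable_jump_iff _ _ _ _).2 hw), neg_add, Real.exp_add, mul_assoc]
  have hm : Measurable (Function.uncurry fun w w' : CadlagPath E =>
      Real.exp (-jumpSumR F 0 s w) * fkWeight F g t w') :=
    ((Real.measurable_exp.comp (measurable_jumpSumR hF hd 0 s).neg).comp measurable_fst).mul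
      ((measurable_fkWeight hF hd hg t).comp measurable_snd)
  have e := hκ.integral_eq x s hm ((hst.integrable_fkWeight hKK hF hd hg hB hgB x).congr hsplit)
  rw [integral_congr_ae hsplit, e]
  refine integral_congr_ae (Eventually.of_forall fun w => ?_)
  beta_reduce
  rw [integral_const_mul, jumpSumR_freeze _ _ le_rfl, fkWeight]
  congr 1
  -- At the cemetery the expectation of the weight vanishes, in agreement with the extension by
  -- zero.
  rcases hw : w s with _ | y
  · exact hκ.integral_fkWeight_infty
  · rfl

end Semigroup

/-! ### Representing kernels: uniqueness and composition. -/

section Composition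
open CadlagPath ProbabilityTheory
variable {E : Type*} [MetricSpace E] [ProperSpace E] [MeasurableSpace E] [BorelSpace E]
  {κ : Kernel (OnePoint E) (CadlagPath E)} {m : Measure E} [SFinite m] {D α : ℝ} {A : ℝ≥0∞}
  {F : E → E → ℝ} {p Q R : ℝ → E → E → ℝ} {b c c' T T' T'' θ θ' : ℝ}

/-- Indicators as test functions give the inequality almost everywhere; by continuity the set where
it fails is open, and an open null set is empty. -/
lemma le_of_forall_integral_mul_le [m.IsOpenPosMeasure] {f h : E → ℝ} (hf : Continuous f)
    (hh : Continuous h) (hfi : Integrable f m) (hhi : Integrable h m)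
    (hle : ∀ g : E → ℝ, Measurable g → (∀ x, 0 ≤ g x) → (∀ x, |g x| ≤ 1) →
      ∫ x, f x * g x ∂m ≤ ∫ x, h x * g x ∂m) (x : E) : f x ≤ h x := by
  have hae : f ≤ᵐ[m] h := by
    refine ae_le_of_forall_setIntegral_le hfi hhi fun S hS _ => ?_
    have h1 := hle (S.indicator fun _ => 1) (measurable_const.indicator hS)
      (fun x => Set.indicator_nonneg (fun _ _ => zero_le_one) x) (fun x => by
        by_cases hx : x ∈ S <;> simp [hx])
    have e : ∀ k : E → ℝ, ∫ x, k x * S.indicator (fun _ => 1) x ∂m = ∫ x in S, k x ∂m := by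
      intro k
      rw [← integral_indicator hS]
      refine integral_congr_ae (Eventually.of_forall fun x => ?_)
      by_cases hx : x ∈ S <;> simp [hx]
    rwa [e, e] at h1
  have hU : IsOpen {x | h x < f x} := isOpen_lt hh hf
  have h0 : m {x | h x < f x} = 0 := by
    simpa [Filter.EventuallyLE, ae_iff, not_le] using hae
  have h1 := hU.eq_empty_of_measure_zero h0
  by_contra hx
  have : x ∈ {x | h x < f x} := not_le.1 hx
  rw [h1] at this
  exact this

lemma eq_of_forall_integral_mul_eq [m.IsOpenPosMeasure] {f h : E → ℝ} (hf : Continuous f)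
    (hh : Continuous h) (hfi : Integrable f m) (hhi : Integrable h m)
    (heq : ∀ g : E → ℝ, Measurable g → (∀ x, |g x| ≤ 1) →
      ∫ x, f x * g x ∂m = ∫ x, h x * g x ∂m) (x : E) : f x = h x :=
  le_antisymm (le_of_forall_integral_mul_le hf hh hfi hhi (fun g hg _ hgB => (heq g hg hgB).le) x)
    (le_of_forall_integral_mul_le hh hf hhi hfi (fun g hg _ hgB => (heq g hg hgB).ge) x)

/-- The kernel `k` represents the Feynman-Kac operator at time `t`. -/
def FKRep (κ : Kernel (OnePoint E) (CadlagPath E)) (m : Measure E) (F : E → E → ℝ) (t : ℝ≥0)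
    (k : E → E → ℝ) : Prop :=
  ∀ (g : E → ℝ) (B : ℝ), Measurable g → 0 ≤ B → (∀ x, |g x| ≤ B) →
    ∀ x : E, ∫ w, fkWeight F g t w ∂(κ x) = ∫ z, k x z * g z ∂m

/-- The composition of two time-dependent kernels, run for the fractions `θ` and `θ'` of the time. -/
def kcomp (m : Measure E) (θ θ' : ℝ) (Q R : ℝ → E → E → ℝ) (t : ℝ) (x z : E) : ℝ :=
  ∫ y, Q (θ * t) x y * R (θ' * t) y z ∂m

lemma measurable_kcomp (hQ : Measurable fun q : ℝ × E × E => Q q.1 q.2.1 q.2.2)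
    (hR : Measurable fun q : ℝ × E × E => R q.1 q.2.1 q.2.2) (θ θ' : ℝ) :
    Measurable fun q : ℝ × E × E => kcomp m θ θ' Q R q.1 q.2.1 q.2.2 := by
  have h1 : Measurable fun q : (ℝ × E × E) × E =>
      Q (θ * q.1.1) q.1.2.1 q.2 * R (θ' * q.1.1) q.2 q.1.2.2 :=
    (hQ.comp (f := fun q : (ℝ × E × E) × E => (θ * q.1.1, q.1.2.1, q.2)) (by fun_prop)).mul
      (hR.comp (f := fun q : (ℝ × E × E) × E => (θ' * q.1.1, q.2, q.1.2.2)) (by fun_prop))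
  exact (h1.stronglyMeasurable.integral_prod_right' (ν := m)).measurable

lemma IsProfKernel.continuous_right (hQ : IsProfKernel D α T c Q) {t : ℝ} (ht : 0 < t) (htT : t < T)
    (x : E) : Continuous (Q t x) := by
  refine continuous_iff_continuousAt.2 fun z => ?_
  exact ContinuousAt.comp (x := z) (f := fun z : E => (t, x, z)) (hQ.continuousAt ht htT x z)
    (by fun_prop)

lemma IsProfKernel.integrable (hQ : IsProfKernel D α T c Q) (hA : HasMass m D α A) {t : ℝ}
    (ht : 0 < t) (htT : t < T) (x : E) : Integrable (Q t x) m := by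
  simpa using hQ.integrable_mul (g := fun _ => (1 : ℝ)) (B := 1) hA measurable_const (by simp) ht htT x

lemma IsHeatKernel.isProfKernel (hp : IsHeatKernel D α b p) (T : ℝ) : IsProfKernel D α T b p :=
  ⟨hp.meas, fun s hs _ => hp.bound s hs, hp.cont.mono (Set.prod_mono (fun _ hs => hs.1) subset_rfl)⟩

lemma IsProfKernel.continuousAt_kcomp (hA : HasMass m D α A) (hc : 0 ≤ c) (hc' : 0 ≤ c')
    (hθ : 0 < θ) (hθ' : 0 < θ') (hQ : IsProfKernel D α T c Q) (hR : IsProfKernel D α T' c' R)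
    {t : ℝ} (ht : 0 < t) (htT : θ * t < T) (htT' : θ' * t < T') (x z : E) :
    ContinuousAt (fun v : ℝ × E × E => kcomp m θ θ' Q R v.1 v.2.1 v.2.2) (t, x, z) := by
  have hQm := hQ.meas
  have hRm := hR.meas
  set δ := θ * (t / 2) with hδd
  set δ' := θ' * (t / 2) with hδd'
  have hδ : 0 < δ := by positivity
  have hδ' : 0 < δ' := by positivity
  refine continuousAt_of_dominated (bound := fun y =>
    c * (T / δ * 2 ^ D * prof D α δ (dist x y)) * (c' * (T' / δ' * prof D α δ' 0))) ?_ ?_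
    ((((hA.integrable_prof hδ x).1.const_mul _).const_mul c).mul_const _) ?_
  · refine Eventually.of_forall fun v => Measurable.aestronglyMeasurable ?_
    exact (hQm.comp (f := fun y : E => (θ * v.1, v.2.1, y)) (by fun_prop)).mul
      (hRm.comp (f := fun y : E => (θ' * v.1, y, v.2.2)) (by fun_prop))
  · have h0 : ∀ᶠ v : ℝ × E × E in 𝓝 (t, x, z), t / 2 < v.1 :=
      continuousAt_fst.eventually (eventually_gt_nhds (by simpa using by linarith))
    have h1 : ∀ᶠ v : ℝ × E × E in 𝓝 (t, x, z), θ * v.1 < T :=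
      (show ContinuousAt (fun v : ℝ × E × E => θ * v.1) (t, x, z) by fun_prop).eventually_lt_const htT
    have h2 : ∀ᶠ v : ℝ × E × E in 𝓝 (t, x, z), θ' * v.1 < T' :=
      (show ContinuousAt (fun v : ℝ × E × E => θ' * v.1) (t, x, z) by fun_prop).eventually_lt_const
        htT'
    have h3 : ∀ᶠ v : ℝ × E × E in 𝓝 (t, x, z), dist v.2.1 x < δ ^ (1 / α) := by
      have : ContinuousAt (fun v : ℝ × E × E => dist v.2.1 x) (t, x, z) := by fun_prop
      refine this.eventually_lt_const ?_
      simpa using Real.rpow_pos_of_pos hδ _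
    filter_upwards [h0, h1, h2, h3] with v hv0 hv1 hv2 hv3
    refine Eventually.of_forall fun y => ?_
    have l1 : δ ≤ θ * v.1 := mul_le_mul_of_nonneg_left hv0.le hθ.le
    have l2 : δ' ≤ θ' * v.1 := mul_le_mul_of_nonneg_left hv0.le hθ'.le
    have e1 := (hQ.bound _ (hδ.trans_le l1) hv1 v.2.1 y).trans
      (mul_le_mul_of_nonneg_left (prof_near hA.hD hA.hα hδ l1 hv1.le hv3.le y) hc)
    have e2 := (hR.bound _ (hδ'.trans_le l2) hv2 y v.2.2).trans
      (mul_le_mul_of_nonneg_left (prof_le_const hA.hD hA.hα hδ' l2 hv2.le dist_nonneg) hc')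
    rw [Real.norm_eq_abs, abs_mul]
    exact mul_le_mul e1 e2 (abs_nonneg _) ((abs_nonneg _).trans e1)
  · refine Eventually.of_forall fun y => ContinuousAt.mul ?_ ?_
    · exact ContinuousAt.comp (x := ((t, x, z) : ℝ × E × E))
        (f := fun v : ℝ × E × E => (θ * v.1, v.2.1, y))
        (hQ.continuousAt (by positivity) htT x y) (by fun_prop)
    · exact ContinuousAt.comp (x := ((t, x, z) : ℝ × E × E))
        (f := fun v : ℝ × E × E => (θ' * v.1, y, v.2.2))
        (hR.continuousAt (by positivity) htT' y z) (by fun_prop)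

lemma IsProfKernel.integrable_comp (hA : HasMass m D α A) (hc' : 0 ≤ c')
    (hQ : IsProfKernel D α T c Q) (hR : IsProfKernel D α T' c' R) {s t : ℝ} (hs : 0 < s) (hsT : s < T)
    (ht : 0 < t) (htT : t < T') (x z : E) : Integrable (fun y => Q s x y * R t y z) m := by
  have hRm := hR.meas
  refine hQ.integrable_mul (B := c' * (t / t * prof D α t 0)) hA
    (hRm.comp (f := fun y : E => (t, y, z)) (by fun_prop)) (fun y => ?_) hs hsT x
  exact (hR.bound t ht htT y z).trans (mul_le_mul_of_nonneg_left
    (prof_le_const hA.hD hA.hα ht le_rfl le_rfl dist_nonneg) hc')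

lemma IsProfKernel.integrable_comp_prod (hA : HasMass m D α A) (hc' : 0 ≤ c') (hQ : IsProfKernel D α T c Q)
    (hR : IsProfKernel D α T' c' R) {s t : ℝ} (hs : 0 < s) (hsT : s < T) (ht : 0 < t) (htT : t < T')
    {g : E → ℝ} {B : ℝ} (hg : Measurable g) (hB : 0 ≤ B) (hgB : ∀ x, |g x| ≤ B) (x : E) :
    Integrable (Function.uncurry fun y z => Q s x y * R t y z * g z) (m.prod m) := by
  have hQm := hQ.meas
  have hRm := hR.meas
  have hfm : Measurable fun q : E × E => Q s x q.1 * R t q.1 q.2 * g q.2 :=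
    ((hQm.comp (f := fun q : E × E => (s, x, q.1)) (by fun_prop)).mul
      (hRm.comp (f := fun q : E × E => (t, q.1, q.2)) (by fun_prop))).mul
      (hg.comp measurable_snd)
  refine (integrable_prod_iff hfm.aestronglyMeasurable).2 ⟨Eventually.of_forall fun y => ?_, ?_⟩
  · change Integrable (fun z => Q s x y * R t y z * g z) m
    simp_rw [mul_assoc]
    exact (hR.integrable_mul hA hg hgB ht htT y).const_mul _
  · have h1 := ((hQ.integrable hA hs hsT x).abs).mul_const (c' * B * A.toReal)
    refine h1.mono' (hfm.norm.stronglyMeasurable.integral_prod_right' (ν := m)).aestronglyMeasurable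
      (Eventually.of_forall fun y => ?_)
    have h2 := (hA.integrable_prof ht y)
    change ‖∫ z, ‖Q s x y * R t y z * g z‖ ∂m‖ ≤ |Q s x y| * (c' * B * A.toReal)
    simp_rw [mul_assoc, norm_mul]
    rw [integral_const_mul, Real.norm_eq_abs, abs_of_nonneg (by positivity), Real.norm_eq_abs]
    refine mul_le_mul_of_nonneg_left ?_ (abs_nonneg _)
    calc ∫ z, ‖R t y z‖ * ‖g z‖ ∂m ≤ ∫ z, c' * B * prof D α t (dist y z) ∂m := by
          refine integral_mono_of_nonneg (Eventually.of_forall fun z => by positivity)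
            (h2.1.const_mul _) (Eventually.of_forall fun z => ?_)
          beta_reduce
          rw [mul_right_comm]
          exact mul_le_mul (hR.bound t ht htT y z) (hgB z) (norm_nonneg _)
            ((abs_nonneg _).trans (hR.bound t ht htT y z))
      _ = c' * B * ∫ z, prof D α t (dist y z) ∂m := integral_const_mul _ _
      _ ≤ c' * (B * A.toReal) := by
          rw [← mul_assoc]
          exact mul_le_mul_of_nonneg_left h2.2 (by positivity)

/-- Composition of representing kernels. -/
lemma FKRep.comp (hκ : IsMarkovLaw κ) (hA : HasMass m D α A) (hF : Measurable (Function.uncurry F))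
    (hd : ∀ x, F x x = 0) {s t : ℝ≥0} {K K' : ℝ≥0∞} (hKs : ExpMoment κ F s K) (hK : K ≠ ⊤)
    (hKt : ExpMoment κ F t K') (hK' : K' ≠ ⊤) (hc' : 0 ≤ c')
    (hQ : IsProfKernel D α T c Q) (hR : IsProfKernel D α T' c' R) (hs : 0 < s) (hsT : s < T)
    (ht : 0 < t) (htT : t < T') (hQr : FKRep κ m F s (Q s)) (hRr : FKRep κ m F t (R t)) :
    FKRep κ m F (s + t) fun x z => ∫ y, Q s x y * R t y z ∂m := by
  intro g B hg hB hgB x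
  have hsR : (0 : ℝ) < s := hs
  have htR : (0 : ℝ) < t := ht
  have hQm := hQ.meas
  have hRm := hR.meas
  rw [hKs.integral_fkWeight_add hκ hK hKt hK' hF hd hg hB hgB x]
  have e1 : (fun y : E => ∫ w', fkWeight F g t w' ∂(κ y)) = kApply m R g t :=
    funext fun y => hRr g B hg hB hgB y
  have hkm : Measurable (kApply m R g t) :=
    (measurable_kApply (m := m) hRm hg).comp (f := fun y : E => ((t : ℝ), y)) (by fun_prop)
  have hB' : 0 ≤ c' * B * A.toReal := by positivity
  have hkB : ∀ y, |kApply m R g t y| ≤ c' * B * A.toReal := fun y =>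
    hR.abs_kApply_le hA hc' hB hgB htR htT y
  rw [e1, hQr _ _ hkm hB' hkB x]
  have hint := hQ.integrable_comp_prod hA hc' hR hsR hsT htR htT hg hB hgB x
  have h3 := integral_integral_swap hint
  calc ∫ y, Q s x y * kApply m R g t y ∂m = ∫ y, (∫ z, Q s x y * R t y z * g z ∂m) ∂m := by
        refine integral_congr_ae (Eventually.of_forall fun y => ?_)
        simp_rw [mul_assoc]
        exact (integral_const_mul _ _).symm
    _ = ∫ z, (∫ y, Q s x y * R t y z * g z ∂m) ∂m := h3
    _ = ∫ z, (∫ y, Q s x y * R t y z ∂m) * g z ∂m := by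
        simp_rw [integral_mul_const]

end Composition

/-! ### Two-sided comparison with the transition density, for all times. -/

section Global
open CadlagPath ProbabilityTheory
variable {E : Type*} [MetricSpace E] [ProperSpace E] [MeasurableSpace E] [BorelSpace E]
  {κ : Kernel (OnePoint E) (CadlagPath E)} {m : Measure E} [SFinite m] [m.IsOpenPosMeasure]
  {D α : ℝ} {A : ℝ≥0∞} {F n : E → E → ℝ} {p Q R : ℝ → E → E → ℝ} {a b c c' T T' Λ : ℝ}

/-- A family of laws whose transition density is comparable with the profile, and a perturbation in
the Kato class. -/
structure IsKatoPerturbation (κ : Kernel (OnePoint E) (CadlagPath E)) (m : Measure E) (D α a b : ℝ)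
    (p : ℝ → E → E → ℝ) (n F : E → E → ℝ) (A : ℝ≥0∞) (Λ : ℝ) : Prop where
  law : IsMarkovLaw κ
  density : HasJumpDensity κ m p n
  heat : IsHeatKernel D α b p
  pos : 0 < a
  lower : ∀ t, 0 < t → ∀ x z, a * prof D α t (dist x z) ≤ p t x z
  meas : Measurable (Function.uncurry F)
  diag : ∀ x, F x x = 0
  kato : IsKatoJump m D α (fkJumpBound F n) A Λ

/-- A continuous kernel comparable with `p` which represents the Feynman-Kac operators up to time
`T`. -/
structure IsFKKernel (κ : Kernel (OnePoint E) (CadlagPath E)) (m : Measure E) (p : ℝ → E → E → ℝ)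
    (F : E → E → ℝ) (T c : ℝ) (Q : ℝ → E → E → ℝ) : Prop where
  one_le : 1 ≤ c
  meas : Measurable fun q : ℝ × E × E => Q q.1 q.2.1 q.2.2
  cont : ContinuousOn (fun q : ℝ × E × E => Q q.1 q.2.1 q.2.2) (Set.Ioo 0 T ×ˢ Set.univ)
  lower : ∀ t, 0 < t → t < T → ∀ x z, c⁻¹ * p t x z ≤ Q t x z
  upper : ∀ t, 0 < t → t < T → ∀ x z, Q t x z ≤ c * p t x z
  rep : ∀ t : ℝ≥0, 0 < t → t < T → FKRep κ m F t (Q t)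

lemma IsKatoPerturbation.neg (h : IsKatoPerturbation κ m D α a b p n F A Λ) :
    IsKatoPerturbation κ m D α a b p n (fun x y => -F x y) A Λ where
  law := h.law
  density := h.density
  heat := h.heat
  pos := h.pos
  lower := h.lower
  meas := h.meas.neg
  diag x := by simp [h.diag]
  kato := by
    have e : fkJumpBound (fun x y => -F x y) n = fkJumpBound F n := by
      ext u w
      simp only [fkJumpBound, expWeight, abs_neg]
    rw [e]
    exact h.kato

lemma IsKatoPerturbation.nonneg (h : IsKatoPerturbation κ m D α a b p n F A Λ) {t : ℝ} (ht : 0 < t)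
    (x z : E) : 0 ≤ p t x z := h.density.nonneg_p t ht x z

lemma IsFKKernel.nonneg (hQ : IsFKKernel κ m p F T c Q)
    (h : IsKatoPerturbation κ m D α a b p n F A Λ) {t : ℝ} (ht : 0 < t) (htT : t < T) (x z : E) :
    0 ≤ Q t x z := by
  have := hQ.one_le
  have := h.nonneg ht x z
  exact le_trans (by positivity) (hQ.lower t ht htT x z)

lemma IsFKKernel.isProfKernel (hQ : IsFKKernel κ m p F T c Q)
    (h : IsKatoPerturbation κ m D α a b p n F A Λ) : IsProfKernel D α T (c * b) Q := by
  refine ⟨hQ.meas, fun t ht htT x z => ?_, hQ.cont⟩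
  have hc := hQ.one_le
  rw [abs_of_nonneg (hQ.nonneg h ht htT x z), mul_assoc]
  refine (hQ.upper t ht htT x z).trans (mul_le_mul_of_nonneg_left ?_ (by linarith))
  exact (le_abs_self _).trans (h.heat.bound t ht x z)

lemma IsFKKernel.mul_nonneg (hQ : IsFKKernel κ m p F T c Q)
    (h : IsKatoPerturbation κ m D α a b p n F A Λ) : 0 ≤ c * b :=
  _root_.mul_nonneg (zero_le_one.trans hQ.one_le) h.heat.pos

lemma FKRep.eq {G : E → E → ℝ} {t : ℝ≥0} {k k' : E → E → ℝ}
    (hk : FKRep κ m G t k) (hk' : FKRep κ m G t k') {x : E} (hc : Continuous (k x))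
    (hc' : Continuous (k' x)) (hi : Integrable (k x) m) (hi' : Integrable (k' x) m) (z : E) :
    k x z = k' x z :=
  eq_of_forall_integral_mul_eq hc hc' hi hi' (fun g hg hgB => by
    rw [← hk g 1 hg zero_le_one hgB x, hk' g 1 hg zero_le_one hgB x]) z

lemma fkWeight_zero (g : E → ℝ) (t : ℝ≥0) (w : CadlagPath E) :
    fkWeight (fun _ _ => 0) g t w = (w t).elim 0 g := by
  have h0 : ∀ s, jump (fun _ _ : E => (0 : ℝ)) s w = 0 := fun s => by
    unfold jump
    rcases w.leftVal s with _ | u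
    · rfl
    rcases w s with _ | v <;> rfl
  simp only [fkWeight, jumpSumR, h0, tsum_zero, neg_zero, Real.exp_zero, one_mul]

lemma expMoment_zero (hκ : IsMarkovLaw κ) (t : ℝ≥0) : ExpMoment κ (fun _ _ => 0) t 1 := by
  intro x
  have := hκ.prob
  have h0 : ∀ w, jumpAbs (fun _ _ : E => (0 : ℝ)) 0 t w = 0 := fun w => by
    refine ENNReal.tsum_eq_zero.2 fun s => ?_
    unfold jump
    rcases w.leftVal s with _ | u
    · rfl
    rcases w s with _ | v
    · rfl
    · exact (by simp : ENNReal.ofReal |(0 : ℝ)| = 0)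
  simp [expAbs, h0]

/-- For the zero perturbation the transition density is a representing kernel, so composition and
uniqueness of representing kernels contain the Chapman-Kolmogorov equation. -/
lemma IsKatoPerturbation.fkRep_zero (h : IsKatoPerturbation κ m D α a b p n F A Λ) {t : ℝ≥0}
    (ht : 0 < t) : FKRep κ m (fun _ _ => 0) t (p t) := by
  intro g B hg hB hgB x
  simp_rw [fkWeight_zero]
  exact h.density.integral_density h.law h.kato.hasMass h.heat hg hB hgB ht x

lemma continuous_comp_right {s t : ℝ} (hA : HasMass m D α A) (hc : 0 ≤ c) (hc' : 0 ≤ c')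
    (hQ : IsProfKernel D α T c Q) (hR : IsProfKernel D α T' c' R) (hs : 0 < s) (hsT : s < T)
    (ht : 0 < t) (htT : t < T') (x : E) : Continuous fun z => ∫ y, Q s x y * R t y z ∂m := by
  refine continuous_iff_continuousAt.2 fun z => ?_
  -- With `s` and `t` in the role of the fractions, `kcomp` at time 1 is the composition in
  -- question.
  have h1 := hQ.continuousAt_kcomp hA hc hc' hs ht hR zero_lt_one (by simpa using hsT)
    (by simpa using htT) x z
  have h2 := ContinuousAt.comp (x := z) (f := fun z : E => ((1 : ℝ), x, z)) h1 (by fun_prop)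
  simpa [kcomp, Function.comp_def] using h2

lemma integrable_comp_right {s t : ℝ} (hA : HasMass m D α A) (hc' : 0 ≤ c')
    (hQ : IsProfKernel D α T c Q) (hR : IsProfKernel D α T' c' R) (hs : 0 < s) (hsT : s < T)
    (ht : 0 < t) (htT : t < T') (x : E) : Integrable (fun z => ∫ y, Q s x y * R t y z ∂m) m := by
  have h1 := hQ.integrable_comp_prod (g := fun _ => (1 : ℝ)) (B := 1) hA hc' hR hs hsT ht htT
    measurable_const zero_le_one (by simp) x
  have h2 := h1.integral_prod_right
  simpa using h2

/-- The Chapman-Kolmogorov equation. -/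
lemma IsKatoPerturbation.chapman_kolmogorov (h : IsKatoPerturbation κ m D α a b p n F A Λ) {s t : ℝ}
    (hs : 0 < s) (ht : 0 < t) (x z : E) : ∫ y, p s x y * p t y z ∂m = p (s + t) x z := by
  lift s to ℝ≥0 using hs.le
  lift t to ℝ≥0 using ht.le
  have hA := h.kato.hasMass
  have hk := h.heat.isProfKernel (s + t + 1)
  have hs1 : (s : ℝ) < s + t + 1 := by linarith
  have ht1 : (t : ℝ) < s + t + 1 := by linarith
  have h1 : FKRep κ m (fun _ _ => 0) (s + t) fun x z => ∫ y, p s x y * p t y z ∂m :=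
    FKRep.comp h.law hA measurable_const (fun _ => rfl) (expMoment_zero h.law s) (by simp)
      (expMoment_zero h.law t) (by simp) h.heat.pos hk hk hs hs1 ht ht1 (h.fkRep_zero hs)
      (h.fkRep_zero ht)
  have h2 := h.fkRep_zero (t := s + t) (add_pos hs ht)
  rw [NNReal.coe_add] at h2
  have hst : (s : ℝ) + t < s + t + 1 := by linarith
  exact FKRep.eq h1 h2
    (continuous_comp_right hA h.heat.pos h.heat.pos hk hk hs hs1 ht ht1 x)
    (hk.continuous_right (add_pos hs ht) hst x)
    (integrable_comp_right hA h.heat.pos hk hk hs hs1 ht ht1 x) (hk.integrable hA (add_pos hs ht) hst x) z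

lemma jumpSumR_neg (F : E → E → ℝ) (a b : ℝ≥0) (w : CadlagPath E) :
    jumpSumR (fun x y => -F x y) a b w = -jumpSumR F a b w := by
  unfold jumpSumR
  rw [← tsum_neg]
  exact tsum_congr fun s => jump_map (fun r : ℝ => -r) neg_zero F s w

/-- The convex function 1/y lies above its tangent 2/c - y/c^2 at y = c, that is, (c - y)^2 ≥ 0;
here y = e^A. A lower bound for the weight of `F` thus follows from an upper bound for the weight of
`-F`. -/
lemma two_div_sub_le_fkWeight (hc : 0 < c) {g : E → ℝ} (hg : ∀ x, 0 ≤ g x) (t : ℝ≥0)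
    (w : CadlagPath E) : 2 / c * (w t).elim 0 g - (c ^ 2)⁻¹ * fkWeight (fun x y => -F x y) g t w ≤
      fkWeight F g t w := by
  unfold fkWeight
  rw [jumpSumR_neg, neg_neg]
  have h0 : 0 ≤ (w t).elim 0 g := by
    rcases w t with _ | y
    · exact le_rfl
    · exact hg y
  set r := jumpSumR F 0 t w
  have e1 : Real.exp (-r) * Real.exp r = 1 := by rw [← Real.exp_add]; simp
  have e2 := Real.exp_pos r
  have key : 2 / c - (c ^ 2)⁻¹ * Real.exp r ≤ Real.exp (-r) := by
    have e3 : Real.exp (-r) = 1 / Real.exp r := by rw [Real.exp_neg, one_div]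
    rw [e3]
    have : 1 / Real.exp r - (2 / c - (c ^ 2)⁻¹ * Real.exp r) =
        (c - Real.exp r) ^ 2 / (c ^ 2 * Real.exp r) := by
      field_simp
      ring
    have : 0 ≤ (c - Real.exp r) ^ 2 / (c ^ 2 * Real.exp r) := by positivity
    linarith
  nlinarith [mul_le_mul_of_nonneg_right key h0]

/-- Existence of a comparable kernel for small times. -/
lemma IsKatoPerturbation.exists_local (h : IsKatoPerturbation κ m D α a b p n F A Λ) :
    ∃ T : ℝ≥0, 0 < T ∧ ExpMoment κ F T 2 ∧ ∃ c Q, IsFKKernel κ m p F T c Q := by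
  have hA := h.kato.hasMass
  obtain ⟨T₁, hT₁, hX₁, c₁, hc₁, Q, hQ, hQr⟩ :=
    h.density.exists_local_density h.law h.heat h.meas h.diag h.kato
  obtain ⟨T₂, hT₂, hX₂, c₂, hc₂, R, hR, hRr⟩ :=
    h.neg.density.exists_local_density h.law h.heat h.neg.meas h.neg.diag h.neg.kato
  have hE := expMoment_two h.law h.meas h.diag hT₁ hX₁
  have hE₂ := expMoment_two h.law h.neg.meas h.neg.diag hT₂ hX₂
  -- Division by `a` converts the bounds by the profile into bounds by `p`, for `F` and `-F` at
  -- once.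
  set c := max 1 (max (c₁ / a) (c₂ / a))
  have hc1 : 1 ≤ c := le_max_left _ _
  have hc0 : 0 < c := by linarith
  have ha := h.pos
  have hle : ∀ c₀, c₀ / a ≤ c → ∀ t, 0 < t → ∀ x z, c₀ * prof D α t (dist x z) ≤ c * p t x z := by
    intro c₀ h0 t ht x z
    have e1 := h.lower t ht x z
    have e2 := prof_nonneg (D := D) (α := α) ht (dist x z)
    rw [div_le_iff₀ ha] at h0
    nlinarith [mul_le_mul_of_nonneg_left e1 hc0.le, mul_le_mul_of_nonneg_right h0 e2]
  have hup : ∀ t : ℝ, 0 < t → t < T₁ → ∀ x z, Q t x z ≤ c * p t x z := fun t ht htT x z =>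
    ((le_abs_self _).trans (hQ.bound t ht htT x z)).trans
      (hle c₁ ((le_max_left _ _).trans (le_max_right _ _)) t ht x z)
  have hup₂ : ∀ t : ℝ, 0 < t → t < T₂ → ∀ x z, R t x z ≤ c * p t x z := fun t ht htT x z =>
    ((le_abs_self _).trans (hR.bound t ht htT x z)).trans
      (hle c₂ ((le_max_right _ _).trans (le_max_right _ _)) t ht x z)
  have hrep : ∀ t : ℝ≥0, 0 < t → t < T₁ → FKRep κ m F t (Q t) := fun t ht htT g B hg hB hgB x =>
    hQr g B hg hB hgB t ht htT x
  refine ⟨min T₁ T₂, lt_min hT₁ hT₂, hE.mono (min_le_left _ _), c, Q, hc1, hQ.meas,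
    hQ.cont.mono (Set.prod_mono (Set.Ioo_subset_Ioo_right (by simp)) subset_rfl), ?_,
    fun t ht htT => hup t ht (htT.trans_le (by simp)), fun t ht htT => hrep t ht
      (lt_of_lt_of_le (by exact_mod_cast htT) (min_le_left _ _))⟩
  intro t ht htT x z
  have ht₁ : t < T₁ := htT.trans_le (by simp)
  have ht₂ : t < T₂ := htT.trans_le (by simp)
  have hk := h.heat.isProfKernel T₁
  lift t to ℝ≥0 using ht.le
  have ht' : 0 < t := ht
  have ht₁' : t < T₁ := by exact_mod_cast ht₁
  have ht₂' : t < T₂ := by exact_mod_cast ht₂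
  refine le_of_forall_integral_mul_le (f := fun z => c⁻¹ * p t x z)
    ((hk.continuous_right ht ht₁ x).const_mul _) (hQ.continuous_right ht ht₁ x)
    ((hk.integrable hA ht ht₁ x).const_mul _) (hQ.integrable hA ht ht₁ x) ?_ z
  intro g hg hg0 hgB
  have j1 := integrable_elim h.law hg zero_le_one hgB t (x : OnePoint E)
  have j2 := (hE₂.mono ht₂'.le).integrable_fkWeight (by simp) h.neg.meas h.neg.diag hg zero_le_one hgB
    (x : OnePoint E)
  have j3 := (hE.mono ht₁'.le).integrable_fkWeight (by simp) h.meas h.diag hg zero_le_one hgB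
    (x : OnePoint E)
  have i1 := integral_mono ((j1.const_mul (2 / c)).sub (j2.const_mul (c ^ 2)⁻¹)) j3
    (fun w => two_div_sub_le_fkWeight (F := F) hc0 hg0 t w)
  simp only [Pi.sub_apply] at i1
  rw [integral_sub (j1.const_mul _) (j2.const_mul _), integral_const_mul, integral_const_mul,
    hQr g 1 hg zero_le_one hgB t ht' ht₁' x, hRr g 1 hg zero_le_one hgB t ht' ht₂' x,
    h.density.integral_density h.law hA h.heat hg zero_le_one hgB ht' x] at i1
  have i2 : ∫ z, R t x z * g z ∂m ≤ c * ∫ z, p t x z * g z ∂m := by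
    rw [← integral_const_mul]
    refine integral_mono (hR.integrable_mul hA hg hgB ht ht₂ x)
      ((hk.integrable_mul hA hg hgB ht ht₁ x).const_mul c) fun z => ?_
    beta_reduce
    rw [← mul_assoc]
    exact mul_le_mul_of_nonneg_right (hup₂ t ht ht₂ x z) (hg0 z)
  simp_rw [mul_assoc]
  rw [integral_const_mul]
  refine le_trans ?_ i1
  have i3 : (c ^ 2)⁻¹ * ∫ z, R t x z * g z ∂m ≤ (c ^ 2)⁻¹ * (c * ∫ z, p t x z * g z ∂m) :=
    mul_le_mul_of_nonneg_left i2 (by positivity)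
  -- The tangent point was chosen equal to the upper constant: 2/c - c^{-2} c = 1/c is positive.
  have i4 : 2 / c * ∫ z, p t x z * g z ∂m - (c ^ 2)⁻¹ * (c * ∫ z, p t x z * g z ∂m) =
      c⁻¹ * ∫ z, p t x z * g z ∂m := by
    field_simp
    ring
  linarith

/-- Composition of comparable kernels. -/
lemma IsFKKernel.comp (h : IsKatoPerturbation κ m D α a b p n F A Λ) {S T : ℝ≥0} {K K' : ℝ≥0∞}
    (hS : 0 < S) (hT : 0 < T)
    (hKS : ExpMoment κ F S K) (hK : K ≠ ⊤) (hKT : ExpMoment κ F T K') (hK' : K' ≠ ⊤)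
    (hQ : IsFKKernel κ m p F S c Q) (hR : IsFKKernel κ m p F T c' R) :
    IsFKKernel κ m p F (S + T) (c * c') (kcomp m (S / (S + T)) (T / (S + T)) Q R) := by
  have hA := h.kato.hasMass
  have hSR : (0 : ℝ) < S := hS
  have hTR : (0 : ℝ) < T := hT
  have hQp := hQ.isProfKernel h
  have hRp := hR.isProfKernel h
  have hc := hQ.one_le
  have hc' := hR.one_le
  have hθ : (0 : ℝ) < S / (S + T) := by positivity
  have hθ' : (0 : ℝ) < T / (S + T) := by positivity
  have hsum : (S : ℝ) / (S + T) + T / (S + T) = 1 := by field_simp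
  have h1 : ∀ t : ℝ, t < S + T → (S : ℝ) / (S + T) * t < S := fun t ht => by
    rw [div_mul_eq_mul_div, div_lt_iff₀ (by positivity)]
    exact mul_lt_mul_of_pos_left ht hSR
  have h2 : ∀ t : ℝ, t < S + T → (T : ℝ) / (S + T) * t < T := fun t ht => by
    rw [div_mul_eq_mul_div, div_lt_iff₀ (by positivity)]
    exact mul_lt_mul_of_pos_left ht hTR
  -- Splitting a time below S + T in the proportion S : T keeps its parts strictly below S and T.
  set θ : ℝ := S / (S + T)
  set θ' : ℝ := T / (S + T)
  have hck : ∀ t, 0 < t → ∀ x z, ∫ y, p (θ * t) x y * p (θ' * t) y z ∂m = p t x z := by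
    intro t ht x z
    rw [h.chapman_kolmogorov (by positivity) (by positivity), ← add_mul, hsum, one_mul]
  have hip : ∀ t, 0 < t → ∀ x z, Integrable (fun y => p (θ * t) x y * p (θ' * t) y z) m :=
    fun t ht x z => (h.heat.isProfKernel (θ * t + 1)).integrable_comp hA h.heat.pos
      (h.heat.isProfKernel (θ' * t + 1)) (by positivity) (by linarith) (by positivity) (by linarith) x z
  have hiQ : ∀ t : ℝ, 0 < t → t < S + T → ∀ x z, Integrable (fun y => Q (θ * t) x y * R (θ' * t) y z) m :=
    fun t ht htT x z => hQp.integrable_comp hA (hR.mul_nonneg h) hRp (by positivity) (h1 t htT)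
      (by positivity) (h2 t htT) x z
  refine ⟨one_le_mul_of_one_le_of_one_le hc hc', measurable_kcomp hQ.meas hR.meas _ _, ?_, ?_, ?_, ?_⟩
  · rintro ⟨t, x, z⟩ ⟨⟨ht, htT⟩, -⟩
    exact (hQp.continuousAt_kcomp hA (hQ.mul_nonneg h) (hR.mul_nonneg h) hθ hθ' hRp ht (h1 t htT)
      (h2 t htT) x z).continuousWithinAt
  · intro t ht htT x z
    rw [← hck t ht x z, ← integral_const_mul]
    refine integral_mono ((hip t ht x z).const_mul _) (hiQ t ht htT x z) fun y => ?_
    have e1 := hQ.lower (θ * t) (by positivity) (h1 t htT) x y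
    have e2 := hR.lower (θ' * t) (by positivity) (h2 t htT) y z
    have n1 := h.nonneg (t := θ * t) (by positivity) x y
    have n2 := h.nonneg (t := θ' * t) (by positivity) y z
    beta_reduce
    calc (c * c')⁻¹ * (p (θ * t) x y * p (θ' * t) y z) =
          (c⁻¹ * p (θ * t) x y) * (c'⁻¹ * p (θ' * t) y z) := by rw [mul_inv]; ring
      _ ≤ _ := mul_le_mul e1 e2 (by positivity) ((by positivity : (0 : ℝ) ≤ _).trans e1)
  · intro t ht htT x z
    rw [← hck t ht x z, ← integral_const_mul]
    refine integral_mono (hiQ t ht htT x z) ((hip t ht x z).const_mul _) fun y => ?_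
    have e1 := hQ.upper (θ * t) (by positivity) (h1 t htT) x y
    have e2 := hR.upper (θ' * t) (by positivity) (h2 t htT) y z
    have n1 := hQ.nonneg h (t := θ * t) (by positivity) (h1 t htT) x y
    have n2 := hR.nonneg h (t := θ' * t) (by positivity) (h2 t htT) y z
    beta_reduce
    calc Q (θ * t) x y * R (θ' * t) y z ≤ (c * p (θ * t) x y) * (c' * p (θ' * t) y z) :=
          mul_le_mul e1 e2 n2 (n1.trans e1)
      _ = _ := by ring
  · intro t ht htT
    have htR : (0 : ℝ) < t := ht
    set s₁ : ℝ≥0 := S / (S + T) * t with hs₁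
    set s₂ : ℝ≥0 := T / (S + T) * t with hs₂
    have c1 : (s₁ : ℝ) = θ * t := by simp [hs₁, θ]
    have c2 : (s₂ : ℝ) = θ' * t := by simp [hs₂, θ']
    have p1 : 0 < s₁ := by positivity
    have p2 : 0 < s₂ := by positivity
    have l1 : (s₁ : ℝ) < S := by rw [c1]; exact h1 t htT
    have l2 : (s₂ : ℝ) < T := by rw [c2]; exact h2 t htT
    have e : s₁ + s₂ = t := by
      apply NNReal.eq
      rw [NNReal.coe_add, c1, c2, ← add_mul, hsum, one_mul]
    have key := FKRep.comp h.law hA h.meas h.diag (hKS.mono (s := s₁) (by exact_mod_cast l1.le)) hK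
      (hKT.mono (s := s₂) (by exact_mod_cast l2.le)) hK' (hR.mul_nonneg h) hQp hRp p1 l1 p2 l2
      (hQ.rep s₁ p1 l1) (hR.rep s₂ p2 l2)
    rw [e, c1, c2] at key
    exact key

/-- Comparable kernels up to any multiple of a fixed time. -/
lemma IsKatoPerturbation.exists_multiple (h : IsKatoPerturbation κ m D α a b p n F A Λ) {T : ℝ≥0}
    (hT : 0 < T) {K : ℝ≥0∞} (hK : K ≠ ⊤) (hE : ExpMoment κ F T K) (hQ : IsFKKernel κ m p F T c Q)
    (N : ℕ) : ExpMoment κ F ((N + 1 : ℕ) * T) (K ^ (N + 1)) ∧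
      ∃ R, IsFKKernel κ m p F ((N + 1 : ℕ) * T) (c ^ (N + 1)) R := by
  induction N with
  | zero => simpa using ⟨hE, Q, hQ⟩
  | succ N ih =>
    obtain ⟨ih1, R, hR⟩ := ih
    have hpos : 0 < ((N + 1 : ℕ) : ℝ≥0) * T := by positivity
    have e : ((N + 1 + 1 : ℕ) : ℝ≥0) * T = (N + 1 : ℕ) * T + T := by push_cast; ring
    have e' : ((N + 1 + 1 : ℕ) : ℝ) * T = ((N + 1 : ℕ) * T : ℝ≥0) + T := by push_cast; ring
    have hR' : IsFKKernel κ m p F ((N + 1 : ℕ) * T : ℝ≥0) (c ^ (N + 1)) R := by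
      rw [NNReal.coe_mul, NNReal.coe_natCast]
      exact hR
    rw [e, e', pow_succ K, pow_succ c]
    exact ⟨ih1.add h.law h.meas h.diag hE, _, hR'.comp h hpos hT ih1 (ENNReal.pow_ne_top hK) hE hK hQ⟩

/-- The Feynman-Kac semigroup of a Kato perturbation has a continuous density which is comparable,
up to exponential factors in time, with the transition density. -/
theorem IsKatoPerturbation.exists_density (h : IsKatoPerturbation κ m D α a b p n F A Λ) :
    ∃ q : ℝ → E → E → ℝ, (∀ t : ℝ≥0, ∃ K : ℝ≥0∞, K ≠ ⊤ ∧ ExpMoment κ F t K) ∧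
      (∀ t : ℝ≥0, 0 < t → FKRep κ m F t (q t)) ∧
      (∀ (g : E → ℝ) (B : ℝ), Measurable g → (∀ x, |g x| ≤ B) → ∀ t, 0 < t → ∀ x,
        Integrable (fun z => q t x z * g z) m) ∧
      ContinuousOn (fun v : ℝ × E × E => q v.1 v.2.1 v.2.2) (Set.Ioi 0 ×ˢ Set.univ) ∧
      ∃ c l : ℝ, 0 < c ∧ 0 < l ∧ ∀ t, 0 < t → ∀ x z,
        c⁻¹ * Real.exp (-(l * t)) * p t x z ≤ q t x z ∧ q t x z ≤ c * Real.exp (l * t) * p t x z := by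
  obtain ⟨T, hT, hE, c, Q, hQ⟩ := h.exists_local
  have hA := h.kato.hasMass
  have hTR : (0 : ℝ) < T := hT
  have hmul := h.exists_multiple hT (by simp) hE hQ
  choose hX R hR using hmul
  have hprof := fun N => (hR N).isProfKernel h
  -- The time t lies below (k t + 1) T, within the range of `R (k t)`; the density is pasted from
  -- these kernels.
  set k : ℝ → ℕ := fun t => ⌊t / T⌋₊
  have hk : ∀ t : ℝ, t < ((k t + 1 : ℕ) : ℝ) * T := fun t => by
    have := Nat.lt_floor_add_one (t / (T : ℝ))
    rw [div_lt_iff₀ hTR] at this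
    exact_mod_cast this
  -- Continuous kernels representing the same operator coincide, so the pasting is locally equal to
  -- a single continuous kernel, even where `k` jumps.
  have hcons : ∀ (N : ℕ) (t : ℝ), 0 < t → t < ((N + 1 : ℕ) : ℝ) * T → ∀ x z,
      R (k t) t x z = R N t x z := by
    intro N t ht htN x z
    lift t to ℝ≥0 using ht.le
    exact FKRep.eq ((hR (k t)).rep t ht (hk t)) ((hR N).rep t ht htN)
      ((hprof _).continuous_right ht (hk t) x) ((hprof _).continuous_right ht htN x)
      ((hprof _).integrable hA ht (hk t) x) ((hprof _).integrable hA ht htN x) z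
  have hc1 := hQ.one_le
  have hc0 : 0 < c := by linarith
  -- As c may be 1, the added 1 keeps the exponential rate strictly positive.
  have hpow : ∀ t : ℝ, 0 < t → c ^ (k t + 1) ≤ c * Real.exp (((Real.log c + 1) / T) * t) := by
    intro t ht
    rw [pow_succ, mul_comm]
    refine mul_le_mul_of_nonneg_left ?_ hc0.le
    rw [← Real.exp_log hc0, ← Real.exp_nat_mul, Real.exp_log hc0, Real.exp_le_exp]
    have h1 : (k t : ℝ) ≤ t / T := Nat.floor_le (by positivity)
    have h2 := Real.log_nonneg hc1
    calc (k t : ℝ) * Real.log c ≤ t / T * (Real.log c + 1) :=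
          mul_le_mul h1 (by linarith) h2 (by positivity)
      _ = (Real.log c + 1) / T * t := by ring
  refine ⟨fun t => R (k t) t, fun t => ?_, fun t ht => (hR (k t)).rep t ht (hk t), ?_, ?_, c,
    (Real.log c + 1) / T, hc0, div_pos (by linarith [Real.log_nonneg hc1]) hTR, ?_⟩
  · refine ⟨_, ENNReal.pow_ne_top (by simp), (hX (k t)).mono ?_⟩
    exact_mod_cast (hk t).le
  · intro g B hg hgB t ht x
    exact (hprof _).integrable_mul hA hg hgB ht (hk t) x
  · rintro ⟨t, x, z⟩ ⟨ht, -⟩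
    have ht : 0 < t := ht
    refine ContinuousAt.continuousWithinAt ?_
    refine ((hprof (k t)).continuousAt ht (hk t) x z).congr ?_
    have e1 : ∀ᶠ v : ℝ × E × E in 𝓝 (t, x, z), v.1 ∈ Set.Ioo 0 (((k t + 1 : ℕ) : ℝ) * T) :=
      continuousAt_fst (p := ((t, x, z) : ℝ × E × E)) (Ioo_mem_nhds ht (hk t))
    filter_upwards [e1] with v hv
    exact (hcons _ v.1 hv.1 hv.2 v.2.1 v.2.2).symm
  · intro t ht x z
    have hp0 := h.nonneg ht x z
    have h1 := (hR (k t)).lower t ht (hk t) x z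
    have h2 := (hR (k t)).upper t ht (hk t) x z
    have h3 := hpow t ht
    have h4 : 0 < c ^ (k t + 1) := by positivity
    refine ⟨le_trans (mul_le_mul_of_nonneg_right ?_ hp0) h1,
      h2.trans (mul_le_mul_of_nonneg_right h3 hp0)⟩
    rw [Real.exp_neg, ← mul_inv]
    exact inv_anti₀ h4 h3

end Global

/-! ### Transport from path space back to the Hunt process. -/

section Transport
open CadlagPath ProbabilityTheory

section Abstract
variable {E Ω : Type*} [MetricSpace E] [ProperSpace E] [MeasurableSpace E] [BorelSpace E]
  [MeasurableSpace Ω] {Z : PathFamily E Ω} {m : Measure E} [SFinite m]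
  {p : ℝ → E → E → ℝ} {n F : E → E → ℝ} {g : E → ℝ} {t : ℝ≥0}

lemma PathFamily.lintegral_law (hZ : Z.IsHunt) {Φ : CadlagPath E → ℝ≥0∞} (hΦ : Measurable Φ)
    (x : OnePoint E) : ∫⁻ w, Φ w ∂(PathFamily.law hZ x) = ∫⁻ ω, Φ (PathFamily.path hZ ω) ∂(Z.P x) :=
  lintegral_map hΦ (PathFamily.measurable_path hZ)

/-- The transition density determines the expectation of nonnegative functions of the position. -/
lemma PathFamily.HasTransitionDensity.lintegral_eq (hp : Z.HasTransitionDensity m p) (hZ : Z.IsHunt)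
    (hpm : ∀ t, 0 < t → ∀ x, Measurable (p t x)) (ht : 0 < t) (x : E) {g : E → ℝ≥0∞}
    (hg : Measurable g) :
    ∫⁻ ω, (Z.X t ω).elim 0 g ∂(Z.P x) = ∫⁻ y, ENNReal.ofReal (p t x y) * g y ∂m := by
  have hme : MeasurableEmbedding ((↑) : E → OnePoint E) :=
    OnePoint.isOpenEmbedding_coe.measurableEmbedding
  have hX := hZ.measurable_X t
  set μ := (Z.P x).map (Z.X t)
  have hν : μ.comap ((↑) : E → OnePoint E) = m.withDensity fun y => ENNReal.ofReal (p t x y) := by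
    ext B hB
    rw [hme.comap_apply, withDensity_apply _ hB, ← hp t x ht B hB,
      Measure.map_apply hX (hme.measurableSet_image.2 hB)]
    congr 1
    ext ω
    simp only [Set.mem_preimage, Set.mem_image, Set.mem_ofPred_eq]
    exact ⟨fun ⟨y, hy, e⟩ => ⟨y, hy, e.symm⟩, fun ⟨y, hy, e⟩ => ⟨y, hy, e.symm⟩⟩
  have hge : Measurable fun y : OnePoint E => y.elim 0 g := measurable_elim hg
  have h1 : ∫⁻ ω, (Z.X t ω).elim 0 g ∂(Z.P x) = ∫⁻ y, y.elim 0 g ∂μ := (lintegral_map hge hX).symm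
  have h2 : ∫⁻ y, y.elim 0 g ∂μ = ∫⁻ y in Set.range ((↑) : E → OnePoint E), y.elim 0 g ∂μ := by
    refine (setLIntegral_eq_of_support_subset fun y hy => ?_).symm
    rcases y with _ | y
    · exact absurd rfl hy
    · exact ⟨y, rfl⟩
  rw [h1, h2, ← hme.map_comap, hme.lintegral_map, hν,
    lintegral_withDensity_eq_lintegral_mul _ (hpm t ht x).ennreal_ofReal (by exact hg)]
  rfl

/-- A Hunt process with a Lévy system and a transition density has a jump density. -/
lemma PathFamily.hasJumpDensity (hZ : Z.IsHunt) (hp : Z.HasTransitionDensity m p)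
    (hpm : Measurable fun q : ℝ × E × E => p q.1 q.2.1 q.2.2)
    (hp0 : ∀ t, 0 < t → ∀ x y, 0 ≤ p t x y) (hn : Measurable (Function.uncurry n))
    (hn0 : ∀ u w, 0 ≤ n u w)
    (hL : Z.HasLevySystem fun x => m.withDensity fun y => ENNReal.ofReal (n x y)) :
    HasJumpDensity (PathFamily.law hZ) m p n := by
  have hpt : ∀ t, 0 < t → ∀ x, Measurable (p t x) := fun t _ x =>
    hpm.comp (f := fun y : E => (t, x, y)) (by fun_prop)
  have hdens : ∀ t : ℝ≥0, 0 < t → ∀ (x : E) (g : E → ℝ≥0∞), Measurable g →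
      ∫⁻ w, (w t).elim 0 g ∂(PathFamily.law hZ x) = ∫⁻ y, ENNReal.ofReal (p t x y) * g y ∂m := by
    intro t ht x g hg
    rw [PathFamily.lintegral_law hZ (measurable_elim_eval hg t)]
    exact hp.lintegral_eq hZ hpt ht x hg
  refine ⟨hpm, hp0, hn, hn0, hdens, fun f hf hd x t ht => ?_⟩
  have := (PathFamily.isMarkovLaw_law hZ).prob
  rw [PathFamily.lintegral_law hZ (measurable_jumpSum hf hd 0 t)]
  refine (hL f hf hd x t ht).trans ?_
  set G : E → ℝ≥0∞ := fun u => ∫⁻ w, ENNReal.ofReal (n u w) * f u w ∂m with hGd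
  have hnm : ∀ u, Measurable (n u) := fun u => hn.of_uncurry_left
  have hfm : ∀ u, Measurable (f u) := fun u => hf.of_uncurry_left
  have hG : Measurable G := by
    have : Measurable fun q : E × E => ENNReal.ofReal (Function.uncurry n q) * Function.uncurry f q := by
      fun_prop
    exact this.lintegral_prod_right'
  have e1 : ∀ u, ∫⁻ w, f u w ∂(m.withDensity fun y => ENNReal.ofReal (n u y)) = G u := fun u => by
    rw [lintegral_withDensity_eq_lintegral_mul _ (hnm u).ennreal_ofReal (hfm u)]
    rfl
  simp_rw [e1]
  -- Exchanging expectation and time integral needs the evaluation to be jointly measurable in path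
  -- and time.
  have hm : Measurable fun q : CadlagPath E × ℝ => (q.1 q.2.toNNReal).elim 0 G :=
    (measurable_elim hG).comp (measurable_eval_uncurry.comp
      (f := fun q : CadlagPath E × ℝ => (q.2.toNNReal, q.1)) (by fun_prop))
  have hm2 : Measurable fun w : CadlagPath E =>
      ∫⁻ s in Set.Ioc (0 : ℝ) t, (w s.toNNReal).elim 0 G := hm.lintegral_prod_right'
  refine (PathFamily.lintegral_law hZ hm2 x).symm.trans ?_
  rw [lintegral_lintegral_swap hm.aemeasurable]
  unfold intensity
  refine setLIntegral_congr_fun measurableSet_Ioc fun s hs => ?_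
  beta_reduce
  rw [hdens s.toNNReal (Real.toNNReal_pos.2 hs.1) x G hG, Real.coe_toNNReal _ hs.1.le]
  refine lintegral_congr fun u => ?_
  rw [hGd, ← lintegral_const_mul _ (by have := hnm u; have := hfm u; fun_prop)]
  exact lintegral_congr fun w => (mul_assoc _ _ _).symm

lemma PathFamily.summable_jump (hZ : Z.IsHunt) {K : ℝ≥0∞} (hK : K ≠ ⊤)
    (h : ExpMoment (PathFamily.law hZ) F t K) (hF : Measurable (Function.uncurry F))
    (hd : ∀ x, F x x = 0) (x : E) :
    ∀ᵐ ω ∂(Z.P x), Summable fun s : Set.Ioc (0 : ℝ≥0) t => Z.jump F s ω := by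
  have h1 : ∀ᵐ ω ∂(Z.P x), jumpAbs F 0 t (PathFamily.path hZ ω) ≠ ⊤ :=
    ae_of_ae_map (PathFamily.measurable_path hZ).aemeasurable (h.ae_ne_top hK hF hd x)
  filter_upwards [h1] with ω hω
  exact (summable_jump_iff F 0 t (PathFamily.path hZ ω)).2 hω

lemma PathFamily.integrable_feynmanKacWeight (hZ : Z.IsHunt) {x : E}
    (h : Integrable (fkWeight F g t) (PathFamily.law hZ x)) :
    Integrable (Z.feynmanKacWeight F g t) (Z.P x) :=
  h.comp_measurable (PathFamily.measurable_path hZ)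

lemma PathFamily.feynmanKac_eq (hZ : Z.IsHunt) (hF : Measurable (Function.uncurry F))
    (hd : ∀ x, F x x = 0) (hg : Measurable g) (x : E) :
    Z.feynmanKac F t g x = ∫ w, fkWeight F g t w ∂(PathFamily.law hZ x) :=
  (integral_map (PathFamily.measurable_path hZ).aemeasurable
    (measurable_fkWeight hF hd hg t).aestronglyMeasurable).symm

end Abstract

section Euclidean
variable {d : ℕ} {α : ℝ} {M : EuclideanSpace ℝ (Fin d) → ℝ} {a b : ℝ}
  {p : ℝ → EuclideanSpace ℝ (Fin d) → EuclideanSpace ℝ (Fin d) → ℝ}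

instance instSFiniteRefMeasure : SFinite (refMeasure M) := by
  unfold refMeasure
  infer_instance

lemma refMeasure_le (hb : ∀ x, M x ≤ b) : refMeasure M ≤ ENNReal.ofReal b • volume := by
  unfold refMeasure
  rw [← withDensity_const]
  exact withDensity_mono (Eventually.of_forall fun x => ENNReal.ofReal_le_ofReal (hb x))

lemma lintegral_refMeasure_le (hb : ∀ x, M x ≤ b) (f : EuclideanSpace ℝ (Fin d) → ℝ≥0∞) :
    ∫⁻ x, f x ∂(refMeasure M) ≤ ENNReal.ofReal b * ∫⁻ x, f x := by
  refine (lintegral_mono' (refMeasure_le hb) le_rfl).trans ?_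
  rw [lintegral_smul_measure, smul_eq_mul]

lemma isOpenPosMeasure_refMeasure (ha : 0 < a) (h : ∀ x, a ≤ M x) :
    (refMeasure M).IsOpenPosMeasure := by
  have h1 : ENNReal.ofReal a • (volume : Measure (EuclideanSpace ℝ (Fin d))) ≤ refMeasure M := by
    unfold refMeasure
    rw [← withDensity_const]
    exact withDensity_mono (Eventually.of_forall fun x => ENNReal.ofReal_le_ofReal (h x))
  have h2 : (volume : Measure (EuclideanSpace ℝ (Fin d))) ≪ refMeasure M :=
    (Measure.AbsolutelyContinuous.rfl.smul_right (ENNReal.ofReal_pos.2 ha).ne').trans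
      h1.absolutelyContinuous
  exact h2.isOpenPosMeasure

/-- A potential in the Kato class relative to `p` has a small potential with respect to the
profile. -/
lemma KatoClass.tendsto_katoMod {D : ℝ} {V V' : EuclideanSpace ℝ (Fin d) → ℝ≥0∞} (hV : KatoClass p V)
    (hb : ∀ x, M x ≤ b) (ha : 0 < a)
    (hp : ∀ t, 0 < t → ∀ x y, a * prof D α t (dist x y) ≤ p t x y) {c : ℝ≥0∞} (hc : c ≠ ⊤)
    (hVV : ∀ x, V' x ≤ c * V x) : Tendsto (katoMod (refMeasure M) D α V') (𝓝[>] 0) (𝓝 0) := by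
  set c' := ENNReal.ofReal b * (ENNReal.ofReal a⁻¹ * c)
  have hc' : c' ≠ ⊤ := ENNReal.mul_ne_top ENNReal.ofReal_ne_top
    (ENNReal.mul_ne_top ENNReal.ofReal_ne_top hc)
  have h1 := ENNReal.Tendsto.const_mul hV (Or.inr hc')
  rw [mul_zero] at h1
  refine tendsto_of_tendsto_of_tendsto_of_le_of_le tendsto_const_nhds h1 (fun t => zero_le)
    fun t => iSup_le fun x => ?_
  refine le_trans ?_ (mul_le_mul_right (le_iSup (fun x => ∫⁻ s in Set.Ioc (0 : ℝ) t,
    ∫⁻ y, ENNReal.ofReal (p s x y) * V y) x) _)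
  beta_reduce
  rw [restrict_Ioo_eq_restrict_Ioc, ← lintegral_const_mul' _ _ hc']
  refine setLIntegral_mono' measurableSet_Ioc fun s hs => ?_
  refine (lintegral_refMeasure_le hb _).trans ?_
  rw [mul_assoc]
  refine mul_le_mul_right ?_ _
  rw [← lintegral_const_mul' _ _ (ENNReal.mul_ne_top ENNReal.ofReal_ne_top hc)]
  refine lintegral_mono fun u => ?_
  have h2 : rho D α s x u ≤ ENNReal.ofReal a⁻¹ * ENNReal.ofReal (p s x u) := by
    unfold rho
    rw [← ENNReal.ofReal_mul (by positivity)]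
    refine ENNReal.ofReal_le_ofReal ?_
    rw [inv_mul_eq_div, le_div_iff₀ ha, mul_comm]
    exact hp s hs.1 x u
  calc rho D α s x u * V' u ≤ (ENNReal.ofReal a⁻¹ * ENNReal.ofReal (p s x u)) * (c * V u) :=
        mul_le_mul' h2 (hVV u)
    _ = _ := by ring

end Euclidean

end Transport

/-! ### Stable-like processes satisfy the abstract hypotheses. -/

section StableLike
open CadlagPath ProbabilityTheory
variable {d : ℕ} {α : ℝ} {M : EuclideanSpace ℝ (Fin d) → ℝ} {a b : ℝ}
  {p : ℝ → EuclideanSpace ℝ (Fin d) → EuclideanSpace ℝ (Fin d) → ℝ}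
  {C F : EuclideanSpace ℝ (Fin d) → EuclideanSpace ℝ (Fin d) → ℝ}
  {Ω : Type*} [MeasurableSpace Ω] {X : PathFamily (EuclideanSpace ℝ (Fin d)) Ω}

/-- The restriction of a time-dependent kernel to positive times. -/
def posTime (p : ℝ → EuclideanSpace ℝ (Fin d) → EuclideanSpace ℝ (Fin d) → ℝ) (t : ℝ)
    (x y : EuclideanSpace ℝ (Fin d)) : ℝ := (Set.Ioi 0).indicator (fun t => p t x y) t

lemma posTime_of_pos {t : ℝ} (ht : 0 < t) (x y : EuclideanSpace ℝ (Fin d)) :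
    posTime p t x y = p t x y := Set.indicator_of_mem (show t ∈ Set.Ioi 0 from ht) _

/-- The jump density of a stable-like process. -/
def stableLikeDensity (α : ℝ) (C : EuclideanSpace ℝ (Fin d) → EuclideanSpace ℝ (Fin d) → ℝ)
    (x y : EuclideanSpace ℝ (Fin d)) : ℝ := 2 * C x y / ‖x - y‖ ^ ((d : ℝ) + α)

/-- Since e^{|F|} - 1 ≤ |F| e^L for |F| ≤ L, the class defined through |F| controls the weight
e^{|F|} - 1 of the expansion. -/
lemma fkJumpBound_stableLike_le {K L : ℝ} (hC0 : ∀ x y, 0 ≤ C x y) (hC : ∀ x y, C x y ≤ K)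
    (hL : ∀ x y, |F x y| ≤ L) (u w : EuclideanSpace ℝ (Fin d)) :
    fkJumpBound F (stableLikeDensity α C) u w ≤
      ENNReal.ofReal (2 * K * Real.exp L) * ENNReal.ofReal (|F u w| / ‖u - w‖ ^ ((d : ℝ) + α)) := by
  have hK : 0 ≤ K := (hC0 u w).trans (hC u w)
  have hr : 0 ≤ ‖u - w‖ ^ ((d : ℝ) + α) := by positivity
  have h0 := hC0 u w
  unfold fkJumpBound expWeight stableLikeDensity
  rw [← ENNReal.ofReal_mul (by positivity), ← ENNReal.ofReal_mul (by positivity)]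
  refine ENNReal.ofReal_le_ofReal ?_
  have h1 := exp_sub_one_le_mul (abs_nonneg (F u w)) (hL u w)
  have h2 : 0 ≤ Real.exp |F u w| - 1 := by linarith [Real.one_le_exp (abs_nonneg (F u w))]
  calc 2 * C u w / ‖u - w‖ ^ ((d : ℝ) + α) * (Real.exp |F u w| - 1)
      ≤ 2 * K / ‖u - w‖ ^ ((d : ℝ) + α) * (|F u w| * Real.exp L) := by
        gcongr
        exact hC u w
    _ = _ := by ring

lemma isKatoPerturbation (hα : 0 < α) (hM : ∀ x, a ≤ M x ∧ M x ≤ b)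
    (hX : IsStableLike X α C (refMeasure M)) (hp : X.HasTransitionDensity (refMeasure M) p)
    (hpc : ContinuousOn
      (fun v : ℝ × EuclideanSpace ℝ (Fin d) × EuclideanSpace ℝ (Fin d) => p v.1 v.2.1 v.2.2)
      (Set.Ioi 0 ×ˢ Set.univ)) {M₁ M₂ : ℝ} (hM₁ : 0 < M₁) (hM₂ : 0 < M₂)
    (hpb : ∀ t : ℝ, 0 < t → ∀ x y,
      M₁ * prof ((d : ℝ) + α) α t (dist x y) ≤ p t x y ∧
        p t x y ≤ M₂ * prof ((d : ℝ) + α) α t (dist x y))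
    (hF : JClass α p F) (hFt : JClass α p (fun x y => F y x)) :
    ∃ A Λ, IsKatoPerturbation (PathFamily.law hX.hunt) (refMeasure M) ((d : ℝ) + α) α M₁ M₂
      (posTime p) (stableLikeDensity α C) F A Λ := by
  obtain ⟨K, hK⟩ := hX.bounded_C
  obtain ⟨L, hL⟩ := hF.bounded
  have hD : 0 < (d : ℝ) + α := by positivity
  -- Nothing is known of `p` at nonpositive times; cut off there, it is jointly measurable by its
  -- continuity at positive times.
  have hpm : Measurable fun q : ℝ × EuclideanSpace ℝ (Fin d) × EuclideanSpace ℝ (Fin d) =>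
      posTime p q.1 q.2.1 q.2.2 := measurable_indicator_of_continuousOn measurableSet_Ioi hpc
  have hp' : X.HasTransitionDensity (refMeasure M) (posTime p) := fun t x ht B hB => by
    simp_rw [posTime_of_pos (p := p) (show (0 : ℝ) < t from ht)]
    exact hp t x ht B hB
  have hp0 : ∀ t, 0 < t → ∀ x y, 0 ≤ posTime p t x y := fun t ht x y => by
    rw [posTime_of_pos ht]
    exact le_trans (mul_nonneg hM₁.le (prof_nonneg ht _)) (hpb t ht x y).1
  have hnm : Measurable (Function.uncurry (stableLikeDensity α C)) := by
    have := hX.measurable_C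
    have h1 : Measurable fun q : EuclideanSpace ℝ (Fin d) × EuclideanSpace ℝ (Fin d) =>
        2 * Function.uncurry C q / ‖q.1 - q.2‖ ^ ((d : ℝ) + α) := by fun_prop
    exact h1
  have hn0 : ∀ u w, 0 ≤ stableLikeDensity α C u w := fun u w => by
    have := hX.nonneg_C u w
    unfold stableLikeDensity
    positivity
  have hjm : Measurable (Function.uncurry (fkJumpBound F (stableLikeDensity α C))) :=
    hnm.ennreal_ofReal.mul (measurable_expWeight hF.measurable)
  have hle := fkJumpBound_stableLike_le (α := α) hX.nonneg_C hK hL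
  have hc : ENNReal.ofReal (2 * K * Real.exp L) * ENNReal.ofReal b ≠ ⊤ :=
    ENNReal.mul_ne_top ENNReal.ofReal_ne_top ENNReal.ofReal_ne_top
  have hK0 : 0 ≤ K := (hX.nonneg_C 0 0).trans (hK 0 0)
  have hL0 : 0 ≤ L := (abs_nonneg _).trans (hL 0 0)
  refine ⟨ENNReal.ofReal M₁⁻¹, 2 * K * Real.exp L * L, PathFamily.isMarkovLaw_law hX.hunt,
    PathFamily.hasJumpDensity hX.hunt hp' hpm hp0 hnm hn0 hX.levy, ⟨hM₂.le, hpm, ?_, ?_⟩, hM₁, ?_,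
    hF.measurable, hF.diag, ⟨hD, hα, by positivity, ENNReal.ofReal_ne_top, hjm, ?_, ?_, ?_, ?_⟩⟩
  · intro t ht x z
    rw [abs_of_nonneg (hp0 t ht x z), posTime_of_pos ht]
    exact (hpb t ht x z).2
  · refine hpc.congr fun v hv => ?_
    exact posTime_of_pos hv.1 _ _
  · intro t ht x z
    rw [posTime_of_pos ht]
    exact (hpb t ht x z).1
  · intro u w
    refine (hle u w).trans ?_
    rw [← ENNReal.ofReal_mul (by positivity), dist_eq_norm]
    refine ENNReal.ofReal_le_ofReal ?_
    rw [mul_assoc _ L, mul_one_div]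
    gcongr
    exact hL u w
  · intro t ht x
    have hpt := hX.hunt.prob x
    lift t to ℝ≥0 using ht.le
    -- This is the probability of being alive at time `t`; the lower heat kernel bound then gives
    -- the profile a mass of at most 1/M₁.
    have h1 : ∫⁻ y, ENNReal.ofReal (p t x y) ∂(refMeasure M) ≤ 1 := by
      have h2 := hp t x ht Set.univ MeasurableSet.univ
      rw [Measure.restrict_univ] at h2
      rw [← h2]
      exact prob_le_one
    calc ∫⁻ y, rho ((d : ℝ) + α) α t x y ∂(refMeasure M)
        ≤ ∫⁻ y, ENNReal.ofReal M₁⁻¹ * ENNReal.ofReal (p t x y) ∂(refMeasure M) := by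
          refine lintegral_mono fun y => ?_
          unfold rho
          rw [← ENNReal.ofReal_mul (by positivity)]
          refine ENNReal.ofReal_le_ofReal ?_
          rw [inv_mul_eq_div, le_div_iff₀ hM₁, mul_comm]
          exact (hpb t ht x y).1
      _ = ENNReal.ofReal M₁⁻¹ * ∫⁻ y, ENNReal.ofReal (p t x y) ∂(refMeasure M) :=
          lintegral_const_mul' _ _ ENNReal.ofReal_ne_top
      _ ≤ ENNReal.ofReal M₁⁻¹ := by
          refine (mul_le_mul_right h1 _).trans (mul_one _).le
  · refine hF.kato.tendsto_katoMod (fun x => (hM x).2) hM₁ (fun t ht x y => (hpb t ht x y).1) hc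
      fun u => ?_
    rw [mul_assoc, mul_comm (ENNReal.ofReal b)]
    refine (lintegral_mono fun w => hle u w).trans ?_
    rw [lintegral_const_mul' _ _ ENNReal.ofReal_ne_top, mul_comm (lintegral _ _)]
    exact mul_le_mul_right (lintegral_refMeasure_le (fun x => (hM x).2) _) _
  -- The incoming marginal is controlled by the transposed function, the norm being symmetric.
  · refine hFt.kato.tendsto_katoMod (fun x => (hM x).2) hM₁ (fun t ht x y => (hpb t ht x y).1) hc
      fun w => ?_
    rw [mul_assoc, mul_comm (ENNReal.ofReal b)]
    refine (lintegral_mono fun u => hle u w).trans ?_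
    rw [lintegral_const_mul' _ _ ENNReal.ofReal_ne_top, mul_comm (lintegral _ _)]
    simp_rw [norm_sub_rev w]
    exact mul_le_mul_right (lintegral_refMeasure_le (fun x => (hM x).2) _) _

end StableLike

end

theorem theorem3p9 {d : ℕ} (hd : 1 ≤ d) {α : ℝ} (hα0 : 0 < α) (hα2 : α < 2)
    (M : EuclideanSpace ℝ (Fin d) → ℝ) (hM : Measurable M)
    (hMb : ∃ a b : ℝ, 0 < a ∧ ∀ x, a ≤ M x ∧ M x ≤ b)
    {Ω : Type*} [MeasurableSpace Ω] (X : PathFamily (EuclideanSpace ℝ (Fin d)) Ω)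
    (C : EuclideanSpace ℝ (Fin d) → EuclideanSpace ℝ (Fin d) → ℝ)
    (hX : IsStableLike X α C (refMeasure M))
    (p : ℝ → EuclideanSpace ℝ (Fin d) → EuclideanSpace ℝ (Fin d) → ℝ)
    (hp : X.HasTransitionDensity (refMeasure M) p)
    (hp_cont : ContinuousOn
      (fun v : ℝ × EuclideanSpace ℝ (Fin d) × EuclideanSpace ℝ (Fin d) => p v.1 v.2.1 v.2.2)
      (Set.Ioi 0 ×ˢ Set.univ))
    (hp_bound : ∃ M₁ M₂ : ℝ, 0 < M₁ ∧ 0 < M₂ ∧ ∀ t : ℝ, 0 < t → ∀ x y,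
      M₁ * stableProfile d α t ‖x - y‖ ≤ p t x y ∧ p t x y ≤ M₂ * stableProfile d α t ‖x - y‖)
    (F : EuclideanSpace ℝ (Fin d) → EuclideanSpace ℝ (Fin d) → ℝ)
    (hF : JClass α p F) (hFt : JClass α p (fun x y => F y x)) :
    ∃ q : ℝ → EuclideanSpace ℝ (Fin d) → EuclideanSpace ℝ (Fin d) → ℝ,
      X.HasFeynmanKacDensity (refMeasure M) F q ∧
      ContinuousOn
        (fun v : ℝ × EuclideanSpace ℝ (Fin d) × EuclideanSpace ℝ (Fin d) => q v.1 v.2.1 v.2.2)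
        (Set.Ioi 0 ×ˢ Set.univ) ∧
      ∃ C₃ C₄ C₅ C₆ : ℝ, 0 < C₃ ∧ 0 < C₄ ∧ 0 < C₅ ∧ 0 < C₆ ∧
        ∀ t : ℝ, 0 < t → ∀ x z,
          C₃ * Real.exp (-(C₄ * t)) * stableProfile d α t ‖x - z‖ ≤ q t x z ∧
          q t x z ≤ C₅ * Real.exp (C₆ * t) * stableProfile d α t ‖x - z‖ := by
  obtain ⟨a, b, ha, hab⟩ := hMb
  obtain ⟨M₁, M₂, hM₁, hM₂, hpb⟩ := hp_bound
  have hpr : ∀ t : ℝ, 0 < t → ∀ x y : EuclideanSpace ℝ (Fin d),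
      stableProfile d α t ‖x - y‖ = prof ((d : ℝ) + α) α t (dist x y) := fun t ht x y => by
    rw [stableProfile_eq hα0 ht (norm_nonneg _), dist_eq_norm]
  have hpb' : ∀ t : ℝ, 0 < t → ∀ x y : EuclideanSpace ℝ (Fin d),
      M₁ * prof ((d : ℝ) + α) α t (dist x y) ≤ p t x y ∧
        p t x y ≤ M₂ * prof ((d : ℝ) + α) α t (dist x y) := fun t ht x y => by
    rw [← hpr t ht x y]
    exact hpb t ht x y
  have := isOpenPosMeasure_refMeasure ha fun x => (hab x).1
  obtain ⟨A, Λ, h⟩ := isKatoPerturbation hα0 hab hX hp hp_cont hM₁ hM₂ hpb' hF hFt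
  obtain ⟨q, hE, hrep, hint, hcont, c, l, hc, hl, hq⟩ := h.exists_density
  refine ⟨q, fun t x ht => ?_, hcont, c⁻¹ * M₁, l, c * M₂, l, by positivity, hl, by positivity, hl,
    fun t ht x z => ?_⟩
  · obtain ⟨K, hK, hKE⟩ := hE t
    refine ⟨PathFamily.summable_jump hX.hunt hK hKE h.meas h.diag x, fun f hf ⟨B, hB⟩ => ?_⟩
    have hB0 : 0 ≤ B := (abs_nonneg _).trans (hB 0)
    refine ⟨PathFamily.integrable_feynmanKacWeight hX.hunt
      (hKE.integrable_fkWeight hK h.meas h.diag hf hB0 hB x), hint f B hf hB t ht x, ?_⟩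
    rw [PathFamily.feynmanKac_eq hX.hunt h.meas h.diag hf]
    exact hrep t ht f B hf hB0 hB x
  · obtain ⟨h1, h2⟩ := hq t ht x z
    obtain ⟨h3, h4⟩ := hpb t ht x z
    rw [posTime_of_pos ht] at h1 h2
    constructor
    · refine le_trans (le_of_eq ?_) ((mul_le_mul_of_nonneg_left h3 (by positivity)).trans h1)
      ring
    · refine (h2.trans (mul_le_mul_of_nonneg_left h4 (by positivity))).trans (le_of_eq ?_)
      ring
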